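/- **Notation.** Let $\mu=(\mu_1,\mu_2,\mu_3)\in(i\mathbb R)^3$ with $\mu_1+\mu_2+\mu_3=0$, and put $\nu_1=\frac13(\mu_1-\mu_2)$, $\nu_2=\frac13(\mu_2-\mu_3)$, $\nu_3=\frac13(\mu_3-\mu_1)$. Let $I(\mu)=\mu$, $w_4(\mu)=(\mu_3,\mu_1,\mu_2)$, $w_5(\mu)=(\mu_2,\mu_3,\mu_1)$. Define $$G(s,\mu)=\frac1{\Gamma(s_1+s_2)}\prod_{j=1}^3\Gamma(s_1-\mu_j)\Gamma(s_2+\mu_j),\qquad S^{++}(s,\mu)=\frac1{24\pi^2}\prod_{j=1}^3\cos(\tfrac32\pi\nu_j),$$ $$S^{+-}(s,\mu)=-\frac{1}{32\pi^2}\frac{\cos(\frac32\pi\nu_2)\sin(\pi(s_1-\mu_1))\sin(\pi(s_2+\mu_2))\sin(\pi(s_2+\mu_3))}{\sin(\frac32\pi\nu_1)\sin(\frac32\pi\nu_3)\sin(\pi(s_1+s_2))},$$ $$S^{-+}(s,\mu)=-\frac{1}{32\pi^2}\frac{\cos(\frac32\pi\nu_1)\sin(\pi(s_1-\mu_1))\sin(\pi(s_1-\mu_2))\sin(\pi(s_2+\mu_3))}{\sin(\frac32\pi\nu_2)\sin(\frac32\pi\nu_3)\sin(\pi(s_1+s_2))},$$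 $$S^{--}(s,\mu)=\frac1{32\pi^2}\frac{\cos(\frac32\pi\nu_3)\sin(\pi(s_1-\mu_2))\sin(\pi(s_2+\mu_2))}{\sin(\frac32\pi\nu_2)\sin(\frac32\pi\nu_1)}.$$ For $y=(y_1,y_2)\in(\mathbb R\setminus\{0\})^2$ with $\operatorname{sgn}y_1=\epsilon_1$, $\operatorname{sgn}y_2=\epsilon_2$, and $\mu$ such that no denominator $\sin(\frac32\pi\nu_j)$ in $S^{\epsilon_1,\epsilon_2}$ vanishes, let $$K^{\epsilon_1,\epsilon_2}_{w_6}(y;\mu)=\int_{-i\infty}^{i\infty}\int_{-i\infty}^{i\infty}|4\pi^2y_1|^{-s_1}|4\pi^2y_2|^{-s_2}\,G(s,\mu)\,S^{\epsilon_1,\epsilon_2}(s,\mu)\,\frac{ds_1\,ds_2}{(2\pi i)^2}.$$ Here $s_j$ runs over a curve $t\mapsto\sigma_j(t)+it$ with $\sigma_j\in C^1(\mathbb R,\mathbb R)$ that passes to the right of all poles of $\Gamma(s_1-\mu_k)$ (for $j=1$), respectively $\Gamma(s_2+\mu_k)$ (for $j=2$), $k=1,2,3$. If $\epsilon_1\ne\epsilon_2$,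 the curves pass to the left of the poles of $\Gamma(1-s_1-s_2)$, that is, $\sigma_1(t)+\sigma_2(-t)<1$ for all $t$. For some $\delta>0$ one has $\sigma_1,\sigma_2\ge-\delta$ everywhere and $\sigma_1(t)=\sigma_2(t)=-\delta$ for all large $|t|$. For $\alpha\in\mathbb C$ and $x>0$ let $J_\alpha$, $K_\alpha$ be the usual Bessel functions and (where the denominators do not vanish) $$J^{+}_\alpha(x)=\frac\pi2\,\frac{J_{-\alpha}(2x)+J_\alpha(2x)}{\cos(\pi\alpha/2)},\quad J^-_\alpha(x)=\frac\pi2\,\frac{J_{-\alpha}(2x)-J_\alpha(2x)}{\sin(\pi\alpha/2)},\quad \tilde K_\alpha(x)=2\cos(\tfrac\pi2\alpha)K_\alpha(2x).$$ With $a=2\pi|y_1|^{1/2}$, $b=2\pi|y_2|^{1/2}$, $\alpha=3\nu_3$ let $$\mathcal J_1^\pm(y;\mu)=\Bigl|\frac{y_1}{y_2}\Bigr|^{\frac12\mu_2}\int_0^\infty J^\pm_\alpha\bigl(a\sqrt{1+u^2}\bigr)J^\pm_\alpha\bigl(b\sqrt{1+u^{-2}}\bigr)u^{3\mu_2}\frac{du}u,$$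 $$\mathcal J_2(y;\mu)=\Bigl|\frac{y_1}{y_2}\Bigr|^{\frac12\mu_2}\int_1^\infty J^-_\alpha\bigl(a\sqrt{u^2-1}\bigr)J^-_\alpha\bigl(b\sqrt{1-u^{-2}}\bigr)u^{3\mu_2}\frac{du}u,$$ $$\mathcal J_3(y;\mu)=\Bigl|\frac{y_1}{y_2}\Bigr|^{\frac12\mu_2}\int_0^\infty \tilde K_\alpha\bigl(a\sqrt{1+u^2}\bigr)J^-_\alpha\bigl(b\sqrt{1+u^{-2}}\bigr)u^{3\mu_2}\frac{du}u,$$ $$\mathcal J_4(y;\mu)=\Bigl|\frac{y_1}{y_2}\Bigr|^{\frac12\mu_2}\int_0^1 \tilde K_\alpha\bigl(a\sqrt{1-u^2}\bigr)\tilde K_\alpha\bigl(b\sqrt{u^{-2}-1}\bigr)u^{3\mu_2}\frac{du}u,$$ $$\mathcal J_5(y;\mu)=\Bigl|\frac{y_1}{y_2}\Bigr|^{\frac12\mu_2}\int_0^\infty \tilde K_\alpha\bigl(a\sqrt{1+u^2}\bigr)\tilde K_\alpha\bigl(b\sqrt{1+u^{-2}}\bigr)u^{3\mu_2}\frac{du}u.$$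 **Lemma.** In each of the following cases, all the integrals that occur converge absolutely, and the kernels do not depend on the choice of the contours. 1. For $y_1,y_2>0$, $$K_{w_6}^{++}(y;\mu)=\frac1{12\pi^2}\,\frac{\cos(\frac32\pi\nu_1)\cos(\frac32\pi\nu_2)}{\cos(\frac32\pi\nu_3)}\,\mathcal J_5(y;\mu).$$ 2. For $y_1>0>y_2$ and pairwise distinct $\mu_1,\mu_2,\mu_3$, $$\sum_{w\in\{I,w_4,w_5\}}K_{w_6}^{+-}(y;w(\mu))=\frac1{24\pi^2}\sum_{w\in\{I,w_4,w_5\}}\bigl(\mathcal J_2(y;w(\mu))+\mathcal J_3(y;w(\mu))+\mathcal J_4(y;w(\mu))\bigr).$$ 3. For $y_2>0>y_1$ and $\nu_2\nu_3\neq0$, $$K_{w_6}^{-+}((y_1,y_2);\mu)=K_{w_6}^{+-}((y_2,y_1);w_4(-\mu)).$$ 4. For $y_1,y_2<0$ and pairwise distinct $\mu_1,\mu_2,\mu_3$, $$\sum_{w\in\{I,w_4,w_5\}}K_{w_6}^{--}(y;w(\mu))=\frac1{48\pi^2}\sum_{w\in\{I,w_4,w_5\}}\bigl(4\mathcal J_1^-(y;w(\mu))+2\mathcal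 J_1^+(y;w(\mu))\bigr).$$ -/

import Mathlib

noncomputable section

namespace GL3Kernel

/-- The set `Λ_c` of `μ ∈ ℂ³` with `μ₁ + μ₂ + μ₃ = 0` and `|Re μ_j| ≤ c`.
The coordinates `μ₁, μ₂, μ₃` are `μ 0, μ 1, μ 2`. -/
def Lambda (c : ℝ) : Set (Fin 3 → ℂ) :=
  {μ | μ 0 + μ 1 + μ 2 = 0 ∧ ∀ j, |(μ j).re| ≤ c}

/-- The coordinates `ν₁ = (μ₁ - μ₂)/3`, `ν₂ = (μ₂ - μ₃)/3`, `ν₃ = (μ₃ - μ₁)/3`. -/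
def nu (μ : Fin 3 → ℂ) : Fin 3 → ℂ :=
  ![(μ 0 - μ 1) / 3, (μ 1 - μ 2) / 3, (μ 2 - μ 0) / 3]

/-- The action `w₄(μ) = (μ₃, μ₁, μ₂)` of a 3-cycle of the Weyl group. -/
def w4 (μ : Fin 3 → ℂ) : Fin 3 → ℂ := ![μ 2, μ 0, μ 1]

/-- The action `w₅(μ) = (μ₂, μ₃, μ₁)` of the other 3-cycle of the Weyl group. -/
def w5 (μ : Fin 3 → ℂ) : Fin 3 → ℂ := ![μ 1, μ 2, μ 0]

/-- The sum of `F (w μ)` over `w ∈ {I, w₄, w₅}`. -/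
def cyclicSum (F : (Fin 3 → ℂ) → ℂ) (μ : Fin 3 → ℂ) : ℂ :=
  F μ + F (w4 μ) + F (w5 μ)

/-- The signs `+` and `-`. -/
inductive Sgn
  | pos
  | neg

/-! ### The Mellin-Barnes kernels -/

/-- `G(s, μ) = Γ(s₁ + s₂)⁻¹ ∏_j Γ(s₁ - μ_j) Γ(s₂ + μ_j)`. -/
def gammaFactor (s₁ s₂ : ℂ) (μ : Fin 3 → ℂ) : ℂ :=
  (Complex.Gamma (s₁ + s₂))⁻¹ *
    ∏ j, (Complex.Gamma (s₁ - μ j) * Complex.Gamma (s₂ + μ j))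

/-- `cos (3πz/2)`. -/
def cosThree (z : ℂ) : ℂ := Complex.cos (3 / 2 * (Real.pi : ℂ) * z)

/-- `sin (3πz/2)`. -/
def sinThree (z : ℂ) : ℂ := Complex.sin (3 / 2 * (Real.pi : ℂ) * z)

/-- `sin (πz)`. -/
def sinPi (z : ℂ) : ℂ := Complex.sin ((Real.pi : ℂ) * z)

/-- The trigonometric functions `S^{ε₁, ε₂}(s, μ)`. -/
def trigFactor : Sgn → Sgn → ℂ → ℂ → (Fin 3 → ℂ) → ℂ
  | .pos, .pos, _, _, μ =>
      1 / (24 * (Real.pi : ℂ) ^ 2) * ∏ j, cosThree (nu μ j)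
  | .pos, .neg, s₁, s₂, μ =>
      -(1 / (32 * (Real.pi : ℂ) ^ 2)) *
        ((cosThree (nu μ 1) * sinPi (s₁ - μ 0) * sinPi (s₂ + μ 1) * sinPi (s₂ + μ 2)) /
          (sinThree (nu μ 0) * sinThree (nu μ 2) * sinPi (s₁ + s₂)))
  | .neg, .pos, s₁, s₂, μ =>
      -(1 / (32 * (Real.pi : ℂ) ^ 2)) *
        ((cosThree (nu μ 0) * sinPi (s₁ - μ 0) * sinPi (s₁ - μ 1) * sinPi (s₂ + μ 2)) /
          (sinThree (nu μ 1) * sinThree (nu μ 2) * sinPi (s₁ + s₂)))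
  | .neg, .neg, s₁, s₂, μ =>
      1 / (32 * (Real.pi : ℂ) ^ 2) *
        ((cosThree (nu μ 2) * sinPi (s₁ - μ 1) * sinPi (s₂ + μ 1)) /
          (sinThree (nu μ 1) * sinThree (nu μ 0)))

/-- The function
`|4π²y₁|^{-s₁} |4π²y₂|^{-s₂} G(s, μ) S^{ε₁, ε₂}(s, μ)`. -/
def mellinBarnes (ε₁ ε₂ : Sgn) (y : ℝ × ℝ) (μ : Fin 3 → ℂ) (s₁ s₂ : ℂ) : ℂ :=
  ((|4 * Real.pi ^ 2 * y.1| : ℝ) : ℂ) ^ (-s₁) * ((|4 * Real.pi ^ 2 * y.2| : ℝ) : ℂ) ^ (-s₂) *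
    gammaFactor s₁ s₂ μ * trigFactor ε₁ ε₂ s₁ s₂ μ

/-- A contour from `-i∞` to `i∞` is given by its real part `σ` as a function of the imaginary
part: it is the curve `t ↦ σ(t) + it`. -/
def contourPoint (σ : ℝ → ℝ) (t : ℝ) : ℂ := (σ t : ℂ) + (t : ℂ) * Complex.I

/-- The velocity `σ'(t) + i` of the curve `t ↦ σ(t) + it`. -/
def contourVelocity (σ : ℝ → ℝ) (t : ℝ) : ℂ := ((deriv σ t : ℝ) : ℂ) + Complex.I

/-- The integrand of the double contour integral, in the parameters `(t₁, t₂)`. -/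
def kernelIntegrand (ε₁ ε₂ : Sgn) (σ₁ σ₂ : ℝ → ℝ) (y : ℝ × ℝ) (μ : Fin 3 → ℂ)
    (t : ℝ × ℝ) : ℂ :=
  mellinBarnes ε₁ ε₂ y μ (contourPoint σ₁ t.1) (contourPoint σ₂ t.2) *
    (contourVelocity σ₁ t.1 * contourVelocity σ₂ t.2)

/-- The double contour integral of `mellinBarnes` with respect to `ds₁ ds₂ / (2πi)²`. -/
def barnesIntegral (ε₁ ε₂ : Sgn) (σ₁ σ₂ : ℝ → ℝ) (y : ℝ × ℝ) (μ : Fin 3 → ℂ) : ℂ :=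
  (∫ t : ℝ × ℝ, kernelIntegrand ε₁ ε₂ σ₁ σ₂ y μ t) /
    (2 * (Real.pi : ℂ) * Complex.I) ^ 2

/-- The Barnes convention for a pair of contours. The `s₁`-contour passes to the right of the
poles `μ_j - k` of `Γ(s₁ - μ_j)`, and the `s₂`-contour to the right of the poles `-μ_j - k`
of `Γ(s₂ + μ_j)`. For opposite signs `(sin(π(s₁ + s₂)) Γ(s₁ + s₂))⁻¹ = Γ(1 - s₁ - s₂)/π` occurs
in the integrand, and the contours pass to the left of its poles `s₁ + s₂ = 1 + k`. The unbounded
parts of the contours are shifted to the line `Re s = -δ`, for some `δ > 0`, and the contours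
stay in the half-plane `Re s ≥ -δ`. -/
structure IsBarnesContour (ε₁ ε₂ : Sgn) (μ : Fin 3 → ℂ) (σ₁ σ₂ : ℝ → ℝ) : Prop where
  contDiff_fst : ContDiff ℝ 1 σ₁
  contDiff_snd : ContDiff ℝ 1 σ₂
  right_fst : ∀ (j : Fin 3) (k : ℕ), (μ j - k).re < σ₁ (μ j - k).im
  right_snd : ∀ (j : Fin 3) (k : ℕ), (-μ j - k).re < σ₂ (-μ j - k).im
  left_add : ε₁ ≠ ε₂ → ∀ (t : ℝ) (k : ℕ), σ₁ t + σ₂ (-t) < 1 + k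
  unbounded : ∃ δ : ℝ, 0 < δ ∧
    (∃ R : ℝ, ∀ t : ℝ, R ≤ |t| → σ₁ t = -δ ∧ σ₂ t = -δ) ∧
    ∀ t : ℝ, -δ ≤ σ₁ t ∧ -δ ≤ σ₂ t

/-- A smooth contour that equals `Re s = 1/4` for `|Im s|² ≤ ∑ ‖μ_j‖²` and `Re s = -1/8` for
`|Im s|² ≥ 1 + ∑ ‖μ_j‖²`. -/
def standardContour (μ : Fin 3 → ℂ) (t : ℝ) : ℝ :=
  -(1 / 8) + 3 / 8 * Real.smoothTransition (1 + ∑ j, ‖μ j‖ ^ 2 - t ^ 2)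

/-- The kernel `K^{ε₁, ε₂}_{w₆}(y; μ)`, for a contour that obeys the Barnes convention
when `Re μ = 0` (see `isBarnesContour_standard`). -/
def kernelW6 (ε₁ ε₂ : Sgn) (y : ℝ × ℝ) (μ : Fin 3 → ℂ) : ℂ :=
  barnesIntegral ε₁ ε₂ (standardContour μ) (standardContour μ) y μ

/-- For all contours that obey the Barnes convention, the integral defining
`K^{ε₁, ε₂}_{w₆}(y; μ)` converges absolutely and has the same value. -/
def KernelWellDefined (ε₁ ε₂ : Sgn) (y : ℝ × ℝ) (μ : Fin 3 → ℂ) : Prop :=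
  ∀ σ₁ σ₂ : ℝ → ℝ, IsBarnesContour ε₁ ε₂ μ σ₁ σ₂ →
    MeasureTheory.Integrable (kernelIntegrand ε₁ ε₂ σ₁ σ₂ y μ) ∧
      barnesIntegral ε₁ ε₂ σ₁ σ₂ y μ = kernelW6 ε₁ ε₂ y μ

/-- The contour used for `kernelW6` obeys the Barnes convention. -/
theorem isBarnesContour_standard (ε₁ ε₂ : Sgn) {μ : Fin 3 → ℂ} (hμ : μ ∈ Lambda 0) :
    IsBarnesContour ε₁ ε₂ μ (standardContour μ) (standardContour μ) := by
  have hre : ∀ j, (μ j).re = 0 := fun j => abs_nonpos_iff.mp (hμ.2 j)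
  have hC : ContDiff ℝ 1 (standardContour μ) := by
    unfold standardContour
    exact contDiff_const.add (contDiff_const.mul
      (Real.smoothTransition.contDiff.comp (contDiff_const.sub (contDiff_id.pow 2))))
  have hin : ∀ j, ∀ t : ℝ, t ^ 2 = (μ j).im ^ 2 → standardContour μ t = 1 / 4 := by
    intro j t ht
    have h1 : ‖μ j‖ ^ 2 ≤ ∑ i, ‖μ i‖ ^ 2 :=
      Finset.single_le_sum (f := fun i => ‖μ i‖ ^ 2) (fun i _ => sq_nonneg _)
        (Finset.mem_univ j)
    have h2 : (μ j).im ^ 2 ≤ ‖μ j‖ ^ 2 := by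
      rw [← sq_abs]
      exact pow_le_pow_left₀ (abs_nonneg _) (Complex.abs_im_le_norm _) 2
    unfold standardContour
    rw [Real.smoothTransition.one_of_one_le (by linarith)]
    norm_num
  have hle : ∀ t, standardContour μ t ≤ 1 / 4 := by
    intro t
    have := Real.smoothTransition.le_one (1 + ∑ j, ‖μ j‖ ^ 2 - t ^ 2)
    unfold standardContour
    linarith
  have hge : ∀ t, -(1 / 8) ≤ standardContour μ t := by
    intro t
    have := Real.smoothTransition.nonneg (1 + ∑ j, ‖μ j‖ ^ 2 - t ^ 2)
    unfold standardContour
    linarith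
  refine ⟨hC, hC, ?_, ?_, ?_, 1 / 8, by norm_num, ⟨1 + ∑ j, ‖μ j‖ ^ 2, ?_⟩,
    fun t => ⟨hge t, hge t⟩⟩
  · intro j k
    rw [hin j _ (by simp)]
    have : (0 : ℝ) ≤ k := Nat.cast_nonneg k
    simp only [Complex.sub_re, Complex.natCast_re, hre j]
    linarith
  · intro j k
    rw [hin j _ (by simp)]
    have : (0 : ℝ) ≤ k := Nat.cast_nonneg k
    simp only [Complex.sub_re, Complex.neg_re, Complex.natCast_re, hre j]
    linarith
  · intro _ t k
    have : (0 : ℝ) ≤ k := Nat.cast_nonneg k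
    have h1 := hle t
    have h2 := hle (-t)
    linarith
  · intro t ht
    have hs : 0 ≤ ∑ j, ‖μ j‖ ^ 2 := Finset.sum_nonneg fun i _ => sq_nonneg _
    have h2 : 1 + ∑ j, ‖μ j‖ ^ 2 ≤ t ^ 2 := by
      rw [← sq_abs t]
      nlinarith
    have : standardContour μ t = -(1 / 8) := by
      unfold standardContour
      rw [Real.smoothTransition.zero_of_nonpos (by linarith)]
      norm_num
    exact ⟨this, this⟩

/-! ### Bessel functions of a positive real argument -/

/-- The Bessel function
`J_α(x) = ∑_k (-1)^k / (k! Γ(k + 1 + α)) (x/2)^{α + 2k}` for `x > 0`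
(a term where `Γ` has a pole is zero). -/
def besselJ (α : ℂ) (x : ℝ) : ℂ :=
  ∑' k : ℕ, (-1 : ℂ) ^ k / ((Nat.factorial k : ℂ) * Complex.Gamma (k + 1 + α)) *
    ((x / 2 : ℝ) : ℂ) ^ (α + 2 * k)

/-- The modified Bessel function `K_α(x) = ∫_0^∞ exp(-x cosh t) cosh(αt) dt` for `x > 0`. -/
def besselK (α : ℂ) (x : ℝ) : ℂ :=
  ∫ t in Set.Ioi (0 : ℝ), (Real.exp (-x * Real.cosh t) : ℂ) * Complex.cosh (α * t)

/-- `J^+_α(x)` and `J^-_α(x)`. -/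
def besselJSgn : Sgn → ℂ → ℝ → ℂ
  | .pos, α, x => (Real.pi : ℂ) / 2 *
      ((besselJ (-α) (2 * x) + besselJ α (2 * x)) / Complex.cos ((Real.pi : ℂ) * α / 2))
  | .neg, α, x => (Real.pi : ℂ) / 2 *
      ((besselJ (-α) (2 * x) - besselJ α (2 * x)) / Complex.sin ((Real.pi : ℂ) * α / 2))

/-- `K̃_α(x) = 2 cos(πα/2) K_α(2x)`. -/
def besselKTilde (α : ℂ) (x : ℝ) : ℂ :=
  2 * Complex.cos ((Real.pi : ℂ) / 2 * α) * besselK α (2 * x)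

/-! ### The integrals of products of two Bessel functions -/

/-- The factor `|y₁/y₂|^{μ₂/2}`. -/
def prefactor (y : ℝ × ℝ) (μ : Fin 3 → ℂ) : ℂ :=
  ((|y.1 / y.2| : ℝ) : ℂ) ^ (μ 1 / 2)

/-- The integrand of `𝒥₁^±`, on `0 < u < ∞`. -/
def integrand1 (ε : Sgn) (y : ℝ × ℝ) (μ : Fin 3 → ℂ) (u : ℝ) : ℂ :=
  besselJSgn ε (3 * nu μ 2) (2 * Real.pi * Real.sqrt |y.1| * Real.sqrt (1 + u ^ 2)) *
    besselJSgn ε (3 * nu μ 2) (2 * Real.pi * Real.sqrt |y.2| * Real.sqrt (1 + (u ^ 2)⁻¹)) *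
    (u : ℂ) ^ (3 * μ 1) / u

/-- The integrand of `𝒥₂`, on `1 < u < ∞`. -/
def integrand2 (y : ℝ × ℝ) (μ : Fin 3 → ℂ) (u : ℝ) : ℂ :=
  besselJSgn .neg (3 * nu μ 2) (2 * Real.pi * Real.sqrt |y.1| * Real.sqrt (u ^ 2 - 1)) *
    besselJSgn .neg (3 * nu μ 2) (2 * Real.pi * Real.sqrt |y.2| * Real.sqrt (1 - (u ^ 2)⁻¹)) *
    (u : ℂ) ^ (3 * μ 1) / u

/-- The integrand of `𝒥₃`, on `0 < u < ∞`. -/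
def integrand3 (y : ℝ × ℝ) (μ : Fin 3 → ℂ) (u : ℝ) : ℂ :=
  besselKTilde (3 * nu μ 2) (2 * Real.pi * Real.sqrt |y.1| * Real.sqrt (1 + u ^ 2)) *
    besselJSgn .neg (3 * nu μ 2) (2 * Real.pi * Real.sqrt |y.2| * Real.sqrt (1 + (u ^ 2)⁻¹)) *
    (u : ℂ) ^ (3 * μ 1) / u

/-- The integrand of `𝒥₄`, on `0 < u < 1`. -/
def integrand4 (y : ℝ × ℝ) (μ : Fin 3 → ℂ) (u : ℝ) : ℂ :=
  besselKTilde (3 * nu μ 2) (2 * Real.pi * Real.sqrt |y.1| * Real.sqrt (1 - u ^ 2)) *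
    besselKTilde (3 * nu μ 2) (2 * Real.pi * Real.sqrt |y.2| * Real.sqrt ((u ^ 2)⁻¹ - 1)) *
    (u : ℂ) ^ (3 * μ 1) / u

/-- The integrand of `𝒥₅`, on `0 < u < ∞`. -/
def integrand5 (y : ℝ × ℝ) (μ : Fin 3 → ℂ) (u : ℝ) : ℂ :=
  besselKTilde (3 * nu μ 2) (2 * Real.pi * Real.sqrt |y.1| * Real.sqrt (1 + u ^ 2)) *
    besselKTilde (3 * nu μ 2) (2 * Real.pi * Real.sqrt |y.2| * Real.sqrt (1 + (u ^ 2)⁻¹)) *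
    (u : ℂ) ^ (3 * μ 1) / u

/-- `𝒥₁^±(y; μ)`. -/
def calJ1 (ε : Sgn) (y : ℝ × ℝ) (μ : Fin 3 → ℂ) : ℂ :=
  prefactor y μ * ∫ u in Set.Ioi (0 : ℝ), integrand1 ε y μ u

/-- `𝒥₂(y; μ)`. -/
def calJ2 (y : ℝ × ℝ) (μ : Fin 3 → ℂ) : ℂ :=
  prefactor y μ * ∫ u in Set.Ioi (1 : ℝ), integrand2 y μ u

/-- `𝒥₃(y; μ)`. -/
def calJ3 (y : ℝ × ℝ) (μ : Fin 3 → ℂ) : ℂ :=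
  prefactor y μ * ∫ u in Set.Ioi (0 : ℝ), integrand3 y μ u

/-- `𝒥₄(y; μ)`. -/
def calJ4 (y : ℝ × ℝ) (μ : Fin 3 → ℂ) : ℂ :=
  prefactor y μ * ∫ u in Set.Ioo (0 : ℝ) 1, integrand4 y μ u

/-- `𝒥₅(y; μ)`. -/
def calJ5 (y : ℝ × ℝ) (μ : Fin 3 → ℂ) : ℂ :=
  prefactor y μ * ∫ u in Set.Ioi (0 : ℝ), integrand5 y μ u

end GL3Kernel

end

section

open Complex Filter Topology MeasureTheory Set

namespace GL3Kernel


/-! Every oscillating Bessel function in the statement is a boundary value of `K_α`. For imaginary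
`α ≠ 0` one has `J⁻_α(x) = K_α(2ix) + K_α(-2ix)` and `J⁺_α(x) = i (K_α(2ix) - K_α(-2ix))`
(`besselJSgn_neg_eq`, `besselJSgn_pos_eq`). All Bessel integrals are therefore combinations of `∫
K_α(2 z₁ p(u)) K_α(2 z₂ q(u)) u^{3μ₂} du/u` with `z₁`, `z₂` on rays of angle `0` or `±π/2`.

For `Re z > 0`, Mellin inversion writes `K_α(2z)` as an integral of a product of two Gamma functions
and a power of `z` (`besselKRight_eq_integral`). Inserting this twice produces `Γ(s₁-μ₁) Γ(s₁-μ₃)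
Γ(s₂+μ₁) Γ(s₂+μ₃)`, and the remaining integral over `u` is an Euler Beta integral. On each of the
regions `(0,∞)`, `(1,∞)`, `(0,1)` the Beta integral supplies the missing Gamma factors up to one
explicit sine `T(s₁,s₂)`; `IsBetaRegion` records this.

The passage to the angles `±π/2` is the analytic core, because there the exponential decay of the
Gamma functions can be used up completely. The contours are first moved to Barnes contours, on which
the decay `(1+|t₁|)^{-1-δ} (1+|t₂|)^{-1-δ}` survives (`exists_kernelSize_contour_le`). On the Bessel
side `K_α(z) = O(|z|^{-1/2})` holds uniformly in the open right half-plane (`norm_besselKRight_le`).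
Dominated convergence on both sides then gives `IsBetaRegion.integral_besselProduct`. Contour
independence (`integral_contourIntegrand_eq`) is proved by damping with `exp(ε(s₁²+s₂²))`, moving
one variable at a time, and letting `ε → 0`.

As a result the kernels and the Bessel integrals are transforms of explicit trigonometric weights
against one Gamma kernel on one contour. Both the Gamma kernel and the contour are invariant under
cyclic permutations of `μ`, so the formulas reduce to pointwise identities between weights. For
signs `(+,+)` the identity is immediate. For `(+,-)` and `(-,-)` it holds only after cyclic
summation (`trig_pos_neg`, `trig_neg_neg`); in the variables `exp(iπμ_j/2)`, whose product is `1`,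
it is an identity of Laurent polynomials. The case `(-,+)` follows by interchanging `s₁` and `s₂`.
-/

/-! ### Stirling bounds for `Γ` and `1/Γ` in vertical strips -/

/-- Weighted AM-GM is applied to `a²/(a²+t²)`, `b²/(b²+t²)` and to the complementary fractions with
numerator `t²`. The two right-hand sides add up to `1`, and the geometric mean of `a`, `b` left in
the second inequality is at most the arithmetic mean. The fractions are the Euler factors of
`|Γ(x+it)|²/Γ(x)²`. -/
lemma sq_div_sq_add_logConcave {a b l : ℝ} (t : ℝ) (ha : 0 < a) (hb : 0 < b) (h0 : 0 ≤ l)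
    (h1 : l ≤ 1) :
    (a ^ 2 / (a ^ 2 + t ^ 2)) ^ (1 - l) * (b ^ 2 / (b ^ 2 + t ^ 2)) ^ l ≤
      ((1 - l) * a + l * b) ^ 2 / (((1 - l) * a + l * b) ^ 2 + t ^ 2) := by
  set c := (1 - l) * a + l * b with hc
  have hgm : a ^ (1 - l) * b ^ l ≤ c :=
    Real.geom_mean_le_arith_mean2_weighted (by linarith) h0 ha.le hb.le (by ring)
  have hg0 : 0 < a ^ (1 - l) * b ^ l := by positivity
  have hc0 : 0 < c := hg0.trans_le hgm
  have hA : 0 < a ^ 2 + t ^ 2 := by positivity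
  have hB : 0 < b ^ 2 + t ^ 2 := by positivity
  have e1 := Real.geom_mean_le_arith_mean2_weighted (w₁ := 1 - l) (w₂ := l)
    (p₁ := a ^ 2 / (a ^ 2 + t ^ 2)) (p₂ := b ^ 2 / (b ^ 2 + t ^ 2))
    (by linarith) h0 (by positivity) (by positivity) (by ring)
  have e2 := Real.geom_mean_le_arith_mean2_weighted (w₁ := 1 - l) (w₂ := l)
    (p₁ := t ^ 2 / (a ^ 2 + t ^ 2)) (p₂ := t ^ 2 / (b ^ 2 + t ^ 2))
    (by linarith) h0 (by positivity) (by positivity) (by ring)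
  set R := (a ^ 2 / (a ^ 2 + t ^ 2)) ^ (1 - l) * (b ^ 2 / (b ^ 2 + t ^ 2)) ^ l with hR
  have hR0 : 0 ≤ R := by positivity
  have e3 : (t ^ 2 / (a ^ 2 + t ^ 2)) ^ (1 - l) * (t ^ 2 / (b ^ 2 + t ^ 2)) ^ l =
      R * (t ^ 2 / (a ^ 2) ) ^ (1 - l) * (t ^ 2 / b ^ 2) ^ l := by
    have : t ^ 2 / (a ^ 2 + t ^ 2) = (a ^ 2 / (a ^ 2 + t ^ 2)) * (t ^ 2 / a ^ 2) := by
      field_simp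
    rw [this]
    have : t ^ 2 / (b ^ 2 + t ^ 2) = (b ^ 2 / (b ^ 2 + t ^ 2)) * (t ^ 2 / b ^ 2) := by
      field_simp
    rw [this, Real.mul_rpow (by positivity) (by positivity),
      Real.mul_rpow (by positivity) (by positivity), hR]
    ring
  have e4 : (t ^ 2 / (a ^ 2) ) ^ (1 - l) * (t ^ 2 / b ^ 2) ^ l =
      t ^ 2 / (a ^ (1 - l) * b ^ l) ^ 2 := by
    rw [Real.div_rpow (by positivity) (by positivity), Real.div_rpow (by positivity) (by positivity),
      div_mul_div_comm]
    congr 1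
    · rcases eq_or_ne t 0 with rfl | ht
      · rcases eq_or_ne l 0 with rfl | hl
        · simp
        · simp [Real.zero_rpow hl]
      · rw [← Real.rpow_add (by positivity)]; simp
    · rw [mul_pow, ← Real.rpow_natCast, ← Real.rpow_natCast, ← Real.rpow_mul ha.le,
        ← Real.rpow_mul hb.le, ← Real.rpow_natCast, ← Real.rpow_natCast,
        ← Real.rpow_mul ha.le, ← Real.rpow_mul hb.le, mul_comm (1 - l), mul_comm l]
  have e5 : t ^ 2 / c ^ 2 ≤ t ^ 2 / (a ^ (1 - l) * b ^ l) ^ 2 := by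
    gcongr
  have e6 : R * (1 + t ^ 2 / c ^ 2) ≤ 1 := by
    have e7 : R * (t ^ 2 / c ^ 2) ≤ R * (t ^ 2 / (a ^ (1 - l) * b ^ l) ^ 2) := by gcongr
    rw [e3, mul_assoc, e4] at e2
    have e8 : (1 - l) * (a ^ 2 / (a ^ 2 + t ^ 2)) + l * (b ^ 2 / (b ^ 2 + t ^ 2)) +
      ((1 - l) * (t ^ 2 / (a ^ 2 + t ^ 2)) + l * (t ^ 2 / (b ^ 2 + t ^ 2))) = 1 := by
      field_simp; ring
    linarith
  rw [le_div_iff₀ (by positivity)]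
  have : R * (c ^ 2 + t ^ 2) = (R * (1 + t ^ 2 / c ^ 2)) * c ^ 2 := by field_simp
  rw [this]
  nlinarith [sq_nonneg c]

/-- `|Γ(x + it)|² / Γ(x)²`. -/
noncomputable def gammaRatio (t x : ℝ) : ℝ := (‖Gamma (x + t * I)‖ / Real.Gamma x) ^ 2

/-- In the quotient of Euler's limits for `Γ(x+it)` and `Γ(x)` the factorials and the moduli of the
powers of `n` cancel. -/
lemma tendsto_gammaRatio (t : ℝ) {x : ℝ} (hx : 0 < x) :
    Tendsto (fun n : ℕ => ∏ j ∈ Finset.range (n + 1), ((x + j) ^ 2 / ((x + j) ^ 2 + t ^ 2))) atTop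
      (𝓝 (gammaRatio t x)) := by
  have h1 := (GammaSeq_tendsto_Gamma (x + t * I)).norm
  have h2 := Real.GammaSeq_tendsto_Gamma x
  have h3 := (h1.div h2 (Real.Gamma_pos_of_pos hx).ne').pow 2
  refine h3.congr' ?_
  filter_upwards [eventually_gt_atTop 0] with n hn
  have hn' : (0 : ℝ) < n := Nat.cast_pos.2 hn
  simp only [Pi.div_apply, GammaSeq, Real.GammaSeq, norm_div, norm_mul, norm_prod]
  rw [show ‖(n : ℂ) ^ ((x : ℂ) + t * I)‖ = (n : ℝ) ^ x by
    rw [← ofReal_natCast, norm_cpow_eq_rpow_re_of_pos hn']; simp]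
  rw [show ‖((n.factorial : ℕ) : ℂ)‖ = (n.factorial : ℝ) by simp]
  have hp : ∀ j : ℕ, 0 < x + j := fun j => by positivity
  have hP : (∏ j ∈ Finset.range (n + 1), (x + (j : ℝ))) ≠ 0 :=
    Finset.prod_ne_zero_iff.2 fun j _ => (hp j).ne'
  have hnorm : ∀ j : ℕ, ‖(x : ℂ) + t * I + j‖ ^ 2 = (x + j) ^ 2 + t ^ 2 := fun j => by
    rw [← normSq_eq_norm_sq, normSq_apply]; simp; ring
  have hQ : (∏ j ∈ Finset.range (n + 1), ‖(x : ℂ) + t * I + j‖) ≠ 0 :=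
    Finset.prod_ne_zero_iff.2 fun j _ => by
      have := hnorm j
      intro h
      rw [h] at this
      have := hp j
      nlinarith [sq_nonneg t]
  have hn1 : (n : ℝ) ^ x ≠ 0 := by positivity
  have hn2 : (n.factorial : ℝ) ≠ 0 := by positivity
  rw [Finset.prod_div_distrib]
  simp_rw [← hnorm]
  rw [Finset.prod_pow, Finset.prod_pow]
  field_simp

lemma gammaRatio_nonneg (t x : ℝ) : 0 ≤ gammaRatio t x := sq_nonneg _

/-- Log-concavity of each Euler factor survives products and limits. -/
lemma gammaRatio_logConcave (t : ℝ) {a b l : ℝ} (ha : 0 < a) (hb : 0 < b) (h0 : 0 < l)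
    (h1 : l ≤ 1) :
    gammaRatio t a ^ (1 - l) * gammaRatio t b ^ l ≤ gammaRatio t ((1 - l) * a + l * b) := by
  have hc : 0 < (1 - l) * a + l * b := by
    have := mul_nonneg (sub_nonneg.2 h1) ha.le
    have := mul_pos h0 hb
    linarith
  have hA := (tendsto_gammaRatio t ha).rpow_const (p := 1 - l) (Or.inr (by linarith))
  have hB := (tendsto_gammaRatio t hb).rpow_const (p := l) (Or.inr h0.le)
  refine le_of_tendsto_of_tendsto' (hA.mul hB) (tendsto_gammaRatio t hc) fun n => ?_
  rw [← Real.finsetProd_rpow _ _ (fun j _ => by positivity),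
    ← Real.finsetProd_rpow _ _ (fun j _ => by positivity), ← Finset.prod_mul_distrib]
  refine Finset.prod_le_prod (fun j _ => by positivity) fun j _ => ?_
  have := sq_div_sq_add_logConcave (a := a + j) (b := b + j) (l := l) t (by positivity)
    (by positivity) h0.le h1
  rwa [show (1 - l) * (a + j) + l * (b + j) = (1 - l) * a + l * b + j by ring] at this

/-- On the line `Re s = 1/2` the reflection `1 - s` is complex conjugation. -/
lemma norm_Gamma_half_sq (t : ℝ) :
    ‖Gamma ((1 / 2 : ℝ) + t * I)‖ ^ 2 = Real.pi / Real.cosh (Real.pi * t) := by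
  have h := Gamma_mul_Gamma_one_sub ((1 / 2 : ℝ) + t * I)
  have h2 : 1 - (((1 / 2 : ℝ) : ℂ) + t * I) = (starRingEnd ℂ) (((1 / 2 : ℝ) : ℂ) + t * I) := by
    simp only [map_add, map_mul, conj_ofReal, conj_I]; push_cast; ring
  rw [h2, Gamma_conj, mul_conj, normSq_eq_norm_sq,
    show (Real.pi : ℂ) * (((1 / 2 : ℝ) : ℂ) + t * I) = (Real.pi * t : ℝ) * I + Real.pi / 2 by
      push_cast; ring, sin_add_pi_div_two, cos_mul_I, ← ofReal_cosh, ← ofReal_div] at h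
  exact_mod_cast h

/-- A log-concave function lies below the extrapolation of its chord. The modulus of `Γ` is known
exactly on `Re s = 1/2` and, by the functional equation, on `Re s = 3/2`; extrapolating to the right
of `3/2` gives the sharp power of `1 + |t|` and the sharp exponential. -/
lemma norm_Gamma_le_aux {x : ℝ} (t : ℝ) (h1 : 3 / 2 ≤ x) (h2 : x ≤ 5 / 2) :
    ‖Gamma (x + t * I)‖ ≤ 16 * Real.Gamma x * ((1 + |t|) ^ (x - 1 / 2) *
      Real.exp (-(Real.pi / 2 * |t|))) := by
  set p := x - 1 / 2 with hp
  have hp1 : 1 ≤ p := by linarith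
  have hp0 : 0 < p := by linarith
  have hG : 0 < Real.Gamma x := Real.Gamma_pos_of_pos (by linarith)
  -- The weight `1/p` is chosen so that the convex combination of `1/2` and `x` is `3/2`.
  have hc := gammaRatio_logConcave t (a := 1 / 2) (b := x) (l := p⁻¹) (by norm_num) (by linarith)
    (by positivity) (inv_le_one_of_one_le₀ hp1)
  have e1 : (1 - p⁻¹) * (1 / 2) + p⁻¹ * x = 3 / 2 := by
    have : x = p + 1 / 2 := by rw [hp]; ring
    rw [this]; field_simp; ring
  rw [e1] at hc
  have hch : 0 < Real.cosh (Real.pi * t) := Real.cosh_pos _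
  have hF1 : gammaRatio t (1 / 2) = 1 / Real.cosh (Real.pi * t) := by
    unfold gammaRatio
    rw [div_pow, norm_Gamma_half_sq, Real.Gamma_one_half_eq, Real.sq_sqrt Real.pi_pos.le]
    field_simp
  -- The factor is `|1/2 + it|² / (1/2)²`.
  have hF3 : gammaRatio t (3 / 2) = (1 + 4 * t ^ 2) * gammaRatio t (1 / 2) := by
    have hne : ((1 / 2 : ℝ) : ℂ) + t * I ≠ 0 := by
      intro h
      have := congrArg Complex.re h
      simp at this
    have := Gamma_add_one _ hne
    rw [show ((1 / 2 : ℝ) : ℂ) + t * I + 1 = ((3 / 2 : ℝ) : ℂ) + t * I by push_cast; ring] at this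
    have hr : Real.Gamma (3 / 2) = 1 / 2 * Real.Gamma (1 / 2) := by
      rw [show (3 / 2 : ℝ) = 1 / 2 + 1 by norm_num, Real.Gamma_add_one (by norm_num)]
    unfold gammaRatio
    rw [this, hr, norm_mul, div_pow, div_pow, mul_pow, mul_pow, ← normSq_eq_norm_sq (_ + _),
      normSq_apply]
    simp
    ring
  have hF1p : 0 < gammaRatio t (1 / 2) := by rw [hF1]; positivity
  have hx : gammaRatio t x ≤ (1 + 4 * t ^ 2) ^ p * gammaRatio t (1 / 2) := by
    have h3 := Real.rpow_le_rpow (mul_nonneg (by positivity)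
      (Real.rpow_nonneg (gammaRatio_nonneg _ _) _)) hc hp0.le
    rw [Real.mul_rpow (by positivity) (Real.rpow_nonneg (gammaRatio_nonneg _ _) _),
      ← Real.rpow_mul hF1p.le, ← Real.rpow_mul (gammaRatio_nonneg _ _), inv_mul_cancel₀ hp0.ne',
      Real.rpow_one, hF3, Real.mul_rpow (by positivity) hF1p.le, sub_mul,
      inv_mul_cancel₀ hp0.ne', one_mul, Real.rpow_sub hF1p, Real.rpow_one] at h3
    have hpos : 0 < gammaRatio t (1 / 2) ^ p := by positivity
    have h4 : gammaRatio t (1 / 2) ^ p * gammaRatio t x ≤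
        gammaRatio t (1 / 2) ^ p * ((1 + 4 * t ^ 2) ^ p * gammaRatio t (1 / 2)) := by
      calc _ = gammaRatio t (1 / 2) ^ p / gammaRatio t (1 / 2) * gammaRatio t x *
            gammaRatio t (1 / 2) := by field_simp
        _ ≤ (1 + 4 * t ^ 2) ^ p * gammaRatio t (1 / 2) ^ p * gammaRatio t (1 / 2) := by gcongr
        _ = _ := by ring
    exact le_of_mul_le_mul_left h4 hpos
  have hcosh : 1 / Real.cosh (Real.pi * t) ≤ 2 * Real.exp (-(Real.pi / 2 * |t|)) ^ 2 := by
    rw [← Real.exp_nat_mul, ← Real.cosh_abs, Real.cosh_eq, abs_mul, abs_of_pos Real.pi_pos]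
    rw [div_le_iff₀ (by positivity)]
    have : Real.exp (((2 : ℕ) : ℝ) * -(Real.pi / 2 * |t|)) * Real.exp (Real.pi * |t|) = 1 := by
      rw [← Real.exp_add]; simp; ring
    have h5 : 0 < Real.exp (((2 : ℕ) : ℝ) * -(Real.pi / 2 * |t|)) * Real.exp (-(Real.pi * |t|)) := by
      positivity
    nlinarith
  have h6 : (1 + 4 * t ^ 2) ^ p ≤ (4 * (1 + |t|) ^ p) ^ 2 := by
    have : 1 + 4 * t ^ 2 ≤ (2 * (1 + |t|)) ^ 2 := by
      rw [← sq_abs t]; nlinarith [abs_nonneg t]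
    calc (1 + 4 * t ^ 2) ^ p ≤ ((2 * (1 + |t|)) ^ 2) ^ p := by gcongr
      _ = ((2 : ℝ) ^ p * (1 + |t|) ^ p) ^ 2 := by
        rw [← Real.mul_rpow (by positivity) (by positivity), ← Real.rpow_natCast,
          ← Real.rpow_natCast, ← Real.rpow_mul (by positivity), ← Real.rpow_mul (by positivity),
          mul_comm p]
      _ ≤ _ := by
        gcongr
        calc (2 : ℝ) ^ p ≤ 2 ^ (2 : ℝ) := Real.rpow_le_rpow_of_exponent_le (by norm_num) (by linarith)
          _ = 4 := by norm_num
  have h7 : gammaRatio t x ≤ (16 * ((1 + |t|) ^ p * Real.exp (-(Real.pi / 2 * |t|)))) ^ 2 := by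
    calc gammaRatio t x ≤ (1 + 4 * t ^ 2) ^ p * gammaRatio t (1 / 2) := hx
      _ ≤ (4 * (1 + |t|) ^ p) ^ 2 * (2 * Real.exp (-(Real.pi / 2 * |t|)) ^ 2) := by
        rw [hF1]; gcongr
      _ ≤ _ := by
        have : 0 ≤ ((1 + |t|) ^ p) ^ 2 * (Real.exp (-(Real.pi / 2 * |t|))) ^ 2 := by positivity
        nlinarith
  have h8 := abs_le_of_sq_le_sq h7 (by positivity)
  rw [abs_of_nonneg (by positivity), div_le_iff₀ hG] at h8
  linarith

/-- The order of magnitude of `Γ(s)` in a vertical strip. -/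
noncomputable def stirlingSize (s : ℂ) : ℝ :=
  (1 + |s.im|) ^ (s.re - 1 / 2) * Real.exp (-(Real.pi / 2 * |s.im|))

lemma stirlingSize_pos (s : ℂ) : 0 < stirlingSize s := by unfold stirlingSize; positivity

lemma stirlingSize_add_one (s : ℂ) : stirlingSize (s + 1) = (1 + |s.im|) * stirlingSize s := by
  unfold stirlingSize
  have h : 0 < 1 + |s.im| := by positivity
  rw [add_im, add_re, one_im, one_re, add_zero, show s.re + 1 - 1 / 2 = 1 + (s.re - 1 / 2) by ring,
    Real.rpow_add h, Real.rpow_one, mul_assoc]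

/-- The functional equation widens the strip by one on each side. To the left one divides by `s`,
which is harmless because `|s| ≥ η` implies `1 + |Im s| ≤ ((1+η)/η) |s|`; to the right one
multiplies by `s - 1`, of size at most a constant times `1 + |Im s|`. -/
lemma norm_Gamma_le_strip {η : ℝ} (h0 : 0 < η) (h1 : η ≤ 1) (n : ℕ) :
    ∃ C, 0 < C ∧ ∀ s : ℂ, 3 / 2 - n ≤ s.re → s.re ≤ 5 / 2 + n → (∀ k : ℕ, η ≤ ‖s + k‖) →
      ‖Gamma s‖ ≤ C * stirlingSize s := by
  induction n with
  | zero =>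
    obtain ⟨C, hC⟩ := (isCompact_Icc (a := (3 / 2 : ℝ)) (b := 5 / 2)).exists_bound_of_continuousOn
      (f := Real.Gamma) (fun x hx => by
        refine (Real.differentiableAt_Gamma fun m => ?_).continuousAt.continuousWithinAt
        have : (0 : ℝ) ≤ m := Nat.cast_nonneg m
        have := hx.1
        intro h
        linarith)
    have hC0 : 0 ≤ C := (norm_nonneg _).trans (hC 2 (by norm_num))
    refine ⟨16 * C + 1, by positivity, fun s hs1 hs2 _ => ?_⟩
    simp only [Nat.cast_zero, sub_zero, add_zero] at hs1 hs2
    have h := norm_Gamma_le_aux s.im hs1 hs2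
    rw [re_add_im] at h
    refine h.trans ?_
    rw [← stirlingSize]
    have := (le_abs_self _).trans (hC s.re ⟨hs1, hs2⟩)
    gcongr
    · exact (stirlingSize_pos s).le
    · linarith
  | succ n ih =>
    obtain ⟨C, hC, ih⟩ := ih
    refine ⟨C * (1 + (1 + η) / η) + C * (n + 3), by positivity, fun s hs1 hs2 hd => ?_⟩
    push_cast at hs1 hs2
    have hsp := stirlingSize_pos s
    have him := abs_im_le_norm s
    by_cases hlow : s.re < 3 / 2 - n
    · have hs0 : s ≠ 0 := by
        intro h
        have := hd 0
        simp [h] at this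
        linarith
      have h := ih (s + 1) (by simp; linarith) (by simp; linarith) (fun k => by
        have := hd (k + 1)
        rwa [show s + ((k + 1 : ℕ) : ℂ) = s + 1 + k by push_cast; ring] at this)
      rw [Gamma_add_one _ hs0, norm_mul, stirlingSize_add_one] at h
      have hns : η ≤ ‖s‖ := by simpa using hd 0
      have h2 : 1 + |s.im| ≤ (1 + η) / η * ‖s‖ := by
        have : ‖s‖ * η ≥ |s.im| * η := by gcongr
        rw [div_mul_eq_mul_div, le_div_iff₀ h0]
        nlinarith
      have h3 : ‖s‖ * ‖Gamma s‖ ≤ ‖s‖ * (C * ((1 + η) / η) * stirlingSize s) := by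
        calc _ ≤ C * ((1 + |s.im|) * stirlingSize s) := h
          _ ≤ C * (((1 + η) / η * ‖s‖) * stirlingSize s) := by gcongr
          _ = _ := by ring
      have h4 := le_of_mul_le_mul_left h3 (norm_pos_iff.2 hs0)
      have : 0 ≤ C * stirlingSize s + C * (n + 3) * stirlingSize s := by positivity
      linarith
    · by_cases hhigh : s.re ≤ 5 / 2 + n
      · have h := ih s (by linarith) hhigh hd
        have : 0 ≤ (C * ((1 + η) / η) + C * (n + 3)) * stirlingSize s := by positivity
        linarith
      · push Not at hlow hhigh
        have hn : (0 : ℝ) ≤ n := Nat.cast_nonneg n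
        have h := ih (s - 1) (by simp; linarith) (by simp; linarith) (fun k => by
          refine h1.trans (le_trans ?_ (re_le_norm _))
          have : (0 : ℝ) ≤ k := Nat.cast_nonneg k
          simp; linarith)
        have hne : s - 1 ≠ 0 := by
          intro h
          have := congrArg Complex.re h
          simp at this
          linarith
        have hg := Gamma_add_one _ hne
        have hst := stirlingSize_add_one (s - 1)
        rw [sub_add_cancel] at hg hst
        rw [hg, norm_mul, hst]
        have h5 : ‖s - 1‖ ≤ (n + 3) * (1 + |(s - 1).im|) := by
          refine (norm_le_abs_re_add_abs_im _).trans ?_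
          have : |(s - 1).re| ≤ n + 3 := by
            rw [abs_le]; simp; constructor <;> linarith
          nlinarith [abs_nonneg (s - 1).im]
        have hp := stirlingSize_pos (s - 1)
        calc ‖s - 1‖ * ‖Gamma (s - 1)‖
            ≤ ((n + 3) * (1 + |(s - 1).im|)) * (C * stirlingSize (s - 1)) := by gcongr
          _ = (C * (n + 3)) * ((1 + |(s - 1).im|) * stirlingSize (s - 1)) := by ring
          _ ≤ _ := by
            gcongr
            have : 0 ≤ C * (1 + (1 + η) / η) := by positivity
            linarith

/-- The Stirling upper bound for `Γ` in a vertical strip, away from the poles. -/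
lemma exists_norm_Gamma_le {η : ℝ} (h0 : 0 < η) (M : ℝ) :
    ∃ C, 0 < C ∧ ∀ s : ℂ, |s.re| ≤ M → (∀ k : ℕ, η ≤ ‖s + k‖) → ‖Gamma s‖ ≤ C * stirlingSize s := by
  obtain ⟨n, hn⟩ := exists_nat_ge (M + 2)
  obtain ⟨C, hC, h⟩ := norm_Gamma_le_strip (lt_min h0 one_pos) (min_le_right η 1) n
  refine ⟨C, hC, fun s hs hd => h s ?_ ?_ fun k => (min_le_left _ _).trans (hd k)⟩
  · linarith [(abs_le.1 hs).1]
  · linarith [(abs_le.1 hs).2]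

lemma norm_sin_le (z : ℂ) : ‖Complex.sin z‖ ≤ Real.exp |z.im| := by
  have h1 : ‖cexp (-z * I)‖ ≤ Real.exp |z.im| := by
    rw [norm_exp]; gcongr; simp [le_abs_self]
  have h2 : ‖cexp (z * I)‖ ≤ Real.exp |z.im| := by
    rw [norm_exp]; gcongr; simp [neg_le_abs]
  rw [Complex.sin, norm_div, norm_mul, norm_I, mul_one, norm_ofNat, div_le_iff₀ (by norm_num)]
  linarith [norm_sub_le (cexp (-z * I)) (cexp (z * I))]

/-- The Stirling upper bound for `1/Γ` in a vertical strip. -/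
lemma exists_norm_inv_Gamma_le (M : ℝ) :
    ∃ C, 0 < C ∧ ∀ s : ℂ, |s.re| ≤ M → ‖(Gamma s)⁻¹‖ ≤ C * (stirlingSize s)⁻¹ := by
  obtain ⟨C, hC, h⟩ := exists_norm_Gamma_le one_pos (M + 1)
  obtain ⟨D, hD⟩ := (isCompact_Icc.reProdIm isCompact_Icc :
    IsCompact (Icc (-M) M ×ℂ Icc (-1) 1)).exists_bound_of_continuousOn
    (f := fun s => (Gamma s)⁻¹ * stirlingSize s) (by
      refine (differentiable_one_div_Gamma.continuous.mul
        (continuous_ofReal.comp ?_)).continuousOn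
      unfold stirlingSize
      refine Continuous.mul (Continuous.rpow (by fun_prop) (by fun_prop) fun x => Or.inl ?_)
        (by fun_prop)
      positivity)
  refine ⟨C + |D|, by positivity, fun s hs => ?_⟩
  have hp := stirlingSize_pos s
  have hp1 := stirlingSize_pos (1 - s)
  -- Near the real axis `1/Γ` is bounded by compactness. Elsewhere the reflection formula applies,
  -- and the imaginary part alone keeps `1 - s` away from the poles of `Γ`.
  by_cases ht : |s.im| ≤ 1
  · have h2 := hD s ⟨abs_le.1 hs, abs_le.1 ht⟩
    rw [norm_mul, norm_real, Real.norm_of_nonneg hp.le] at h2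
    rw [← div_eq_mul_inv, le_div_iff₀ hp]
    linarith [le_abs_self D]
  · push Not at ht
    have h3 := h (1 - s) (by
      rw [abs_le] at hs ⊢
      simp; constructor <;> linarith) (fun k => by
        refine ht.le.trans (le_trans ?_ (abs_im_le_norm _))
        simp)
    have hsin : Complex.sin (Real.pi * s) ≠ 0 := by
      rw [Complex.sin_ne_zero_iff]
      intro k hk
      have := congrArg Complex.im hk
      simp [Real.pi_ne_zero] at this
      rw [this] at ht
      simp at ht
      linarith
    have hpi : (Real.pi : ℂ) ≠ 0 := ofReal_ne_zero.2 Real.pi_ne_zero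
    have hrefl : (Gamma s)⁻¹ = Gamma (1 - s) * Complex.sin (Real.pi * s) / Real.pi := by
      have h4 := Gamma_mul_Gamma_one_sub s
      have h5 : Gamma s ≠ 0 := by
        intro h
        rw [h, zero_mul] at h4
        exact div_ne_zero hpi hsin h4.symm
      field_simp
      rw [h4]
      field_simp
    have hs2 : ‖Complex.sin (Real.pi * s)‖ ≤ Real.exp (Real.pi * |s.im|) := by
      refine (norm_sin_le _).trans (le_of_eq ?_)
      simp [abs_mul, abs_of_pos Real.pi_pos]
    have hst : stirlingSize (1 - s) * Real.exp (Real.pi * |s.im|) = (stirlingSize s)⁻¹ := by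
      unfold stirlingSize
      rw [mul_inv, ← Real.exp_neg, ← Real.rpow_neg (by positivity)]
      simp only [sub_im, one_im, zero_sub, abs_neg, sub_re, one_re]
      rw [mul_assoc, ← Real.exp_add]
      congr 2 <;> ring
    rw [hrefl, norm_div, norm_mul, norm_real, Real.norm_of_nonneg Real.pi_pos.le]
    calc _ ≤ ‖Gamma (1 - s)‖ * ‖Complex.sin (Real.pi * s)‖ :=
          div_le_self (by positivity) (by linarith [Real.pi_gt_three])
      _ ≤ (C * stirlingSize (1 - s)) * Real.exp (Real.pi * |s.im|) := by gcongr
      _ = C * (stirlingSize s)⁻¹ := by rw [mul_assoc, hst]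
      _ ≤ _ := by
        have := inv_pos.2 hp
        gcongr
        linarith [abs_nonneg D]


/-! ### Contours -/

/-- A contour to the right of the poles of `Γ(s - μ_j)`, vertical outside a compact set. -/
structure IsContour (μ : Fin 3 → ℂ) (σ : ℝ → ℝ) : Prop where
  contDiff : ContDiff ℝ 1 σ
  right : ∀ j, 0 < σ (μ j).im
  eventually_const : ∃ R c, ∀ t, R ≤ |t| → σ t = c

/-- Two contours; if `opp` holds, they are to the left of the poles of `Γ(1 - s₁ - s₂)`. -/
structure IsContourPair (opp : Bool) (μ : Fin 3 → ℂ) (σ₁ σ₂ : ℝ → ℝ) : Prop where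
  fst : IsContour μ σ₁
  snd : IsContour (-μ) σ₂
  left : opp = true → ∀ t, σ₁ t + σ₂ (-t) < 1

lemma contourPoint_re (σ : ℝ → ℝ) (t : ℝ) : (contourPoint σ t).re = σ t := by
  simp [contourPoint]

lemma contourPoint_im (σ : ℝ → ℝ) (t : ℝ) : (contourPoint σ t).im = t := by
  simp [contourPoint]

lemma IsContourPair.swap {opp : Bool} {μ : Fin 3 → ℂ} {σ₁ σ₂ : ℝ → ℝ}
    (h : IsContourPair opp μ σ₁ σ₂) : IsContourPair opp (-μ) σ₂ σ₁ :=
  ⟨h.snd, by simpa using h.fst, fun ho t => by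
    have := h.left ho (-t)
    rw [neg_neg] at this
    linarith⟩

lemma IsContour.bounded {μ : Fin 3 → ℂ} {σ : ℝ → ℝ} (h : IsContour μ σ) :
    ∃ M, 0 < M ∧ ∀ t, |σ t| ≤ M ∧ |deriv σ t| ≤ M := by
  obtain ⟨R, c, hc⟩ := h.eventually_const
  obtain ⟨A, hA⟩ := (isCompact_Icc (a := -|R|) (b := |R|)).exists_bound_of_continuousOn
    h.contDiff.continuous.continuousOn
  obtain ⟨B, hB⟩ := (isCompact_Icc (a := -|R|) (b := |R|)).exists_bound_of_continuousOn
    (h.contDiff.continuous_deriv le_rfl).continuousOn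
  refine ⟨|A| + |B| + |c| + 1, by positivity, fun t => ?_⟩
  have hA0 := abs_nonneg A
  have hB0 := abs_nonneg B
  have hc0 := abs_nonneg c
  by_cases ht : |t| ≤ |R|
  · have h1 := hA t (abs_le.1 ht)
    have h2 := hB t (abs_le.1 ht)
    rw [Real.norm_eq_abs] at h1 h2
    constructor <;> linarith [le_abs_self A, le_abs_self B]
  · push Not at ht
    have he : σ =ᶠ[𝓝 t] fun _ => c := by
      filter_upwards [(continuous_abs.tendsto t).eventually (lt_mem_nhds ht)] with x hx
      exact hc x ((le_abs_self R).trans hx.le)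
    rw [he.deriv_eq, he.eq_of_nhds]
    simp
    constructor <;> linarith

/-- At heights close to `Im μ_j` the contour is to the right of the rightmost pole by continuity, so
the real part gives the distance; at all other heights the imaginary part does. -/
lemma IsContour.dist_pole {μ : Fin 3 → ℂ} (hμ : ∀ j, (μ j).re = 0) {σ : ℝ → ℝ}
    (h : IsContour μ σ) : ∃ η, 0 < η ∧ ∀ t j (k : ℕ), η ≤ ‖contourPoint σ t - μ j + k‖ := by
  have key : ∀ j, ∃ η, 0 < η ∧ ∀ t (k : ℕ), η ≤ ‖contourPoint σ t - μ j + k‖ := by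
    intro j
    have h0 := h.right j
    obtain ⟨d, hd, hd'⟩ := Metric.eventually_nhds_iff.1
      ((h.contDiff.continuous.tendsto (μ j).im).eventually
        (lt_mem_nhds (half_lt_self h0)))
    refine ⟨min d (σ (μ j).im / 2), by positivity, fun t k => ?_⟩
    by_cases ht : dist t (μ j).im < d
    · refine (min_le_right _ _).trans (le_trans ?_ (re_le_norm _))
      have := hd' ht
      have hk : (0 : ℝ) ≤ k := Nat.cast_nonneg k
      simp only [add_re, sub_re, contourPoint_re, hμ, natCast_re]
      linarith
    · refine (min_le_left _ _).trans (le_trans ?_ (abs_im_le_norm _))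
      simp only [add_im, sub_im, contourPoint_im, natCast_im, add_zero]
      rw [Real.dist_eq] at ht
      linarith
  choose η h1 h2 using key
  refine ⟨min (η 0) (min (η 1) (η 2)), by simp [h1], fun t j k => le_trans ?_ (h2 j t k)⟩
  fin_cases j <;> simp

/-- The imaginary part of `1 - s₁ - s₂` is small only if `t₂` is close to `-t₁`. On `t₂ = -t₁` the
real part has a positive lower bound, and the Lipschitz continuity of `σ₂` keeps half of it nearby.
-/
lemma IsContourPair.dist_pole_add {μ : Fin 3 → ℂ} {σ₁ σ₂ : ℝ → ℝ}
    (h : IsContourPair true μ σ₁ σ₂) : ∃ η, 0 < η ∧ ∀ t₁ t₂ (k : ℕ),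
      η ≤ ‖1 - contourPoint σ₁ t₁ - contourPoint σ₂ t₂ + k‖ := by
  obtain ⟨R₁, c₁, hc₁⟩ := h.fst.eventually_const
  obtain ⟨R₂, c₂, hc₂⟩ := h.snd.eventually_const
  obtain ⟨M, hM, hM'⟩ := h.snd.bounded
  set R := max |R₁| |R₂| with hR
  have hl := h.left rfl
  have hcont : Continuous fun t => 1 - (σ₁ t + σ₂ (-t)) :=
    continuous_const.sub (h.fst.contDiff.continuous.add
      (h.snd.contDiff.continuous.comp continuous_neg))
  -- Both contours are constant for `|t| ≥ R`, so the minimum over `[-R, R]` is the minimum over the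
  -- whole line.
  obtain ⟨t₀, -, ht₀⟩ := (isCompact_Icc (a := -R) (b := R)).exists_isMinOn
    ⟨0, by simp [hR]⟩ hcont.continuousOn
  set e := 1 - (σ₁ t₀ + σ₂ (-t₀)) with he
  have he0 : 0 < e := by have := hl t₀; linarith
  have hmin : ∀ t, e ≤ 1 - (σ₁ t + σ₂ (-t)) := by
    intro t
    by_cases ht : |t| ≤ R
    · exact ht₀ (abs_le.1 ht)
    · push Not at ht
      have hR1 : R₁ ≤ R := (le_abs_self _).trans (le_max_left _ _)
      have hR2 : R₂ ≤ R := (le_abs_self _).trans (le_max_right _ _)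
      have hR0 : 0 ≤ R := (abs_nonneg _).trans (le_max_left _ _)
      have hRR : e ≤ 1 - (σ₁ R + σ₂ (-R)) := ht₀ (show R ∈ Icc (-R) R from ⟨by linarith, le_rfl⟩)
      rw [hc₁ R (by rwa [abs_of_nonneg hR0]), hc₂ (-R) (by rwa [abs_neg, abs_of_nonneg hR0])] at hRR
      rw [hc₁ t (by linarith), hc₂ (-t) (by rw [abs_neg]; linarith)]
      exact hRR
  have hlip : ∀ x y, |σ₂ x - σ₂ y| ≤ M * |x - y| := fun x y => by
    have := Convex.norm_image_sub_le_of_norm_deriv_le (f := σ₂) (C := M) (s := univ)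
      (fun x _ => (h.snd.contDiff.differentiable one_ne_zero) x)
      (fun x _ => (hM' x).2) convex_univ (mem_univ y) (mem_univ x)
    simpa using this
  refine ⟨min (e / 2) (e / (2 * M)), by positivity, fun t₁ t₂ k => ?_⟩
  by_cases ht : |t₁ + t₂| ≤ e / (2 * M)
  · refine (min_le_left _ _).trans (le_trans ?_ (re_le_norm _))
    have hk : (0 : ℝ) ≤ k := Nat.cast_nonneg k
    simp only [add_re, sub_re, contourPoint_re, one_re, natCast_re]
    have h1 := hmin t₁
    have h2 := hlip t₂ (-t₁)
    have h3 : M * |t₂ - -t₁| ≤ e / 2 := by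
      rw [sub_neg_eq_add, add_comm]
      calc _ ≤ M * (e / (2 * M)) := by gcongr
        _ = e / 2 := by field_simp
    have := (le_abs_self _).trans (h2.trans h3)
    linarith
  · push Not at ht
    refine (min_le_right _ _).trans (ht.le.trans (le_trans (le_of_eq ?_) (abs_im_le_norm _)))
    simp only [add_im, sub_im, contourPoint_im, one_im, natCast_im]
    rw [← abs_neg]
    ring_nf

/-! ### The product of Gamma functions -/

/-- `∏_j Γ(s₁ - μ_j) Γ(s₂ + μ_j)` times `Γ(1 - s₁ - s₂)/π` or `1/Γ(s₁ + s₂)`. -/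
noncomputable def gammaKernel (opp : Bool) (μ : Fin 3 → ℂ) (s₁ s₂ : ℂ) : ℂ :=
  (∏ j, (Gamma (s₁ - μ j) * Gamma (s₂ + μ j))) *
    bif opp then Gamma (1 - s₁ - s₂) / Real.pi else (Gamma (s₁ + s₂))⁻¹

lemma gammaKernel_swap (opp : Bool) (μ : Fin 3 → ℂ) (s₁ s₂ : ℂ) :
    gammaKernel opp (-μ) s₂ s₁ = gammaKernel opp μ s₁ s₂ := by
  unfold gammaKernel
  congr 1
  · refine Finset.prod_congr rfl fun j _ => ?_
    simp only [Pi.neg_apply, sub_neg_eq_add, ← sub_eq_add_neg]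
    ring
  · rw [sub_right_comm, add_comm]

/-- The order of magnitude of `gammaKernel`. -/
noncomputable def kernelSize (opp : Bool) (s₁ s₂ : ℂ) : ℝ :=
  stirlingSize s₁ ^ 3 * stirlingSize s₂ ^ 3 *
    bif opp then stirlingSize (1 - s₁ - s₂) else (stirlingSize (s₁ + s₂))⁻¹

/-- The points `(s₁, s₂)` in strips, at distance at least `η` from the poles. -/
def awayFromPoles (opp : Bool) (μ : Fin 3 → ℂ) (M η : ℝ) : Set (ℂ × ℂ) :=
  {s | |s.1.re| ≤ M ∧ |s.2.re| ≤ M ∧ (∀ j (k : ℕ), η ≤ ‖s.1 - μ j + k‖) ∧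
    (∀ j (k : ℕ), η ≤ ‖s.2 + μ j + k‖) ∧ (opp = true → ∀ k : ℕ, η ≤ ‖1 - s.1 - s.2 + k‖)}

/-- Peetre's inequality: `1 + |x+y| ≤ (1+|x|)(1+|y|)`, used in both directions according to the sign
of the exponent. It removes the imaginary shifts by `μ_j` from all size estimates. -/
lemma stirlingSize_shift {m : ℂ} (hm : m.re = 0) (M : ℝ) :
    ∃ C, 0 < C ∧ ∀ s : ℂ, |s.re| ≤ M → stirlingSize (s + m) ≤ C * stirlingSize s := by
  refine ⟨(1 + |m.im|) ^ (|M| + 1 / 2) * Real.exp (Real.pi / 2 * |m.im|), by positivity,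
    fun s hs => ?_⟩
  unfold stirlingSize
  rw [add_re, add_im, hm, add_zero, mul_mul_mul_comm, ← Real.exp_add]
  have h0 : 0 ≤ |m.im| := abs_nonneg _
  have h1 : 0 ≤ |s.im| := abs_nonneg _
  have h2 : |s.im| ≤ |s.im + m.im| + |m.im| := by
    have := abs_sub (s.im + m.im) m.im
    simpa using this
  have hp : |s.re - 1 / 2| ≤ |M| + 1 / 2 := by
    rw [abs_le] at hs ⊢
    constructor <;> linarith [le_abs_self M, neg_abs_le M]
  gcongr
  · have hmul1 : 1 + |s.im + m.im| ≤ (1 + |m.im|) * (1 + |s.im|) := by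
      nlinarith [abs_add_le s.im m.im]
    have hmul2 : 1 + |s.im| ≤ (1 + |m.im|) * (1 + |s.im + m.im|) := by
      nlinarith [abs_nonneg (s.im + m.im)]
    have hle : (1 + |m.im|) ^ |s.re - 1 / 2| ≤ (1 + |m.im|) ^ (|M| + 1 / 2) :=
      Real.rpow_le_rpow_of_exponent_le (by linarith) hp
    refine le_trans ?_ (mul_le_mul_of_nonneg_right hle (by positivity))
    rcases le_total 0 (s.re - 1 / 2) with h | h
    · rw [abs_of_nonneg h, ← Real.mul_rpow (by positivity) (by positivity)]
      gcongr
    · rw [abs_of_nonpos h, Real.rpow_neg (by positivity), ← div_eq_inv_mul,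
        ← Real.div_rpow (by positivity) (by positivity)]
      refine Real.rpow_le_rpow_of_nonpos (by positivity) ?_ h
      rw [div_le_iff₀ (by positivity)]
      linarith
  · nlinarith [Real.pi_pos]

lemma exists_norm_gammaKernel_le (opp : Bool) {μ : Fin 3 → ℂ} (hμ : ∀ j, (μ j).re = 0)
    (M : ℝ) {η : ℝ} (hη : 0 < η) : ∃ C, 0 < C ∧ ∀ s ∈ awayFromPoles opp μ M η,
      ‖gammaKernel opp μ s.1 s.2‖ ≤ C * kernelSize opp s.1 s.2 := by
  obtain ⟨C, hC, hΓ⟩ := exists_norm_Gamma_le hη (1 + 2 * M)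
  obtain ⟨C', hC', hΓ'⟩ := exists_norm_inv_Gamma_le (2 * M)
  have hΓM : ∀ m : ℂ, m.re = 0 → ∃ B, 0 < B ∧ ∀ s : ℂ, |s.re| ≤ M → (∀ k : ℕ, η ≤ ‖s + m + k‖) →
      ‖Gamma (s + m)‖ ≤ B * stirlingSize s := by
    intro m hm
    obtain ⟨B, hB, hB'⟩ := stirlingSize_shift hm M
    refine ⟨C * B, by positivity, fun s hs hd => ?_⟩
    have hM := (abs_nonneg _).trans hs
    calc _ ≤ C * stirlingSize (s + m) := hΓ _ (by simp [hm]; linarith) hd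
      _ ≤ C * (B * stirlingSize s) := by gcongr; exact hB' s hs
      _ = _ := by ring
  choose B hB hBΓ using fun j => hΓM (-μ j) (by simp [hμ])
  choose B' hB' hBΓ' using fun j => hΓM (μ j) (hμ j)
  refine ⟨(∏ j, (B j * B' j)) * (C + C'), ?_, ?_⟩
  · have : 0 < ∏ j, (B j * B' j) := Finset.prod_pos fun j _ => mul_pos (hB j) (hB' j)
    positivity
  · rintro ⟨s₁, s₂⟩ ⟨h1, h2, h3, h4, h5⟩
    simp only at h1 h2 h3 h4 h5 ⊢
    have hb := abs_le.1 h1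
    have hb' := abs_le.1 h2
    have hs1 := stirlingSize_pos s₁
    have hs2 := stirlingSize_pos s₂
    have hB0 : 0 < ∏ j, (B j * B' j) := Finset.prod_pos fun j _ => mul_pos (hB j) (hB' j)
    have hprod : ‖∏ j, (Gamma (s₁ - μ j) * Gamma (s₂ + μ j))‖ ≤
        (∏ j, (B j * B' j)) * (stirlingSize s₁ ^ 3 * stirlingSize s₂ ^ 3) := by
      have : (∏ j, (B j * B' j)) * (stirlingSize s₁ ^ 3 * stirlingSize s₂ ^ 3) =
          ∏ j : Fin 3, ((B j * stirlingSize s₁) * (B' j * stirlingSize s₂)) := by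
        simp only [Fin.prod_univ_three]; ring
      rw [this, norm_prod]
      refine Finset.prod_le_prod (fun j _ => norm_nonneg _) fun j _ => ?_
      rw [norm_mul]
      have e1 := hBΓ j s₁ h1 (by simpa only [← sub_eq_add_neg] using h3 j)
      rw [← sub_eq_add_neg] at e1
      have e2 := hBΓ' j s₂ h2 (h4 j)
      have := (hB j).le
      gcongr
    unfold gammaKernel kernelSize
    rw [norm_mul]
    cases opp
    · have e := hΓ' (s₁ + s₂) (by rw [abs_le, add_re]; constructor <;> linarith)
      have hs := inv_pos.2 (stirlingSize_pos (s₁ + s₂))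
      simp only [cond_false]
      calc _ ≤ ((∏ j, (B j * B' j)) * (stirlingSize s₁ ^ 3 * stirlingSize s₂ ^ 3)) *
            ((C + C') * (stirlingSize (s₁ + s₂))⁻¹) := by
            gcongr
            refine e.trans ?_
            gcongr
            linarith
        _ = _ := by ring
    · have e := hΓ (1 - s₁ - s₂) (by rw [abs_le]; simp only [sub_re, one_re]; constructor <;> linarith)
        (h5 rfl)
      have hs := (stirlingSize_pos (1 - s₁ - s₂))
      simp only [cond_true]
      calc _ ≤ ((∏ j, (B j * B' j)) * (stirlingSize s₁ ^ 3 * stirlingSize s₂ ^ 3)) *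
            ((C + C') * stirlingSize (1 - s₁ - s₂)) := by
            gcongr
            rw [norm_div, norm_real, Real.norm_of_nonneg Real.pi_pos.le]
            refine (div_le_self (norm_nonneg _) (by linarith [Real.pi_gt_three])).trans
              (e.trans ?_)
            gcongr
            linarith
        _ = _ := by ring

/-- Crude bounds suffice here, since they are only set against a Gaussian factor. -/
lemma stirlingSize_le_exp {M : ℝ} {s : ℂ} (hs : |s.re| ≤ M) :
    stirlingSize s ≤ Real.exp ((M + 1 / 2) * |s.im|) ∧
      (stirlingSize s)⁻¹ ≤ Real.exp ((M + 3) * |s.im|) := by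
  have h0 := abs_nonneg s.im
  have hp : |s.re - 1 / 2| ≤ M + 1 / 2 := by
    rw [abs_le] at hs ⊢
    constructor <;> linarith
  have key : ∀ p : ℝ, |p| ≤ M + 1 / 2 → (1 + |s.im|) ^ p ≤ Real.exp ((M + 1 / 2) * |s.im|) := by
    intro p hp
    calc (1 + |s.im|) ^ p ≤ (1 + |s.im|) ^ (M + 1 / 2) :=
          Real.rpow_le_rpow_of_exponent_le (by linarith) ((le_abs_self p).trans hp)
      _ ≤ (Real.exp |s.im|) ^ (M + 1 / 2) := by
          refine Real.rpow_le_rpow (by positivity) ?_ ((abs_nonneg p).trans hp)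
          linarith [Real.add_one_le_exp |s.im|]
      _ = _ := by rw [← Real.exp_mul, mul_comm]
  unfold stirlingSize
  constructor
  · calc _ ≤ Real.exp ((M + 1 / 2) * |s.im|) * 1 := by
          gcongr
          · exact key _ hp
          · rw [Real.exp_le_one_iff]
            have : 0 ≤ Real.pi / 2 * |s.im| := by positivity
            linarith
      _ = _ := mul_one _
  · rw [mul_inv, ← Real.exp_neg, neg_neg, ← Real.rpow_neg (by positivity)]
    calc _ ≤ Real.exp ((M + 1 / 2) * |s.im|) * Real.exp (Real.pi / 2 * |s.im|) := by
          gcongr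
          exact key _ (by rwa [abs_neg])
      _ ≤ _ := by
          rw [← Real.exp_add]
          gcongr
          nlinarith [Real.pi_lt_d2]

lemma exists_kernelSize_le_exp (opp : Bool) {M : ℝ} (hM : 0 ≤ M) :
    ∃ A, 0 < A ∧ ∀ s₁ s₂ : ℂ, |s₁.re| ≤ M → |s₂.re| ≤ M →
      kernelSize opp s₁ s₂ ≤ Real.exp (A * (|s₁.im| + |s₂.im|)) := by
  refine ⟨3 * (M + 1 / 2) + (1 + 2 * M + 3), by positivity, fun s₁ s₂ h1 h2 => ?_⟩
  have hb := abs_le.1 h1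
  have hb' := abs_le.1 h2
  have e1 := (stirlingSize_le_exp h1).1
  have e2 := (stirlingSize_le_exp h2).1
  have hs1 := stirlingSize_pos s₁
  have hs2 := stirlingSize_pos s₂
  have him := abs_add_le s₁.im s₂.im
  have e3 : (bif opp then stirlingSize (1 - s₁ - s₂) else (stirlingSize (s₁ + s₂))⁻¹) ≤
      Real.exp ((1 + 2 * M + 3) * (|s₁.im| + |s₂.im|)) := by
    cases opp
    · refine (stirlingSize_le_exp (s := s₁ + s₂) (M := 1 + 2 * M)
        (by rw [abs_le, add_re]; constructor <;> linarith)).2.trans ?_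
      simp only [add_im]
      gcongr
    · refine (stirlingSize_le_exp (s := 1 - s₁ - s₂) (M := 1 + 2 * M)
        (by rw [abs_le]; simp only [sub_re, one_re]; constructor <;> linarith)).1.trans ?_
      have : |(1 - s₁ - s₂).im| = |s₁.im + s₂.im| := by
        rw [← abs_neg]; simp; ring_nf
      rw [this]
      gcongr
      linarith
  have h3 : 0 ≤ (bif opp then stirlingSize (1 - s₁ - s₂) else (stirlingSize (s₁ + s₂))⁻¹) := by
    cases opp
    · exact inv_nonneg.2 (stirlingSize_pos _).le
    · exact (stirlingSize_pos _).le
  unfold kernelSize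
  calc _ ≤ (Real.exp ((M + 1 / 2) * |s₁.im|)) ^ 3 * (Real.exp ((M + 1 / 2) * |s₂.im|)) ^ 3 *
        Real.exp ((1 + 2 * M + 3) * (|s₁.im| + |s₂.im|)) := by gcongr
    _ = _ := by
      rw [← Real.exp_nat_mul, ← Real.exp_nat_mul, ← Real.exp_add, ← Real.exp_add]
      congr 1
      push_cast
      ring

/-- Uniform constants for a pair of contours: one bound for the real parts and their derivatives,
and one distance from all poles. -/
lemma IsContourPair.awayFromPoles {opp : Bool} {μ : Fin 3 → ℂ} (hμ : ∀ j, (μ j).re = 0)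
    {σ₁ σ₂ : ℝ → ℝ} (h : IsContourPair opp μ σ₁ σ₂) : ∃ M η, 0 < M ∧ 0 < η ∧
      (∀ t, |σ₁ t| ≤ M ∧ |σ₂ t| ≤ M ∧ |deriv σ₁ t| ≤ M ∧ |deriv σ₂ t| ≤ M) ∧
      ∀ t₁ t₂, (contourPoint σ₁ t₁, contourPoint σ₂ t₂) ∈ awayFromPoles opp μ M η := by
  obtain ⟨M₁, hM₁, h1⟩ := h.fst.bounded
  obtain ⟨M₂, hM₂, h2⟩ := h.snd.bounded
  obtain ⟨η₁, hη₁, h3⟩ := h.fst.dist_pole hμ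
  obtain ⟨η₂, hη₂, h4⟩ := h.snd.dist_pole (by simp [hμ])
  obtain ⟨η₃, hη₃, h5⟩ : ∃ η, 0 < η ∧ (opp = true → ∀ t₁ t₂ (k : ℕ),
      η ≤ ‖1 - contourPoint σ₁ t₁ - contourPoint σ₂ t₂ + k‖) := by
    cases opp
    · exact ⟨1, one_pos, by simp⟩
    · obtain ⟨η, h, h'⟩ := h.dist_pole_add
      exact ⟨η, h, fun _ => h'⟩
  have hmax1 := le_max_left M₁ M₂
  have hmax2 := le_max_right M₁ M₂
  have hm1 := min_le_left η₁ (min η₂ η₃)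
  have hm2 := (min_le_right η₁ (min η₂ η₃)).trans (min_le_left _ _)
  have hm3 := (min_le_right η₁ (min η₂ η₃)).trans (min_le_right _ _)
  refine ⟨max M₁ M₂, min η₁ (min η₂ η₃), by positivity, by positivity, fun t =>
    ⟨(h1 t).1.trans hmax1, (h2 t).1.trans hmax2, (h1 t).2.trans hmax1, (h2 t).2.trans hmax2⟩,
    fun t₁ t₂ => ⟨?_, ?_, fun j k => hm1.trans (h3 _ _ _), fun j k => hm2.trans ?_,
      fun ho k => hm3.trans (h5 ho _ _ _)⟩⟩
  · simpa only [contourPoint_re] using (h1 t₁).1.trans hmax1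
  · simpa only [contourPoint_re] using (h2 t₂).1.trans hmax2
  · simpa using h4 t₂ j k

lemma ne_neg_nat_of_le_norm {η : ℝ} (hη : 0 < η) {z : ℂ} (h : ∀ k : ℕ, η ≤ ‖z + k‖) (m : ℕ) :
    z ≠ -m := by
  intro hz
  have := h m
  rw [hz] at this
  simp at this
  linarith

lemma continuousAt_gammaKernel {opp : Bool} {μ : Fin 3 → ℂ} {M η : ℝ} (hη : 0 < η) {s : ℂ × ℂ}
    (hs : s ∈ awayFromPoles opp μ M η) :
    ContinuousAt (fun s : ℂ × ℂ => gammaKernel opp μ s.1 s.2) s := by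
  obtain ⟨-, -, h3, h4, h5⟩ := hs
  unfold gammaKernel
  refine ContinuousAt.mul (tendsto_finsetProd _ fun j _ => ContinuousAt.mul ?_ ?_) ?_
  · exact (differentiableAt_Gamma _ (ne_neg_nat_of_le_norm hη (h3 j))).continuousAt.comp
      (f := fun s : ℂ × ℂ => s.1 - μ j) (by fun_prop)
  · exact (differentiableAt_Gamma _ (ne_neg_nat_of_le_norm hη (h4 j))).continuousAt.comp
      (f := fun s : ℂ × ℂ => s.2 + μ j) (by fun_prop)
  · cases opp
    · exact (differentiable_one_div_Gamma.continuous.comp (by fun_prop)).continuousAt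
    · exact ((differentiableAt_Gamma _ (ne_neg_nat_of_le_norm hη (h5 rfl))).continuousAt.comp
        (f := fun s : ℂ × ℂ => 1 - s.1 - s.2) (by fun_prop)).div_const _

lemma differentiableAt_gammaKernel {opp : Bool} {μ : Fin 3 → ℂ} {M η : ℝ} (hη : 0 < η) {s : ℂ × ℂ}
    (hs : s ∈ awayFromPoles opp μ M η) :
    DifferentiableAt ℂ (fun z => gammaKernel opp μ z s.2) s.1 := by
  obtain ⟨-, -, h3, h4, h5⟩ := hs
  unfold gammaKernel
  refine DifferentiableAt.mul (DifferentiableAt.fun_finsetProd fun j _ => DifferentiableAt.mul ?_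
    (by fun_prop)) ?_
  · exact (differentiableAt_Gamma _ (ne_neg_nat_of_le_norm hη (h3 j))).comp
      (f := fun z : ℂ => z - μ j) _ (by fun_prop)
  · cases opp
    · exact (differentiable_one_div_Gamma.comp (f := fun z : ℂ => z + s.2) (by fun_prop)) _
    · exact ((differentiableAt_Gamma _ (ne_neg_nat_of_le_norm hη (h5 rfl))).comp
        (f := fun z : ℂ => 1 - z - s.2) _ (by fun_prop)).div_const _


/-! ### Deformation of a single contour -/

lemma hasDerivAt_contourPoint {σ : ℝ → ℝ} (h : ContDiff ℝ 1 σ) (t : ℝ) :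
    HasDerivAt (contourPoint σ) (contourVelocity σ t) t := by
  unfold contourPoint contourVelocity
  have h1 := ((h.differentiable one_ne_zero) t).hasDerivAt.ofReal_comp
  have h2 := ((hasDerivAt_id t).ofReal_comp).mul_const I
  rw [ofReal_one, one_mul] at h2
  exact h1.add h2

lemma continuous_contourPoint {σ : ℝ → ℝ} (h : ContDiff ℝ 1 σ) : Continuous (contourPoint σ) :=
  continuous_iff_continuousAt.2 fun t => (hasDerivAt_contourPoint h t).continuousAt

lemma continuous_contourVelocity {σ : ℝ → ℝ} (h : ContDiff ℝ 1 σ) :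
    Continuous (contourVelocity σ) := by
  unfold contourVelocity
  exact (continuous_ofReal.comp (h.continuous_deriv le_rfl)).add continuous_const

/-- The difference of the integrals over two contours, cut off at height `T`, is given by the
integrals over the horizontal segments that connect them. -/
lemma norm_integral_contour_sub_le {g : ℂ → ℂ} {σ ρ : ℝ → ℝ} (hσ : ContDiff ℝ 1 σ)
    (hρ : ContDiff ℝ 1 ρ)
    (hg : ∀ l ∈ Icc (0 : ℝ) 1, ∀ t, AnalyticAt ℂ g (contourPoint σ t + l * (ρ t - σ t)))
    {T B : ℝ} (hT : 0 ≤ T)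
    (hB : ∀ l ∈ Icc (0 : ℝ) 1, ∀ t, |t| = T →
      ‖g (contourPoint σ t + l * (ρ t - σ t)) * (ρ t - σ t)‖ ≤ B) :
    ‖(∫ t in (-T)..T, g (contourPoint ρ t) * contourVelocity ρ t) -
      ∫ t in (-T)..T, g (contourPoint σ t) * contourVelocity σ t‖ ≤ 2 * B := by
  set h : ℝ → ℝ → ℂ := fun l t => contourPoint σ t + l * (ρ t - σ t) with hh
  set v : ℝ → ℝ → ℂ := fun l t =>
    contourVelocity σ t + l * ((deriv ρ t : ℝ) - (deriv σ t : ℝ)) with hv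
  set D : ℝ → ℂ := fun t => (ρ t : ℂ) - σ t with hD
  set D' : ℝ → ℂ := fun t => ((deriv ρ t : ℝ) : ℂ) - (deriv σ t : ℝ) with hD'
  -- `K` is both the `l`-derivative of `g(h) ∂h/∂t` and the `t`-derivative of `g(h) ∂h/∂l`, for the
  -- straight homotopy `h` from `σ` to `ρ`. Integrating it over the rectangle in the two orders
  -- compares the contour integrals with the boundary terms at `t = ±T`.
  set K : ℝ → ℝ → ℂ := fun l t => deriv g (h l t) * v l t * D t + g (h l t) * D' t with hK
  have hDd : ∀ t, HasDerivAt D (D' t) t := fun t =>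
    ((hρ.differentiable one_ne_zero t).hasDerivAt.ofReal_comp).sub
      ((hσ.differentiable one_ne_zero t).hasDerivAt.ofReal_comp)
  have hht : ∀ l t, HasDerivAt (h l) (v l t) t := fun l t =>
    (hasDerivAt_contourPoint hσ t).add ((hDd t).const_mul (l : ℂ))
  have hhl : ∀ l t, HasDerivAt (fun l : ℝ => h l t) (D t) l := fun l t => by
    have := ((hasDerivAt_id l).ofReal_comp.mul_const (D t)).const_add (contourPoint σ t)
    rw [ofReal_one, one_mul] at this
    exact this
  have hvl : ∀ l t, HasDerivAt (fun l : ℝ => v l t) (D' t) l := fun l t => by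
    have := ((hasDerivAt_id l).ofReal_comp.mul_const (D' t)).const_add (contourVelocity σ t)
    rw [ofReal_one, one_mul] at this
    exact this
  have hDc : Continuous D := continuous_iff_continuousAt.2 fun t => (hDd t).continuousAt
  have hD'c : Continuous D' := (continuous_ofReal.comp (hρ.continuous_deriv le_rfl)).sub
    (continuous_ofReal.comp (hσ.continuous_deriv le_rfl))
  have hhc : Continuous fun x : ℝ × ℝ => h x.1 x.2 :=
    ((continuous_contourPoint hσ).comp continuous_snd).add
      ((continuous_ofReal.comp continuous_fst).mul (hDc.comp continuous_snd))
  have hvc : Continuous fun x : ℝ × ℝ => v x.1 x.2 :=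
    ((continuous_contourVelocity hσ).comp continuous_snd).add
      ((continuous_ofReal.comp continuous_fst).mul (hD'c.comp continuous_snd))
  have hgd : ∀ l ∈ Icc (0 : ℝ) 1, ∀ t, HasDerivAt g (deriv g (h l t)) (h l t) :=
    fun l hl t => (hg l hl t).differentiableAt.hasDerivAt
  have hKc : ContinuousOn (fun x : ℝ × ℝ => K x.1 x.2) (Icc 0 1 ×ˢ univ) := by
    intro x hx
    have h1 : ContinuousAt (fun x : ℝ × ℝ => g (h x.1 x.2)) x :=
      (hg x.1 hx.1 x.2).continuousAt.comp (f := fun x : ℝ × ℝ => h x.1 x.2) hhc.continuousAt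
    have h2 : ContinuousAt (fun x : ℝ × ℝ => deriv g (h x.1 x.2)) x :=
      (hg x.1 hx.1 x.2).deriv.continuousAt.comp (f := fun x : ℝ × ℝ => h x.1 x.2)
        hhc.continuousAt
    exact (((h2.mul hvc.continuousAt).mul (hDc.comp continuous_snd).continuousAt).add
      (h1.mul (hD'c.comp continuous_snd).continuousAt)).continuousWithinAt
  have hPd : ∀ l ∈ Icc (0 : ℝ) 1, ∀ t, HasDerivAt (fun l : ℝ => g (h l t) * v l t) (K l t) l := by
    intro l hl t
    have := ((hgd l hl t).comp l (hhl l t)).mul (hvl l t)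
    rw [mul_right_comm] at this
    exact this
  have hQd : ∀ l ∈ Icc (0 : ℝ) 1, ∀ t, HasDerivAt (fun t : ℝ => g (h l t) * D t) (K l t) t := by
    intro l hl t
    exact ((hgd l hl t).comp t (hht l t)).mul (hDd t)
  have hK1 : ∀ t, (∫ l in (0 : ℝ)..1, K l t) = g (contourPoint ρ t) * contourVelocity ρ t -
      g (contourPoint σ t) * contourVelocity σ t := by
    intro t
    rw [intervalIntegral.integral_eq_sub_of_hasDerivAt (f := fun l : ℝ => g (h l t) * v l t)
      (fun l hl => hPd l (by rwa [uIcc_of_le zero_le_one] at hl) t)]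
    · congr 2
      · congr 1
        simp [hh, contourPoint]; ring
      · simp [hv, contourVelocity]; ring
      · simp [hh]
      · simp [hv]
    · refine ContinuousOn.intervalIntegrable ?_
      rw [uIcc_of_le zero_le_one]
      exact hKc.comp (f := fun l : ℝ => (l, t)) (by fun_prop) fun l hl => ⟨hl, mem_univ _⟩
  have hK2 : ∀ l ∈ Icc (0 : ℝ) 1, (∫ t in (-T)..T, K l t) =
      g (h l T) * D T - g (h l (-T)) * D (-T) := by
    intro l hl
    rw [intervalIntegral.integral_eq_sub_of_hasDerivAt (f := fun t : ℝ => g (h l t) * D t)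
      (fun t _ => hQd l hl t)]
    refine Continuous.intervalIntegrable ?_ _ _
    exact hKc.comp_continuous (f := fun t : ℝ => (l, t)) (by fun_prop) fun t => ⟨hl, mem_univ _⟩
  have hcont : ∀ {τ : ℝ → ℝ}, ContDiff ℝ 1 τ → (∀ t, AnalyticAt ℂ g (contourPoint τ t)) →
      IntervalIntegrable (fun t => g (contourPoint τ t) * contourVelocity τ t) volume (-T) T := by
    intro τ hτ ha
    refine Continuous.intervalIntegrable (Continuous.mul ?_ (continuous_contourVelocity hτ)) _ _
    exact continuous_iff_continuousAt.2 fun t => (ha t).continuousAt.comp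
      (continuous_contourPoint hτ).continuousAt
  rw [← intervalIntegral.integral_sub]
  · simp_rw [← hK1]
    rw [intervalIntegral_intervalIntegral_swap]
    · have : ‖∫ l in (0 : ℝ)..1, ∫ t in (-T)..T, K l t‖ ≤ (2 * B) * |1 - 0| := by
        refine intervalIntegral.norm_integral_le_of_norm_le_const fun l hl => ?_
        rw [uIoc_of_le zero_le_one] at hl
        have hl' : l ∈ Icc (0 : ℝ) 1 := Ioc_subset_Icc_self hl
        rw [hK2 l hl', two_mul]
        exact (norm_sub_le _ _).trans (add_le_add (hB l hl' T (abs_of_nonneg hT))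
          (hB l hl' (-T) (by rw [abs_neg, abs_of_nonneg hT])))
      simpa using this
    · refine ((hKc.comp (f := Prod.swap) (s := Icc (-T) T ×ˢ Icc (0 : ℝ) 1)
        continuous_swap.continuousOn fun x hx => ⟨hx.2, mem_univ _⟩).integrableOn_compact
        (isCompact_Icc.prod isCompact_Icc)).mono_set ?_
      rw [uIoc_of_le (by linarith), uIoc_of_le zero_le_one]
      exact prod_mono Ioc_subset_Icc_self Ioc_subset_Icc_self
  · exact hcont hρ fun t => by
      have := hg 1 (by simp) t
      rwa [show contourPoint σ t + ((1 : ℝ) : ℂ) * (ρ t - σ t) = contourPoint ρ t by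
        simp [contourPoint]; ring] at this
  · exact hcont hσ fun t => by
      have := hg 0 (by simp) t
      simpa using this

/-- Deformation of a contour. -/
lemma integral_contour_eq {g : ℂ → ℂ} {σ ρ : ℝ → ℝ} (hσ : ContDiff ℝ 1 σ)
    (hρ : ContDiff ℝ 1 ρ)
    (hg : ∀ l ∈ Icc (0 : ℝ) 1, ∀ t, AnalyticAt ℂ g (contourPoint σ t + l * (ρ t - σ t)))
    {B : ℝ → ℝ} (hB : Tendsto B atTop (𝓝 0)) {R : ℝ}
    (hgB : ∀ l ∈ Icc (0 : ℝ) 1, ∀ t, R ≤ |t| →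
      ‖g (contourPoint σ t + l * (ρ t - σ t)) * (ρ t - σ t)‖ ≤ B |t|)
    (hiσ : Integrable fun t => g (contourPoint σ t) * contourVelocity σ t)
    (hiρ : Integrable fun t => g (contourPoint ρ t) * contourVelocity ρ t) :
    ∫ t, g (contourPoint ρ t) * contourVelocity ρ t =
      ∫ t, g (contourPoint σ t) * contourVelocity σ t := by
  have h1 := intervalIntegral_tendsto_integral hiρ tendsto_neg_atTop_atBot tendsto_id
  have h2 := intervalIntegral_tendsto_integral hiσ tendsto_neg_atTop_atBot tendsto_id
  have h3 := (h1.sub h2).norm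
  have h4 : Tendsto (fun T => 2 * B T) atTop (𝓝 0) := by simpa using hB.const_mul 2
  have h5 := le_of_tendsto_of_tendsto h3 h4 (by
    filter_upwards [eventually_ge_atTop 0, eventually_ge_atTop R] with T hT hTR
    exact norm_integral_contour_sub_le hσ hρ hg hT fun l hl t ht => by
      have := hgB l hl t (by rwa [ht])
      rwa [ht] at this)
  exact sub_eq_zero.1 (norm_le_zero_iff.1 h5)


/-! ### Independence of double contour integrals of the contours -/

/-- Entire functions of `s₁` and of `s₂`, of exponential growth in strips. -/
structure IsWeight (T : ℂ → ℂ → ℂ) : Prop where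
  continuous : Continuous fun s : ℂ × ℂ => T s.1 s.2
  diff_fst : ∀ s₂, Differentiable ℂ fun z => T z s₂
  diff_snd : ∀ s₁, Differentiable ℂ fun z => T s₁ z
  growth : ∀ M, ∃ C A, 0 ≤ C ∧ 0 ≤ A ∧ ∀ s₁ s₂ : ℂ, |s₁.re| ≤ M → |s₂.re| ≤ M →
    ‖T s₁ s₂‖ ≤ C * Real.exp (A * (|s₁.im| + |s₂.im|))

lemma IsWeight.swap {T : ℂ → ℂ → ℂ} (h : IsWeight T) : IsWeight fun s₁ s₂ => T s₂ s₁ :=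
  ⟨h.continuous.comp continuous_swap, h.diff_snd, h.diff_fst, fun M => by
    obtain ⟨C, A, hC, hA, hT⟩ := h.growth M
    exact ⟨C, A, hC, hA, fun s₁ s₂ h1 h2 => by rw [add_comm]; exact hT s₂ s₁ h2 h1⟩⟩

lemma IsWeight.mul {T U : ℂ → ℂ → ℂ} (hT : IsWeight T) (hU : IsWeight U) :
    IsWeight fun s₁ s₂ => T s₁ s₂ * U s₁ s₂ :=
  ⟨hT.continuous.mul hU.continuous, fun s => (hT.diff_fst s).mul (hU.diff_fst s),
    fun s => (hT.diff_snd s).mul (hU.diff_snd s), fun M => by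
    obtain ⟨C, A, hC, hA, h⟩ := hT.growth M
    obtain ⟨C', A', hC', hA', h'⟩ := hU.growth M
    refine ⟨C * C', A + A', by positivity, by positivity, fun s₁ s₂ h1 h2 => ?_⟩
    rw [norm_mul, add_mul, Real.exp_add, mul_mul_mul_comm]
    exact mul_le_mul (h _ _ h1 h2) (h' _ _ h1 h2) (norm_nonneg _) (by positivity)⟩

lemma isWeight_const (c : ℂ) : IsWeight fun _ _ => c :=
  ⟨continuous_const, fun _ => differentiable_const _, fun _ => differentiable_const _,
    fun _ => ⟨‖c‖, 0, norm_nonneg _, le_rfl, fun _ _ _ _ => by simp⟩⟩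

lemma isWeight_exp (a b c : ℂ) : IsWeight fun s₁ s₂ => cexp (a * s₁ + b * s₂ + c) where
  continuous := by fun_prop
  diff_fst := fun _ => by fun_prop
  diff_snd := fun _ => by fun_prop
  growth := fun M => by
    refine ⟨Real.exp ((‖a‖ + ‖b‖) * |M| + ‖c‖), ‖a‖ + ‖b‖, (Real.exp_pos _).le, by positivity,
      fun s₁ s₂ h1 h2 => ?_⟩
    have hm := le_abs_self M
    have e : ∀ (a s : ℂ), |s.re| ≤ M → (a * s).re ≤ ‖a‖ * (|M| + |s.im|) := fun a s hs => by
      refine (re_le_norm _).trans ?_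
      rw [norm_mul]
      gcongr
      linarith [norm_le_abs_re_add_abs_im s]
    rw [norm_exp, ← Real.exp_add]
    gcongr
    simp only [add_re]
    have e1 := e a s₁ h1
    have e2 := e b s₂ h2
    have e3 := re_le_norm c
    have e4 := mul_nonneg (norm_nonneg a) (abs_nonneg s₂.im)
    have e5 := mul_nonneg (norm_nonneg b) (abs_nonneg s₁.im)
    linarith

lemma IsWeight.sub {T U : ℂ → ℂ → ℂ} (hT : IsWeight T) (hU : IsWeight U) :
    IsWeight fun s₁ s₂ => T s₁ s₂ - U s₁ s₂ :=
  ⟨hT.continuous.sub hU.continuous, fun s => (hT.diff_fst s).sub (hU.diff_fst s),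
    fun s => (hT.diff_snd s).sub (hU.diff_snd s), fun M => by
    obtain ⟨C, A, hC, hA, h⟩ := hT.growth M
    obtain ⟨C', A', hC', hA', h'⟩ := hU.growth M
    refine ⟨C + C', A + A', by positivity, by positivity, fun s₁ s₂ h1 h2 => ?_⟩
    have hx : 0 ≤ |s₁.im| + |s₂.im| := by positivity
    calc _ ≤ C * Real.exp (A * (|s₁.im| + |s₂.im|)) + C' * Real.exp (A' * (|s₁.im| + |s₂.im|)) :=
          (norm_sub_le _ _).trans (add_le_add (h _ _ h1 h2) (h' _ _ h1 h2))
      _ ≤ C * Real.exp ((A + A') * (|s₁.im| + |s₂.im|)) +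
          C' * Real.exp ((A + A') * (|s₁.im| + |s₂.im|)) := by
        gcongr <;> linarith
      _ = _ := by ring⟩

lemma isWeight_sin (a b c : ℂ) : IsWeight fun s₁ s₂ => Complex.sin (a * s₁ + b * s₂ + c) := by
  have h := ((isWeight_exp (-a * I) (-b * I) (-c * I)).sub
    (isWeight_exp (a * I) (b * I) (c * I))).mul (isWeight_const (I / 2))
  convert h using 3 with s₁ s₂
  rw [Complex.sin, ← mul_div_assoc]
  congr 4 <;> ring_nf

/-- The integrand of the double contour integral of `H`, in the parameters `(t₁, t₂)`. -/
noncomputable def contourIntegrand (H : ℂ → ℂ → ℂ) (σ₁ σ₂ : ℝ → ℝ) (t : ℝ × ℝ) : ℂ :=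
  H (contourPoint σ₁ t.1) (contourPoint σ₂ t.2) *
    (contourVelocity σ₁ t.1 * contourVelocity σ₂ t.2)

lemma norm_contourVelocity_le {σ : ℝ → ℝ} {M t : ℝ} (h : |deriv σ t| ≤ M) :
    ‖contourVelocity σ t‖ ≤ M + 1 := by
  refine (norm_add_le _ _).trans ?_
  simpa using h

lemma continuous_contourIntegrand {opp : Bool} {μ : Fin 3 → ℂ} (hμ : ∀ j, (μ j).re = 0)
    {σ₁ σ₂ : ℝ → ℝ} (h : IsContourPair opp μ σ₁ σ₂) {T : ℂ → ℂ → ℂ}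
    (hT : Continuous fun s : ℂ × ℂ => T s.1 s.2) :
    Continuous (contourIntegrand (fun s₁ s₂ => gammaKernel opp μ s₁ s₂ * T s₁ s₂) σ₁ σ₂) := by
  obtain ⟨M, η, hM, hη, -, hd⟩ := h.awayFromPoles hμ
  have c1 := (continuous_contourPoint h.fst.contDiff).comp (continuous_fst (X := ℝ) (Y := ℝ))
  have c2 := (continuous_contourPoint h.snd.contDiff).comp (continuous_snd (X := ℝ) (Y := ℝ))
  have c3 := (continuous_contourVelocity h.fst.contDiff).comp (continuous_fst (X := ℝ) (Y := ℝ))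
  have c4 := (continuous_contourVelocity h.snd.contDiff).comp (continuous_snd (X := ℝ) (Y := ℝ))
  refine (Continuous.mul ?_ (hT.comp (c1.prodMk c2))).mul (c3.mul c4)
  exact continuous_iff_continuousAt.2 fun t =>
    (continuousAt_gammaKernel hη (hd t.1 t.2)).comp (f := fun t : ℝ × ℝ =>
      (contourPoint σ₁ t.1, contourPoint σ₂ t.2)) (c1.prodMk c2).continuousAt

/-- A weighted Gamma kernel with a Gaussian factor. -/
noncomputable def dampedKernel (opp : Bool) (μ : Fin 3 → ℂ) (T : ℂ → ℂ → ℂ) (ε : ℝ)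
    (s₁ s₂ : ℂ) : ℂ :=
  gammaKernel opp μ s₁ s₂ * (T s₁ s₂ * cexp (ε * (s₁ ^ 2 + s₂ ^ 2)))

/-- Since `Re s² = (Re s)² - (Im s)²`, the damping factor decays like a Gaussian in strips and beats
every weight of exponential growth. -/
lemma norm_gaussian (ε : ℝ) (s₁ s₂ : ℂ) : ‖cexp (ε * (s₁ ^ 2 + s₂ ^ 2))‖ =
    Real.exp (ε * (s₁.re ^ 2 + s₂.re ^ 2)) * Real.exp (-ε * (s₁.im ^ 2 + s₂.im ^ 2)) := by
  rw [norm_exp, ← Real.exp_add]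
  congr 1
  simp [sq]
  ring

lemma exists_norm_dampedKernel_le (opp : Bool) {μ : Fin 3 → ℂ} (hμ : ∀ j, (μ j).re = 0)
    {T : ℂ → ℂ → ℂ} (hT : IsWeight T) {ε : ℝ} (hε : 0 < ε) {M η : ℝ} (hM : 0 ≤ M) (hη : 0 < η) :
    ∃ C A, 0 ≤ C ∧ 0 ≤ A ∧ ∀ s ∈ awayFromPoles opp μ M η, ‖dampedKernel opp μ T ε s.1 s.2‖ ≤
      C * (Real.exp (A * |s.1.im| - ε * s.1.im ^ 2) *
        Real.exp (A * |s.2.im| - ε * s.2.im ^ 2)) := by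
  obtain ⟨C₁, hC₁, h1⟩ := exists_norm_gammaKernel_le opp hμ M hη
  obtain ⟨A₁, hA₁, h2⟩ := exists_kernelSize_le_exp opp hM
  obtain ⟨C₂, A₂, hC₂, hA₂, h3⟩ := hT.growth M
  refine ⟨C₁ * C₂ * Real.exp (ε * (2 * M ^ 2)), A₁ + A₂, by positivity, by positivity,
    fun s hs => ?_⟩
  have e1 := h1 s hs
  have e2 := h2 s.1 s.2 hs.1 hs.2.1
  have e3 := h3 s.1 s.2 hs.1 hs.2.1
  have e4 : s.1.re ^ 2 + s.2.re ^ 2 ≤ 2 * M ^ 2 := by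
    have := sq_le_sq' (abs_le.1 hs.1).1 (abs_le.1 hs.1).2
    have := sq_le_sq' (abs_le.1 hs.2.1).1 (abs_le.1 hs.2.1).2
    linarith
  unfold dampedKernel
  rw [norm_mul, norm_mul, norm_gaussian]
  calc _ ≤ (C₁ * Real.exp (A₁ * (|s.1.im| + |s.2.im|))) *
        ((C₂ * Real.exp (A₂ * (|s.1.im| + |s.2.im|))) * (Real.exp (ε * (2 * M ^ 2)) *
          Real.exp (-ε * (s.1.im ^ 2 + s.2.im ^ 2)))) := by
        gcongr
        exact e1.trans (by gcongr)
    _ = _ := by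
        rw [show Real.exp ((A₁ + A₂) * |s.1.im| - ε * s.1.im ^ 2) *
          Real.exp ((A₁ + A₂) * |s.2.im| - ε * s.2.im ^ 2) =
          Real.exp (A₁ * (|s.1.im| + |s.2.im|)) * Real.exp (A₂ * (|s.1.im| + |s.2.im|)) *
          Real.exp (-ε * (s.1.im ^ 2 + s.2.im ^ 2)) by
            simp only [← Real.exp_add]; congr 1; ring]
        ring

lemma integrable_exp_abs_sub_sq (A : ℝ) {ε : ℝ} (hε : 0 < ε) :
    Integrable fun t : ℝ => Real.exp (A * |t| - ε * t ^ 2) := by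
  refine Integrable.mono' ((integrable_exp_neg_mul_sq (half_pos hε)).const_mul
    (Real.exp (A ^ 2 / (2 * ε)))) (Continuous.aestronglyMeasurable (by fun_prop))
    (ae_of_all _ fun t => ?_)
  rw [Real.norm_of_nonneg (Real.exp_pos _).le, ← Real.exp_add]
  gcongr
  have h : 0 ≤ (A - ε * |t|) ^ 2 / (2 * ε) := by positivity
  have h2 : (A - ε * |t|) ^ 2 / (2 * ε) = A ^ 2 / (2 * ε) - A * |t| + ε / 2 * t ^ 2 := by
    rw [← sq_abs t]; field_simp; ring
  linarith

lemma tendsto_exp_sub_sq (A : ℝ) {ε : ℝ} (hε : 0 < ε) :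
    Tendsto (fun t : ℝ => Real.exp (A * t - ε * t ^ 2)) atTop (𝓝 0) := by
  refine Real.tendsto_exp_atBot.comp ?_
  have : (fun t : ℝ => A * t - ε * t ^ 2) = fun t => t * (A + -(ε * t)) := by ext; ring
  rw [this]
  exact tendsto_id.atTop_mul_atBot₀ (tendsto_atBot_add_const_left _ _
    (tendsto_neg_atTop_atBot.comp (tendsto_id.const_mul_atTop hε)))

lemma integrable_dampedKernel {opp : Bool} {μ : Fin 3 → ℂ} (hμ : ∀ j, (μ j).re = 0)
    {σ₁ σ₂ : ℝ → ℝ} (h : IsContourPair opp μ σ₁ σ₂) {T : ℂ → ℂ → ℂ} (hT : IsWeight T) {ε : ℝ}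
    (hε : 0 < ε) : Integrable (contourIntegrand (dampedKernel opp μ T ε) σ₁ σ₂) := by
  obtain ⟨M, η, hM, hη, hb, hd⟩ := h.awayFromPoles hμ
  obtain ⟨C, A, hC, hA, hle⟩ := exists_norm_dampedKernel_le opp hμ hT hε hM.le hη
  have hi := (integrable_exp_abs_sub_sq A hε).mul_prod (integrable_exp_abs_sub_sq A hε)
  refine Integrable.mono' (hi.const_mul (C * ((M + 1) * (M + 1))))
    (Continuous.aestronglyMeasurable ?_) (ae_of_all _ fun t => ?_)
  · exact continuous_contourIntegrand hμ h (hT.continuous.mul (by fun_prop))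
  · unfold contourIntegrand
    rw [norm_mul, norm_mul]
    have e1 := hle _ (hd t.1 t.2)
    simp only [contourPoint_im] at e1
    have e2 := norm_contourVelocity_le (hb t.1).2.2.1
    have e3 := norm_contourVelocity_le (hb t.2).2.2.2
    calc _ ≤ (C * (Real.exp (A * |t.1| - ε * t.1 ^ 2) * Real.exp (A * |t.2| - ε * t.2 ^ 2))) *
          ((M + 1) * (M + 1)) := by gcongr
      _ = _ := by ring

/-- This provides the open neighbourhood on which differentiability implies analyticity. -/
lemma awayFromPoles_of_mem_ball {opp : Bool} {μ : Fin 3 → ℂ} {M η : ℝ} {s : ℂ × ℂ}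
    (hη : 0 < η) (hs : s ∈ awayFromPoles opp μ M η) {z : ℂ} (hz : z ∈ Metric.ball s.1 (η / 2)) :
    (z, s.2) ∈ awayFromPoles opp μ (M + η) (η / 2) := by
  obtain ⟨h1, h2, h3, h4, h5⟩ := hs
  rw [Metric.mem_ball, dist_eq_norm] at hz
  have hr : |z.re - s.1.re| < η / 2 := by
    have := abs_re_le_norm (z - s.1)
    rw [sub_re] at this
    linarith
  refine ⟨?_, by simp only; linarith, fun j k => ?_, fun j k => by linarith [h4 j k],
    fun ho k => ?_⟩
  · simp only
    have := abs_sub_abs_le_abs_sub z.re s.1.re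
    linarith
  · have h := h3 j k
    have : s.1 - μ j + k = (z - μ j + k) - (z - s.1) := by ring
    rw [this] at h
    have := norm_sub_le (z - μ j + k) (z - s.1)
    simp only
    linarith
  · have h := h5 ho k
    have : 1 - s.1 - s.2 + k = (1 - z - s.2 + k) + (z - s.1) := by ring
    rw [this] at h
    have := norm_add_le (1 - z - s.2 + k) (z - s.1)
    simp only
    linarith

lemma analyticAt_dampedKernel {opp : Bool} {μ : Fin 3 → ℂ} {T : ℂ → ℂ → ℂ} (hT : IsWeight T)
    (ε : ℝ) {M η : ℝ} {s : ℂ × ℂ} (hη : 0 < η) (hs : s ∈ awayFromPoles opp μ M η) :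
    AnalyticAt ℂ (fun z => dampedKernel opp μ T ε z s.2) s.1 := by
  have : DifferentiableOn ℂ (fun z => dampedKernel opp μ T ε z s.2) (Metric.ball s.1 (η / 2)) := by
    intro z hz
    refine (DifferentiableAt.mul ?_ ((hT.diff_fst s.2 z).mul (by fun_prop))).differentiableWithinAt
    exact differentiableAt_gammaKernel (s := (z, s.2)) (half_pos hη)
      (awayFromPoles_of_mem_ball hη hs hz)
  exact this.analyticAt (Metric.isOpen_ball.mem_nhds (Metric.mem_ball_self (half_pos hη)))

/-- The conditions on a contour are convex, so the straight homotopy between two contours meets no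
pole. -/
lemma IsContour.interpolate {μ : Fin 3 → ℂ} {σ ρ : ℝ → ℝ} (hσ : IsContour μ σ)
    (hρ : IsContour μ ρ) {l : ℝ} (hl : l ∈ Icc (0 : ℝ) 1) :
    IsContour μ fun t => σ t + l * (ρ t - σ t) where
  contDiff := hσ.contDiff.add (contDiff_const.mul (hρ.contDiff.sub hσ.contDiff))
  right := fun j => by
    have h1 := hσ.right j
    have h2 := hρ.right j
    rcases eq_or_lt_of_le hl.1 with h | h
    · rw [← h]; linarith
    · nlinarith [hl.2]
  eventually_const := by
    obtain ⟨R, c, h⟩ := hσ.eventually_const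
    obtain ⟨R', c', h'⟩ := hρ.eventually_const
    exact ⟨max R R', c + l * (c' - c), fun t ht => by
      rw [h t ((le_max_left _ _).trans ht), h' t ((le_max_right _ _).trans ht)]⟩

lemma IsContourPair.interpolate {opp : Bool} {μ : Fin 3 → ℂ} {σ ρ τ : ℝ → ℝ}
    (h : IsContourPair opp μ σ τ) (h' : IsContourPair opp μ ρ τ) {l : ℝ}
    (hl : l ∈ Icc (0 : ℝ) 1) : IsContourPair opp μ (fun t => σ t + l * (ρ t - σ t)) τ where
  fst := h.fst.interpolate h'.fst hl
  snd := h.snd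
  left := fun ho t => by
    have h1 := h.left ho t
    have h2 := h'.left ho t
    rcases eq_or_lt_of_le hl.1 with h | h
    · rw [← h]; linarith
    · nlinarith [hl.2]

lemma contourPoint_interpolate (σ ρ : ℝ → ℝ) (l t : ℝ) :
    contourPoint (fun t => σ t + l * (ρ t - σ t)) t = contourPoint σ t + l * (ρ t - σ t) := by
  simp only [contourPoint]; push_cast; ring

/-- By Fubini it suffices to deform the `s₁`-contour for almost every fixed `t₂`. -/
lemma integral_dampedKernel_fst {opp : Bool} {μ : Fin 3 → ℂ} (hμ : ∀ j, (μ j).re = 0)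
    {σ ρ τ : ℝ → ℝ} (h : IsContourPair opp μ σ τ) (h' : IsContourPair opp μ ρ τ)
    {T : ℂ → ℂ → ℂ} (hT : IsWeight T) {ε : ℝ} (hε : 0 < ε) :
    ∫ t, contourIntegrand (dampedKernel opp μ T ε) ρ τ t =
      ∫ t, contourIntegrand (dampedKernel opp μ T ε) σ τ t := by
  have hi := integrable_dampedKernel hμ h hT hε
  have hi' := integrable_dampedKernel hμ h' hT hε
  rw [Measure.volume_eq_prod] at hi hi' ⊢
  rw [integral_prod_symm _ hi, integral_prod_symm _ hi']
  refine integral_congr_ae ?_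
  filter_upwards [hi.prod_left_ae, hi'.prod_left_ae] with t₂ hi2 hi2'
  obtain ⟨M₁, hM₁, hb₁⟩ := h.fst.bounded
  obtain ⟨M₂, hM₂, hb₂⟩ := h'.fst.bounded
  obtain ⟨M₃, hM₃, hb₃⟩ := h.snd.bounded
  obtain ⟨η, hη, hd⟩ := h.snd.dist_pole (by simp [hμ])
  set s₂ := contourPoint τ t₂ with hs₂
  set v := contourVelocity τ t₂ with hv
  -- The velocity has imaginary part `1`; dividing by it turns integrability of the sections into
  -- integrability of the one-variable integrand.
  have hv0 : v ≠ 0 := by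
    intro h0
    have := congrArg Complex.im h0
    simp [hv, contourVelocity] at this
  set g : ℂ → ℂ := fun z => dampedKernel opp μ T ε z s₂ with hg
  obtain ⟨C, A, hC, hA, hle⟩ := exists_norm_dampedKernel_le opp hμ hT hε
    (M := M₁ + M₂ + M₃) (η := min 1 η) (by positivity) (by positivity)
  have key : ∫ t, g (contourPoint ρ t) * contourVelocity ρ t =
      ∫ t, g (contourPoint σ t) * contourVelocity σ t := by
    -- Beyond this height the imaginary parts of `s₁ - μ_j` and of `s₁ + s₂` have modulus at least
    -- `1`, so the homotopy stays away from all poles depending on `s₁`.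
    refine integral_contour_eq (R := |t₂| + (∑ j, |(μ j).im|) + 1)
      (B := fun t => (C * Real.exp (A * |t₂| - ε * t₂ ^ 2) * (M₁ + M₂)) *
        Real.exp (A * t - ε * t ^ 2))
      h.fst.contDiff h'.fst.contDiff (fun l hl t => ?_) ?_ (fun l hl t ht => ?_) ?_ ?_
    · obtain ⟨M, η, hM, hη, -, hd⟩ := (h.interpolate h' hl).awayFromPoles hμ
      have := analyticAt_dampedKernel hT ε hη (hd t t₂)
      simpa only [contourPoint_interpolate] using this
    · simpa using (tendsto_exp_sub_sq A hε).const_mul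
        (C * Real.exp (A * |t₂| - ε * t₂ ^ 2) * (M₁ + M₂))
    · have hre : |(contourPoint σ t + l * (ρ t - σ t)).re| ≤ M₁ + M₂ := by
        rw [← contourPoint_interpolate, contourPoint_re]
        have e1 := abs_le.1 (hb₁ t).1
        have e2 := abs_le.1 (hb₂ t).1
        rw [abs_le]
        have := hl.1
        have := hl.2
        constructor <;> nlinarith
      have him : (contourPoint σ t + l * (ρ t - σ t)).im = t := by
        rw [← contourPoint_interpolate, contourPoint_im]
      have hsum : ∀ j, |(μ j).im| ≤ ∑ j, |(μ j).im| := fun j =>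
        Finset.single_le_sum (f := fun j => |(μ j).im|) (fun _ _ => abs_nonneg _)
          (Finset.mem_univ j)
      have hs0 : 0 ≤ ∑ j, |(μ j).im| := Finset.sum_nonneg fun _ _ => abs_nonneg _
      have hmem : (contourPoint σ t + l * (ρ t - σ t), s₂) ∈
          awayFromPoles opp μ (M₁ + M₂ + M₃) (min 1 η) := by
        refine ⟨by simp only; linarith, ?_, fun j k => ?_, fun j k => ?_, fun _ k => ?_⟩
        · simp only [hs₂, contourPoint_re]
          linarith [(hb₃ t₂).1]
        · refine (min_le_left _ _).trans (le_trans ?_ (abs_im_le_norm _))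
          simp only [add_im, sub_im, natCast_im, add_zero, him]
          have := hsum j
          have := abs_sub_abs_le_abs_sub t (μ j).im
          have := abs_nonneg t₂
          linarith
        · refine (min_le_right _ _).trans ?_
          simpa using hd t₂ j k
        · refine (min_le_left _ _).trans (le_trans ?_ (abs_im_le_norm _))
          have : (1 - (contourPoint σ t + l * (ρ t - σ t)) - s₂ + k).im = -(t + t₂) := by
            rw [add_im, sub_im, sub_im, him, hs₂, contourPoint_im]
            simp
            ring
          rw [this, abs_neg]
          have := abs_sub_abs_le_abs_sub t (-t₂)
          rw [abs_neg, sub_neg_eq_add] at this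
          linarith
      have e := hle _ hmem
      simp only [him, hs₂, contourPoint_im] at e
      rw [norm_mul]
      have hdiff : ‖(ρ t : ℂ) - σ t‖ ≤ M₁ + M₂ := by
        rw [← ofReal_sub, norm_real, Real.norm_eq_abs]
        have := abs_sub (ρ t) (σ t)
        linarith [(hb₁ t).1, (hb₂ t).1]
      calc _ ≤ (C * (Real.exp (A * |t| - ε * t ^ 2) * Real.exp (A * |t₂| - ε * t₂ ^ 2))) *
            (M₁ + M₂) := by gcongr
        _ = _ := by rw [sq_abs]; ring
    · refine (hi2.mul_const v⁻¹).congr (ae_of_all _ fun t => ?_)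
      simp only [contourIntegrand, ← hv, ← hs₂, hg]
      rw [← mul_assoc, mul_inv_cancel_right₀ hv0]
    · refine (hi2'.mul_const v⁻¹).congr (ae_of_all _ fun t => ?_)
      simp only [contourIntegrand, ← hv, ← hs₂, hg]
      rw [← mul_assoc, mul_inv_cancel_right₀ hv0]
  have e : ∀ κ : ℝ → ℝ, (∫ t, contourIntegrand (dampedKernel opp μ T ε) κ τ (t, t₂)) =
      (∫ t, g (contourPoint κ t) * contourVelocity κ t) * v := fun κ => by
    rw [← integral_mul_const]
    refine integral_congr_ae (ae_of_all _ fun t => ?_)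
    simp only [contourIntegrand, ← hv, hg]
    ring
  rw [e, e, key]

/-- Interchanging the two variables and replacing `μ` by `-μ` reduces this to a deformation in `s₁`.
-/
lemma integral_dampedKernel_snd {opp : Bool} {μ : Fin 3 → ℂ} (hμ : ∀ j, (μ j).re = 0)
    {σ ρ τ : ℝ → ℝ} (h : IsContourPair opp μ τ σ) (h' : IsContourPair opp μ τ ρ)
    {T : ℂ → ℂ → ℂ} (hT : IsWeight T) {ε : ℝ} (hε : 0 < ε) :
    ∫ t, contourIntegrand (dampedKernel opp μ T ε) τ ρ t =
      ∫ t, contourIntegrand (dampedKernel opp μ T ε) τ σ t := by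
  have key := integral_dampedKernel_fst (by simp [hμ]) h.swap h'.swap hT.swap hε
  have e : ∀ κ : ℝ → ℝ, ∫ t, contourIntegrand (dampedKernel opp μ T ε) τ κ t =
      ∫ t, contourIntegrand (dampedKernel opp (-μ) (fun s₁ s₂ => T s₂ s₁) ε) κ τ t := by
    intro κ
    rw [Measure.volume_eq_prod, ← integral_prod_swap]
    refine integral_congr_ae (ae_of_all _ fun t => ?_)
    simp only [contourIntegrand, dampedKernel, Prod.fst_swap, Prod.snd_swap]
    rw [← gammaKernel_swap opp μ, mul_comm (contourVelocity _ _), add_comm (_ ^ 2)]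
  rw [e, e, key]

/-- A smooth lower bound for two contours. -/
lemma IsContour.exists_le {μ : Fin 3 → ℂ} {σ ρ : ℝ → ℝ} (hσ : IsContour μ σ)
    (hρ : IsContour μ ρ) : ∃ τ, IsContour μ τ ∧ ∀ t, τ t ≤ σ t ∧ τ t ≤ ρ t := by
  -- The lower bound is the smoothed minimum `(σ + ρ - √((σ-ρ)² + κ))/2`. It is positive at height
  -- `Im μ_j` exactly when `κ < 4σρ` there, because `(σ+ρ)² - (σ-ρ)² = 4σρ`.
  obtain ⟨κ, hκ, hκ'⟩ : ∃ κ : ℝ, 0 < κ ∧ ∀ j, κ < 4 * (σ (μ j).im * ρ (μ j).im) := by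
    have hpos : ∀ j, 0 < 4 * (σ (μ j).im * ρ (μ j).im) := fun j =>
      mul_pos four_pos (mul_pos (hσ.right j) (hρ.right j))
    obtain ⟨κ, h1, h2⟩ := exists_between (lt_min (hpos 0) (lt_min (hpos 1) (hpos 2)))
    refine ⟨κ, h1, fun j => ?_⟩
    simp only [lt_min_iff] at h2
    fin_cases j
    exacts [h2.1, h2.2.1, h2.2.2]
  have hp : ∀ t, 0 < (σ t - ρ t) ^ 2 + κ := fun t => by positivity
  refine ⟨fun t => (σ t + ρ t - √((σ t - ρ t) ^ 2 + κ)) / 2, ⟨?_, fun j => ?_, ?_⟩, fun t => ?_⟩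
  · refine ((hσ.contDiff.add hρ.contDiff).sub (ContDiff.sqrt ?_ fun t => (hp t).ne')).div_const _
    exact ((hσ.contDiff.sub hρ.contDiff).pow 2).add contDiff_const
  · have : √((σ (μ j).im - ρ (μ j).im) ^ 2 + κ) < σ (μ j).im + ρ (μ j).im := by
      rw [Real.sqrt_lt' (add_pos (hσ.right j) (hρ.right j))]
      linarith [hκ' j]
    linarith
  · obtain ⟨R, c, h⟩ := hσ.eventually_const
    obtain ⟨R', c', h'⟩ := hρ.eventually_const
    exact ⟨max R R', (c + c' - √((c - c') ^ 2 + κ)) / 2, fun t ht => by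
      rw [h t ((le_max_left _ _).trans ht), h' t ((le_max_right _ _).trans ht)]⟩
  · have : |σ t - ρ t| ≤ √((σ t - ρ t) ^ 2 + κ) := Real.abs_le_sqrt (by linarith)
    have := abs_le.1 this
    constructor <;> linarith

/-- Exchanging one contour at a time might violate `σ₁(t) + σ₂(-t) < 1` for mixed pairs. Lowering a
contour preserves this condition, so both pairs are joined to a common lower pair. -/
lemma integral_dampedKernel_eq {opp : Bool} {μ : Fin 3 → ℂ} (hμ : ∀ j, (μ j).re = 0)
    {σ₁ σ₂ ρ₁ ρ₂ : ℝ → ℝ} (h : IsContourPair opp μ σ₁ σ₂) (h' : IsContourPair opp μ ρ₁ ρ₂)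
    {T : ℂ → ℂ → ℂ} (hT : IsWeight T) {ε : ℝ} (hε : 0 < ε) :
    ∫ t, contourIntegrand (dampedKernel opp μ T ε) ρ₁ ρ₂ t =
      ∫ t, contourIntegrand (dampedKernel opp μ T ε) σ₁ σ₂ t := by
  obtain ⟨τ₁, hτ₁, hle₁⟩ := h.fst.exists_le h'.fst
  obtain ⟨τ₂, hτ₂, hle₂⟩ := h.snd.exists_le h'.snd
  have p1 : IsContourPair opp μ τ₁ σ₂ :=
    ⟨hτ₁, h.snd, fun ho t => by linarith [h.left ho t, (hle₁ t).1]⟩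
  have p2 : IsContourPair opp μ τ₁ ρ₂ :=
    ⟨hτ₁, h'.snd, fun ho t => by linarith [h'.left ho t, (hle₁ t).2]⟩
  have p3 : IsContourPair opp μ τ₁ τ₂ :=
    ⟨hτ₁, hτ₂, fun ho t => by linarith [h.left ho t, (hle₁ t).1, (hle₂ (-t)).1]⟩
  rw [← integral_dampedKernel_fst hμ h p1 hT hε, ← integral_dampedKernel_fst hμ h' p2 hT hε,
    ← integral_dampedKernel_snd hμ p1 p3 hT hε, ← integral_dampedKernel_snd hμ p2 p3 hT hε]

/-- Absolutely convergent double contour integrals do not depend on the contours. -/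
theorem integral_contourIntegrand_eq {opp : Bool} {μ : Fin 3 → ℂ} (hμ : ∀ j, (μ j).re = 0)
    {σ₁ σ₂ ρ₁ ρ₂ : ℝ → ℝ} (h : IsContourPair opp μ σ₁ σ₂) (h' : IsContourPair opp μ ρ₁ ρ₂)
    {T : ℂ → ℂ → ℂ} (hT : IsWeight T)
    (hi : Integrable (contourIntegrand (fun s₁ s₂ => gammaKernel opp μ s₁ s₂ * T s₁ s₂) σ₁ σ₂))
    (hi' : Integrable (contourIntegrand (fun s₁ s₂ => gammaKernel opp μ s₁ s₂ * T s₁ s₂) ρ₁ ρ₂)) :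
    ∫ t, contourIntegrand (fun s₁ s₂ => gammaKernel opp μ s₁ s₂ * T s₁ s₂) ρ₁ ρ₂ t =
      ∫ t, contourIntegrand (fun s₁ s₂ => gammaKernel opp μ s₁ s₂ * T s₁ s₂) σ₁ σ₂ t := by
  -- The damping is removed by dominated convergence: for `0 < ε < 1` the damping factor is at most
  -- `exp(2M²)`.
  have key : ∀ {κ₁ κ₂ : ℝ → ℝ}, IsContourPair opp μ κ₁ κ₂ →
      Integrable (contourIntegrand (fun s₁ s₂ => gammaKernel opp μ s₁ s₂ * T s₁ s₂) κ₁ κ₂) →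
      Tendsto (fun ε : ℝ => ∫ t, contourIntegrand (dampedKernel opp μ T ε) κ₁ κ₂ t) (𝓝[>] 0)
        (𝓝 (∫ t, contourIntegrand (fun s₁ s₂ => gammaKernel opp μ s₁ s₂ * T s₁ s₂) κ₁ κ₂ t)) := by
    intro κ₁ κ₂ hp hint
    obtain ⟨M, η, hM, hη, hb, hd⟩ := hp.awayFromPoles hμ
    have e : ∀ ε t, contourIntegrand (dampedKernel opp μ T ε) κ₁ κ₂ t =
        contourIntegrand (fun s₁ s₂ => gammaKernel opp μ s₁ s₂ * T s₁ s₂) κ₁ κ₂ t *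
          cexp (ε * (contourPoint κ₁ t.1 ^ 2 + contourPoint κ₂ t.2 ^ 2)) := fun ε t => by
      simp only [contourIntegrand, dampedKernel]; ring
    refine tendsto_integral_filter_of_dominated_convergence
      (fun t => ‖contourIntegrand (fun s₁ s₂ => gammaKernel opp μ s₁ s₂ * T s₁ s₂) κ₁ κ₂ t‖ *
        Real.exp (2 * M ^ 2)) ?_ ?_ (hint.norm.mul_const _) ?_
    · filter_upwards [self_mem_nhdsWithin] with ε hε
      exact (integrable_dampedKernel hμ hp hT hε).aestronglyMeasurable
    · filter_upwards [self_mem_nhdsWithin, nhdsWithin_le_nhds (gt_mem_nhds one_pos)] with ε hε hε1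
      refine ae_of_all _ fun t => ?_
      rw [mem_Ioi] at hε
      rw [e, norm_mul, norm_gaussian]
      gcongr
      rw [← Real.exp_add]
      gcongr
      simp only [contourPoint_re, contourPoint_im]
      have h1 := sq_le_sq' (abs_le.1 (hb t.1).1).1 (abs_le.1 (hb t.1).1).2
      have h2 := sq_le_sq' (abs_le.1 (hb t.2).2.1).1 (abs_le.1 (hb t.2).2.1).2
      have h3 : 0 ≤ t.1 ^ 2 + t.2 ^ 2 := by positivity
      have h4 : 0 ≤ κ₁ t.1 ^ 2 + κ₂ t.2 ^ 2 := by positivity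
      nlinarith
    · refine ae_of_all _ fun t => ?_
      simp_rw [e]
      have : Continuous fun ε : ℝ =>
          contourIntegrand (fun s₁ s₂ => gammaKernel opp μ s₁ s₂ * T s₁ s₂) κ₁ κ₂ t *
          cexp (ε * (contourPoint κ₁ t.1 ^ 2 + contourPoint κ₂ t.2 ^ 2)) := by fun_prop
      simpa using (this.tendsto 0).mono_left nhdsWithin_le_nhds
  refine tendsto_nhds_unique_of_eventuallyEq (key h' hi') (key h hi) ?_
  filter_upwards [self_mem_nhdsWithin] with ε hε
  exact integral_dampedKernel_eq hμ h h' hT hε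


/-! ### Absolute convergence on contours that obey the Barnes convention -/

/-- Two contours that obey the Barnes convention. -/
structure IsBarnesPair (opp : Bool) (μ : Fin 3 → ℂ) (σ₁ σ₂ : ℝ → ℝ) : Prop
    extends IsContourPair opp μ σ₁ σ₂ where
  unbounded : ∃ δ : ℝ, 0 < δ ∧ (∃ R : ℝ, ∀ t : ℝ, R ≤ |t| → σ₁ t = -δ ∧ σ₂ t = -δ) ∧
    ∀ t : ℝ, -δ ≤ σ₁ t ∧ -δ ≤ σ₂ t

lemma IsBarnesContour.isBarnesPair {ε₁ ε₂ : Sgn} {opp : Bool} {μ : Fin 3 → ℂ}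
    (hμ : ∀ j, (μ j).re = 0) {σ₁ σ₂ : ℝ → ℝ} (h : IsBarnesContour ε₁ ε₂ μ σ₁ σ₂)
    (ho : opp = true → ε₁ ≠ ε₂) : IsBarnesPair opp μ σ₁ σ₂ := by
  obtain ⟨δ, hδ, ⟨R, hR⟩, hle⟩ := h.unbounded
  refine ⟨⟨⟨h.contDiff_fst, fun j => ?_, ⟨R, -δ, fun t ht => (hR t ht).1⟩⟩,
    ⟨h.contDiff_snd, fun j => ?_, ⟨R, -δ, fun t ht => (hR t ht).2⟩⟩, fun h' t => ?_⟩, h.unbounded⟩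
  · simpa [hμ] using h.right_fst j 0
  · simpa [hμ] using h.right_snd j 0
  · simpa using h.left_add (ho h') t 0

/-- The exponential rate of decay of `gammaKernel`. -/
noncomputable def decayRate (opp : Bool) (t₁ t₂ : ℝ) : ℝ :=
  Real.pi / 2 * (3 * |t₁| + 3 * |t₂| + bif opp then |t₁ + t₂| else -|t₁ + t₂|)

/-- Outside a compact set the contour is the line `Re s = -δ`; the bounded part only changes the
constant. -/
lemma exists_stirlingSize_contour_le {σ : ℝ → ℝ} {M δ R : ℝ} (hM : ∀ t, |σ t| ≤ M)
    (hR : ∀ t, R ≤ |t| → σ t = -δ) : ∃ C, 0 < C ∧ ∀ t, stirlingSize (contourPoint σ t) ≤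
      C * ((1 + |t|) ^ (-δ - 1 / 2) * Real.exp (-(Real.pi / 2 * |t|))) := by
  refine ⟨(1 + |R|) ^ (M + |δ|), by positivity, fun t => ?_⟩
  unfold stirlingSize
  rw [contourPoint_re, contourPoint_im, ← mul_assoc]
  gcongr
  have hMδ : 0 ≤ M + |δ| := add_nonneg ((abs_nonneg _).trans (hM 0)) (abs_nonneg _)
  by_cases ht : R ≤ |t|
  · rw [hR t ht]
    exact le_mul_of_one_le_left (by positivity)
      (Real.one_le_rpow (by linarith [abs_nonneg R]) hMδ)
  · push Not at ht
    have h1 : (1 + |t|) ^ (σ t - 1 / 2) = (1 + |t|) ^ (σ t + δ) * (1 + |t|) ^ (-δ - 1 / 2) := by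
      rw [← Real.rpow_add (by positivity)]; congr 1; ring
    rw [h1]
    gcongr
    calc (1 + |t|) ^ (σ t + δ) ≤ (1 + |t|) ^ (M + |δ|) := by
          refine Real.rpow_le_rpow_of_exponent_le (by linarith [abs_nonneg t]) ?_
          linarith [(abs_le.1 (hM t)).2, le_abs_self δ]
      _ ≤ _ := Real.rpow_le_rpow (by positivity) (by linarith [le_abs_self R]) hMδ

/-- Each variable receives the exponent `3(-δ - 1/2)` from its three Gamma functions, and at most
`1/2 + 2δ` from the factor in `s₁ + s₂`, because both real parts are at least `-δ`. The total
`-(1+δ)` is integrable without help from the exponential. -/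
lemma exists_kernelSize_contour_le (opp : Bool) {σ₁ σ₂ : ℝ → ℝ} {M δ R : ℝ}
    (hM : ∀ t, |σ₁ t| ≤ M ∧ |σ₂ t| ≤ M) (hR : ∀ t, R ≤ |t| → σ₁ t = -δ ∧ σ₂ t = -δ)
    (hδ : 0 < δ) (hge : ∀ t, -δ ≤ σ₁ t ∧ -δ ≤ σ₂ t) :
    ∃ C, 0 < C ∧ ∀ t₁ t₂, kernelSize opp (contourPoint σ₁ t₁) (contourPoint σ₂ t₂) ≤
      C * ((1 + |t₁|) ^ (-(1 + δ)) * (1 + |t₂|) ^ (-(1 + δ)) *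
        Real.exp (-decayRate opp t₁ t₂)) := by
  obtain ⟨C₁, hC₁, h1⟩ := exists_stirlingSize_contour_le (fun t => (hM t).1)
    (fun t ht => (hR t ht).1)
  obtain ⟨C₂, hC₂, h2⟩ := exists_stirlingSize_contour_le (fun t => (hM t).2)
    (fun t ht => (hR t ht).2)
  refine ⟨C₁ ^ 3 * C₂ ^ 3, by positivity, fun t₁ t₂ => ?_⟩
  have p1 : 0 < 1 + |t₁| := by positivity
  have p2 : 0 < 1 + |t₂| := by positivity
  have h3 : (bif opp then stirlingSize (1 - contourPoint σ₁ t₁ - contourPoint σ₂ t₂) else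
      (stirlingSize (contourPoint σ₁ t₁ + contourPoint σ₂ t₂))⁻¹) ≤
      ((1 + |t₁|) * (1 + |t₂|)) ^ (1 / 2 + 2 * δ) *
        Real.exp (-(Real.pi / 2 * bif opp then |t₁ + t₂| else -|t₁ + t₂|)) := by
    have hpow : (1 + |t₁ + t₂|) ^ (1 / 2 - σ₁ t₁ - σ₂ t₂) ≤
        ((1 + |t₁|) * (1 + |t₂|)) ^ (1 / 2 + 2 * δ) := by
      calc _ ≤ (1 + |t₁ + t₂|) ^ (1 / 2 + 2 * δ) := by
            refine Real.rpow_le_rpow_of_exponent_le (by linarith [abs_nonneg (t₁ + t₂)]) ?_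
            linarith [(hge t₁).1, (hge t₂).2]
        _ ≤ _ := by
            gcongr
            nlinarith [abs_add_le t₁ t₂, abs_nonneg t₁, abs_nonneg t₂,
              mul_nonneg (abs_nonneg t₁) (abs_nonneg t₂)]
    cases opp
    · simp only [cond_false, stirlingSize, add_re, add_im, contourPoint_re, contourPoint_im]
      rw [mul_inv, ← Real.exp_neg, ← Real.rpow_neg (by positivity)]
      gcongr
      · refine le_trans (le_of_eq ?_) hpow
        congr 1; ring
      · linarith
    · simp only [cond_true, stirlingSize, sub_re, sub_im, contourPoint_re, contourPoint_im, one_re,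
        one_im]
      rw [show 0 - t₁ - t₂ = -(t₁ + t₂) by ring, abs_neg]
      gcongr
      refine le_trans (le_of_eq ?_) hpow
      congr 1; ring
  have hs1 := (stirlingSize_pos (contourPoint σ₁ t₁)).le
  have hs2 := (stirlingSize_pos (contourPoint σ₂ t₂)).le
  have hs3 : 0 ≤ (bif opp then stirlingSize (1 - contourPoint σ₁ t₁ - contourPoint σ₂ t₂) else
      (stirlingSize (contourPoint σ₁ t₁ + contourPoint σ₂ t₂))⁻¹) := by
    cases opp
    · exact inv_nonneg.2 (stirlingSize_pos _).le
    · exact (stirlingSize_pos _).le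
  unfold kernelSize
  calc _ ≤ (C₁ * ((1 + |t₁|) ^ (-δ - 1 / 2) * Real.exp (-(Real.pi / 2 * |t₁|)))) ^ 3 *
        (C₂ * ((1 + |t₂|) ^ (-δ - 1 / 2) * Real.exp (-(Real.pi / 2 * |t₂|)))) ^ 3 *
        (((1 + |t₁|) * (1 + |t₂|)) ^ (1 / 2 + 2 * δ) *
        Real.exp (-(Real.pi / 2 * bif opp then |t₁ + t₂| else -|t₁ + t₂|))) := by
        gcongr
        · exact h1 t₁
        · exact h2 t₂
    _ = _ := by
        have e : ∀ x : ℝ, 0 < x → x ^ (-(1 + δ)) =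
            (x ^ (-δ - 1 / 2)) ^ 3 * x ^ (1 / 2 + 2 * δ) := fun x hx => by
          rw [← Real.rpow_natCast, ← Real.rpow_mul hx.le, ← Real.rpow_add hx]
          congr 1; push_cast; ring
        have e2 : Real.exp (-decayRate opp t₁ t₂) = Real.exp (-(Real.pi / 2 * |t₁|)) ^ 3 *
            Real.exp (-(Real.pi / 2 * |t₂|)) ^ 3 *
            Real.exp (-(Real.pi / 2 * bif opp then |t₁ + t₂| else -|t₁ + t₂|)) := by
          rw [← Real.exp_nat_mul, ← Real.exp_nat_mul, ← Real.exp_add, ← Real.exp_add]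
          unfold decayRate
          congr 1; push_cast; ring
        rw [e _ p1, e _ p2, e2, Real.mul_rpow p1.le p2.le]
        ring

/-- The growth of `T` is compensated by the decay of the Gamma functions. -/
def IsTame (opp : Bool) (T : ℂ → ℂ → ℂ) : Prop :=
  ∀ M : ℝ, ∃ C, 0 ≤ C ∧ ∀ s₁ s₂ : ℂ, |s₁.re| ≤ M → |s₂.re| ≤ M →
    ‖T s₁ s₂‖ ≤ C * Real.exp (decayRate opp s₁.im s₂.im)

/-- A dominating function for all functions with given bounds in strips. -/
lemma IsBarnesPair.exists_dominating {opp : Bool} {μ : Fin 3 → ℂ} (hμ : ∀ j, (μ j).re = 0)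
    {σ₁ σ₂ : ℝ → ℝ} (h : IsBarnesPair opp μ σ₁ σ₂) : ∃ M : ℝ, ∀ C : ℝ, 0 ≤ C → ∃ b : ℝ × ℝ → ℝ,
      Integrable b ∧ ∀ T : ℂ → ℂ → ℂ, (∀ s₁ s₂ : ℂ, |s₁.re| ≤ M → |s₂.re| ≤ M →
        ‖T s₁ s₂‖ ≤ C * Real.exp (decayRate opp s₁.im s₂.im)) →
      ∀ t, ‖contourIntegrand (fun s₁ s₂ => gammaKernel opp μ s₁ s₂ * T s₁ s₂) σ₁ σ₂ t‖ ≤ b t := by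
  obtain ⟨M, η, hM, hη, hb, hd⟩ := h.toIsContourPair.awayFromPoles hμ
  obtain ⟨δ, hδ, ⟨R, hR⟩, hge⟩ := h.unbounded
  obtain ⟨C₁, hC₁, h1⟩ := exists_norm_gammaKernel_le opp hμ M hη
  obtain ⟨C₂, hC₂, h2⟩ := exists_kernelSize_contour_le opp
    (fun t => ⟨(hb t).1, (hb t).2.1⟩) hR hδ hge
  refine ⟨M, fun C hC => ⟨fun t => (C₁ * C₂ * C * ((M + 1) * (M + 1))) *
    ((1 + |t.1|) ^ (-(1 + δ)) * (1 + |t.2|) ^ (-(1 + δ))), ?_, fun T hT t => ?_⟩⟩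
  · have hi : Integrable fun t : ℝ => (1 + |t|) ^ (-(1 + δ)) := by
      simpa using integrable_one_add_norm (E := ℝ) (μ := volume) (r := 1 + δ) (by simpa using hδ)
    exact (hi.mul_prod hi).const_mul _
  · have e1 := h1 _ (hd t.1 t.2)
    have e2 := h2 t.1 t.2
    have e3 := hT _ _ (hd t.1 t.2).1 (hd t.1 t.2).2.1
    simp only [contourPoint_im] at e3
    have e4 := norm_contourVelocity_le (hb t.1).2.2.1
    have e5 := norm_contourVelocity_le (hb t.2).2.2.2
    unfold contourIntegrand
    rw [norm_mul, norm_mul, norm_mul]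
    calc _ ≤ (C₁ * (C₂ * ((1 + |t.1|) ^ (-(1 + δ)) * (1 + |t.2|) ^ (-(1 + δ)) *
          Real.exp (-decayRate opp t.1 t.2)))) * (C * Real.exp (decayRate opp t.1 t.2)) *
          ((M + 1) * (M + 1)) := by
          gcongr
          exact e1.trans (by gcongr)
      _ = _ := by
          rw [Real.exp_neg]
          field_simp

theorem IsBarnesPair.integrable {opp : Bool} {μ : Fin 3 → ℂ} (hμ : ∀ j, (μ j).re = 0)
    {σ₁ σ₂ : ℝ → ℝ} (h : IsBarnesPair opp μ σ₁ σ₂) {T : ℂ → ℂ → ℂ}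
    (hT : Continuous fun s : ℂ × ℂ => T s.1 s.2) (hT' : IsTame opp T) :
    Integrable (contourIntegrand (fun s₁ s₂ => gammaKernel opp μ s₁ s₂ * T s₁ s₂) σ₁ σ₂) := by
  obtain ⟨M, hM⟩ := h.exists_dominating hμ
  obtain ⟨C, hC, hC'⟩ := hT' M
  obtain ⟨b, hb, hb'⟩ := hM C hC
  exact hb.mono' (continuous_contourIntegrand hμ h.toIsContourPair hT).aestronglyMeasurable
    (ae_of_all _ (hb' T hC'))

theorem IsBarnesPair.tendsto {opp : Bool} {μ : Fin 3 → ℂ} (hμ : ∀ j, (μ j).re = 0)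
    {σ₁ σ₂ : ℝ → ℝ} (h : IsBarnesPair opp μ σ₁ σ₂) {ι : Type*} {l : Filter ι}
    [l.IsCountablyGenerated] {T : ι → ℂ → ℂ → ℂ} {T' : ℂ → ℂ → ℂ}
    (hT : ∀ᶠ i in l, Continuous fun s : ℂ × ℂ => T i s.1 s.2)
    (hT' : ∀ M : ℝ, ∃ C, 0 ≤ C ∧ ∀ᶠ i in l, ∀ s₁ s₂ : ℂ, |s₁.re| ≤ M → |s₂.re| ≤ M →
      ‖T i s₁ s₂‖ ≤ C * Real.exp (decayRate opp s₁.im s₂.im))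
    (hlim : ∀ s₁ s₂, Tendsto (fun i => T i s₁ s₂) l (𝓝 (T' s₁ s₂))) :
    Tendsto (fun i => ∫ t, contourIntegrand
      (fun s₁ s₂ => gammaKernel opp μ s₁ s₂ * T i s₁ s₂) σ₁ σ₂ t) l
      (𝓝 (∫ t, contourIntegrand (fun s₁ s₂ => gammaKernel opp μ s₁ s₂ * T' s₁ s₂) σ₁ σ₂ t)) := by
  obtain ⟨M, hM⟩ := h.exists_dominating hμ
  obtain ⟨C, hC, hC'⟩ := hT' M
  obtain ⟨b, hb, hb'⟩ := hM C hC
  refine tendsto_integral_filter_of_dominated_convergence b ?_ ?_ hb ?_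
  · filter_upwards [hT] with i hi
    exact (continuous_contourIntegrand hμ h.toIsContourPair hi).aestronglyMeasurable
  · filter_upwards [hC'] with i hi
    exact ae_of_all _ (hb' (T i) hi)
  · exact ae_of_all _ fun t => ((hlim _ _).const_mul _).mul_const _


/-! ### Laplace type integrals -/

lemma hasDerivAt_integral_cexp {S : Set ℝ} (hS : MeasurableSet S) {φ : ℝ → ℝ} {g : ℝ → ℂ}
    (hφ : ∀ u ∈ S, 0 ≤ φ u) (hφc : ContinuousOn φ S) (hgc : ContinuousOn g S)
    (hint : ∀ x : ℝ, 0 < x → IntegrableOn (fun u => Real.exp (-x * φ u) * ‖g u‖) S)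
    {z : ℂ} (hz : 0 < z.re) :
    HasDerivAt (fun z : ℂ => ∫ u in S, cexp (-z * φ u) * g u)
      (∫ u in S, cexp (-z * φ u) * (-φ u * g u)) z := by
  have hc : ∀ w : ℂ, ContinuousOn (fun u => cexp (-w * φ u) * g u) S := fun w =>
    (continuous_exp.comp_continuousOn
      (continuousOn_const.mul (continuous_ofReal.comp_continuousOn hφc))).mul hgc
  have hc' : ContinuousOn (fun u => cexp (-z * φ u) * (-φ u * g u)) S :=
    (continuous_exp.comp_continuousOn
      (continuousOn_const.mul (continuous_ofReal.comp_continuousOn hφc))).mul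
      ((continuous_ofReal.comp_continuousOn hφc).neg.mul hgc)
  have hnorm : ∀ (w : ℂ) (x : ℝ), ‖cexp (-w * x)‖ = Real.exp (-w.re * x) := fun w x => by
    rw [norm_exp]; simp
  -- With `x = Re z`, on the half-plane `Re w > x/2` the factor `φ` from differentiation costs half
  -- of the exponent: `φ exp(-xφ/2) ≤ (4/x) exp(-xφ/4)`.
  refine (hasDerivAt_integral_of_dominated_loc_of_deriv_le (μ := volume.restrict S)
    (s := {w : ℂ | z.re / 2 < w.re})
    (F' := fun w u => cexp (-w * φ u) * (-φ u * g u))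
    (bound := fun u => 4 / z.re * (Real.exp (-(z.re / 4) * φ u) * ‖g u‖))
    ((isOpen_lt continuous_const continuous_re).mem_nhds (by simp; linarith))
    (Eventually.of_forall fun w => (hc w).aestronglyMeasurable hS) ?_
    (hc'.aestronglyMeasurable hS) ?_ ((hint _ (by linarith)).const_mul _) ?_).2
  · refine (hint z.re hz).mono' ((hc z).aestronglyMeasurable hS) (ae_of_all _ fun u => ?_)
    rw [norm_mul, hnorm]
  · refine (ae_restrict_mem hS).mono fun u hu w hw => ?_
    rw [mem_ofPred_eq] at hw
    have h0 := hφ u hu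
    rw [norm_mul, norm_mul, norm_neg, norm_real, Real.norm_of_nonneg h0, hnorm, ← mul_assoc,
      ← mul_assoc]
    refine mul_le_mul_of_nonneg_right ?_ (norm_nonneg _)
    have h1 : z.re / 4 * φ u ≤ Real.exp (z.re / 4 * φ u) := by
      linarith [Real.add_one_le_exp (z.re / 4 * φ u)]
    calc Real.exp (-w.re * φ u) * φ u ≤ Real.exp (-(z.re / 2) * φ u) * φ u := by gcongr
      _ = 4 / z.re * (Real.exp (-(z.re / 2) * φ u) * (z.re / 4 * φ u)) := by field_simp
      _ ≤ 4 / z.re * (Real.exp (-(z.re / 2) * φ u) * Real.exp (z.re / 4 * φ u)) := by gcongr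
      _ = _ := by rw [← Real.exp_add]; congr 2; ring_nf
  · refine ae_of_all _ fun u w _ => ?_
    have h1 : HasDerivAt (fun w : ℂ => -w * φ u) (-(φ u : ℂ)) w := by
      simpa using (hasDerivAt_id w).neg.mul_const (φ u : ℂ)
    exact (h1.cexp.mul_const (g u)).congr_deriv (mul_assoc _ _ _)

/-- Identity theorem: the real points `1 + 1/(n+1)` accumulate at `1`. -/
lemma eqOn_re_pos_of_eq_real {f g : ℂ → ℂ} (hf : ∀ z : ℂ, 0 < z.re → DifferentiableAt ℂ f z)
    (hg : ∀ z : ℂ, 0 < z.re → DifferentiableAt ℂ g z) (h : ∀ x : ℝ, 0 < x → f x = g x) {z : ℂ}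
    (hz : 0 < z.re) : f z = g z := by
  have ho : IsOpen {z : ℂ | 0 < z.re} := isOpen_lt continuous_const continuous_re
  have hd : ∀ {k : ℂ → ℂ}, (∀ z : ℂ, 0 < z.re → DifferentiableAt ℂ k z) →
      AnalyticOnNhd ℂ k {z : ℂ | 0 < z.re} := fun hk =>
    DifferentiableOn.analyticOnNhd (fun z hz => (hk z hz).differentiableWithinAt) ho
  refine (hd hf).eqOn_of_preconnected_of_frequently_eq (hd hg) (convex_halfSpace_re_gt 0).isPreconnected
    (z₀ := 1) (by simp) ?_ hz
  have ht : Tendsto (fun n : ℕ => ((1 + 1 / ((n : ℝ) + 1) : ℝ) : ℂ)) atTop (𝓝[≠] 1) := by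
    refine tendsto_nhdsWithin_iff.2 ⟨?_, Eventually.of_forall fun n => ?_⟩
    · have := (tendsto_one_div_add_atTop_nhds_zero_nat (𝕜 := ℝ)).const_add 1
      have h2 := (continuous_ofReal.tendsto _).comp this
      rwa [add_zero, ofReal_one] at h2
    · have : (0 : ℝ) < 1 / ((n : ℝ) + 1) := by positivity
      rw [mem_compl_singleton_iff, ← ofReal_one, Ne, ofReal_inj]
      linarith
  exact ht.frequently (Frequently.of_forall fun n => h _ (by positivity))

lemma integrableOn_exp_mul_rpow {x p : ℝ} (hx : 0 < x) (hp : 0 < p) :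
    IntegrableOn (fun u : ℝ => Real.exp (-x * u) * u ^ (p - 1)) (Ioi 0) := by
  have := integrableOn_rpow_mul_exp_neg_mul_rpow (p := 1) (s := p - 1) (b := x) (by linarith)
    one_pos hx
  refine this.congr_fun (fun u _ => ?_) measurableSet_Ioi
  simp only [Real.rpow_one]
  ring

lemma continuousOn_cpow_Ioi (w : ℂ) : ContinuousOn (fun u : ℝ => (u : ℂ) ^ w) (Ioi 0) :=
  fun u hu => (continuousAt_ofReal_cpow_const u w (Or.inr (ne_of_gt hu))).continuousWithinAt

/-- The Gamma integral with a complex scale. -/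
lemma integral_cexp_mul_cpow {w c : ℂ} (hw : 0 < w.re) (hc : 0 < c.re) :
    ∫ r in Ioi (0 : ℝ), cexp (-c * r) * (r : ℂ) ^ (w - 1) = Gamma w * c ^ (-w) := by
  refine eqOn_re_pos_of_eq_real (f := fun c => ∫ r in Ioi (0 : ℝ), cexp (-c * r) * (r : ℂ) ^ (w - 1))
    (g := fun c => Gamma w * c ^ (-w)) (fun z hz => ?_) (fun z hz => ?_) (fun x hx => ?_) hc
  · refine (hasDerivAt_integral_cexp measurableSet_Ioi (φ := fun r => r)
      (g := fun r => (r : ℂ) ^ (w - 1)) (fun u hu => le_of_lt hu) continuousOn_id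
      (continuousOn_cpow_Ioi _) (fun x hx => ?_) hz).differentiableAt
    refine (integrableOn_exp_mul_rpow hx hw).congr_fun (fun u hu => ?_) measurableSet_Ioi
    simp only
    rw [norm_cpow_eq_rpow_re_of_pos hu, sub_re, one_re]
  · exact (DifferentiableAt.cpow (by fun_prop) (by fun_prop) (Or.inl hz)).const_mul _
  · have := integral_cpow_mul_exp_neg_mul_Ioi hw hx
    rw [one_div, inv_cpow _ _ (by rw [arg_ofReal_of_nonneg hx.le]; exact Real.pi_pos.ne),
      ← cpow_neg, mul_comm] at this
    rw [← this]
    refine setIntegral_congr_fun measurableSet_Ioi fun u _ => ?_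
    simp only [neg_mul]
    ring

/-! ### The Bessel function `K` in the right half-plane -/

/-- `K_α(z)` for `Re z > 0`. -/
noncomputable def besselKRight (α z : ℂ) : ℂ :=
  ∫ t in Ioi (0 : ℝ), cexp (-z * Real.cosh t) * Complex.cosh (α * t)

lemma besselK_eq (α : ℂ) (x : ℝ) : besselK α x = besselKRight α x := by
  unfold besselK besselKRight
  refine setIntegral_congr_fun measurableSet_Ioi fun t _ => ?_
  rw [ofReal_exp]
  push_cast
  rfl

lemma norm_cexp_neg_mul (z : ℂ) (x : ℝ) : ‖cexp (-z * x)‖ = Real.exp (-z.re * x) := by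
  rw [norm_exp]; simp

lemma cosh_mul_eq_cos {α : ℂ} (hα : α.re = 0) (t : ℝ) :
    Complex.cosh (α * t) = (Real.cos (α.im * t) : ℝ) := by
  have : α = α.im * I := by apply Complex.ext <;> simp [hα]
  rw [this]
  rw [show (α.im : ℂ) * I * t = ((α.im * t : ℝ) : ℂ) * I by push_cast; ring, cosh_mul_I]
  push_cast
  simp

lemma integrableOn_besselKRight {α z : ℂ} (hα : α.re = 0) (hz : 0 < z.re) :
    IntegrableOn (fun t : ℝ => cexp (-z * Real.cosh t) * Complex.cosh (α * t)) (Ioi 0) := by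
  refine (exp_neg_integrableOn_Ioi 0 hz).mono' (Continuous.aestronglyMeasurable (by fun_prop)) ?_
  refine (ae_restrict_mem measurableSet_Ioi).mono fun t ht => ?_
  rw [norm_mul, norm_cexp_neg_mul, cosh_mul_eq_cos hα, norm_real]
  calc _ ≤ Real.exp (-z.re * Real.cosh t) * 1 := by
        gcongr; exact Real.abs_cos_le_one _
    _ ≤ _ := by
      rw [mul_one]
      have h1 : t ≤ Real.sinh t := Real.self_le_sinh_iff.2 (le_of_lt ht)
      have h2 := Real.sinh_lt_cosh t
      have h3 := mul_le_mul_of_nonneg_left (h1.trans h2.le) hz.le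
      rw [Real.exp_le_exp]
      linarith

lemma integral_cosh_div_sinh_sq {a : ℝ} (ha : 0 < a) :
    IntegrableOn (fun t => Real.cosh t / Real.sinh t ^ 2) (Ioi a) ∧
      ∫ t in Ioi a, Real.cosh t / Real.sinh t ^ 2 = 1 / Real.sinh a := by
  have hs : ∀ t, a ≤ t → 0 < Real.sinh t := fun t ht => Real.sinh_pos_iff.2 (ha.trans_le ht)
  have hd : ∀ t ∈ Ici a, HasDerivAt (fun t => -(Real.sinh t)⁻¹) (Real.cosh t / Real.sinh t ^ 2) t := by
    intro t ht
    have := ((Real.hasDerivAt_sinh t).inv (hs t ht).ne').neg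
    rwa [neg_div, neg_neg] at this
  have hlim : Tendsto (fun t => -(Real.sinh t)⁻¹) atTop (𝓝 0) := by
    have h1 : Tendsto Real.sinh atTop atTop :=
      tendsto_atTop_mono' _ ((eventually_ge_atTop 0).mono fun t ht => Real.self_le_sinh_iff.2 ht)
        tendsto_id
    simpa using h1.inv_tendsto_atTop.neg
  have hpos : ∀ t ∈ Ioi a, 0 ≤ Real.cosh t / Real.sinh t ^ 2 := fun t ht => by
    have := hs t (le_of_lt ht)
    positivity
  refine ⟨integrableOn_Ioi_deriv_of_nonneg' hd hpos hlim, ?_⟩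
  rw [integral_Ioi_of_hasDerivAt_of_nonneg' hd hpos hlim]
  simp

/-- `K_α(z) = O(|z|^{-1/2})` uniformly in the right half-plane, for imaginary `α`. -/
lemma norm_besselKRight_le {α z : ℂ} (hα : α.re = 0) (hz : 0 < z.re) :
    ‖besselKRight α z‖ ≤ (3 + ‖α‖) * ‖z‖ ^ (-(1 / 2) : ℝ) := by
  have hz0 : 0 < ‖z‖ := norm_pos_iff.2 fun h => by simp [h] at hz
  have hzne : z ≠ 0 := norm_pos_iff.1 hz0
  -- The splitting point balances the trivial bound `a` on `(0, a]` against the bound `1/(a|z|)`, up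
  -- to a constant, from integration by parts on `(a, ∞)`.
  set a := ‖z‖ ^ (-(1 / 2) : ℝ) with ha
  have ha0 : 0 < a := by positivity
  have haa : ‖z‖ * (a * a) = 1 := by
    rw [ha, ← Real.rpow_add hz0]
    norm_num
    rw [Real.rpow_neg hz0.le, Real.rpow_one]
    exact mul_inv_cancel₀ hz0.ne'
  set β := α.im with hβ
  have hβα : |β| ≤ ‖α‖ := abs_im_le_norm α
  have hexp : ∀ t, ‖cexp (-z * Real.cosh t)‖ ≤ 1 := fun t => by
    rw [norm_cexp_neg_mul, Real.exp_le_one_iff]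
    have := Real.cosh_pos t
    nlinarith
  have hi := integrableOn_besselKRight hα hz
  have hsplit : besselKRight α z = (∫ t in Ioc 0 a, cexp (-z * Real.cosh t) * Complex.cosh (α * t)) +
      ∫ t in Ioi a, cexp (-z * Real.cosh t) * Complex.cosh (α * t) := by
    rw [← setIntegral_union (Ioc_disjoint_Ioi le_rfl) measurableSet_Ioi
      (hi.mono_set Ioc_subset_Ioi_self) (hi.mono_set (Ioi_subset_Ioi ha0.le)),
      Ioc_union_Ioi_eq_Ioi ha0.le]
    rfl
  have h1 : ‖∫ t in Ioc 0 a, cexp (-z * Real.cosh t) * Complex.cosh (α * t)‖ ≤ a := by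
    have := norm_setIntegral_le_of_norm_le_const (μ := volume) (s := Ioc 0 a) (C := 1)
      (f := fun t : ℝ => cexp (-z * Real.cosh t) * Complex.cosh (α * t)) (by simp) (fun t _ => by
        rw [norm_mul, cosh_mul_eq_cos hα, norm_real]
        exact mul_le_one₀ (hexp t) (norm_nonneg _) (Real.abs_cos_le_one _))
    simpa [ha0.le] using this
  have hs : ∀ t, a ≤ t → 0 < Real.sinh t := fun t ht => Real.sinh_pos_iff.2 (ha0.trans_le ht)
  -- Integration by parts against the exact derivative `-z sinh t · exp(-z cosh t)`; `G` is the
  -- remaining term, dominated by `cosh t / (|z| sinh² t)`.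
  set F : ℝ → ℂ := fun t => cexp (-z * Real.cosh t) * (Real.cos (β * t) / Real.sinh t : ℝ) / (-z)
    with hF
  set q : ℝ → ℝ := fun t => (-(Real.sin (β * t) * β) * Real.sinh t -
    Real.cos (β * t) * Real.cosh t) / Real.sinh t ^ 2 with hq
  set G : ℝ → ℂ := fun t => cexp (-z * Real.cosh t) * (q t : ℝ) / (-z) with hG
  have hFd : ∀ t ∈ Ici a, HasDerivAt F (cexp (-z * Real.cosh t) * Complex.cosh (α * t) + G t) t := by
    intro t ht
    have hst := hs t ht
    have e1 : HasDerivAt (fun t : ℝ => cexp (-z * Real.cosh t))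
        (cexp (-z * Real.cosh t) * (-z * Real.sinh t)) t :=
      ((Real.hasDerivAt_cosh t).ofReal_comp.const_mul (-z)).cexp
    have e2 : HasDerivAt (fun t : ℝ => Real.cos (β * t) / Real.sinh t) (q t) t := by
      have := (((hasDerivAt_id t).const_mul β).cos).div (Real.hasDerivAt_sinh t) hst.ne'
      exact this.congr_deriv (by simp [hq])
    have e3 := (e1.mul e2.ofReal_comp).div_const (-z)
    refine e3.congr_deriv ?_
    rw [cosh_mul_eq_cos hα, ← hβ, hG]
    have hs' : (Real.sinh t : ℂ) ≠ 0 := ofReal_ne_zero.2 hst.ne'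
    simp only [ofReal_div]
    field_simp
    ring
  obtain ⟨hci, hcv⟩ := integral_cosh_div_sinh_sq ha0
  have hGle : ∀ t ∈ Ioi a, ‖G t‖ ≤ (1 + ‖α‖) / ‖z‖ * (Real.cosh t / Real.sinh t ^ 2) := by
    intro t ht
    have hst := hs t (le_of_lt ht)
    have hch := Real.cosh_pos t
    have hsc := Real.sinh_lt_cosh t
    rw [hG]
    simp only
    rw [norm_div, norm_mul, norm_neg, norm_real, Real.norm_eq_abs, hq]
    simp only
    rw [abs_div, abs_of_nonneg (sq_nonneg (Real.sinh t))]
    have : |-(Real.sin (β * t) * β) * Real.sinh t - Real.cos (β * t) * Real.cosh t| ≤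
        (1 + ‖α‖) * Real.cosh t := by
      refine (abs_sub _ _).trans ?_
      rw [abs_mul, abs_neg, abs_mul, abs_mul, abs_of_pos hst, abs_of_pos hch]
      have := Real.abs_sin_le_one (β * t)
      have := Real.abs_cos_le_one (β * t)
      calc _ ≤ 1 * ‖α‖ * Real.cosh t + 1 * Real.cosh t := by gcongr
        _ = _ := by ring
    calc _ ≤ 1 * ((1 + ‖α‖) * Real.cosh t / Real.sinh t ^ 2) / ‖z‖ := by
          gcongr
          exact hexp t
      _ = _ := by ring
  have hGi : IntegrableOn G (Ioi a) := by
    refine (hci.const_mul ((1 + ‖α‖) / ‖z‖)).mono' ?_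
      ((ae_restrict_mem measurableSet_Ioi).mono hGle)
    refine ContinuousOn.aestronglyMeasurable ?_ measurableSet_Ioi
    have hne : ∀ t ∈ Ioi a, Real.sinh t ^ 2 ≠ 0 := fun t ht =>
      (pow_pos (hs t (le_of_lt ht)) 2).ne'
    refine ContinuousOn.div_const (ContinuousOn.mul (by fun_prop)
      (continuous_ofReal.comp_continuousOn ?_)) _
    exact ContinuousOn.div (by fun_prop) (by fun_prop) hne
  have hFlim : Tendsto F atTop (𝓝 0) := by
    have h3 : Tendsto (fun t => 1 / ‖z‖ * (Real.sinh t)⁻¹) atTop (𝓝 0) := by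
      have h1 : Tendsto Real.sinh atTop atTop :=
        tendsto_atTop_mono' _ ((eventually_ge_atTop 0).mono fun t ht => Real.self_le_sinh_iff.2 ht)
          tendsto_id
      simpa using h1.inv_tendsto_atTop.const_mul (1 / ‖z‖)
    refine squeeze_zero_norm' ((eventually_ge_atTop a).mono fun t ht => ?_) h3
    have hst := hs t ht
    rw [hF]
    simp only
    rw [norm_div, norm_mul, norm_neg, norm_real, Real.norm_eq_abs, abs_div, abs_of_pos hst]
    calc _ ≤ 1 * (1 / Real.sinh t) / ‖z‖ := by
          gcongr
          · exact hexp t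
          · exact Real.abs_cos_le_one _
      _ = _ := by ring
  have hia := hi.mono_set (Ioi_subset_Ioi ha0.le)
  have hint := integral_Ioi_of_hasDerivAt_of_tendsto' hFd (hia.add hGi) hFlim
  rw [integral_add hia hGi, zero_sub] at hint
  have hsa : a ≤ Real.sinh a := Real.self_le_sinh_iff.2 ha0.le
  have hFa : ‖F a‖ ≤ a := by
    rw [hF]
    simp only
    rw [norm_div, norm_mul, norm_neg, norm_real, Real.norm_eq_abs, abs_div, abs_of_pos (hs a le_rfl)]
    calc _ ≤ 1 * (1 / a) / ‖z‖ := by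
          gcongr
          · exact hexp a
          · exact Real.abs_cos_le_one _
      _ = (‖z‖ * (a * a)) / (a * ‖z‖) := by rw [haa]; field_simp
      _ = a := by field_simp
  have hGn : ‖∫ t in Ioi a, G t‖ ≤ (1 + ‖α‖) * a := by
    refine (norm_integral_le_of_norm_le (hci.const_mul ((1 + ‖α‖) / ‖z‖))
      ((ae_restrict_mem measurableSet_Ioi).mono hGle)).trans ?_
    rw [integral_const_mul, hcv]
    calc _ ≤ (1 + ‖α‖) / ‖z‖ * (1 / a) := by gcongr
      _ = (1 + ‖α‖) * ((‖z‖ * (a * a)) / (a * ‖z‖)) := by rw [haa]; field_simp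
      _ = _ := by field_simp
  have h2 : (∫ t in Ioi a, cexp (-z * Real.cosh t) * Complex.cosh (α * t)) =
      -F a - ∫ t in Ioi a, G t := by rw [← hint]; ring
  rw [hsplit, h2]
  calc _ ≤ a + (a + (1 + ‖α‖) * a) := by
        refine (norm_add_le _ _).trans (add_le_add h1 ((norm_sub_le _ _).trans ?_))
        rw [norm_neg]
        exact add_le_add hFa hGn
    _ = _ := by ring


/-! ### Recurrence relations -/

/-- `2 K_ν(z)` as an integral over the real line. -/
noncomputable def besselL (ν z : ℂ) : ℂ := ∫ t : ℝ, cexp (-z * Real.cosh t) * cexp (ν * t)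

/-- From `cosh t ≥ 1 + t²/2` the integrand is bounded by a Gaussian times an exponential. -/
lemma integrable_exp_cosh {x : ℝ} (hx : 0 < x) (p : ℝ) :
    Integrable fun t : ℝ => Real.exp (-x * Real.cosh t) * Real.exp (p * t) := by
  refine (integrable_exp_abs_sub_sq |p| (half_pos hx)).mono'
    (Continuous.aestronglyMeasurable (by fun_prop)) (ae_of_all _ fun t => ?_)
  rw [Real.norm_of_nonneg (by positivity), ← Real.exp_add, Real.exp_le_exp]
  have h1 : 1 + t ^ 2 / 2 ≤ Real.cosh t := by
    rw [← Real.cosh_abs, ← sq_abs]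
    have h2 := Real.cosh_two_mul (|t| / 2)
    rw [mul_div_cancel₀ _ two_ne_zero, Real.cosh_sq] at h2
    have h3 : |t| / 2 ≤ Real.sinh (|t| / 2) := Real.self_le_sinh_iff.2 (by positivity)
    nlinarith [abs_nonneg t]
  have h2 : p * t ≤ |p| * |t| := by rw [← abs_mul]; exact le_abs_self _
  nlinarith

lemma integrable_besselL (ν : ℂ) {z : ℂ} (hz : 0 < z.re) :
    Integrable fun t : ℝ => cexp (-z * Real.cosh t) * cexp (ν * t) := by
  refine (integrable_exp_cosh hz ν.re).mono' (Continuous.aestronglyMeasurable (by fun_prop))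
    (ae_of_all _ fun t => ?_)
  rw [norm_mul, norm_cexp_neg_mul, norm_exp]
  simp

lemma besselL_neg (ν z : ℂ) : besselL (-ν) z = besselL ν z := by
  unfold besselL
  rw [← integral_neg_eq_self]
  refine integral_congr_ae (ae_of_all _ fun t => ?_)
  simp

lemma besselL_eq_two_mul {α z : ℂ} (hz : 0 < z.re) :
    besselL α z = 2 * besselKRight α z := by
  have hi := integrable_besselL α hz
  have hi' : IntegrableOn (fun t : ℝ => cexp (-z * Real.cosh t) * cexp (α * (-t : ℝ))) (Ioi 0) := by
    refine (integrable_besselL (-α) hz).integrableOn.congr_fun (fun t _ => ?_) measurableSet_Ioi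
    simp only
    rw [ofReal_neg, mul_neg, neg_mul α]
  have h := intervalIntegral.integral_Iic_add_Ioi (b := 0) hi.integrableOn hi.integrableOn
  have h0 := integral_comp_neg_Ioi 0 fun t : ℝ => cexp (-z * Real.cosh t) * cexp (α * t)
  rw [neg_zero] at h0
  simp only [Real.cosh_neg] at h0
  rw [← h0, ← integral_add hi' hi.integrableOn] at h
  unfold besselL besselKRight
  rw [← h, ← integral_const_mul]
  refine integral_congr_ae (ae_of_all _ fun t => ?_)
  simp only [Complex.cosh]
  push_cast
  rw [mul_neg]
  ring

lemma hasDerivAt_besselL (ν : ℂ) {z : ℂ} (hz : 0 < z.re) :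
    HasDerivAt (besselL ν) (-(besselL (ν + 1) z + besselL (ν - 1) z) / 2) z := by
  have h := hasDerivAt_integral_cexp MeasurableSet.univ (φ := Real.cosh)
    (g := fun t : ℝ => cexp (ν * t)) (fun u _ => (Real.cosh_pos u).le) (by fun_prop) (by fun_prop)
    (fun x hx => by
      rw [integrableOn_univ]
      refine (integrable_exp_cosh hx ν.re).congr (ae_of_all _ fun t => ?_)
      simp [norm_exp]) hz
  simp only [Measure.restrict_univ] at h
  refine h.congr_deriv ?_
  unfold besselL
  rw [← integral_add (integrable_besselL _ hz) (integrable_besselL _ hz), ← integral_neg,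
    ← integral_div]
  refine integral_congr_ae (ae_of_all _ fun t => ?_)
  simp only
  rw [add_mul, sub_mul, one_mul, Complex.exp_add, Complex.exp_sub, div_eq_mul_inv (cexp (ν * t)),
    ← Complex.exp_neg]
  push_cast
  simp only [Complex.cosh]
  ring

/-- The integral over the real line of the `t`-derivative of `exp(-z cosh t + νt)` vanishes. -/
lemma besselL_recurrence (ν : ℂ) {z : ℂ} (hz : 0 < z.re) :
    ν * besselL ν z = z / 2 * (besselL (ν + 1) z - besselL (ν - 1) z) := by
  have h1 := integrable_besselL ν hz
  have h2 := integrable_besselL (ν + 1) hz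
  have h3 := integrable_besselL (ν - 1) hz
  have hi : Integrable fun t : ℝ => ν * (cexp (-z * Real.cosh t) * cexp (ν * t)) -
      z / 2 * (cexp (-z * Real.cosh t) * cexp ((ν + 1) * t) -
        cexp (-z * Real.cosh t) * cexp ((ν - 1) * t)) :=
    (h1.const_mul ν).sub ((h2.sub h3).const_mul (z / 2))
  have hd : ∀ t : ℝ, HasDerivAt (fun t : ℝ => cexp (-z * Real.cosh t) * cexp (ν * t))
      (ν * (cexp (-z * Real.cosh t) * cexp (ν * t)) -
      z / 2 * (cexp (-z * Real.cosh t) * cexp ((ν + 1) * t) -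
        cexp (-z * Real.cosh t) * cexp ((ν - 1) * t))) t := by
    intro t
    have e1 := ((Real.hasDerivAt_cosh t).ofReal_comp.const_mul (-z)).cexp
    have e2 := ((hasDerivAt_id t).ofReal_comp.const_mul ν).cexp
    refine (e1.mul e2).congr_deriv ?_
    simp only [id]
    rw [add_mul, sub_mul, one_mul, Complex.exp_add, Complex.exp_sub,
      div_eq_mul_inv (cexp (ν * t)), ← Complex.exp_neg]
    push_cast
    simp only [Complex.sinh]
    ring
  have h := integral_eq_zero_of_hasDerivAt_of_integrable hd hi h1
  have h23 : Integrable fun t : ℝ => cexp (-z * Real.cosh t) * cexp ((ν + 1) * t) -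
      cexp (-z * Real.cosh t) * cexp ((ν - 1) * t) := h2.sub h3
  rw [integral_sub (h1.const_mul ν) (h23.const_mul (z / 2)), integral_const_mul,
    integral_const_mul, integral_sub h2 h3] at h
  exact sub_eq_zero.1 h

/-! ### The entire series -/

/-- `∑_k ζ^k / (k! Γ(k + 1 + ν))`. -/
noncomputable def besselSeries (ν ζ : ℂ) : ℂ :=
  ∑' k : ℕ, ζ ^ k / ((k.factorial : ℂ) * Gamma (k + 1 + ν))

/-- The moduli do not increase with `k`, since consecutive Gamma values differ by a factor of
modulus at least `1`. -/
lemma exists_norm_inv_Gamma_nat_le {ν : ℂ} (hν : 0 ≤ ν.re) :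
    ∃ B, 0 ≤ B ∧ ∀ k : ℕ, ‖(Gamma (k + 1 + ν))⁻¹‖ ≤ B := by
  refine ⟨‖(Gamma (1 + ν))⁻¹‖, norm_nonneg _, fun k => ?_⟩
  induction k with
  | zero => simp
  | succ k ih =>
    have hre : (1 : ℝ) ≤ ((k : ℂ) + 1 + ν).re := by simp; linarith [(Nat.cast_nonneg k : (0 : ℝ) ≤ k)]
    have hne : (k : ℂ) + 1 + ν ≠ 0 := fun h => by rw [h] at hre; simp at hre; linarith
    have := Gamma_add_one _ hne
    rw [show ((k + 1 : ℕ) : ℂ) + 1 + ν = (k : ℂ) + 1 + ν + 1 by push_cast; ring, this, mul_inv,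
      norm_mul, norm_inv ((k : ℂ) + 1 + ν)]
    refine (mul_le_of_le_one_left (norm_nonneg _) ?_).trans ih
    exact inv_le_one_of_one_le₀ (hre.trans (re_le_norm _))

lemma summable_besselSeries {ν : ℂ} (hν : 0 ≤ ν.re) (ζ : ℂ) :
    Summable fun k : ℕ => ζ ^ k / ((k.factorial : ℂ) * Gamma (k + 1 + ν)) := by
  obtain ⟨B, hB, h⟩ := exists_norm_inv_Gamma_nat_le hν
  refine Summable.of_norm_bounded ((Real.summable_pow_div_factorial ‖ζ‖).mul_right B) fun k => ?_
  rw [norm_div, norm_mul, norm_pow, ← div_div, div_eq_mul_inv _ ‖Gamma _‖, ← norm_inv,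
    norm_natCast]
  gcongr
  exact h k

lemma besselSeries_zero (ν : ℂ) : besselSeries ν 0 = (Gamma (1 + ν))⁻¹ := by
  unfold besselSeries
  rw [tsum_eq_single 0 fun k hk => by simp [hk]]
  simp

lemma hasDerivAt_besselSeries {ν : ℂ} (hν : 0 ≤ ν.re) (ζ : ℂ) :
    HasDerivAt (besselSeries ν) (besselSeries (ν + 1) ζ) ζ := by
  obtain ⟨B, hB, h⟩ := exists_norm_inv_Gamma_nat_le hν
  set R := ‖ζ‖ + 1 with hR
  set g' : ℕ → ℂ → ℂ := fun k y => (k * y ^ (k - 1)) / ((k.factorial : ℂ) * Gamma (k + 1 + ν))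
    with hg'
  set b : ℕ → ℝ := fun k => k * R ^ (k - 1) / k.factorial * B with hb
  have hshift : ∀ k : ℕ, ((k + 1 : ℕ) : ℝ) * R ^ (k + 1 - 1) / (k + 1).factorial =
      R ^ k / k.factorial := fun k => by
    rw [Nat.factorial_succ, Nat.add_sub_cancel]
    push_cast
    field_simp
  have hbs : Summable b := by
    refine Summable.mul_right B ?_
    rw [← summable_nat_add_iff 1]
    simp only [hshift]
    exact Real.summable_pow_div_factorial R
  have hd := hasDerivAt_tsum_of_isPreconnected (t := Metric.ball (0 : ℂ) R)
    (g := fun (k : ℕ) (y : ℂ) => y ^ k / ((k.factorial : ℂ) * Gamma (k + 1 + ν))) (g' := g') (y₀ := 0) (y := ζ)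
    hbs Metric.isOpen_ball (convex_ball _ _).isPreconnected
    (fun k y _ => (hasDerivAt_pow k y).div_const _) (fun k y hy => ?_) (by simp [hR]; positivity)
    (summable_besselSeries hν 0) (by simp [hR])
  · refine hd.congr_deriv ?_
    have hs : Summable fun k => g' k ζ := by
      refine Summable.of_norm_bounded hbs fun k => ?_
      simp only [hg', hb]
      rw [norm_div, norm_mul, norm_mul, norm_pow, ← div_div, div_eq_mul_inv _ ‖Gamma _‖, ← norm_inv,
        norm_natCast, norm_natCast]
      gcongr
      · linarith
      · exact h k
    rw [hs.tsum_eq_zero_add]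
    unfold besselSeries
    simp only [hg', Nat.cast_zero, zero_mul, zero_div, zero_add]
    refine tsum_congr fun k => ?_
    rw [Nat.factorial_succ, Nat.add_sub_cancel]
    have : ((k + 1 : ℕ) : ℂ) ≠ 0 := Nat.cast_ne_zero.2 (Nat.succ_ne_zero k)
    rw [Nat.cast_mul, mul_assoc, mul_div_mul_left _ _ this]
    congr 3
    push_cast
    ring
  · rw [mem_ball_zero_iff] at hy
    simp only [hg', hb]
    rw [norm_div, norm_mul, norm_mul, norm_pow, ← div_div, div_eq_mul_inv _ ‖Gamma _‖, ← norm_inv,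
      norm_natCast, norm_natCast]
    gcongr
    exact h k

/-- In `1/Γ(k+1+ν) = (k+1+ν)/Γ(k+2+ν)` the numerator is split as `(ν+1) + k`; the factor `k` cancels
in `k!` and shifts the index. -/
lemma besselSeries_recurrence {ν : ℂ} (hν : 0 ≤ ν.re) (ζ : ℂ) :
    besselSeries ν ζ = (ν + 1) * besselSeries (ν + 1) ζ + ζ * besselSeries (ν + 2) ζ := by
  have h1 := summable_besselSeries (ν := ν + 1) (by simp; linarith) ζ
  have h2 := summable_besselSeries (ν := ν + 2) (by simp; linarith) ζ
  set f : ℕ → ℂ := fun k => k * (ζ ^ k / ((k.factorial : ℂ) * Gamma (k + 1 + (ν + 1)))) with hf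
  have hf1 : ∀ k, f (k + 1) = ζ * (ζ ^ k / ((k.factorial : ℂ) * Gamma (k + 1 + (ν + 2)))) := by
    intro k
    have : ((k : ℂ) + 1) ≠ 0 := Nat.cast_add_one_ne_zero k
    simp only [hf]
    rw [Nat.factorial_succ, show ((k + 1 : ℕ) : ℂ) + 1 + (ν + 1) = (k : ℂ) + 1 + (ν + 2) by
      push_cast; ring]
    push_cast
    rw [pow_succ, mul_assoc ((k : ℂ) + 1), ← mul_div_assoc, mul_div_mul_left _ _ this]
    ring
  have hfs : Summable f := by
    rw [← summable_nat_add_iff 1]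
    simp only [hf1]
    exact h2.mul_left ζ
  have hft : ∑' k, f k = ζ * besselSeries (ν + 2) ζ := by
    rw [hfs.tsum_eq_zero_add]
    simp only [hf1, tsum_mul_left]
    simp [hf, besselSeries]
  rw [← hft, besselSeries, besselSeries, ← tsum_mul_left, ← (h1.mul_left (ν + 1)).tsum_add hfs]
  refine tsum_congr fun k => ?_
  have hre : (1 : ℝ) ≤ ((k : ℂ) + 1 + ν).re := by simp; linarith [(Nat.cast_nonneg k : (0 : ℝ) ≤ k)]
  have hne : (k : ℂ) + 1 + ν ≠ 0 := fun h => by rw [h] at hre; simp at hre; linarith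
  have hg := Gamma_add_one _ hne
  have hg0 : Gamma ((k : ℂ) + 1 + ν) ≠ 0 := Gamma_ne_zero_of_re_pos (by linarith)
  have hk : (k.factorial : ℂ) ≠ 0 := Nat.cast_ne_zero.2 k.factorial_ne_zero
  simp only [hf]
  rw [show (k : ℂ) + 1 + (ν + 1) = (k : ℂ) + 1 + ν + 1 by ring, hg]
  field_simp
  ring

/-! ### The connection formula -/

/-- `2 (z/2)^ν K_ν(z)`. -/
noncomputable def besselM (ν z : ℂ) : ℂ := (z / 2) ^ ν * besselL ν z

lemma cpow_add_one_eq {x : ℂ} (y : ℂ) (hx : x ≠ 0) : x ^ (y + 1) = x ^ y * x := by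
  rw [cpow_add _ _ hx, cpow_one]

lemma hasDerivAt_besselM (ν : ℂ) {z : ℂ} (hz : 0 < z.re) :
    HasDerivAt (besselM ν) (-(z / 2) * besselM (ν - 1) z) z := by
  have hz2 : z / 2 ≠ 0 := fun h => by
    have : z = 0 := by simpa using h
    simp [this] at hz
  have hz0 : z ≠ 0 := fun h => by simp [h] at hz
  have h1 : HasDerivAt (fun z : ℂ => (z / 2) ^ ν) (ν * (z / 2) ^ (ν - 1) * (1 / 2)) z :=
    ((hasDerivAt_id z).div_const 2).cpow_const (Or.inl (by simp [hz]))
  refine (h1.mul (hasDerivAt_besselL ν hz)).congr_deriv ?_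
  unfold besselM
  have h2 := besselL_recurrence ν hz
  have h3 : (z / 2) ^ ν = (z / 2) ^ (ν - 1) * (z / 2) := by
    rw [← cpow_add_one_eq _ hz2, sub_add_cancel]
  rw [h3]
  linear_combination (z / 2) ^ (ν - 1) / 2 * h2

lemma besselM_recurrence (ν : ℂ) {z : ℂ} (hz : 0 < z.re) :
    besselM (ν + 1) z = ν * besselM ν z + z ^ 2 / 4 * besselM (ν - 1) z := by
  have hz2 : z / 2 ≠ 0 := fun h => by
    have : z = 0 := by simpa using h
    simp [this] at hz
  have h2 := besselL_recurrence ν hz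
  have h3 : (z / 2) ^ ν = (z / 2) ^ (ν - 1) * (z / 2) := by
    rw [← cpow_add_one_eq _ hz2, sub_add_cancel]
  unfold besselM
  rw [cpow_add_one_eq _ hz2, h3]
  linear_combination (-(z / 2) ^ (ν - 1) * (z / 2)) * h2

lemma integral_comp_exp_mul (f : ℝ → ℂ) :
    ∫ u in Ioi (0 : ℝ), f u = ∫ t : ℝ, (Real.exp t : ℂ) * f (Real.exp t) := by
  have h := integral_image_eq_integral_abs_deriv_smul MeasurableSet.univ
    (fun x _ => (Real.hasDerivAt_exp x).hasDerivWithinAt) Real.exp_injective.injOn f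
  rw [image_univ, Real.range_exp] at h
  rw [h, Measure.restrict_univ]
  refine integral_congr_ae (ae_of_all _ fun t => ?_)
  simp only [abs_of_pos (Real.exp_pos t), real_smul]

/-- The substitution `t = s - log(x/2)` turns the integrand into `exp(-e^s - (x²/4)e^{-s}) e^{νs}`,
which tends to that of `Γ(ν)` and is dominated by its modulus. -/
lemma tendsto_besselM_zero {ν : ℂ} (hν : 0 < ν.re) :
    Tendsto (fun x : ℝ => besselM ν x) (𝓝[>] 0) (𝓝 (Gamma ν)) := by
  have hrep : ∀ x : ℝ, 0 < x → besselM ν x = ∫ s : ℝ,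
      cexp (-((Real.exp s + x ^ 2 / 4 * Real.exp (-s) : ℝ) : ℂ)) * cexp (ν * s) := by
    intro x hx
    unfold besselM besselL
    rw [← integral_const_mul, ← integral_sub_right_eq_self _ (Real.log (x / 2))]
    refine integral_congr_ae (ae_of_all _ fun s => ?_)
    have hx2 : 0 < x / 2 := by positivity
    have h1 : ((x : ℂ) / 2) ^ ν = cexp (ν * Real.log (x / 2)) := by
      rw [cpow_def_of_ne_zero (by simp [hx.ne']), ofReal_log hx2.le, mul_comm]
      push_cast
      rfl
    have h2 : x * Real.cosh (s - Real.log (x / 2)) =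
        Real.exp s + x ^ 2 / 4 * Real.exp (-s) := by
      rw [Real.cosh_eq, Real.exp_sub, neg_sub, Real.exp_sub, Real.exp_log hx2, Real.exp_neg]
      field_simp
      ring
    simp only
    rw [h1, ← h2, ← mul_assoc, mul_comm (cexp (ν * _)), mul_assoc, ← Complex.exp_add]
    congr 2
    · push_cast; ring
    · push_cast; ring
  have hΓ : Gamma ν = ∫ s : ℝ, cexp (-(Real.exp s : ℂ)) * cexp (ν * s) := by
    rw [Gamma_eq_integral hν, GammaIntegral, integral_comp_exp_mul]
    refine integral_congr_ae (ae_of_all _ fun s => ?_)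
    simp only
    rw [cpow_def_of_ne_zero (by simp), ← ofReal_log (Real.exp_pos s).le, Real.log_exp,
      mul_left_comm]
    congr 1
    · push_cast; rfl
    · rw [ofReal_exp, ← Complex.exp_add]
      congr 1
      ring
  have hdom : Integrable fun s : ℝ => Real.exp (-Real.exp s) * Real.exp (ν.re * s) := by
    have h := Real.GammaIntegral_convergent hν
    have h2 := (integrableOn_image_iff_integrableOn_abs_deriv_smul MeasurableSet.univ
      (fun x _ => (Real.hasDerivAt_exp x).hasDerivWithinAt) Real.exp_injective.injOn
      (fun x => Real.exp (-x) * x ^ (ν.re - 1))).1 (by rwa [image_univ, Real.range_exp])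
    rw [integrableOn_univ] at h2
    refine h2.congr (ae_of_all _ fun s => ?_)
    simp only [smul_eq_mul]
    rw [abs_of_pos (Real.exp_pos s), ← Real.exp_mul, mul_left_comm, ← Real.exp_add]
    congr 2
    ring
  rw [hΓ]
  refine Tendsto.congr' (f₁ := fun x : ℝ => ∫ s : ℝ,
      cexp (-((Real.exp s + x ^ 2 / 4 * Real.exp (-s) : ℝ) : ℂ)) * cexp (ν * s)) ?_ ?_
  · filter_upwards [self_mem_nhdsWithin] with x hx
    exact (hrep x hx).symm
  · refine tendsto_integral_filter_of_dominated_convergence _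
      (Eventually.of_forall fun x => Continuous.aestronglyMeasurable (by fun_prop))
      (Eventually.of_forall fun x => ae_of_all _ fun s => ?_) hdom (ae_of_all _ fun s => ?_)
    · rw [norm_mul, ← ofReal_neg, norm_exp_ofReal, norm_exp]
      simp only [mul_re, ofReal_re, ofReal_im, mul_zero, sub_zero]
      gcongr
      have : 0 ≤ x ^ 2 / 4 * Real.exp (-s) := by positivity
      linarith
    · have hc : Continuous fun x : ℝ =>
        cexp (-((Real.exp s + x ^ 2 / 4 * Real.exp (-s) : ℝ) : ℂ)) * cexp (ν * s) := by fun_prop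
      have := (hc.tendsto 0).mono_left (nhdsWithin_le_nhds (s := Ioi 0))
      simpa using this

/-- In classical notation, `z (K_{α+1} I_α + K_α I_{α+1}) = 1`. The recurrences make the derivative
vanish, and the limit at `0⁺` is `Γ(α+1)/Γ(1+α)`. -/
lemma besselM_wronskian {α : ℂ} (hα : α.re = 0) {z : ℂ} (hz : 0 < z.re) :
    besselM (α + 1) z * besselSeries α (z ^ 2 / 4) +
      z ^ 2 / 4 * besselM α z * besselSeries (α + 1) (z ^ 2 / 4) = 1 := by
  set W : ℂ → ℂ := fun z => besselM (α + 1) z * besselSeries α (z ^ 2 / 4) +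
      z ^ 2 / 4 * besselM α z * besselSeries (α + 1) (z ^ 2 / 4) with hW
  have hd : ∀ z : ℂ, 0 < z.re → HasDerivAt W 0 z := by
    intro z hz
    have hsq : HasDerivAt (fun z : ℂ => z ^ 2 / 4) (z / 2) z :=
      ((hasDerivAt_pow 2 z).div_const 4).congr_deriv (by push_cast; ring)
    have e0 := (hasDerivAt_besselSeries hα.ge (z ^ 2 / 4)).comp z hsq
    have e1 := (hasDerivAt_besselSeries (ν := α + 1) (by simp [hα]) (z ^ 2 / 4)).comp z hsq
    have m0 := hasDerivAt_besselM α hz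
    have m1 := hasDerivAt_besselM (α + 1) hz
    refine ((m1.mul e0).add ((hsq.mul m0).mul e1)).congr_deriv ?_
    have r1 := besselSeries_recurrence hα.ge (z ^ 2 / 4)
    have r2 := besselM_recurrence α hz
    simp only [Function.comp, add_sub_cancel_right, Pi.mul_apply]
    rw [show α + 1 + 1 = α + 2 by ring]
    linear_combination (-(z / 2) * besselM α z) * r1 +
      (z / 2) * besselSeries (α + 1) (z ^ 2 / 4) * r2
  have hconst : ∀ x : ℝ, 0 < x → W x = W z := fun x hx =>
    (isOpen_lt continuous_const continuous_re).is_const_of_deriv_eq_zero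
      (convex_halfSpace_re_gt 0).isPreconnected
      (fun w hw => (hd w hw).differentiableAt.differentiableWithinAt)
      (fun w hw => (hd w hw).deriv) (by simpa using hx) hz
  have hseries : ∀ ν : ℂ, 0 ≤ ν.re → Tendsto (fun x : ℝ => besselSeries ν ((x : ℂ) ^ 2 / 4))
      (𝓝[>] 0) (𝓝 (besselSeries ν 0)) := by
    intro ν hν
    have hc : Continuous (besselSeries ν) :=
      continuous_iff_continuousAt.2 fun ζ => (hasDerivAt_besselSeries hν ζ).continuousAt
    have : Continuous fun x : ℝ => besselSeries ν ((x : ℂ) ^ 2 / 4) := hc.comp (by fun_prop)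
    simpa using (this.tendsto 0).mono_left (nhdsWithin_le_nhds (s := Ioi 0))
  -- The limit of `besselM` at `0` is not available for imaginary index, but the bound `O(x^{-1/2})`
  -- is beaten by `x²`.
  have hM0 : Tendsto (fun x : ℝ => (x : ℂ) ^ 2 / 4 * besselM α x) (𝓝[>] 0) (𝓝 0) := by
    have hb : Tendsto (fun x : ℝ => x ^ (3 / 2 : ℝ) * (3 + ‖α‖) / 2) (𝓝[>] 0) (𝓝 0) := by
      have : Continuous fun x : ℝ => x ^ (3 / 2 : ℝ) * (3 + ‖α‖) / 2 :=
        ((Real.continuous_rpow_const (by norm_num)).mul_const _).div_const _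
      have h := (this.tendsto 0).mono_left (nhdsWithin_le_nhds (s := Ioi 0))
      rwa [Real.zero_rpow (by norm_num), zero_mul, zero_div] at h
    refine squeeze_zero_norm' ?_ hb
    filter_upwards [self_mem_nhdsWithin] with x hx
    rw [mem_Ioi] at hx
    have hre : 0 < (x : ℂ).re := by simpa using hx
    have h1 := norm_besselKRight_le hα hre
    rw [norm_real, Real.norm_of_nonneg hx.le] at h1
    unfold besselM
    rw [besselL_eq_two_mul hre, norm_mul, norm_mul, norm_mul, norm_div, norm_pow, norm_real,
      Real.norm_of_nonneg hx.le, show (x : ℂ) / 2 = ((x / 2 : ℝ) : ℂ) by push_cast; rfl,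
      norm_cpow_eq_rpow_re_of_pos (by positivity), hα, Real.rpow_zero, one_mul]
    simp only [norm_ofNat]
    calc _ ≤ x ^ 2 / 4 * (2 * ((3 + ‖α‖) * x ^ (-(1 / 2) : ℝ))) := by gcongr
      _ = _ := by
        rw [show (3 / 2 : ℝ) = 2 + -(1 / 2) by norm_num, Real.rpow_add hx, Real.rpow_two]
        ring
  have hlim : Tendsto (fun x : ℝ => W x) (𝓝[>] 0)
      (𝓝 (Gamma (α + 1) * besselSeries α 0 + 0 * besselSeries (α + 1) 0)) :=
    ((tendsto_besselM_zero (by simp [hα])).mul (hseries α hα.ge)).add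
      (hM0.mul (hseries (α + 1) (by simp [hα])))
  have hlim' : Tendsto (fun x : ℝ => W x) (𝓝[>] 0) (𝓝 (W z)) := by
    refine tendsto_const_nhds.congr' ?_
    filter_upwards [self_mem_nhdsWithin] with x hx
    exact (hconst x hx).symm
  have := tendsto_nhds_unique hlim' hlim
  rw [besselSeries_zero, zero_mul, add_zero, add_comm α, mul_inv_cancel₀] at this
  · exact this
  · exact Gamma_ne_zero_of_re_pos (by simp [hα])

/-- The Wronskian of `I_α` and `I_{-α}`. It is constant by the recurrences, and at `ζ = 0` it equals
`α/(Γ(1+α)Γ(1-α))`, which the reflection formula evaluates. -/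
lemma besselSeries_wronskian {α : ℂ} (hα : α.re = 0) (h0 : α ≠ 0) (ζ : ℂ) :
    ζ * besselSeries (α + 1) ζ * besselSeries (-α) ζ +
      α * (besselSeries α ζ * besselSeries (-α) ζ) -
      ζ * besselSeries (-α + 1) ζ * besselSeries α ζ = Complex.sin (Real.pi * α) / Real.pi := by
  have hα' : (-α).re = 0 := by simp [hα]
  set W : ℂ → ℂ := fun ζ => ζ * besselSeries (α + 1) ζ * besselSeries (-α) ζ +
      α * (besselSeries α ζ * besselSeries (-α) ζ) -
      ζ * besselSeries (-α + 1) ζ * besselSeries α ζ with hW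
  have hd : ∀ ζ : ℂ, HasDerivAt W 0 ζ := by
    intro ζ
    have e0 := hasDerivAt_besselSeries hα.ge ζ
    have e1 := hasDerivAt_besselSeries (ν := α + 1) (by simp [hα]) ζ
    have f0 := hasDerivAt_besselSeries hα'.ge ζ
    have f1 := hasDerivAt_besselSeries (ν := -α + 1) (by simp [hα]) ζ
    have hid := hasDerivAt_id ζ
    refine (((((hid.mul e1).mul f0).add ((e0.mul f0).const_mul α)).sub
      ((hid.mul f1).mul e0))).congr_deriv ?_
    have r1 := besselSeries_recurrence hα.ge ζ
    have r2 := besselSeries_recurrence hα'.ge ζ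
    simp only [id, Pi.mul_apply]
    rw [show α + 1 + 1 = α + 2 by ring, show -α + 1 + 1 = -α + 2 by ring]
    linear_combination besselSeries α ζ * r2 - besselSeries (-α) ζ * r1
  have hconst : W ζ = W 0 := is_const_of_deriv_eq_zero (fun w => (hd w).differentiableAt)
    (fun w => (hd w).deriv) ζ 0
  have hv : W 0 = Complex.sin (Real.pi * α) / Real.pi := by
    simp only [hW, besselSeries_zero, zero_mul, zero_add, sub_zero]
    have h1 := Gamma_mul_Gamma_one_sub α
    rw [add_comm 1 α, Gamma_add_one _ h0, ← sub_eq_add_neg, mul_inv, mul_assoc,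
      mul_inv_cancel_left₀ h0, ← mul_inv, h1, inv_div]
  exact hconst.trans hv

/-- The continuation of `K_α` to the slit plane by power series. -/
noncomputable def besselKHat (α z : ℂ) : ℂ :=
  Real.pi / (2 * Complex.sin (Real.pi * α)) * ((z / 2) ^ (-α) * besselSeries (-α) (z ^ 2 / 4) -
    (z / 2) ^ α * besselSeries α (z ^ 2 / 4))

lemma sin_pi_mul_ne_zero {α : ℂ} (hα : α.re = 0) (h0 : α ≠ 0) : Complex.sin (Real.pi * α) ≠ 0 := by
  rw [Complex.sin_ne_zero_iff]
  intro k hk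
  have hpi : (Real.pi : ℂ) ≠ 0 := ofReal_ne_zero.2 Real.pi_ne_zero
  have h1 : α = k := mul_left_cancel₀ hpi (by rw [hk]; ring)
  have h2 := congrArg Complex.re h1
  rw [hα, intCast_re] at h2
  rw [h1, ← ofReal_intCast, ← h2] at h0
  exact h0 ofReal_zero

/-- `K_α = π/2 (I_{-α} - I_α)/sin(πα)` in the right half-plane. -/
theorem besselKRight_eq_besselKHat {α z : ℂ} (hα : α.re = 0) (h0 : α ≠ 0) (hz : 0 < z.re) :
    besselKRight α z = besselKHat α z := by
  have hα' : (-α).re = 0 := by simp [hα]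
  have hz2 : z / 2 ≠ 0 := fun h => by
    have : z = 0 := by simpa using h
    simp [this] at hz
  have w1 := besselM_wronskian hα hz
  have w2 := besselM_wronskian hα' hz
  have w3 := besselSeries_wronskian hα h0 (z ^ 2 / 4)
  have r := besselL_recurrence α hz
  have hL := besselL_eq_two_mul (α := α) hz
  have hs := sin_pi_mul_ne_zero hα h0
  have hpi : (Real.pi : ℂ) ≠ 0 := ofReal_ne_zero.2 Real.pi_ne_zero
  have hL1 : besselL (-α + 1) z = besselL (α - 1) z := by rw [← besselL_neg]; ring_nf
  unfold besselM at w1 w2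
  rw [cpow_add_one_eq _ hz2] at w1 w2
  rw [hL1, besselL_neg] at w2
  have ha : (z / 2) ^ α * (z / 2) ^ (-α) = 1 := by rw [← cpow_add _ _ hz2]; simp
  unfold besselKHat
  set a := (z / 2) ^ α
  set b := (z / 2) ^ (-α)
  set e0 := besselSeries α (z ^ 2 / 4)
  set e1 := besselSeries (α + 1) (z ^ 2 / 4)
  set f0 := besselSeries (-α) (z ^ 2 / 4)
  set f1 := besselSeries (-α + 1) (z ^ 2 / 4)
  set L := besselL α z
  -- The Wronskians of `K_α` against `I_α` and `I_{-α}`, with the three-term recurrence, eliminate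
  -- `K_{α±1}`; the coefficient left in front of `K_α` is the Wronskian of `I_α` and `I_{-α}`.
  have key : L * (Complex.sin (Real.pi * α) / Real.pi) = b * f0 - a * e0 := by
    rw [← w3]
    linear_combination b * f0 * w1 - a * e0 * w2 + e0 * f0 * r -
      (z / 2 * besselL (α + 1) z * e0 * f0 + z ^ 2 / 4 * L * e1 * f0 -
        z / 2 * besselL (α - 1) z * e0 * f0 - z ^ 2 / 4 * L * f1 * e0) * ha
  rw [← key, hL]
  field_simp


/-! ### Boundary values of the modified Bessel function -/

/-- The function `K_α` on the closed right half-plane without `0`. -/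
noncomputable def besselKExt (α z : ℂ) : ℂ :=
  if 0 < z.re then besselKRight α z else besselKHat α z

lemma continuous_besselSeries {ν : ℂ} (hν : 0 ≤ ν.re) : Continuous (besselSeries ν) :=
  continuous_iff_continuousAt.2 fun ζ => (hasDerivAt_besselSeries hν ζ).continuousAt

lemma continuousAt_besselKHat {α z : ℂ} (hα : α.re = 0) (hz : z ∈ slitPlane) :
    ContinuousAt (besselKHat α) z := by
  have hα' : (-α).re = 0 := by simp [hα]
  have hz2 : z / 2 ∈ slitPlane := by
    rw [mem_slitPlane_iff] at hz ⊢
    rcases hz with h | h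
    · left; simpa using h
    · right; simpa using h
  have hc : ContinuousAt (fun z : ℂ => z / 2) z := by fun_prop
  have hs : ∀ ν : ℂ, 0 ≤ ν.re → ContinuousAt (fun z : ℂ => besselSeries ν (z ^ 2 / 4)) z :=
    fun ν hν => ((continuous_besselSeries hν).comp (by fun_prop)).continuousAt
  unfold besselKHat
  exact continuousAt_const.mul (((hc.cpow continuousAt_const hz2).mul (hs _ hα'.ge)).sub
    ((hc.cpow continuousAt_const hz2).mul (hs _ hα.ge)))

lemma mem_slitPlane_of_re_nonneg {z : ℂ} (hz : 0 ≤ z.re) (h0 : z ≠ 0) : z ∈ slitPlane := by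
  rw [mem_slitPlane_iff]
  rcases hz.lt_or_eq with h | h
  · exact Or.inl h
  · right
    intro hi
    exact h0 (Complex.ext h.symm hi)

lemma continuousAt_besselKRight {α z : ℂ} (hz : 0 < z.re) : ContinuousAt (besselKRight α) z := by
  have h : ContinuousAt (fun z => besselL α z / 2) z :=
    (hasDerivAt_besselL α hz).continuousAt.div_const 2
  refine h.congr ?_
  filter_upwards [(isOpen_lt continuous_const continuous_re).mem_nhds hz] with w hw
  rw [besselL_eq_two_mul hw]
  ring

/-- `K_α` is continuous up to the boundary of the right half-plane. -/
lemma tendsto_besselKRight {ι : Type*} {l : Filter ι} {w : ι → ℂ} {α z : ℂ} (hα : α.re = 0)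
    (h0 : α ≠ 0 ∨ 0 < z.re) (hz : 0 ≤ z.re) (hz0 : z ≠ 0) (hw : ∀ᶠ i in l, 0 < (w i).re)
    (h : Tendsto w l (𝓝 z)) :
    Tendsto (fun i => besselKRight α (w i)) l (𝓝 (besselKExt α z)) := by
  unfold besselKExt
  split_ifs with hre
  · exact (continuousAt_besselKRight hre).tendsto.comp h
  · have hα0 := h0.resolve_right hre
    have := (continuousAt_besselKHat hα (mem_slitPlane_of_re_nonneg hz hz0)).tendsto.comp h
    refine this.congr' ?_
    filter_upwards [hw] with i hi
    exact (besselKRight_eq_besselKHat hα hα0 hi).symm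

/-- The uniform bound passes to the boundary along `z + ε`. -/
lemma norm_besselKExt_le {α z : ℂ} (hα : α.re = 0) (h0 : α ≠ 0 ∨ 0 < z.re) (hz : 0 ≤ z.re)
    (hz0 : z ≠ 0) : ‖besselKExt α z‖ ≤ (3 + ‖α‖) * ‖z‖ ^ (-(1 / 2) : ℝ) := by
  have hw : Tendsto (fun ε : ℝ => z + (ε : ℂ)) (𝓝[>] 0) (𝓝 z) := by
    have hc : Continuous fun ε : ℝ => z + (ε : ℂ) := by fun_prop
    simpa using (hc.tendsto 0).mono_left (nhdsWithin_le_nhds (s := Ioi 0))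
  have hpos : ∀ᶠ ε : ℝ in 𝓝[>] 0, 0 < (z + (ε : ℂ)).re := by
    filter_upwards [self_mem_nhdsWithin] with ε hε
    rw [add_re, ofReal_re]
    exact add_pos_of_nonneg_of_pos hz hε
  refine le_of_tendsto_of_tendsto (tendsto_besselKRight hα h0 hz hz0 hpos hw).norm
    (tendsto_const_nhds.mul (hw.norm.rpow_const (Or.inl (norm_ne_zero_iff.2 hz0)))) ?_
  filter_upwards [hpos] with ε hε
  exact norm_besselKRight_le hα hε

lemma continuousAt_besselKExt_mul {α z : ℂ} (hα : α.re = 0) (hz : 0 ≤ z.re)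
    (hz0 : z ≠ 0) {x : ℝ} (hx : 0 < x) : ContinuousAt (fun x : ℝ => besselKExt α (z * x)) x := by
  have hx0 : z * (x : ℂ) ≠ 0 := mul_ne_zero hz0 (ofReal_ne_zero.2 hx.ne')
  have hc : ContinuousAt (fun x : ℝ => z * (x : ℂ)) x := by fun_prop
  have hre : (z * (x : ℂ)).re = z.re * x := by simp
  by_cases hzr : 0 < z.re
  · refine ((continuousAt_besselKRight (α := α) (z := z * x) (by rw [hre]; positivity)).comp_of_eq hc
      rfl).congr ?_
    filter_upwards [lt_mem_nhds hx] with w hw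
    have : 0 < (z * (w : ℂ)).re := by simp; positivity
    exact (if_pos this).symm
  · have hzr' : z.re = 0 := le_antisymm (not_lt.1 hzr) hz
    refine ((continuousAt_besselKHat hα (mem_slitPlane_of_re_nonneg (by rw [hre]; positivity) hx0)).comp_of_eq hc rfl).congr (Eventually.of_forall fun w => ?_)
    simp [besselKExt, hzr']

/-! ### The Bessel functions of the kernels -/

lemma besselJ_eq (α : ℂ) {x : ℝ} (hx : 0 < x) :
    besselJ α x = ((x / 2 : ℝ) : ℂ) ^ α * besselSeries α (-((x : ℂ) ^ 2) / 4) := by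
  have hx2 : ((x / 2 : ℝ) : ℂ) ≠ 0 := ofReal_ne_zero.2 (by positivity)
  unfold besselJ besselSeries
  rw [← tsum_mul_left]
  refine tsum_congr fun k => ?_
  rw [cpow_add _ _ hx2, show (2 * (k : ℂ)) = ((2 * k : ℕ) : ℂ) by push_cast; rfl, cpow_natCast,
    pow_mul, show -((x : ℂ) ^ 2) / 4 = -1 * (((x / 2 : ℝ) : ℂ) ^ 2) by push_cast; ring, mul_pow]
  ring

lemma cpow_mul_ofReal {w : ℂ} (hw : w ≠ 0) (α : ℂ) {x : ℝ} (hx : 0 < x) :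
    (w * (x : ℂ)) ^ α = w ^ α * (x : ℂ) ^ α := by
  have hx0 : (x : ℂ) ≠ 0 := ofReal_ne_zero.2 hx.ne'
  rw [cpow_def_of_ne_zero (mul_ne_zero hw hx0), cpow_def_of_ne_zero hw, cpow_def_of_ne_zero hx0,
    mul_comm w, log_ofReal_mul hx hw, ← Complex.exp_add, ← ofReal_log hx.le]
  congr 1
  ring

lemma I_cpow (α : ℂ) : I ^ α = cexp (Real.pi / 2 * α * I) := by
  rw [cpow_def_of_ne_zero I_ne_zero, log_I]
  congr 1
  ring

lemma neg_I_cpow (α : ℂ) : (-I) ^ α = cexp (-(Real.pi / 2 * α * I)) := by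
  rw [cpow_def_of_ne_zero (neg_ne_zero.2 I_ne_zero), log_neg_I]
  congr 1
  ring

/-- At argument `π/2` the series variable becomes `-x²/4`, which turns `I_{±α}` into `J_{±α}` with a
phase. -/
lemma besselKHat_I_mul (α : ℂ) {x : ℝ} (hx : 0 < x) :
    besselKHat α (I * x) = Real.pi / (2 * Complex.sin (Real.pi * α)) *
      (cexp (-(Real.pi / 2 * α * I)) * besselJ (-α) x - cexp (Real.pi / 2 * α * I) * besselJ α x) := by
  unfold besselKHat
  rw [besselJ_eq _ hx, besselJ_eq _ hx, show I * (x : ℂ) / 2 = I * ((x / 2 : ℝ) : ℂ) by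
    push_cast; ring, cpow_mul_ofReal I_ne_zero _ (half_pos hx),
    cpow_mul_ofReal I_ne_zero _ (half_pos hx), I_cpow, I_cpow, mul_pow, I_sq, neg_one_mul]
  rw [show (Real.pi : ℂ) / 2 * -α * I = -(Real.pi / 2 * α * I) by ring]
  ring

lemma besselKHat_neg_I_mul (α : ℂ) {x : ℝ} (hx : 0 < x) :
    besselKHat α (-I * x) = Real.pi / (2 * Complex.sin (Real.pi * α)) *
      (cexp (Real.pi / 2 * α * I) * besselJ (-α) x - cexp (-(Real.pi / 2 * α * I)) * besselJ α x) := by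
  have h0 := neg_ne_zero.2 I_ne_zero
  unfold besselKHat
  rw [besselJ_eq _ hx, besselJ_eq _ hx, show -I * (x : ℂ) / 2 = -I * ((x / 2 : ℝ) : ℂ) by
    push_cast; ring, cpow_mul_ofReal h0 _ (half_pos hx),
    cpow_mul_ofReal h0 _ (half_pos hx), neg_I_cpow, neg_I_cpow, mul_pow, neg_sq, I_sq, neg_one_mul]
  rw [show -((Real.pi : ℂ) / 2 * -α * I) = (Real.pi / 2 * α * I) by ring]
  ring

/-- Adding the values on the two imaginary half-axes combines the phases into `2 cos(πα/2)`, which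
cancels against `sin(πα) = 2 sin(πα/2) cos(πα/2)`. -/
lemma besselJSgn_neg_eq {α : ℂ} (hα : α.re = 0) (h0 : α ≠ 0) {x : ℝ} (hx : 0 < x) :
    besselJSgn .neg α x = besselKExt α (2 * I * x) + besselKExt α (2 * -I * x) := by
  have h2x : 0 < 2 * x := by positivity
  have e1 : besselKExt α (2 * I * x) = besselKHat α (I * (2 * x : ℝ)) := by
    unfold besselKExt
    rw [if_neg (by simp)]
    push_cast
    ring_nf
  have e2 : besselKExt α (2 * -I * x) = besselKHat α (-I * (2 * x : ℝ)) := by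
    unfold besselKExt
    rw [if_neg (by simp)]
    push_cast
    ring_nf
  have hs := sin_pi_mul_ne_zero hα h0
  rw [e1, e2, besselKHat_I_mul _ h2x, besselKHat_neg_I_mul _ h2x]
  have hsin : Complex.sin (Real.pi * α) =
      2 * Complex.sin (Real.pi * α / 2) * Complex.cos (Real.pi * α / 2) := by
    rw [← Complex.sin_two_mul]; ring_nf
  rw [hsin] at hs ⊢
  have hs1 : Complex.sin (Real.pi * α / 2) ≠ 0 := fun h => by simp [h] at hs
  have hs2 : Complex.cos (Real.pi * α / 2) ≠ 0 := fun h => by simp [h] at hs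
  have hcos : cexp (-(Real.pi / 2 * α * I)) + cexp (Real.pi / 2 * α * I) =
      2 * Complex.cos (Real.pi * α / 2) := by
    rw [Complex.two_cos]; ring_nf
  simp only [besselJSgn]
  generalize Complex.sin (Real.pi * α / 2) = S at *
  generalize Complex.cos (Real.pi * α / 2) = C at *
  generalize besselJ α (2 * x) = A at *
  generalize besselJ (-α) (2 * x) = B at *
  have hC : C = (cexp (-(Real.pi / 2 * α * I)) + cexp (Real.pi / 2 * α * I)) / 2 := by
    rw [hcos]; ring
  rw [show (Real.pi : ℂ) / (2 * (2 * S * C)) *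
      (cexp (-(Real.pi / 2 * α * I)) * B - cexp (Real.pi / 2 * α * I) * A) +
    Real.pi / (2 * (2 * S * C)) *
      (cexp (Real.pi / 2 * α * I) * B - cexp (-(Real.pi / 2 * α * I)) * A) =
    Real.pi / (2 * (2 * S * C)) *
      (cexp (-(Real.pi / 2 * α * I)) + cexp (Real.pi / 2 * α * I)) * (B - A) by ring, hcos]
  field_simp

/-- Subtracting the values combines the phases into `2 sin(πα/2)`, so the cosine remains in the
denominator. -/
lemma besselJSgn_pos_eq {α : ℂ} (hα : α.re = 0) (h0 : α ≠ 0) {x : ℝ} (hx : 0 < x) :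
    besselJSgn .pos α x = I * (besselKExt α (2 * I * x) - besselKExt α (2 * -I * x)) := by
  have h2x : 0 < 2 * x := by positivity
  have e1 : besselKExt α (2 * I * x) = besselKHat α (I * (2 * x : ℝ)) := by
    unfold besselKExt
    rw [if_neg (by simp)]
    push_cast
    ring_nf
  have e2 : besselKExt α (2 * -I * x) = besselKHat α (-I * (2 * x : ℝ)) := by
    unfold besselKExt
    rw [if_neg (by simp)]
    push_cast
    ring_nf
  have hs := sin_pi_mul_ne_zero hα h0
  rw [e1, e2, besselKHat_I_mul _ h2x, besselKHat_neg_I_mul _ h2x]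
  have hsin : Complex.sin (Real.pi * α) =
      2 * Complex.sin (Real.pi * α / 2) * Complex.cos (Real.pi * α / 2) := by
    rw [← Complex.sin_two_mul]; ring_nf
  rw [hsin] at hs ⊢
  have hs1 : Complex.sin (Real.pi * α / 2) ≠ 0 := fun h => by simp [h] at hs
  have hs2 : Complex.cos (Real.pi * α / 2) ≠ 0 := fun h => by simp [h] at hs
  have hsin' : I * (cexp (-(Real.pi / 2 * α * I)) - cexp (Real.pi / 2 * α * I)) =
      2 * Complex.sin (Real.pi * α / 2) := by
    rw [Complex.two_sin]; ring_nf
  simp only [besselJSgn]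
  generalize Complex.sin (Real.pi * α / 2) = S at *
  generalize Complex.cos (Real.pi * α / 2) = C at *
  generalize besselJ α (2 * x) = A at *
  generalize besselJ (-α) (2 * x) = B at *
  rw [show I * ((Real.pi : ℂ) / (2 * (2 * S * C)) *
      (cexp (-(Real.pi / 2 * α * I)) * B - cexp (Real.pi / 2 * α * I) * A) -
    Real.pi / (2 * (2 * S * C)) *
      (cexp (Real.pi / 2 * α * I) * B - cexp (-(Real.pi / 2 * α * I)) * A)) =
    Real.pi / (2 * (2 * S * C)) *
      (I * (cexp (-(Real.pi / 2 * α * I)) - cexp (Real.pi / 2 * α * I))) * (B + A) by ring, hsin']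
  field_simp

lemma besselKTilde_eq (α : ℂ) {x : ℝ} (hx : 0 < x) :
    besselKTilde α x = 2 * Complex.cos (Real.pi / 2 * α) * besselKExt α (2 * 1 * x) := by
  unfold besselKTilde besselKExt
  rw [if_pos (by simpa using hx), besselK_eq]
  push_cast
  ring_nf


/-! ### The Mellin-Barnes integral of the modified Bessel function -/

lemma integrable_exp_neg_mul_abs {c : ℝ} (hc : 0 < c) :
    Integrable fun y : ℝ => Real.exp (-c * |y|) := by
  refine (integrable_inv_one_add_sq.const_mul (max 1 (2 / c ^ 2))).mono'
    (Continuous.aestronglyMeasurable (by fun_prop)) (ae_of_all _ fun y => ?_)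
  have h := Real.quadratic_le_exp_of_nonneg (mul_nonneg hc.le (abs_nonneg y))
  rw [mul_pow, sq_abs] at h
  have hm1 := le_max_left 1 (2 / c ^ 2)
  have hm2 := le_max_right 1 (2 / c ^ 2)
  have hm2' : 2 ≤ max 1 (2 / c ^ 2) * c ^ 2 := by rwa [div_le_iff₀ (by positivity)] at hm2
  rw [Real.norm_of_nonneg (Real.exp_pos _).le, neg_mul, Real.exp_neg, ← div_eq_mul_inv,
    inv_le_comm₀ (Real.exp_pos _) (by positivity), inv_div]
  refine le_trans ?_ h
  rw [div_le_iff₀ (by positivity)]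
  have := mul_nonneg hc.le (abs_nonneg y)
  nlinarith [mul_nonneg (sub_nonneg.2 hm2') (sq_nonneg y),
    mul_nonneg this (zero_le_one.trans hm1)]

/-- With `v = √r e^t` the variable `r` enters only through a power and `exp(-zr/v)`, so that the
Mellin transform in `r` is a Gamma integral. -/
lemma besselKRight_two_mul_sqrt (α : ℂ) {z : ℂ} (hz : 0 < z.re) {r : ℝ} (hr : 0 < r) :
    besselKRight α (2 * z * (Real.sqrt r : ℝ)) = 1 / 2 * (r : ℂ) ^ (-(α / 2)) *
      ∫ v in Ioi (0 : ℝ), cexp (-z * (v + r / v : ℝ)) * (v : ℂ) ^ (α - 1) := by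
  have hre : 0 < (2 * z * (Real.sqrt r : ℝ)).re := by
    have := Real.sqrt_pos.2 hr
    simp [hr, hz]
  have h := besselL_eq_two_mul (α := α) hre
  have h2 : besselL α (2 * z * (Real.sqrt r : ℝ)) = (r : ℂ) ^ (-(α / 2)) *
      ∫ v in Ioi (0 : ℝ), cexp (-z * (v + r / v : ℝ)) * (v : ℂ) ^ (α - 1) := by
    rw [integral_comp_exp_mul]
    unfold besselL
    rw [← integral_const_mul, ← integral_sub_right_eq_self _ (Real.log r / 2)]
    refine integral_congr_ae (ae_of_all _ fun t => ?_)
    have hs : Real.sqrt r = Real.exp (Real.log r / 2) := by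
      rw [Real.exp_half, Real.exp_log hr]
    have hr' : r = Real.exp (Real.log r / 2) * Real.exp (Real.log r / 2) := by
      rw [← hs, Real.mul_self_sqrt hr.le]
    have e1 : 2 * (Real.sqrt r * Real.cosh (t - Real.log r / 2)) =
        Real.exp t + r / Real.exp t := by
      rw [hs, Real.cosh_eq, Real.exp_sub, neg_sub, Real.exp_sub]
      field_simp
      linear_combination -hr'
    simp only
    rw [← e1, cpow_def_of_ne_zero (ofReal_ne_zero.2 hr.ne'), cpow_def_of_ne_zero (by simp),
      ← ofReal_log hr.le, ← ofReal_log (Real.exp_pos t).le, Real.log_exp, ofReal_exp]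
    simp only [← Complex.exp_add]
    congr 1
    push_cast
    ring
  linear_combination (h2 - h) / 2

/-- Because `Re α = 0`, the absolute `r`-integral is `Γ(Re s)(v/Re z)^{Re s}`, and a convergent
Gamma integral in `v` is left. -/
lemma integrable_mellin_besselKRight {α z s : ℂ} (hα : α.re = 0) (hz : 0 < z.re) (hs : 0 < s.re) :
    Integrable (fun p : ℝ × ℝ => (p.2 : ℂ) ^ (s - α / 2 - 1) *
      (cexp (-z * (p.1 + p.2 / p.1 : ℝ)) * (p.1 : ℂ) ^ (α - 1)))
      ((volume.restrict (Ioi 0)).prod (volume.restrict (Ioi 0))) := by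
  have hnorm : ∀ v r : ℝ, 0 < v → 0 < r → ‖(r : ℂ) ^ (s - α / 2 - 1) *
      (cexp (-z * (v + r / v : ℝ)) * (v : ℂ) ^ (α - 1))‖ =
      (Real.exp (-z.re * v) * v ^ (-1 : ℝ)) * (r ^ (s.re - 1) * Real.exp (-(z.re / v * r))) := by
    intro v r hv hr
    rw [norm_mul, norm_mul, norm_cexp_neg_mul, norm_cpow_eq_rpow_re_of_pos hr,
      norm_cpow_eq_rpow_re_of_pos hv]
    have e1 : (s - α / 2 - 1).re = s.re - 1 := by simp [hα]
    have e2 : (α - 1).re = -1 := by simp [hα]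
    rw [e1, e2, show -z.re * (v + r / v) = -z.re * v + -(z.re / v * r) by ring, Real.exp_add]
    ring
  have hint : ∀ v : ℝ, 0 < v → IntegrableOn
      (fun r : ℝ => r ^ (s.re - 1) * Real.exp (-(z.re / v * r))) (Ioi 0) := by
    intro v hv
    refine (integrableOn_exp_mul_rpow (div_pos hz hv) hs).congr_fun (fun r _ => ?_) measurableSet_Ioi
    simp only
    rw [neg_mul, mul_comm]
  have hmeas : AEStronglyMeasurable (fun p : ℝ × ℝ => (p.2 : ℂ) ^ (s - α / 2 - 1) *
      (cexp (-z * (p.1 + p.2 / p.1 : ℝ)) * (p.1 : ℂ) ^ (α - 1)))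
      ((volume.restrict (Ioi 0)).prod (volume.restrict (Ioi 0))) := by
    rw [Measure.prod_restrict]
    refine ContinuousOn.aestronglyMeasurable ?_ (measurableSet_Ioi.prod measurableSet_Ioi)
    refine ContinuousOn.mul ((continuousOn_cpow_Ioi _).comp continuousOn_snd fun p hp => hp.2)
      (ContinuousOn.mul ?_ ((continuousOn_cpow_Ioi _).comp continuousOn_fst fun p hp => hp.1))
    refine (continuous_const.mul continuous_ofReal).cexp.comp_continuousOn (continuousOn_fst.add
      (continuousOn_snd.div continuousOn_fst fun p hp => ne_of_gt hp.1))
  rw [integrable_prod_iff hmeas]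
  constructor
  · refine (ae_restrict_mem measurableSet_Ioi).mono fun v hv => ?_
    refine ((hint v hv).const_mul (Real.exp (-z.re * v) * v ^ (-1 : ℝ))).mono' ?_ ?_
    · refine ContinuousOn.aestronglyMeasurable ?_ measurableSet_Ioi
      refine (continuousOn_cpow_Ioi _).mul (Continuous.continuousOn ?_)
      exact (Complex.continuous_exp.comp (continuous_const.mul (continuous_ofReal.comp
        (continuous_const.add (continuous_id.div_const v))))).mul
        (continuous_const (y := (v : ℂ) ^ (α - 1)))
    · exact (ae_restrict_mem measurableSet_Ioi).mono fun r hr => (hnorm v r hv hr).le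
  · have hb := (integrableOn_exp_mul_rpow hz hs).const_mul ((1 / z.re) ^ s.re * Real.Gamma s.re)
    refine Integrable.congr hb ((ae_restrict_mem measurableSet_Ioi).mono fun v hv => ?_)
    have hv' : 0 < v := hv
    simp only
    rw [setIntegral_congr_fun measurableSet_Ioi fun r hr => hnorm v r hv hr, integral_const_mul,
      Real.integral_rpow_mul_exp_neg_mul_Ioi hs (div_pos hz hv), one_div_div, div_eq_mul_one_div v,
      Real.mul_rpow hv'.le (one_div_pos.2 hz).le, sub_eq_add_neg, Real.rpow_add hv']
    ring

/-- The two Gamma factors come from integrating first over `r` with scale `z/v` and then over `v`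
with scale `z`. -/
lemma mellin_besselKRight {α z s : ℂ} (hα : α.re = 0) (hz : 0 < z.re) (hs : 0 < s.re) :
    MellinConvergent (fun r => besselKRight α (2 * z * (Real.sqrt r : ℝ))) s ∧
    mellin (fun r => besselKRight α (2 * z * (Real.sqrt r : ℝ))) s =
      1 / 2 * (Gamma (s - α / 2) * Gamma (s + α / 2) * z ^ (-2 * s)) := by
  have hz0 : z ≠ 0 := fun h => by simp [h] at hz
  have hi := integrable_mellin_besselKRight hα hz hs
  have hcongr : ∀ r ∈ Ioi (0 : ℝ), 1 / 2 * ∫ v in Ioi (0 : ℝ), (r : ℂ) ^ (s - α / 2 - 1) *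
      (cexp (-z * (v + r / v : ℝ)) * (v : ℂ) ^ (α - 1)) =
      (r : ℂ) ^ (s - 1) • besselKRight α (2 * z * (Real.sqrt r : ℝ)) := by
    intro r hr
    rw [besselKRight_two_mul_sqrt α hz hr, integral_const_mul, smul_eq_mul,
      show s - α / 2 - 1 = (s - 1) + -(α / 2) by ring, cpow_add _ _ (ofReal_ne_zero.2 (ne_of_gt hr))]
    ring
  constructor
  · exact IntegrableOn.congr_fun (hi.integral_prod_right.const_mul (1 / 2)) hcongr measurableSet_Ioi
  · rw [mellin, ← setIntegral_congr_fun measurableSet_Ioi hcongr, integral_const_mul,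
      ← integral_integral_swap (f := fun v r : ℝ => (r : ℂ) ^ (s - α / 2 - 1) *
        (cexp (-z * (v + r / v : ℝ)) * (v : ℂ) ^ (α - 1))) hi]
    congr 1
    have hinner : ∀ v ∈ Ioi (0 : ℝ), ∫ r in Ioi (0 : ℝ), (r : ℂ) ^ (s - α / 2 - 1) *
        (cexp (-z * (v + r / v : ℝ)) * (v : ℂ) ^ (α - 1)) =
        Gamma (s - α / 2) * z ^ (-(s - α / 2)) * (cexp (-z * v) * (v : ℂ) ^ (s + α / 2 - 1)) := by
      intro v hv
      have hv0 : (v : ℂ) ≠ 0 := ofReal_ne_zero.2 (ne_of_gt hv)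
      have hzv : 0 < (z / v).re := by rw [div_ofReal_re]; exact div_pos hz hv
      have h := integral_cexp_mul_cpow (w := s - α / 2) (c := z / v) (by simp [hα, hs]) hzv
      have h3 : (z / v) ^ (-(s - α / 2)) = z ^ (-(s - α / 2)) * (v : ℂ) ^ (s - α / 2) := by
        rw [div_eq_mul_inv, ← ofReal_inv, cpow_mul_ofReal hz0 _ (inv_pos.2 hv), ofReal_inv, cpow_neg,
          cpow_neg, inv_cpow _ _ (by rw [arg_ofReal_of_nonneg (le_of_lt hv)]; exact Real.pi_pos.ne),
          inv_inv]
      rw [h3] at h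
      have h4 : (v : ℂ) ^ (s + α / 2 - 1) = (v : ℂ) ^ (s - α / 2) * (v : ℂ) ^ (α - 1) := by
        rw [← cpow_add _ _ hv0]; congr 1; ring
      rw [h4, show Gamma (s - α / 2) * z ^ (-(s - α / 2)) *
        (cexp (-z * v) * ((v : ℂ) ^ (s - α / 2) * (v : ℂ) ^ (α - 1))) =
        (cexp (-z * v) * (v : ℂ) ^ (α - 1)) *
          (Gamma (s - α / 2) * (z ^ (-(s - α / 2)) * (v : ℂ) ^ (s - α / 2))) by ring, ← h,
        ← integral_const_mul]
      refine integral_congr_ae (ae_of_all _ fun r => ?_)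
      simp only
      rw [show -z * (v + r / v : ℝ) = -z * v + -(z / v) * r by push_cast; field_simp; ring,
        Complex.exp_add]
      ring
    rw [setIntegral_congr_fun measurableSet_Ioi hinner, integral_const_mul,
      integral_cexp_mul_cpow (by simp [hα, hs]) hz,
      show -2 * s = -(s - α / 2) + -(s + α / 2) by ring, cpow_add _ _ hz0]
    ring

/-- The Gamma functions decay like `exp(-π|y|)` and the power of `z` grows at most like `exp(2|arg
z||y|)`, so convergence rests on `|arg z| < π/2`. As `3/8 < 1/2`, the Stirling powers are at most
`1`. -/
lemma integrable_barnes_besselKRight {z : ℂ} (hz : 0 < z.re) {β γ : ℂ} (hβ : β.re = 0)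
    (hγ : γ.re = 0) (c : ℂ) :
    Integrable fun y : ℝ => Gamma ((3 / 8 : ℝ) + y * I + β) * Gamma ((3 / 8 : ℝ) + y * I + γ) *
      z ^ (-2 * ((3 / 8 : ℝ) + y * I) + c) := by
  have hz0 : z ≠ 0 := fun h => by simp [h] at hz
  obtain ⟨C, hC, hΓ⟩ := exists_norm_Gamma_le (η := 3 / 8) (by norm_num) (3 / 8)
  have hΓ' : ∀ (y : ℝ) (β : ℂ), β.re = 0 → ‖Gamma ((3 / 8 : ℝ) + y * I + β)‖ ≤
      C * (Real.exp (Real.pi / 2 * ‖β‖) * Real.exp (-(Real.pi / 2 * |y|))) := by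
    intro y β hβ
    have hre : (((3 / 8 : ℝ) : ℂ) + y * I + β).re = 3 / 8 := by simp [hβ]
    have him : (((3 / 8 : ℝ) : ℂ) + y * I + β).im = y + β.im := by simp
    refine (hΓ _ (by rw [hre]; norm_num) fun k => ?_).trans ?_
    · refine le_trans ?_ (re_le_norm _)
      rw [add_re, hre, natCast_re]
      linarith [(Nat.cast_nonneg k : (0 : ℝ) ≤ k)]
    · refine mul_le_mul_of_nonneg_left ?_ hC.le
      unfold stirlingSize
      rw [hre, him, ← Real.exp_add]
      have h1 : (1 + |y + β.im|) ^ ((3 / 8 : ℝ) - 1 / 2) ≤ 1 :=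
        Real.rpow_le_one_of_one_le_of_nonpos (by linarith [abs_nonneg (y + β.im)]) (by norm_num)
      have h2 : |y| ≤ |y + β.im| + ‖β‖ := by
        calc |y| = |(y + β.im) - β.im| := by ring_nf
          _ ≤ |y + β.im| + |β.im| := abs_sub _ _
          _ ≤ _ := by gcongr; exact abs_im_le_norm β
      refine (mul_le_of_le_one_left (Real.exp_pos _).le h1).trans (Real.exp_le_exp.2 ?_)
      nlinarith [Real.pi_pos]
  have harg := abs_lt.1 (abs_arg_lt_pi_div_two_iff.2 (Or.inl hz))
  have harg' : 0 < Real.pi - 2 * |z.arg| := by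
    have := abs_arg_lt_pi_div_two_iff.2 (Or.inl hz)
    linarith
  refine ((integrable_exp_neg_mul_abs harg').const_mul (C * Real.exp (Real.pi / 2 * ‖β‖) *
    (C * Real.exp (Real.pi / 2 * ‖γ‖)) * (‖z‖ ^ (-2 * (3 / 8 : ℝ) + c.re) *
      Real.exp (|z.arg| * |c.im|)))).mono' ?_ (ae_of_all _ fun y => ?_)
  · refine Continuous.aestronglyMeasurable (Continuous.mul (Continuous.mul ?_ ?_) ?_)
    · refine continuous_iff_continuousAt.2 fun y => ContinuousAt.comp
        (f := fun y : ℝ => ((3 / 8 : ℝ) : ℂ) + y * I + β) (continuousAt_Gamma _ fun m h => ?_)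
        (by fun_prop)
      have := congrArg re h
      simp [hβ] at this
      linarith [(Nat.cast_nonneg m : (0 : ℝ) ≤ m)]
    · refine continuous_iff_continuousAt.2 fun y => ContinuousAt.comp
        (f := fun y : ℝ => ((3 / 8 : ℝ) : ℂ) + y * I + γ) (continuousAt_Gamma _ fun m h => ?_)
        (by fun_prop)
      have := congrArg re h
      simp [hγ] at this
      linarith [(Nat.cast_nonneg m : (0 : ℝ) ≤ m)]
    · exact Continuous.const_cpow (by fun_prop) (Or.inl hz0)
  · rw [norm_mul, norm_mul, norm_cpow_of_ne_zero hz0]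
    have hre : (-2 * (((3 / 8 : ℝ) : ℂ) + y * I) + c).re = -2 * (3 / 8 : ℝ) + c.re := by simp
    have him : (-2 * (((3 / 8 : ℝ) : ℂ) + y * I) + c).im = -2 * y + c.im := by simp
    rw [hre, him, div_eq_mul_inv (‖z‖ ^ _), ← Real.exp_neg]
    calc _ ≤ C * (Real.exp (Real.pi / 2 * ‖β‖) * Real.exp (-(Real.pi / 2 * |y|))) *
          (C * (Real.exp (Real.pi / 2 * ‖γ‖) * Real.exp (-(Real.pi / 2 * |y|)))) *
          (‖z‖ ^ (-2 * (3 / 8 : ℝ) + c.re) * (Real.exp (|z.arg| * |c.im|) *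
            Real.exp (2 * |z.arg| * |y|))) := by
          gcongr
          · exact hΓ' y β hβ
          · exact hΓ' y γ hγ
          · rw [← Real.exp_add]
            refine Real.exp_le_exp.2 ((neg_le_abs _).trans ?_)
            rw [abs_mul, mul_comm 2, mul_assoc, ← mul_add]
            gcongr
            refine (abs_add_le _ _).trans ?_
            rw [abs_mul, abs_neg, abs_two, add_comm]
      _ = _ := by
          rw [show -(Real.pi - 2 * |z.arg|) * |y| = -(Real.pi / 2 * |y|) + -(Real.pi / 2 * |y|) +
            2 * |z.arg| * |y| by ring, Real.exp_add, Real.exp_add]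
          ring

/-- The Mellin-Barnes integral for `K_α`. -/
theorem besselKRight_eq_integral {α z c : ℂ} (hα : α.re = 0) (hz : 0 < z.re) (hc : c.re = 0) :
    besselKRight α (2 * z) = 1 / (4 * Real.pi) * ∫ y : ℝ,
      Gamma ((3 / 8 : ℝ) + y * I + (c - α / 2)) * Gamma ((3 / 8 : ℝ) + y * I + (c + α / 2)) *
      z ^ (-2 * ((3 / 8 : ℝ) + y * I) + -2 * c) := by
  have hci : c = c.im * I := by apply Complex.ext <;> simp [hc]
  have hσ : 0 < ((3 / 8 : ℝ) : ℂ).re := by norm_num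
  -- Mellin inversion is evaluated at the single point `r = 1`.
  have h := mellinInv_mellin_eq (3 / 8) (fun r => besselKRight α (2 * z * (Real.sqrt r : ℝ))) one_pos
    (mellin_besselKRight hα hz hσ).1 ?_ ?_
  · rw [Real.sqrt_one, ofReal_one, mul_one] at h
    rw [← h, mellinInv]
    simp only [ofReal_one, one_cpow, one_smul]
    -- A vertical translation by the imaginary number `c` moves `c` into the Gamma functions; it is
    -- later chosen to match the parameters `μ_j`.
    rw [← integral_add_right_eq_self _ c.im, real_smul, ← integral_const_mul, ← integral_const_mul]
    refine integral_congr_ae (ae_of_all _ fun y => ?_)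
    have e : ((3 / 8 : ℝ) : ℂ) + (y + c.im : ℝ) * I = (3 / 8 : ℝ) + y * I + c := by
      conv_rhs => rw [hci]
      push_cast; ring
    simp only
    rw [(mellin_besselKRight hα hz (by simp)).2, e]
    rw [show (3 / 8 : ℝ) + y * I + c - α / 2 = (3 / 8 : ℝ) + y * I + (c - α / 2) by ring,
      show (3 / 8 : ℝ) + y * I + c + α / 2 = (3 / 8 : ℝ) + y * I + (c + α / 2) by ring,
      show -2 * ((3 / 8 : ℝ) + y * I + c) = -2 * ((3 / 8 : ℝ) + y * I) + -2 * c by ring]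
    push_cast
    ring
  · have := (integrable_barnes_besselKRight hz (β := -(α / 2)) (γ := α / 2) (by simp [hα])
      (by simp [hα]) 0).const_mul (1 / 2)
    refine this.congr (ae_of_all _ fun y => ?_)
    simp only
    rw [(mellin_besselKRight hα hz (by simp)).2, add_zero, ← sub_eq_add_neg]
  · have hre : 0 < (2 * z * (Real.sqrt 1 : ℝ)).re := by simpa using hz
    exact ContinuousAt.comp_of_eq (f := fun r : ℝ => 2 * z * (Real.sqrt r : ℝ))
      (continuousAt_besselKRight hre) (by fun_prop) rfl


/-! ### Products of two modified Bessel functions -/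

/-- The function of `u` that arises from products of two modified Bessel functions by inserting
their Mellin-Barnes integrals. -/
noncomputable def betaIntegrand (p q : ℝ → ℝ) (m s₁ s₂ : ℂ) (u : ℝ) : ℂ :=
  (p u : ℂ) ^ (-2 * s₁ - m) * (q u : ℂ) ^ (-2 * s₂ + m) * (u : ℂ) ^ (3 * m) / u

/-- A region of integration on which products of two modified Bessel functions with arguments
proportional to `p` and `q` have the Mellin-Barnes kernel `gammaKernel opp μ * T`. -/
structure IsBetaRegion (opp : Bool) (μ : Fin 3 → ℂ) (S : Set ℝ) (p q : ℝ → ℝ)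
    (T : ℂ → ℂ → ℂ) : Prop where
  measurableSet : MeasurableSet S
  pos : ∀ u ∈ S, 0 < u ∧ 0 < p u ∧ 0 < q u
  continuousOn_fst : ContinuousOn p S
  continuousOn_snd : ContinuousOn q S
  integrableOn : ∀ r : ℝ, 0 < r → r < 1 / 2 →
    IntegrableOn (fun u => p u ^ (-2 * r) * q u ^ (-2 * r) / u) S
  beta : ∀ s₁ s₂ : ℂ, s₁.re = 3 / 8 → s₂.re = 3 / 8 → gammaKernel opp μ s₁ s₂ * T s₁ s₂ =
    2 * (Gamma (s₁ - μ 2) * Gamma (s₁ - μ 0)) * (Gamma (s₂ + μ 0) * Gamma (s₂ + μ 2)) *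
      ∫ u in S, betaIntegrand p q (μ 1) s₁ s₂ u

lemma norm_betaIntegrand {p q : ℝ → ℝ} {m s₁ s₂ : ℂ} {u : ℝ} (hm : m.re = 0) (hu : 0 < u)
    (hp : 0 < p u) (hq : 0 < q u) : ‖betaIntegrand p q m s₁ s₂ u‖ =
      p u ^ (-2 * s₁.re) * q u ^ (-2 * s₂.re) / u := by
  unfold betaIntegrand
  rw [norm_div, norm_mul, norm_mul, norm_cpow_eq_rpow_re_of_pos hp, norm_cpow_eq_rpow_re_of_pos hq,
    norm_cpow_eq_rpow_re_of_pos hu, norm_real, Real.norm_of_nonneg hu.le]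
  simp [hm]

/-- Products of two modified Bessel functions as Mellin-Barnes integrals on a vertical line. -/
theorem IsBetaRegion.integral_besselKRight_mul {opp : Bool} {μ : Fin 3 → ℂ} {S : Set ℝ}
    {p q : ℝ → ℝ} {T : ℂ → ℂ → ℂ} (h : IsBetaRegion opp μ S p q T) (hμ : ∀ j, (μ j).re = 0)
    (hsum : μ 0 + μ 1 + μ 2 = 0) {z₁ z₂ : ℂ} (hz₁ : 0 < z₁.re) (hz₂ : 0 < z₂.re) :
    Integrable (contourIntegrand (fun s₁ s₂ => gammaKernel opp μ s₁ s₂ *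
        (T s₁ s₂ * (z₁ ^ (-2 * s₁ - μ 1) * z₂ ^ (-2 * s₂ + μ 1)))) (fun _ => 3 / 8)
      (fun _ => 3 / 8)) ∧
    ∫ u in S, besselKRight (μ 2 - μ 0) (2 * z₁ * p u) * besselKRight (μ 2 - μ 0) (2 * z₂ * q u) *
        (u : ℂ) ^ (3 * μ 1) / u =
      1 / 8 * ((∫ t, contourIntegrand (fun s₁ s₂ => gammaKernel opp μ s₁ s₂ *
        (T s₁ s₂ * (z₁ ^ (-2 * s₁ - μ 1) * z₂ ^ (-2 * s₂ + μ 1)))) (fun _ => 3 / 8)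
        (fun _ => 3 / 8) t) / (2 * Real.pi * I) ^ 2) := by
  have hz₁0 : z₁ ≠ 0 := fun h => by simp [h] at hz₁
  have hz₂0 : z₂ ≠ 0 := fun h => by simp [h] at hz₂
  have hα : (μ 2 - μ 0).re = 0 := by simp [hμ]
  set m := μ 1 with hm
  have hm0 : m.re = 0 := hμ 1
  set F₁ : ℝ → ℂ := fun y => Gamma ((3 / 8 : ℝ) + y * I + -μ 2) * Gamma ((3 / 8 : ℝ) + y * I + -μ 0) *
      z₁ ^ (-2 * ((3 / 8 : ℝ) + y * I) + -m) with hF₁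
  set F₂ : ℝ → ℂ := fun y => Gamma ((3 / 8 : ℝ) + y * I + μ 0) * Gamma ((3 / 8 : ℝ) + y * I + μ 2) *
      z₂ ^ (-2 * ((3 / 8 : ℝ) + y * I) + m) with hF₂
  have hi₁ : Integrable F₁ := integrable_barnes_besselKRight hz₁ (by simp [hμ]) (by simp [hμ]) _
  have hi₂ : Integrable F₂ := integrable_barnes_besselKRight hz₂ (hμ 0) (hμ 2) _
  have hK₁ : ∀ {x : ℝ}, 0 < x → besselKRight (μ 2 - μ 0) (2 * z₁ * x) = 1 / (4 * Real.pi) *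
      ∫ y : ℝ, F₁ y * (x : ℂ) ^ (-2 * (((3 / 8 : ℝ) : ℂ) + y * I) - m) := by
    intro x hx
    rw [mul_assoc, besselKRight_eq_integral (c := m / 2) hα (by simpa [hx] using hz₁)
      (by simp [hm0])]
    congr 1
    refine integral_congr_ae (ae_of_all _ fun y => ?_)
    simp only [hF₁]
    -- Since the `μ_j` sum to zero, the shift by half of `μ 1` turns `∓α/2` into `-μ 2` and `-μ 0`.
    rw [show m / 2 - (μ 2 - μ 0) / 2 = -μ 2 by linear_combination hsum / 2,
      show m / 2 + (μ 2 - μ 0) / 2 = -μ 0 by linear_combination hsum / 2,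
      show -2 * (m / 2) = -m by ring, cpow_mul_ofReal hz₁0 _ hx, ← sub_eq_add_neg (-2 * _)]
    ring
  have hK₂ : ∀ {x : ℝ}, 0 < x → besselKRight (μ 2 - μ 0) (2 * z₂ * x) = 1 / (4 * Real.pi) *
      ∫ y : ℝ, F₂ y * (x : ℂ) ^ (-2 * (((3 / 8 : ℝ) : ℂ) + y * I) + m) := by
    intro x hx
    rw [mul_assoc, besselKRight_eq_integral (c := -m / 2) hα (by simpa [hx] using hz₂)
      (by simp [hm0])]
    congr 1
    refine integral_congr_ae (ae_of_all _ fun y => ?_)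
    simp only [hF₂]
    rw [show -m / 2 - (μ 2 - μ 0) / 2 = μ 0 by linear_combination -hsum / 2,
      show -m / 2 + (μ 2 - μ 0) / 2 = μ 2 by linear_combination -hsum / 2,
      show -2 * (-m / 2) = m by ring, cpow_mul_ofReal hz₂0 _ hx]
    ring
  set G : ℝ → ℝ × ℝ → ℂ := fun u t => F₁ t.1 * F₂ t.2 *
    betaIntegrand p q m ((3 / 8 : ℝ) + t.1 * I) ((3 / 8 : ℝ) + t.2 * I) u with hG
  have hGi : Integrable (Function.uncurry G) ((volume.restrict S).prod volume) := by
    have hb := ((h.integrableOn (3 / 8) (by norm_num) (by norm_num))).mul_prod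
      (hi₁.norm.mul_prod hi₂.norm)
    refine Integrable.mono' hb ?_ ?_
    · have hcl : ∀ {f : ℝ → ℝ} {k : ℝ × ℝ → ℂ}, ContinuousOn f S → (∀ u ∈ S, 0 < f u) →
          Continuous k → AEStronglyMeasurable (fun x : ℝ × ℝ × ℝ => (f x.1 : ℂ) ^ k x.2)
            ((volume.restrict S).prod volume) := by
        intro f k hf hpos hk
        have hrw : (volume.restrict S).prod (volume : Measure (ℝ × ℝ)) =
            (volume.prod volume).restrict (S ×ˢ univ) := by
          rw [← Measure.prod_restrict, Measure.restrict_univ]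
        rw [hrw]
        refine ContinuousOn.aestronglyMeasurable ?_ (h.measurableSet.prod MeasurableSet.univ)
        refine ContinuousOn.cpow (continuous_ofReal.comp_continuousOn
          (hf.comp _root_.continuousOn_fst fun x hx => hx.1)) (hk.comp continuous_snd).continuousOn
          fun x hx => Or.inl ?_
        simpa using hpos _ hx.1
      have h1 := hcl (k := fun t => -2 * (((3 / 8 : ℝ) : ℂ) + t.1 * I) - m) h.continuousOn_fst
        (fun u hu => (h.pos u hu).2.1) (by fun_prop)
      have h2 := hcl (k := fun t => -2 * (((3 / 8 : ℝ) : ℂ) + t.2 * I) + m) h.continuousOn_snd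
        (fun u hu => (h.pos u hu).2.2) (by fun_prop)
      have h3 := hcl (f := fun u => u) (k := fun t => 3 * m) continuousOn_id
        (fun u hu => (h.pos u hu).1) (by fun_prop)
      have h4 : AEStronglyMeasurable (fun x : ℝ × ℝ × ℝ => (x.1 : ℂ)⁻¹)
          ((volume.restrict S).prod volume) :=
        (measurable_ofReal.comp measurable_fst).inv.aestronglyMeasurable
      have h5 : AEStronglyMeasurable (fun x : ℝ × ℝ × ℝ => F₁ x.2.1 * F₂ x.2.2)
          ((volume.restrict S).prod volume) :=
        (hi₁.mul_prod hi₂).aestronglyMeasurable.comp_snd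
      exact h5.mul (((h1.mul h2).mul h3).mul h4)
    · have hmem : ∀ᵐ x : ℝ × ℝ × ℝ ∂(volume.restrict S).prod volume, x.1 ∈ S :=
        Measure.quasiMeasurePreserving_fst.ae (ae_restrict_mem h.measurableSet)
      filter_upwards [hmem] with x hx
      obtain ⟨hu, hp, hq⟩ := h.pos _ hx
      simp only [Function.uncurry, hG]
      rw [norm_mul, norm_betaIntegrand hm0 hu hp hq, norm_mul]
      simp only [add_re, ofReal_re, mul_re, I_re, mul_zero, ofReal_im, I_im, mul_one, sub_self,
        add_zero]
      rw [mul_comm]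
  have hGu : ∀ u ∈ S, ∫ t, G u t = (4 * Real.pi) ^ 2 *
      (besselKRight (μ 2 - μ 0) (2 * z₁ * p u) * besselKRight (μ 2 - μ 0) (2 * z₂ * q u) *
        (u : ℂ) ^ (3 * m) / u) := by
    intro u hu
    obtain ⟨hu0, hp, hq⟩ := h.pos _ hu
    have hpi : (Real.pi : ℂ) ≠ 0 := ofReal_ne_zero.2 Real.pi_ne_zero
    rw [hK₁ hp, hK₂ hq]
    have e := integral_prod_mul (μ := (volume : Measure ℝ)) (ν := (volume : Measure ℝ))
      (fun y : ℝ => F₁ y * (p u : ℂ) ^ (-2 * (((3 / 8 : ℝ) : ℂ) + y * I) - m))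
      (fun y : ℝ => F₂ y * (q u : ℂ) ^ (-2 * (((3 / 8 : ℝ) : ℂ) + y * I) + m))
    have e2 : (4 * (Real.pi : ℂ)) ^ 2 * (1 / (4 * Real.pi) *
        (∫ y : ℝ, F₁ y * (p u : ℂ) ^ (-2 * (((3 / 8 : ℝ) : ℂ) + y * I) - m)) *
        (1 / (4 * Real.pi) * ∫ y : ℝ, F₂ y * (q u : ℂ) ^ (-2 * (((3 / 8 : ℝ) : ℂ) + y * I) + m)) *
        (u : ℂ) ^ (3 * m) / u) =
        (∫ y : ℝ, F₁ y * (p u : ℂ) ^ (-2 * (((3 / 8 : ℝ) : ℂ) + y * I) - m)) *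
        (∫ y : ℝ, F₂ y * (q u : ℂ) ^ (-2 * (((3 / 8 : ℝ) : ℂ) + y * I) + m)) *
        ((u : ℂ) ^ (3 * m) / u) := by
      generalize (∫ y : ℝ, F₁ y * (p u : ℂ) ^ (-2 * (((3 / 8 : ℝ) : ℂ) + y * I) - m)) = A
      generalize (∫ y : ℝ, F₂ y * (q u : ℂ) ^ (-2 * (((3 / 8 : ℝ) : ℂ) + y * I) + m)) = B
      field_simp
    rw [e2, ← e, ← integral_mul_const, ← Measure.volume_eq_prod]
    refine integral_congr_ae (ae_of_all _ fun t => ?_)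
    simp only [hG, betaIntegrand]
    ring
  -- The factor `2` in `beta` and the product `I · I = -1` of the velocities give `-1/2`.
  have hGt : ∀ t : ℝ × ℝ, ∫ u in S, G u t = -(1 / 2) *
      contourIntegrand (fun s₁ s₂ => gammaKernel opp μ s₁ s₂ *
        (T s₁ s₂ * (z₁ ^ (-2 * s₁ - m) * z₂ ^ (-2 * s₂ + m)))) (fun _ => 3 / 8)
        (fun _ => 3 / 8) t := by
    intro t
    have hb := h.beta ((3 / 8 : ℝ) + t.1 * I) ((3 / 8 : ℝ) + t.2 * I) (by simp) (by simp)
    simp only [hG, contourIntegrand, contourPoint, contourVelocity, deriv_const, ofReal_zero,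
      zero_add, I_mul_I]
    rw [integral_const_mul, ← mul_assoc (gammaKernel _ _ _ _), hb]
    simp only [hF₁, hF₂, ← sub_eq_add_neg]
    ring
  have hpi : (Real.pi : ℂ) ≠ 0 := ofReal_ne_zero.2 Real.pi_ne_zero
  constructor
  · have hr := hGi.integral_prod_right.const_mul (-2)
    refine hr.congr (ae_of_all _ fun t => ?_)
    simp only [Function.uncurry]
    rw [hGt]
    ring
  · have hswap := integral_integral_swap hGi
    simp only [hGt] at hswap
    rw [setIntegral_congr_fun h.measurableSet hGu, integral_const_mul, integral_const_mul] at hswap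
    -- The constant `1/8` is `-1/2` divided by `(4π)²` and multiplied by `(2πi)² = -4π²`.
    rw [mul_pow, mul_pow, I_sq]
    generalize (∫ t : ℝ × ℝ, contourIntegrand _ (fun _ => (3 / 8 : ℝ)) (fun _ => (3 / 8 : ℝ)) t) = X
      at hswap ⊢
    generalize (∫ u in S, (_ : ℂ)) = Y at hswap ⊢
    field_simp
    linear_combination 2 * hswap


/-! ### The regions of integration -/

lemma ofReal_exp_cpow (w : ℝ) (c : ℂ) : ((Real.exp w : ℝ) : ℂ) ^ c = cexp (c * w) := by
  rw [cpow_def_of_ne_zero (ofReal_ne_zero.2 (Real.exp_ne_zero w)), ← ofReal_log (Real.exp_pos w).le,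
    Real.log_exp, mul_comm]

/-- The curve `x ^ c₁ (1 - x) ^ c₂` for `0 < x < 1`. -/
noncomputable def betaCurve (c₁ c₂ x : ℝ) : ℝ :=
  Real.exp (c₁ * Real.log x + c₂ * Real.log (1 - x))

lemma hasDerivAt_betaCurve (c₁ c₂ : ℝ) {x : ℝ} (hx : x ∈ Ioo (0 : ℝ) 1) :
    HasDerivAt (betaCurve c₁ c₂) (betaCurve c₁ c₂ x * (c₁ / x - c₂ / (1 - x))) x := by
  have h1 : (1 - x) ≠ 0 := (sub_pos.2 hx.2).ne'
  have h := ((((Real.hasDerivAt_log hx.1.ne').const_mul c₁).add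
    ((((hasDerivAt_id x).const_sub 1).log h1).const_mul c₂))).exp
  refine h.congr_deriv ?_
  simp only [betaCurve, id, Pi.add_apply]
  ring

/-- The substitution that leads to a Beta integral. -/
lemma integral_betaIntegrand_eq {S : Set ℝ} {p q : ℝ → ℝ} {c₁ c₂ p₁ p₂ q₁ q₂ w : ℝ}
    {m s₁ s₂ a b : ℂ} (hS : BijOn (betaCurve c₁ c₂) (Ioo 0 1) S)
    (hp : ∀ x ∈ Ioo (0 : ℝ) 1, p (betaCurve c₁ c₂ x) = betaCurve p₁ p₂ x)
    (hq : ∀ x ∈ Ioo (0 : ℝ) 1, q (betaCurve c₁ c₂ x) = betaCurve q₁ q₂ x)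
    (hw : ∀ x ∈ Ioo (0 : ℝ) 1, |c₁ / x - c₂ / (1 - x)| = 1 / 2 * betaCurve (-1) (-w) x)
    (ha : a - 1 = p₁ * (-2 * s₁ - m) + q₁ * (-2 * s₂ + m) + c₁ * (3 * m) - 1)
    (hb : b - 1 = p₂ * (-2 * s₁ - m) + q₂ * (-2 * s₂ + m) + c₂ * (3 * m) - w)
    (ha0 : 0 < a.re) (hb0 : 0 < b.re) :
    IntegrableOn (betaIntegrand p q m s₁ s₂) S ∧
      ∫ u in S, betaIntegrand p q m s₁ s₂ u = 1 / 2 * betaIntegral a b := by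
  have hd : ∀ x ∈ Ioo (0 : ℝ) 1, HasDerivWithinAt (betaCurve c₁ c₂)
      (betaCurve c₁ c₂ x * (c₁ / x - c₂ / (1 - x))) (Ioo 0 1) x :=
    fun x hx => (hasDerivAt_betaCurve c₁ c₂ hx).hasDerivWithinAt
  -- All factors are exponentials of linear forms in `log x` and `log(1-x)`, so the identity reduces
  -- to the linear relations `ha` and `hb` between exponents. The logarithmic derivative of the
  -- curve contributes `x^{-1}(1-x)^{-w}/2`.
  have hform : ∀ x ∈ Ioo (0 : ℝ) 1, |betaCurve c₁ c₂ x * (c₁ / x - c₂ / (1 - x))| •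
      betaIntegrand p q m s₁ s₂ (betaCurve c₁ c₂ x) =
      1 / 2 * ((x : ℂ) ^ (a - 1) * (1 - (x : ℂ)) ^ (b - 1)) := by
    intro x hx
    have hpos : ∀ c d : ℝ, 0 < betaCurve c d x := fun c d => Real.exp_pos _
    have h1 : (1 - (x : ℂ)) = ((Real.exp (Real.log (1 - x)) : ℝ) : ℂ) := by
      rw [Real.exp_log (sub_pos.2 hx.2)]; push_cast; rfl
    have h2 : (x : ℂ) = ((Real.exp (Real.log x) : ℝ) : ℂ) := by rw [Real.exp_log hx.1]
    rw [abs_mul, abs_of_pos (hpos _ _), hw x hx, betaIntegrand, hp x hx, hq x hx, real_smul]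
    have h0 : ((betaCurve c₁ c₂ x : ℝ) : ℂ) ≠ 0 := ofReal_ne_zero.2 (hpos _ _).ne'
    push_cast
    rw [show (betaCurve c₁ c₂ x : ℂ) * (1 / 2 * (betaCurve (-1) (-w) x : ℂ)) *
        ((betaCurve p₁ p₂ x : ℂ) ^ (-2 * s₁ - m) * (betaCurve q₁ q₂ x : ℂ) ^ (-2 * s₂ + m) *
          (betaCurve c₁ c₂ x : ℂ) ^ (3 * m) / (betaCurve c₁ c₂ x : ℂ)) =
        1 / 2 * ((betaCurve (-1) (-w) x : ℂ) *
        ((betaCurve p₁ p₂ x : ℂ) ^ (-2 * s₁ - m) * (betaCurve q₁ q₂ x : ℂ) ^ (-2 * s₂ + m) *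
          (betaCurve c₁ c₂ x : ℂ) ^ (3 * m))) by field_simp]
    congr 1
    rw [h1]
    conv_rhs => rw [h2]
    unfold betaCurve
    simp only [ofReal_exp_cpow]
    rw [ofReal_exp]
    simp only [← Complex.exp_add]
    congr 1
    rw [ha, hb]
    push_cast
    ring
  have hbeta : IntegrableOn (fun x : ℝ => 1 / 2 * ((x : ℂ) ^ (a - 1) * (1 - (x : ℂ)) ^ (b - 1)))
      (Ioo 0 1) := by
    have h := betaIntegral_convergent ha0 hb0
    rw [intervalIntegrable_iff_integrableOn_Ioo_of_le zero_le_one] at h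
    exact h.const_mul _
  rw [← hS.image_eq]
  constructor
  · rw [integrableOn_image_iff_integrableOn_abs_deriv_smul measurableSet_Ioo hd hS.injOn]
    exact hbeta.congr_fun (fun x hx => (hform x hx).symm) measurableSet_Ioo
  · rw [integral_image_eq_integral_abs_deriv_smul measurableSet_Ioo hd hS.injOn,
      setIntegral_congr_fun measurableSet_Ioo hform, integral_const_mul, betaIntegral,
      intervalIntegral.integral_of_le zero_le_one, integral_Ioc_eq_integral_Ioo]

lemma sqrt_exp (x : ℝ) : Real.sqrt (Real.exp x) = Real.exp (1 / 2 * x) := by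
  rw [← Real.exp_half]; ring_nf

lemma betaCurve_sq (c₁ c₂ x : ℝ) : betaCurve c₁ c₂ x ^ 2 = betaCurve (2 * c₁) (2 * c₂) x := by
  unfold betaCurve
  rw [← Real.exp_nat_mul]
  push_cast
  ring_nf

lemma sqrt_betaCurve (c₁ c₂ x : ℝ) : Real.sqrt (betaCurve c₁ c₂ x) =
    betaCurve (c₁ / 2) (c₂ / 2) x := by
  unfold betaCurve
  rw [sqrt_exp]
  ring_nf

lemma betaCurve_eq_zpow (a b : ℤ) {x : ℝ} (hx : x ∈ Ioo (0 : ℝ) 1) :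
    betaCurve a b x = x ^ a * (1 - x) ^ b := by
  unfold betaCurve
  rw [Real.exp_add, mul_comm (a : ℝ), mul_comm (b : ℝ), Real.exp_mul, Real.exp_mul,
    Real.exp_log hx.1, Real.exp_log (sub_pos.2 hx.2), Real.rpow_intCast, Real.rpow_intCast]

/-! #### The half-line -/

/-- The substitution `u² = x/(1-x)`, for which `1 + u² = 1/(1-x)` and `1 + u^{-2} = 1/x`. -/
lemma bijOn_betaCurve_Ioi_zero : BijOn (betaCurve (1 / 2) (-(1 / 2))) (Ioo 0 1) (Ioi 0) := by
  have hsq : ∀ x ∈ Ioo (0 : ℝ) 1, betaCurve (1 / 2) (-(1 / 2)) x ^ 2 = x / (1 - x) := by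
    intro x hx
    rw [betaCurve_sq]
    have := betaCurve_eq_zpow 1 (-1) hx
    norm_num at this ⊢
    rw [this, div_eq_mul_inv]
  refine InvOn.bijOn (f' := fun u => u ^ 2 / (1 + u ^ 2)) ⟨fun x hx => ?_, fun u hu => ?_⟩
    (fun x hx => Real.exp_pos _) fun u hu => ?_
  · have : 0 < 1 - x := sub_pos.2 hx.2
    simp only
    rw [hsq x hx]
    field_simp
    ring
  · have hu' : 0 < u := hu
    have h1 : 1 - u ^ 2 / (1 + u ^ 2) = 1 / (1 + u ^ 2) := by field_simp; ring
    have h2 : 1 + u ^ 2 ≠ 0 := by positivity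
    simp only [betaCurve]
    rw [h1, Real.log_div (by positivity) h2, Real.log_div one_ne_zero h2, Real.log_pow, Real.log_one]
    push_cast
    rw [show 1 / 2 * (2 * Real.log u - Real.log (1 + u ^ 2)) + -(1 / 2) *
      (0 - Real.log (1 + u ^ 2)) = Real.log u by ring, Real.exp_log hu']
  · have hu' : 0 < u := hu
    refine ⟨by positivity, ?_⟩
    rw [div_lt_one (by positivity)]
    linarith

/-- The substitution `u² = 1/x`, for which `u² - 1 = (1-x)/x` and `1 - u^{-2} = 1-x`. -/
lemma bijOn_betaCurve_Ioi_one : BijOn (betaCurve (-(1 / 2)) 0) (Ioo 0 1) (Ioi 1) := by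
  have hsq : ∀ x ∈ Ioo (0 : ℝ) 1, betaCurve (-(1 / 2)) 0 x ^ 2 = x⁻¹ := by
    intro x hx
    rw [betaCurve_sq]
    have := betaCurve_eq_zpow (-1) 0 hx
    norm_num at this ⊢
    exact this
  refine InvOn.bijOn (f' := fun u => (u ^ 2)⁻¹) ⟨fun x hx => ?_, fun u hu => ?_⟩
    (fun x hx => ?_) fun u hu => ?_
  · simp only
    rw [hsq x hx, inv_inv]
  · have hu' : 1 < u := hu
    simp only [betaCurve]
    rw [Real.log_inv, Real.log_pow]
    push_cast
    rw [show -(1 / 2) * (-(2 * Real.log u)) + 0 * Real.log (1 - (u ^ 2)⁻¹) = Real.log u by ring,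
      Real.exp_log (by linarith)]
  · rw [mem_Ioi, betaCurve, Real.one_lt_exp_iff, zero_mul, add_zero]
    have := Real.log_neg hx.1 hx.2
    linarith
  · have hu' : 1 < u := hu
    exact ⟨by positivity, inv_lt_one_of_one_lt₀ (by nlinarith)⟩

/-- The substitution `u² = x`, for which `1 - u² = 1-x` and `u^{-2} - 1 = (1-x)/x`. -/
lemma bijOn_betaCurve_Ioo : BijOn (betaCurve (1 / 2) 0) (Ioo 0 1) (Ioo 0 1) := by
  have hsq : ∀ x ∈ Ioo (0 : ℝ) 1, betaCurve (1 / 2) 0 x ^ 2 = x := by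
    intro x hx
    rw [betaCurve_sq]
    have := betaCurve_eq_zpow 1 0 hx
    norm_num at this ⊢
    exact this
  refine InvOn.bijOn (f' := fun u => u ^ 2) ⟨fun x hx => hsq x hx, fun u hu => ?_⟩
    (fun x hx => ⟨Real.exp_pos _, ?_⟩) fun u hu => ?_
  · simp only [betaCurve]
    rw [Real.log_pow]
    push_cast
    rw [show 1 / 2 * (2 * Real.log u) + 0 * Real.log (1 - u ^ 2) = Real.log u by ring,
      Real.exp_log hu.1]
  · rw [betaCurve, Real.exp_lt_one_iff, zero_mul, add_zero]
    have := Real.log_neg hx.1 hx.2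
    linarith
  · exact ⟨pow_pos hu.1 2, by nlinarith [hu.1, hu.2]⟩


/-! ### Beta integrals and sine weights on the three regions -/

lemma integrableOn_rpow_of_betaIntegrand {S : Set ℝ} {p q : ℝ → ℝ} (hS : MeasurableSet S)
    (hpos : ∀ u ∈ S, 0 < u ∧ 0 < p u ∧ 0 < q u) {r : ℝ}
    (h : IntegrableOn (betaIntegrand p q 0 r r) S) :
    IntegrableOn (fun u => p u ^ (-2 * r) * q u ^ (-2 * r) / u) S := by
  refine IntegrableOn.congr_fun h.norm (fun u hu => ?_) hS
  obtain ⟨h1, h2, h3⟩ := hpos u hu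
  rw [norm_betaIntegrand rfl h1 h2 h3, ofReal_re]

lemma integral_betaIntegrand_half_line {m s₁ s₂ : ℂ} (h1 : 0 < (s₁ - m).re)
    (h2 : 0 < (s₂ + m).re) :
    IntegrableOn (betaIntegrand (fun u => Real.sqrt (1 + u ^ 2))
      (fun u => Real.sqrt (1 + (u ^ 2)⁻¹)) m s₁ s₂) (Ioi 0) ∧
    ∫ u in Ioi (0 : ℝ), betaIntegrand (fun u => Real.sqrt (1 + u ^ 2))
      (fun u => Real.sqrt (1 + (u ^ 2)⁻¹)) m s₁ s₂ u = 1 / 2 * betaIntegral (s₂ + m) (s₁ - m) := by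
  have hsq : ∀ x ∈ Ioo (0 : ℝ) 1, betaCurve (1 / 2) (-(1 / 2)) x ^ 2 = x / (1 - x) := by
    intro x hx
    rw [betaCurve_sq]
    have := betaCurve_eq_zpow 1 (-1) hx
    norm_num at this ⊢
    rw [this, div_eq_mul_inv]
  refine integral_betaIntegrand_eq (p₁ := 0) (p₂ := -(1 / 2)) (q₁ := -(1 / 2)) (q₂ := 0) (w := 1)
    bijOn_betaCurve_Ioi_zero (fun x hx => ?_) (fun x hx => ?_) (fun x hx => ?_)
    (by push_cast; ring) (by push_cast; ring) h2 h1
  · have h0 : 0 < 1 - x := sub_pos.2 hx.2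
    have := betaCurve_eq_zpow 0 (-1) hx
    rw [hsq x hx, show 1 + x / (1 - x) = betaCurve 0 (-1) x by
      norm_num at this ⊢; rw [this]; field_simp; ring, sqrt_betaCurve]
    norm_num
  · have h0 : 0 < 1 - x := sub_pos.2 hx.2
    have h3 := hx.1
    have := betaCurve_eq_zpow (-1) 0 hx
    rw [hsq x hx, show 1 + (x / (1 - x))⁻¹ = betaCurve (-1) 0 x by
      norm_num at this ⊢; rw [this]; field_simp; ring, sqrt_betaCurve]
    norm_num
  · have h0 : 0 < 1 - x := sub_pos.2 hx.2
    have h3 := hx.1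
    have := betaCurve_eq_zpow (-1) (-1) hx
    norm_num at this
    rw [this, show 1 / 2 / x - -(1 / 2) / (1 - x) = 1 / 2 * (x⁻¹ * (1 - x)⁻¹) by field_simp; ring,
      abs_of_pos (by positivity)]

lemma integral_betaIntegrand_Ioi_one {m s₁ s₂ : ℂ} (h1 : 0 < (s₁ - m).re)
    (h2 : 0 < (1 - s₁ - s₂).re) :
    IntegrableOn (betaIntegrand (fun u => Real.sqrt (u ^ 2 - 1))
      (fun u => Real.sqrt (1 - (u ^ 2)⁻¹)) m s₁ s₂) (Ioi 1) ∧
    ∫ u in Ioi (1 : ℝ), betaIntegrand (fun u => Real.sqrt (u ^ 2 - 1))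
      (fun u => Real.sqrt (1 - (u ^ 2)⁻¹)) m s₁ s₂ u =
        1 / 2 * betaIntegral (s₁ - m) (1 - s₁ - s₂) := by
  have hsq : ∀ x ∈ Ioo (0 : ℝ) 1, betaCurve (-(1 / 2)) 0 x ^ 2 = x⁻¹ := by
    intro x hx
    rw [betaCurve_sq]
    have := betaCurve_eq_zpow (-1) 0 hx
    norm_num at this ⊢
    exact this
  refine integral_betaIntegrand_eq (p₁ := -(1 / 2)) (p₂ := 1 / 2) (q₁ := 0) (q₂ := 1 / 2) (w := 0)
    bijOn_betaCurve_Ioi_one (fun x hx => ?_) (fun x hx => ?_) (fun x hx => ?_)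
    (by push_cast; ring) (by push_cast; ring) h1 h2
  · have h0 : 0 < 1 - x := sub_pos.2 hx.2
    have h3 := hx.1
    have := betaCurve_eq_zpow (-1) 1 hx
    rw [hsq x hx, show x⁻¹ - 1 = betaCurve (-1) 1 x by
      norm_num at this ⊢; rw [this]; field_simp, sqrt_betaCurve]
    norm_num
  · have := betaCurve_eq_zpow 0 1 hx
    rw [hsq x hx, inv_inv, show 1 - x = betaCurve 0 1 x by norm_num at this ⊢; rw [this],
      sqrt_betaCurve]
    norm_num
  · have h3 := hx.1
    have := betaCurve_eq_zpow (-1) 0 hx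
    norm_num at this
    rw [neg_zero, this, zero_div, sub_zero, show -(1 / 2) / x = -(1 / 2 * x⁻¹) by field_simp, abs_neg,
      abs_of_pos (by positivity)]

lemma integral_betaIntegrand_Ioo {m s₁ s₂ : ℂ} (h1 : 0 < (s₂ + m).re)
    (h2 : 0 < (1 - s₁ - s₂).re) :
    IntegrableOn (betaIntegrand (fun u => Real.sqrt (1 - u ^ 2))
      (fun u => Real.sqrt ((u ^ 2)⁻¹ - 1)) m s₁ s₂) (Ioo 0 1) ∧
    ∫ u in Ioo (0 : ℝ) 1, betaIntegrand (fun u => Real.sqrt (1 - u ^ 2))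
      (fun u => Real.sqrt ((u ^ 2)⁻¹ - 1)) m s₁ s₂ u =
        1 / 2 * betaIntegral (s₂ + m) (1 - s₁ - s₂) := by
  have hsq : ∀ x ∈ Ioo (0 : ℝ) 1, betaCurve (1 / 2) 0 x ^ 2 = x := by
    intro x hx
    rw [betaCurve_sq]
    have := betaCurve_eq_zpow 1 0 hx
    norm_num at this ⊢
    exact this
  refine integral_betaIntegrand_eq (p₁ := 0) (p₂ := 1 / 2) (q₁ := -(1 / 2)) (q₂ := 1 / 2) (w := 0)
    bijOn_betaCurve_Ioo (fun x hx => ?_) (fun x hx => ?_) (fun x hx => ?_)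
    (by push_cast; ring) (by push_cast; ring) h1 h2
  · have := betaCurve_eq_zpow 0 1 hx
    rw [hsq x hx, show 1 - x = betaCurve 0 1 x by norm_num at this ⊢; rw [this],
      sqrt_betaCurve]
    norm_num
  · have h0 : 0 < 1 - x := sub_pos.2 hx.2
    have h3 := hx.1
    have := betaCurve_eq_zpow (-1) 1 hx
    rw [hsq x hx, show x⁻¹ - 1 = betaCurve (-1) 1 x by
      norm_num at this ⊢; rw [this]; field_simp, sqrt_betaCurve]
    norm_num
  · have h3 := hx.1
    have := betaCurve_eq_zpow (-1) 0 hx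
    norm_num at this
    rw [neg_zero, this, zero_div, sub_zero, show 1 / 2 / x = (1 / 2 * x⁻¹) by field_simp,
      abs_of_pos (by positivity)]

/-- If the sine vanished, the reflection formula, read with `π/0 = 0`, would give `Γ(z)Γ(1-z) = 0`,
although both arguments have positive real part. -/
lemma sin_pi_mul_ne_zero_of_re {z : ℂ} (h0 : 0 < z.re) (h1 : z.re < 1) :
    Complex.sin (Real.pi * z) ≠ 0 := by
  intro hs
  have h := Gamma_mul_Gamma_one_sub z
  rw [hs, div_zero] at h
  exact mul_ne_zero (Gamma_ne_zero_of_re_pos h0)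
    (Gamma_ne_zero_of_re_pos (s := 1 - z) (by simpa using h1)) h

lemma Gamma_one_sub_mul_sin {z : ℂ} (hs : Complex.sin (Real.pi * z) ≠ 0) :
    Gamma (1 - z) / Real.pi * Complex.sin (Real.pi * z) = (Gamma z)⁻¹ := by
  have hpi : (Real.pi : ℂ) ≠ 0 := ofReal_ne_zero.2 Real.pi_ne_zero
  have h := Gamma_mul_Gamma_one_sub z
  have hz : Gamma z ≠ 0 := fun hz => by
    rw [hz, zero_mul] at h
    exact (div_ne_zero hpi hs) h.symm
  rw [eq_div_iff hs] at h
  rw [div_mul_eq_mul_div, div_eq_iff hpi, inv_mul_eq_div, eq_div_iff hz]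
  linear_combination h

/-- The Beta integral `B(s₂+μ₂, s₁-μ₂)` contributes exactly the two missing Gamma factors and
`1/Γ(s₁+s₂)`, so no sine is needed. -/
lemma isBetaRegion_half_line_false {μ : Fin 3 → ℂ} (hμ : ∀ j, (μ j).re = 0) :
    IsBetaRegion false μ (Ioi 0) (fun u => Real.sqrt (1 + u ^ 2))
      (fun u => Real.sqrt (1 + (u ^ 2)⁻¹)) fun _ _ => 1 where
  measurableSet := measurableSet_Ioi
  pos := fun u hu => ⟨hu, Real.sqrt_pos.2 (by positivity), Real.sqrt_pos.2 (by positivity)⟩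
  continuousOn_fst := by fun_prop
  continuousOn_snd := (continuousOn_const.add ((continuousOn_id.pow 2).inv₀ fun u hu =>
    pow_ne_zero 2 (ne_of_gt hu))).sqrt
  integrableOn := fun r h0 _ => integrableOn_rpow_of_betaIntegrand measurableSet_Ioi
    (fun u hu => ⟨hu, Real.sqrt_pos.2 (by positivity), Real.sqrt_pos.2 (by positivity)⟩)
    (integral_betaIntegrand_half_line (by simpa using h0) (by simpa using h0)).1
  beta := fun s₁ s₂ h1 h2 => by
    have e1 : 0 < (s₁ - μ 1).re := by simp [h1, hμ]
    have e2 : 0 < (s₂ + μ 1).re := by simp [h2, hμ]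
    rw [(integral_betaIntegrand_half_line e1 e2).2]
    have hB := Gamma_mul_Gamma_eq_betaIntegral e2 e1
    have hne : Gamma (s₁ + s₂) ≠ 0 := Gamma_ne_zero_of_re_pos (by simp [h1, h2])
    rw [show s₂ + μ 1 + (s₁ - μ 1) = s₁ + s₂ by ring] at hB
    simp only [gammaKernel, Fin.prod_univ_three, cond_false]
    rw [mul_one, ← div_eq_mul_inv, div_eq_iff hne]
    linear_combination Gamma (s₁ - μ 2) * Gamma (s₁ - μ 0) * Gamma (s₂ + μ 0) * Gamma (s₂ + μ 2) * hB

lemma gammaKernel_true_mul_sin (μ : Fin 3 → ℂ) {s₁ s₂ : ℂ}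
    (hs : Complex.sin (Real.pi * (s₁ + s₂)) ≠ 0) :
    gammaKernel true μ s₁ s₂ * Complex.sin (Real.pi * (s₁ + s₂)) = gammaKernel false μ s₁ s₂ := by
  simp only [gammaKernel, cond_false, cond_true]
  rw [mul_assoc, ← Gamma_one_sub_mul_sin hs, sub_sub]

/-- The same integral, rewritten with `Γ(1-s₁-s₂)` in place of `1/Γ(s₁+s₂)`, in order to combine it
with the other two regions. -/
lemma isBetaRegion_half_line_true {μ : Fin 3 → ℂ} (hμ : ∀ j, (μ j).re = 0) :
    IsBetaRegion true μ (Ioi 0) (fun u => Real.sqrt (1 + u ^ 2))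
      (fun u => Real.sqrt (1 + (u ^ 2)⁻¹)) fun s₁ s₂ => Complex.sin (Real.pi * (s₁ + s₂)) :=
  { isBetaRegion_half_line_false hμ with
    beta := fun s₁ s₂ h1 h2 => by
      rw [gammaKernel_true_mul_sin _ (sin_pi_mul_ne_zero_of_re (by simp [h1, h2])
        (by simp [h1, h2]; norm_num)), ← (isBetaRegion_half_line_false hμ).beta s₁ s₂ h1 h2, mul_one] }

/-- The Beta integral is `B(s₁-μ₂, 1-s₁-s₂)`; its denominator `Γ(1-s₂-μ₂)` becomes `Γ(s₂+μ₂)` times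
a sine by reflection. -/
lemma isBetaRegion_Ioi_one {μ : Fin 3 → ℂ} (hμ : ∀ j, (μ j).re = 0) :
    IsBetaRegion true μ (Ioi 1) (fun u => Real.sqrt (u ^ 2 - 1))
      (fun u => Real.sqrt (1 - (u ^ 2)⁻¹)) fun _ s₂ => Complex.sin (Real.pi * (s₂ + μ 1)) := by
  have hpos : ∀ u ∈ Ioi (1 : ℝ), 0 < u ∧ 0 < Real.sqrt (u ^ 2 - 1) ∧
      0 < Real.sqrt (1 - (u ^ 2)⁻¹) := by
    intro u hu
    have h1 : 1 < u := hu
    have h2 : 1 < u ^ 2 := by nlinarith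
    exact ⟨by linarith, Real.sqrt_pos.2 (by linarith),
      Real.sqrt_pos.2 (sub_pos.2 (inv_lt_one_of_one_lt₀ h2))⟩
  exact
  { measurableSet := measurableSet_Ioi
    pos := hpos
    continuousOn_fst := by fun_prop
    continuousOn_snd := (continuousOn_const.sub ((continuousOn_id.pow 2).inv₀ fun u hu =>
      pow_ne_zero 2 (hpos u hu).1.ne')).sqrt
    integrableOn := fun r h0 h1 => integrableOn_rpow_of_betaIntegrand measurableSet_Ioi hpos
      (integral_betaIntegrand_Ioi_one (by simpa using h0) (by simp; linarith)).1
    beta := fun s₁ s₂ h1 h2 => by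
      have e1 : 0 < (s₁ - μ 1).re := by simp [h1, hμ]
      have e2 : 0 < (1 - s₁ - s₂).re := by simp [h1, h2]; norm_num
      rw [(integral_betaIntegrand_Ioi_one e1 e2).2]
      have hB := Gamma_mul_Gamma_eq_betaIntegral e1 e2
      have hne : Gamma (1 - (s₂ + μ 1)) ≠ 0 :=
        Gamma_ne_zero_of_re_pos (by simp [h2, hμ]; norm_num)
      have hne' : Gamma (s₂ + μ 1) ≠ 0 := Gamma_ne_zero_of_re_pos (by simp [h2, hμ])
      have hr := Gamma_one_sub_mul_sin (z := s₂ + μ 1) (sin_pi_mul_ne_zero_of_re (by simp [h2, hμ])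
        (by simp [h2, hμ]; norm_num))
      rw [show s₁ - μ 1 + (1 - s₁ - s₂) = 1 - (s₂ + μ 1) by ring] at hB
      rw [← one_div, eq_div_iff hne'] at hr
      simp only [gammaKernel, Fin.prod_univ_three, cond_true]
      have hB' : betaIntegral (s₁ - μ 1) (1 - s₁ - s₂) =
          Gamma (s₁ - μ 1) * Gamma (1 - s₁ - s₂) / Gamma (1 - (s₂ + μ 1)) := by
        rw [hB, mul_div_cancel_left₀ _ hne]
      rw [hB', eq_comm]
      rw [show ∀ A B C : ℂ, 2 * A * B * (1 / 2 * C) = A * B * C from fun A B C => by ring,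
        ← mul_div_assoc, div_eq_iff hne]
      linear_combination (-Gamma (s₁ - μ 2) * Gamma (s₁ - μ 0) * Gamma (s₂ + μ 0) *
        Gamma (s₂ + μ 2) * Gamma (s₁ - μ 1) * Gamma (1 - s₁ - s₂)) * hr }

/-- The Beta integral is `B(s₂+μ₂, 1-s₁-s₂)`; here reflection is applied to the denominator
`Γ(1-s₁+μ₂)`. -/
lemma isBetaRegion_Ioo {μ : Fin 3 → ℂ} (hμ : ∀ j, (μ j).re = 0) :
    IsBetaRegion true μ (Ioo 0 1) (fun u => Real.sqrt (1 - u ^ 2))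
      (fun u => Real.sqrt ((u ^ 2)⁻¹ - 1)) fun s₁ _ => Complex.sin (Real.pi * (s₁ - μ 1)) := by
  have hpos : ∀ u ∈ Ioo (0 : ℝ) 1, 0 < u ∧ 0 < Real.sqrt (1 - u ^ 2) ∧
      0 < Real.sqrt ((u ^ 2)⁻¹ - 1) := by
    intro u hu
    have h2 : u ^ 2 < 1 := by nlinarith [hu.1, hu.2]
    exact ⟨hu.1, Real.sqrt_pos.2 (by linarith),
      Real.sqrt_pos.2 (sub_pos.2 ((one_lt_inv₀ (pow_pos hu.1 2)).2 h2))⟩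
  exact
  { measurableSet := measurableSet_Ioo
    pos := hpos
    continuousOn_fst := by fun_prop
    continuousOn_snd := (((continuousOn_id.pow 2).inv₀ fun u hu =>
      pow_ne_zero 2 (hpos u hu).1.ne').sub continuousOn_const).sqrt
    integrableOn := fun r h0 h1 => integrableOn_rpow_of_betaIntegrand measurableSet_Ioo hpos
      (integral_betaIntegrand_Ioo (by simpa using h0) (by simp; linarith)).1
    beta := fun s₁ s₂ h1 h2 => by
      have e1 : 0 < (s₂ + μ 1).re := by simp [h2, hμ]
      have e2 : 0 < (1 - s₁ - s₂).re := by simp [h1, h2]; norm_num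
      rw [(integral_betaIntegrand_Ioo e1 e2).2]
      have hB := Gamma_mul_Gamma_eq_betaIntegral e1 e2
      have hne : Gamma (1 - (s₁ - μ 1)) ≠ 0 :=
        Gamma_ne_zero_of_re_pos (by simp [h1, hμ]; norm_num)
      have hne' : Gamma (s₁ - μ 1) ≠ 0 := Gamma_ne_zero_of_re_pos (by simp [h1, hμ])
      have hr := Gamma_one_sub_mul_sin (z := s₁ - μ 1) (sin_pi_mul_ne_zero_of_re (by simp [h1, hμ])
        (by simp [h1, hμ]; norm_num))
      rw [show s₂ + μ 1 + (1 - s₁ - s₂) = 1 - (s₁ - μ 1) by ring] at hB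
      rw [← one_div, eq_div_iff hne'] at hr
      simp only [gammaKernel, Fin.prod_univ_three, cond_true]
      have hB' : betaIntegral (s₂ + μ 1) (1 - s₁ - s₂) =
          Gamma (s₂ + μ 1) * Gamma (1 - s₁ - s₂) / Gamma (1 - (s₁ - μ 1)) := by
        rw [hB, mul_div_cancel_left₀ _ hne]
      rw [hB', eq_comm]
      rw [show ∀ A B C : ℂ, 2 * A * B * (1 / 2 * C) = A * B * C from fun A B C => by ring,
        ← mul_div_assoc, div_eq_iff hne]
      linear_combination (-Gamma (s₁ - μ 2) * Gamma (s₁ - μ 0) * Gamma (s₂ + μ 0) *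
        Gamma (s₂ + μ 2) * Gamma (s₂ + μ 1) * Gamma (1 - s₁ - s₂)) * hr }


/-! ### Products of two Bessel functions -/

/-- The function `z₁ ^ (-2 s₁ - m) z₂ ^ (-2 s₂ + m)` for `z₁ = a exp(iθ₁)`, `z₂ = b exp(iθ₂)`. -/
noncomputable def phaseWeight (a b : ℝ) (m : ℂ) (θ₁ θ₂ : ℝ) (s₁ s₂ : ℂ) : ℂ :=
  cexp ((Real.log a + θ₁ * I) * (-2 * s₁ - m) + (Real.log b + θ₂ * I) * (-2 * s₂ + m))

lemma isWeight_phaseWeight (a b : ℝ) (m : ℂ) (θ₁ θ₂ : ℝ) :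
    IsWeight (phaseWeight a b m θ₁ θ₂) := by
  convert isWeight_exp (-2 * (Real.log a + θ₁ * I)) (-2 * (Real.log b + θ₂ * I))
    (-(Real.log a + θ₁ * I) * m + (Real.log b + θ₂ * I) * m) using 3
  rw [phaseWeight]
  ring_nf

/-- The bound depends only on the larger angles `θ₁`, `θ₂`, so it dominates a whole family of
rotations towards them. -/
lemma norm_phaseWeight_le (a b : ℝ) {m : ℂ} (hm : m.re = 0) {θ₁ θ₂ φ₁ φ₂ M : ℝ}
    (h1 : |φ₁| ≤ |θ₁|) (h2 : |φ₂| ≤ |θ₂|) {s₁ s₂ : ℂ} (hs₁ : |s₁.re| ≤ M) (hs₂ : |s₂.re| ≤ M) :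
    ‖phaseWeight a b m φ₁ φ₂ s₁ s₂‖ ≤ Real.exp (2 * |Real.log a| * M + |θ₁| * |m.im| +
      (2 * |Real.log b| * M + |θ₂| * |m.im|)) *
        Real.exp (2 * |θ₁| * |s₁.im| + 2 * |θ₂| * |s₂.im|) := by
  unfold phaseWeight
  rw [norm_exp, ← Real.exp_add]
  refine Real.exp_le_exp.2 ?_
  have key : ∀ (L φ θ : ℝ) (s : ℂ), |φ| ≤ |θ| → |s.re| ≤ M →
      -2 * L * s.re + 2 * φ * s.im ≤ 2 * |L| * M + 2 * |θ| * |s.im| := by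
    intro L φ θ s h hs
    have e1 : -2 * L * s.re ≤ 2 * |L| * M := by
      calc -2 * L * s.re ≤ |-2 * L * s.re| := le_abs_self _
        _ = 2 * |L| * |s.re| := by rw [abs_mul, abs_mul, abs_neg, abs_two]
        _ ≤ _ := by gcongr
    have e2 : 2 * φ * s.im ≤ 2 * |θ| * |s.im| := by
      calc 2 * φ * s.im ≤ |2 * φ * s.im| := le_abs_self _
        _ = 2 * |φ| * |s.im| := by rw [abs_mul, abs_mul, abs_two]
        _ ≤ _ := by gcongr
    linarith
  have key2 : ∀ (φ θ : ℝ), |φ| ≤ |θ| → |φ * m.im| ≤ |θ| * |m.im| := by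
    intro φ θ h
    rw [abs_mul]
    gcongr
  have k1 := key (Real.log a) φ₁ θ₁ s₁ h1 hs₁
  have k2 := key (Real.log b) φ₂ θ₂ s₂ h2 hs₂
  have k3 := (le_abs_self _).trans (key2 φ₁ θ₁ h1)
  have k4 := (neg_le_abs _).trans (key2 φ₂ θ₂ h2)
  have e : ((Real.log a + φ₁ * I) * (-2 * s₁ - m) + (Real.log b + φ₂ * I) * (-2 * s₂ + m)).re =
      (-2 * Real.log a * s₁.re + 2 * φ₁ * s₁.im) + φ₁ * m.im +
      ((-2 * Real.log b * s₂.re + 2 * φ₂ * s₂.im) + -(φ₂ * m.im)) := by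
    simp [hm]
    ring
  rw [e]
  linarith

lemma ofReal_mul_cexp_cpow {a : ℝ} (ha : 0 < a) {θ : ℝ} (hθ : |θ| ≤ Real.pi / 2) (w : ℂ) :
    ((a : ℂ) * cexp (θ * I)) ^ w = cexp ((Real.log a + θ * I) * w) := by
  have h := abs_le.1 hθ
  have hpi := Real.pi_pos
  rw [cpow_def_of_ne_zero (mul_ne_zero (ofReal_ne_zero.2 ha.ne') (Complex.exp_ne_zero _)),
    log_ofReal_mul ha (Complex.exp_ne_zero _), log_exp (by simp; linarith) (by simp; linarith)]

/-- A condition on the growth of the weight `T` of a region, under which products of Bessel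
functions with arguments on the rays with angles `θ₁` and `θ₂` have Mellin-Barnes integrals. -/
def IsTameAt (opp : Bool) (T : ℂ → ℂ → ℂ) (θ₁ θ₂ : ℝ) : Prop :=
  IsTame opp fun s₁ s₂ => T s₁ s₂ * (Real.exp (2 * |θ₁| * |s₁.im| + 2 * |θ₂| * |s₂.im|) : ℝ)

lemma IsTameAt.exists_norm_le {opp : Bool} {T : ℂ → ℂ → ℂ} {θ₁ θ₂ : ℝ} (h : IsTameAt opp T θ₁ θ₂)
    (a b : ℝ) {m : ℂ} (hm : m.re = 0) (M : ℝ) : ∃ C, 0 ≤ C ∧ ∀ φ₁ φ₂ : ℝ, |φ₁| ≤ |θ₁| → |φ₂| ≤ |θ₂| →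
      ∀ s₁ s₂ : ℂ, |s₁.re| ≤ M → |s₂.re| ≤ M → ‖T s₁ s₂ * phaseWeight a b m φ₁ φ₂ s₁ s₂‖ ≤
        C * Real.exp (decayRate opp s₁.im s₂.im) := by
  obtain ⟨C, hC, hT⟩ := h M
  refine ⟨Real.exp (2 * |Real.log a| * M + |θ₁| * |m.im| + (2 * |Real.log b| * M + |θ₂| * |m.im|)) * C,
    by positivity, fun φ₁ φ₂ h1 h2 s₁ s₂ hs₁ hs₂ => ?_⟩
  have := hT s₁ s₂ hs₁ hs₂
  rw [norm_mul, norm_real, Real.norm_of_nonneg (Real.exp_pos _).le] at this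
  rw [norm_mul]
  calc _ ≤ ‖T s₁ s₂‖ * _ := mul_le_mul_of_nonneg_left
        (norm_phaseWeight_le a b hm h1 h2 hs₁ hs₂) (norm_nonneg _)
    _ = _ * (‖T s₁ s₂‖ * Real.exp (2 * |θ₁| * |s₁.im| + 2 * |θ₂| * |s₂.im|)) := mul_left_comm _ _ _
    _ ≤ _ := by
      rw [mul_assoc _ C]
      exact mul_le_mul_of_nonneg_left this (Real.exp_pos _).le

/-- The product of two Bessel functions on rays. -/
noncomputable def besselProduct (μ : Fin 3 → ℂ) (p q : ℝ → ℝ) (a b θ₁ θ₂ u : ℝ) : ℂ :=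
  besselKExt (μ 2 - μ 0) (2 * cexp (θ₁ * I) * (a * p u : ℝ)) *
    besselKExt (μ 2 - μ 0) (2 * cexp (θ₂ * I) * (b * q u : ℝ)) * (u : ℂ) ^ (3 * μ 1) / u

lemma cexp_mul_I_re_nonneg {θ : ℝ} (hθ : |θ| ≤ Real.pi / 2) : 0 ≤ (cexp (θ * I)).re := by
  rw [exp_ofReal_mul_I_re]
  exact Real.cos_nonneg_of_mem_Icc (abs_le.1 hθ)

lemma cexp_mul_I_re_pos {θ : ℝ} (hθ : |θ| < Real.pi / 2) : 0 < (cexp (θ * I)).re := by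
  rw [exp_ofReal_mul_I_re]
  exact Real.cos_pos_of_mem_Ioo (abs_lt.1 hθ)

lemma norm_besselKExt_ray_le {α : ℂ} (hα : α.re = 0) {θ x : ℝ} (hθ : |θ| ≤ Real.pi / 2)
    (h0 : α ≠ 0 ∨ |θ| < Real.pi / 2) (hx : 0 < x) :
    ‖besselKExt α (2 * cexp (θ * I) * x)‖ ≤ (3 + ‖α‖) * x ^ (-(1 / 2) : ℝ) := by
  have hre : (2 * cexp (θ * I) * x).re = 2 * (cexp (θ * I)).re * x := by
    simp
  have hne : 2 * cexp (θ * I) * (x : ℂ) ≠ 0 := mul_ne_zero (mul_ne_zero two_ne_zero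
    (Complex.exp_ne_zero _)) (ofReal_ne_zero.2 hx.ne')
  refine (norm_besselKExt_le hα (h0.imp_right fun h => ?_) ?_ hne).trans ?_
  · rw [hre]
    have := cexp_mul_I_re_pos h
    positivity
  · rw [hre]
    have := cexp_mul_I_re_nonneg hθ
    positivity
  · refine mul_le_mul_of_nonneg_left ?_ (by positivity)
    rw [norm_mul, norm_mul, norm_exp_ofReal_mul_I, norm_real, Real.norm_of_nonneg hx.le,
      RCLike.norm_ofNat]
    exact Real.rpow_le_rpow_of_nonpos hx (by linarith) (by norm_num)

/-- The decay `O(|z|^{-1/2})` of each factor gives a majorant independent of the angles. It is the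
case `r = 1/4` of the integrability condition of the region. -/
lemma IsBetaRegion.norm_besselProduct_le {opp : Bool} {μ : Fin 3 → ℂ} {S : Set ℝ}
    {p q : ℝ → ℝ} {T : ℂ → ℂ → ℂ} (h : IsBetaRegion opp μ S p q T) (hμ : ∀ j, (μ j).re = 0)
    {a b θ₁ θ₂ : ℝ} (ha : 0 < a) (hb : 0 < b) (hθ₁ : |θ₁| ≤ Real.pi / 2) (hθ₂ : |θ₂| ≤ Real.pi / 2)
    (h1 : μ 2 - μ 0 ≠ 0 ∨ |θ₁| < Real.pi / 2) (h2 : μ 2 - μ 0 ≠ 0 ∨ |θ₂| < Real.pi / 2)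
    {u : ℝ} (hu : u ∈ S) : ‖besselProduct μ p q a b θ₁ θ₂ u‖ ≤
      (3 + ‖μ 2 - μ 0‖) ^ 2 * (a ^ (-(1 / 2) : ℝ) * b ^ (-(1 / 2) : ℝ)) *
        (p u ^ (-2 * (1 / 4) : ℝ) * q u ^ (-2 * (1 / 4) : ℝ) / u) := by
  obtain ⟨hu0, hp, hq⟩ := h.pos u hu
  have hα : (μ 2 - μ 0).re = 0 := by simp [hμ]
  have e1 := norm_besselKExt_ray_le hα hθ₁ h1 (mul_pos ha hp)
  have e2 := norm_besselKExt_ray_le hα hθ₂ h2 (mul_pos hb hq)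
  unfold besselProduct
  rw [norm_div, norm_mul, norm_mul, norm_cpow_eq_rpow_re_of_pos hu0, norm_real,
    Real.norm_of_nonneg hu0.le, show (3 * μ 1).re = 0 by simp [hμ], Real.rpow_zero, mul_one]
  rw [Real.mul_rpow ha.le hp.le] at e1
  rw [Real.mul_rpow hb.le hq.le] at e2
  rw [show (-2 * (1 / 4) : ℝ) = -(1 / 2) by norm_num]
  calc _ ≤ (3 + ‖μ 2 - μ 0‖) * (a ^ (-(1 / 2) : ℝ) * p u ^ (-(1 / 2) : ℝ)) *
        ((3 + ‖μ 2 - μ 0‖) * (b ^ (-(1 / 2) : ℝ) * q u ^ (-(1 / 2) : ℝ))) / u := by gcongr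
    _ = _ := by ring

lemma IsBetaRegion.continuousOn_besselProduct {opp : Bool} {μ : Fin 3 → ℂ} {S : Set ℝ}
    {p q : ℝ → ℝ} {T : ℂ → ℂ → ℂ} (h : IsBetaRegion opp μ S p q T) (hμ : ∀ j, (μ j).re = 0)
    {a b θ₁ θ₂ : ℝ} (ha : 0 < a) (hb : 0 < b) (hθ₁ : |θ₁| ≤ Real.pi / 2)
    (hθ₂ : |θ₂| ≤ Real.pi / 2) : ContinuousOn (besselProduct μ p q a b θ₁ θ₂) S := by
  have hα : (μ 2 - μ 0).re = 0 := by simp [hμ]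
  have hc : ∀ {θ c : ℝ} {f : ℝ → ℝ}, |θ| ≤ Real.pi / 2 → 0 < c → ContinuousOn f S →
      (∀ u ∈ S, 0 < f u) →
      ContinuousOn (fun u => besselKExt (μ 2 - μ 0) (2 * cexp (θ * I) * (c * f u : ℝ))) S := by
    intro θ c f hθ hc hf hpos u hu
    have hre : 0 ≤ (2 * cexp (θ * I)).re := by
      have := cexp_mul_I_re_nonneg hθ
      simpa using this
    exact (continuousAt_besselKExt_mul hα hre (mul_ne_zero two_ne_zero (Complex.exp_ne_zero _))
      (mul_pos hc (hpos u hu))).comp_continuousWithinAt (f := fun u => c * f u)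
        ((hf u hu).const_mul c)
  unfold besselProduct
  refine (((hc hθ₁ ha h.continuousOn_fst fun u hu => (h.pos u hu).2.1).mul
    (hc hθ₂ hb h.continuousOn_snd fun u hu => (h.pos u hu).2.2)).mul
    ((continuousOn_cpow_Ioi _).mono fun u hu => (h.pos u hu).1)).div
    continuous_ofReal.continuousOn fun u hu => ofReal_ne_zero.2 (h.pos u hu).1.ne'

lemma IsBetaRegion.integrableOn_besselProduct {opp : Bool} {μ : Fin 3 → ℂ} {S : Set ℝ}
    {p q : ℝ → ℝ} {T : ℂ → ℂ → ℂ} (h : IsBetaRegion opp μ S p q T) (hμ : ∀ j, (μ j).re = 0)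
    {a b θ₁ θ₂ : ℝ} (ha : 0 < a) (hb : 0 < b) (hθ₁ : |θ₁| ≤ Real.pi / 2) (hθ₂ : |θ₂| ≤ Real.pi / 2)
    (h1 : μ 2 - μ 0 ≠ 0 ∨ |θ₁| < Real.pi / 2) (h2 : μ 2 - μ 0 ≠ 0 ∨ |θ₂| < Real.pi / 2) :
    IntegrableOn (besselProduct μ p q a b θ₁ θ₂) S :=
  ((h.integrableOn (1 / 4) (by norm_num) (by norm_num)).const_mul _).mono'
    ((h.continuousOn_besselProduct hμ ha hb hθ₁ hθ₂).aestronglyMeasurable h.measurableSet)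
    ((ae_restrict_mem h.measurableSet).mono fun _ hu =>
      h.norm_besselProduct_le hμ ha hb hθ₁ hθ₂ h1 h2 hu)

/-- The line `Re s = 3/8` separates the poles because `0 < 3/8` and `3/8 + 3/8 < 1`. -/
lemma isContourPair_line (opp : Bool) {μ : Fin 3 → ℂ} :
    IsContourPair opp μ (fun _ => 3 / 8) (fun _ => 3 / 8) where
  fst := ⟨contDiff_const, fun _ => by norm_num, ⟨0, 3 / 8, fun _ _ => rfl⟩⟩
  snd := ⟨contDiff_const, fun _ => by norm_num, ⟨0, 3 / 8, fun _ _ => rfl⟩⟩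
  left := fun _ _ => by norm_num

/-- Products of two Bessel functions as Mellin-Barnes integrals, inside the half-plane. -/
lemma IsBetaRegion.integral_besselProduct_of_lt {opp : Bool} {μ : Fin 3 → ℂ} {S : Set ℝ}
    {p q : ℝ → ℝ} {T : ℂ → ℂ → ℂ} (h : IsBetaRegion opp μ S p q T) (hμ : ∀ j, (μ j).re = 0)
    (hsum : μ 0 + μ 1 + μ 2 = 0) (hT : IsWeight T) {a b θ₁ θ₂ : ℝ} (ha : 0 < a) (hb : 0 < b)
    (hθ₁ : |θ₁| < Real.pi / 2) (hθ₂ : |θ₂| < Real.pi / 2) (ht : IsTameAt opp T θ₁ θ₂)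
    {σ₁ σ₂ : ℝ → ℝ} (hσ : IsBarnesPair opp μ σ₁ σ₂) :
    ∫ u in S, besselProduct μ p q a b θ₁ θ₂ u =
      1 / 8 * ((∫ t, contourIntegrand (fun s₁ s₂ => gammaKernel opp μ s₁ s₂ *
        (T s₁ s₂ * phaseWeight a b (μ 1) θ₁ θ₂ s₁ s₂)) σ₁ σ₂ t) / (2 * Real.pi * I) ^ 2) := by
  have hre : ∀ {c θ : ℝ}, 0 < c → |θ| < Real.pi / 2 → 0 < ((c : ℂ) * cexp (θ * I)).re := by
    intro c θ hc hθ
    rw [re_ofReal_mul]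
    exact mul_pos hc (cexp_mul_I_re_pos hθ)
  have hw : IsWeight fun s₁ s₂ => T s₁ s₂ * phaseWeight a b (μ 1) θ₁ θ₂ s₁ s₂ :=
    hT.mul (isWeight_phaseWeight _ _ _ _ _)
  obtain ⟨hi, hl⟩ := h.integral_besselKRight_mul hμ hsum (hre ha hθ₁) (hre hb hθ₂)
  simp only [ofReal_mul_cexp_cpow ha hθ₁.le, ofReal_mul_cexp_cpow hb hθ₂.le, ← Complex.exp_add]
    at hi hl
  have hi' := hσ.integrable hμ hw.continuous fun M => by
    obtain ⟨C, hC, hC'⟩ := ht.exists_norm_le a b (hμ 1) M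
    exact ⟨C, hC, fun s₁ s₂ h1 h2 => hC' θ₁ θ₂ le_rfl le_rfl s₁ s₂ h1 h2⟩
  -- The line `Re s = 3/8` is exchanged for Barnes contours, on which the limit to the imaginary
  -- axis can be dominated.
  have hdef := integral_contourIntegrand_eq hμ (isContourPair_line opp) hσ.toIsContourPair hw hi hi'
  rw [hdef]
  refine Eq.trans (setIntegral_congr_fun h.measurableSet fun u hu => ?_) hl
  obtain ⟨hu0, hp, hq⟩ := h.pos u hu
  have hK : ∀ {c θ x : ℝ}, 0 < c → |θ| < Real.pi / 2 → 0 < x →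
      besselKExt (μ 2 - μ 0) (2 * cexp (θ * I) * (c * x : ℝ)) =
      besselKRight (μ 2 - μ 0) (2 * (c * cexp (θ * I)) * x) := by
    intro c θ x hc hθ hx
    have e : 2 * cexp (θ * I) * (c * x : ℝ) = 2 * (c * cexp (θ * I)) * x := by push_cast; ring
    rw [e, besselKExt, if_pos]
    have := hre hc hθ
    rw [re_mul_ofReal, mul_re]
    simp only [re_ofNat, im_ofNat, zero_mul, sub_zero]
    positivity
  simp only [besselProduct]
  rw [hK ha hθ₁ hp, hK hb hθ₂ hq]

/-- Products of two Bessel functions as Mellin-Barnes integrals. -/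
theorem IsBetaRegion.integral_besselProduct {opp : Bool} {μ : Fin 3 → ℂ} {S : Set ℝ}
    {p q : ℝ → ℝ} {T : ℂ → ℂ → ℂ} (h : IsBetaRegion opp μ S p q T) (hμ : ∀ j, (μ j).re = 0)
    (hsum : μ 0 + μ 1 + μ 2 = 0) (hT : IsWeight T) {a b θ₁ θ₂ : ℝ} (ha : 0 < a) (hb : 0 < b)
    (hθ₁ : |θ₁| ≤ Real.pi / 2) (hθ₂ : |θ₂| ≤ Real.pi / 2)
    (h1 : μ 2 - μ 0 ≠ 0 ∨ |θ₁| < Real.pi / 2) (h2 : μ 2 - μ 0 ≠ 0 ∨ |θ₂| < Real.pi / 2)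
    (ht : IsTameAt opp T θ₁ θ₂) {σ₁ σ₂ : ℝ → ℝ} (hσ : IsBarnesPair opp μ σ₁ σ₂) :
    ∫ u in S, besselProduct μ p q a b θ₁ θ₂ u =
      1 / 8 * ((∫ t, contourIntegrand (fun s₁ s₂ => gammaKernel opp μ s₁ s₂ *
        (T s₁ s₂ * phaseWeight a b (μ 1) θ₁ θ₂ s₁ s₂)) σ₁ σ₂ t) / (2 * Real.pi * I) ^ 2) := by
  have hα : (μ 2 - μ 0).re = 0 := by simp [hμ]
  have hev : ∀ᶠ l : ℝ in 𝓝[<] 1, l ∈ Ioo (0 : ℝ) 1 := by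
    filter_upwards [self_mem_nhdsWithin, mem_nhdsWithin_of_mem_nhds (lt_mem_nhds zero_lt_one)]
      with l h1 h2 using ⟨h2, h1⟩
  have hle : ∀ {l : ℝ} (θ : ℝ), l ∈ Ioo (0 : ℝ) 1 → |l * θ| ≤ |θ| := fun θ hl => by
    rw [abs_mul, abs_of_pos hl.1]
    exact mul_le_of_le_one_left (abs_nonneg _) hl.2.le
  have hlt : ∀ {l θ : ℝ}, |θ| ≤ Real.pi / 2 → l ∈ Ioo (0 : ℝ) 1 → |l * θ| < Real.pi / 2 := by
    intro l θ hθ hl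
    rw [abs_mul, abs_of_pos hl.1]
    nlinarith [Real.pi_pos, hl.1, hl.2, abs_nonneg θ]
  have htend : ∀ θ : ℝ, Tendsto (fun l : ℝ => l * θ) (𝓝[<] 1) (𝓝 θ) := by
    intro θ
    have hc : Continuous fun l : ℝ => l * θ := by fun_prop
    simpa using (hc.tendsto 1).mono_left (nhdsWithin_le_nhds (s := Iio 1))
  -- Both angles are shrunk by `l < 1`, so the arguments lie in the open half-plane, and then `l →
  -- 1`.
  have hL : Tendsto (fun l : ℝ => ∫ u in S, besselProduct μ p q a b (l * θ₁) (l * θ₂) u) (𝓝[<] 1)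
      (𝓝 (∫ u in S, besselProduct μ p q a b θ₁ θ₂ u)) := by
    refine tendsto_integral_filter_of_dominated_convergence _ ?_ ?_
      ((h.integrableOn (1 / 4) (by norm_num) (by norm_num)).const_mul
        ((3 + ‖μ 2 - μ 0‖) ^ 2 * (a ^ (-(1 / 2) : ℝ) * b ^ (-(1 / 2) : ℝ)))) ?_
    · filter_upwards [hev] with l hl
      exact (h.continuousOn_besselProduct hμ ha hb (hlt hθ₁ hl).le
        (hlt hθ₂ hl).le).aestronglyMeasurable h.measurableSet
    · filter_upwards [hev] with l hl
      exact (ae_restrict_mem h.measurableSet).mono fun u hu =>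
        h.norm_besselProduct_le hμ ha hb (hlt hθ₁ hl).le (hlt hθ₂ hl).le (Or.inr (hlt hθ₁ hl))
          (Or.inr (hlt hθ₂ hl)) hu
    · refine (ae_restrict_mem h.measurableSet).mono fun u hu => ?_
      obtain ⟨hu0, hp, hq⟩ := h.pos u hu
      have hK : ∀ {θ x : ℝ}, 0 < x → |θ| ≤ Real.pi / 2 → (μ 2 - μ 0 ≠ 0 ∨ |θ| < Real.pi / 2) →
          Tendsto (fun l : ℝ => besselKExt (μ 2 - μ 0) (2 * cexp ((l * θ : ℝ) * I) * x)) (𝓝[<] 1)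
            (𝓝 (besselKExt (μ 2 - μ 0) (2 * cexp (θ * I) * x))) := by
        intro θ x hx hθ h0
        have hre : ∀ φ : ℝ, (2 * cexp (φ * I) * x).re = 2 * (cexp (φ * I)).re * x := by simp
        have hpos : ∀ l ∈ Ioo (0 : ℝ) 1, 0 < (2 * cexp ((l * θ : ℝ) * I) * x).re := fun l hl => by
          rw [hre]
          have := cexp_mul_I_re_pos (hlt hθ hl)
          positivity
        have hc : Continuous fun φ : ℝ => 2 * cexp (φ * I) * (x : ℂ) := by fun_prop
        have := tendsto_besselKRight hα (z := 2 * cexp (θ * I) * x)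
          (h0.imp_right fun h => by
            rw [hre]
            have := cexp_mul_I_re_pos h
            positivity)
          (by
            rw [hre]
            have := cexp_mul_I_re_nonneg hθ
            positivity)
          (mul_ne_zero (mul_ne_zero two_ne_zero (Complex.exp_ne_zero _)) (ofReal_ne_zero.2 hx.ne'))
          (hev.mono hpos) ((hc.tendsto θ).comp (htend θ))
        refine this.congr' ?_
        filter_upwards [hev] with l hl
        exact (if_pos (hpos l hl)).symm
      exact (((hK (mul_pos ha hp) hθ₁ h1).mul (hK (mul_pos hb hq) hθ₂ h2)).mul_const _).div_const _
  -- On the Mellin-Barnes side one majorant, built from the final angles, serves all `l`.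
  have hR := hσ.tendsto hμ (l := 𝓝[<] (1 : ℝ))
    (T := fun l s₁ s₂ => T s₁ s₂ * phaseWeight a b (μ 1) (l * θ₁) (l * θ₂) s₁ s₂)
    (T' := fun s₁ s₂ => T s₁ s₂ * phaseWeight a b (μ 1) θ₁ θ₂ s₁ s₂)
    (Eventually.of_forall fun l => (hT.mul (isWeight_phaseWeight _ _ _ _ _)).continuous)
    (fun M => by
      obtain ⟨C, hC, hC'⟩ := ht.exists_norm_le a b (hμ 1) M
      refine ⟨C, hC, ?_⟩
      filter_upwards [hev] with l hl s₁ s₂ h1 h2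
      exact hC' _ _ (hle θ₁ hl) (hle θ₂ hl) s₁ s₂ h1 h2)
    (fun s₁ s₂ => by
      have hc : Continuous fun l : ℝ => phaseWeight a b (μ 1) (l * θ₁) (l * θ₂) s₁ s₂ := by
        unfold phaseWeight
        fun_prop
      have := (hc.tendsto 1).mono_left (nhdsWithin_le_nhds (s := Iio 1))
      simp only [one_mul] at this
      exact this.const_mul _)
  refine tendsto_nhds_unique hL (((hR.div_const _).const_mul _).congr' ?_)
  filter_upwards [hev] with l hl
  refine (h.integral_besselProduct_of_lt hμ hsum hT ha hb (hlt hθ₁ hl) (hlt hθ₂ hl) ?_ hσ).symm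
  intro M
  obtain ⟨C, hC, hC'⟩ := ht M
  refine ⟨C, hC, fun s₁ s₂ e1 e2 => le_trans ?_ (hC' s₁ s₂ e1 e2)⟩
  rw [norm_mul, norm_mul, norm_real, norm_real, Real.norm_of_nonneg (Real.exp_pos _).le,
    Real.norm_of_nonneg (Real.exp_pos _).le]
  have := hle θ₁ hl
  have := hle θ₂ hl
  gcongr


/-! ### Growth of the trigonometric weights -/

lemma isTameAt_of_norm_le {opp : Bool} {T : ℂ → ℂ → ℂ} {θ₁ θ₂ C : ℝ} (hC : 0 ≤ C)
    {e : ℝ → ℝ → ℝ} (hT : ∀ s₁ s₂, ‖T s₁ s₂‖ ≤ C * Real.exp (e s₁.im s₂.im))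
    (he : ∀ t₁ t₂ : ℝ, e t₁ t₂ + (2 * |θ₁| * |t₁| + 2 * |θ₂| * |t₂|) ≤ decayRate opp t₁ t₂) :
    IsTameAt opp T θ₁ θ₂ := by
  refine fun M => ⟨C, hC, fun s₁ s₂ _ _ => ?_⟩
  rw [norm_mul, norm_real, Real.norm_of_nonneg (Real.exp_pos _).le]
  calc _ ≤ C * Real.exp (e s₁.im s₂.im) * _ :=
        mul_le_mul_of_nonneg_right (hT s₁ s₂) (Real.exp_pos _).le
    _ ≤ _ := by
      rw [mul_assoc, ← Real.exp_add]
      exact mul_le_mul_of_nonneg_left (Real.exp_le_exp.2 (he _ _)) hC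

lemma norm_sin_pi_add_le (s c : ℂ) :
    ‖Complex.sin (Real.pi * (s + c))‖ ≤ Real.exp (Real.pi * ‖c‖) * Real.exp (Real.pi * |s.im|) := by
  refine (norm_sin_le _).trans ?_
  rw [← Real.exp_add, im_ofReal_mul, abs_mul, abs_of_pos Real.pi_pos, ← mul_add, add_im]
  refine Real.exp_le_exp.2 (mul_le_mul_of_nonneg_left ?_ Real.pi_pos.le)
  rw [add_comm ‖c‖]
  exact (abs_add_le _ _).trans (by gcongr; exact abs_im_le_norm c)

lemma norm_sin_pi_sub_le (s c : ℂ) :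
    ‖Complex.sin (Real.pi * (s - c))‖ ≤ Real.exp (Real.pi * ‖c‖) * Real.exp (Real.pi * |s.im|) := by
  simpa [sub_eq_add_neg] using norm_sin_pi_add_le s (-c)

lemma isWeight_sin_pi_fst_sub (c : ℂ) :
    IsWeight fun s₁ _ => Complex.sin (Real.pi * (s₁ - c)) := by
  convert isWeight_sin Real.pi 0 (-(Real.pi * c)) using 4
  ring

lemma isWeight_sin_pi_snd_add (c : ℂ) :
    IsWeight fun _ s₂ => Complex.sin (Real.pi * (s₂ + c)) := by
  convert isWeight_sin 0 Real.pi (Real.pi * c) using 4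
  ring

lemma isWeight_sin_pi_add : IsWeight fun s₁ s₂ => Complex.sin (Real.pi * (s₁ + s₂)) := by
  convert isWeight_sin Real.pi Real.pi 0 using 4
  ring

lemma two_mul_abs_mul_le {θ : ℝ} (hθ : |θ| ≤ Real.pi / 2) (t : ℝ) :
    2 * |θ| * |t| ≤ Real.pi * |t| :=
  mul_le_mul_of_nonneg_right (by linarith) (abs_nonneg t)

/-- The inequality of rates reduces to `|t₁+t₂| ≤ |t₁| + |t₂|`. For angles `±π/2` it is an equality
when `t₁`, `t₂` have the same sign, so no exponential decay is left there. -/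
lemma isTameAt_false_const (c : ℂ) {θ₁ θ₂ : ℝ} (h1 : |θ₁| ≤ Real.pi / 2) (h2 : |θ₂| ≤ Real.pi / 2) :
    IsTameAt false (fun _ _ => c) θ₁ θ₂ := by
  refine isTameAt_of_norm_le (norm_nonneg c) (e := fun _ _ => 0) (fun s₁ s₂ => by simp)
    fun t₁ t₂ => ?_
  have := two_mul_abs_mul_le h1 t₁
  have := two_mul_abs_mul_le h2 t₂
  simp only [decayRate, cond_false]
  nlinarith [abs_add_le t₁ t₂, Real.pi_pos]

/-- Only the second factor is rotated, because the first Bessel function in `𝒥₃` is `K̃`. -/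
lemma isTameAt_sin_pi_add {θ : ℝ} (h : |θ| ≤ Real.pi / 2) :
    IsTameAt true (fun s₁ s₂ => Complex.sin (Real.pi * (s₁ + s₂))) 0 θ := by
  refine isTameAt_of_norm_le zero_le_one (e := fun t₁ t₂ => Real.pi * |t₁ + t₂|)
    (fun s₁ s₂ => ?_) fun t₁ t₂ => ?_
  · simpa [abs_of_pos Real.pi_pos] using norm_sin_le (Real.pi * (s₁ + s₂))
  · have := two_mul_abs_mul_le h t₂
    simp only [decayRate, cond_true, abs_zero]
    nlinarith [abs_add_le t₁ t₂, Real.pi_pos, mul_nonneg Real.pi_pos.le (abs_nonneg t₁)]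

/-- With both angles at `±π/2` the rates differ by a multiple of `|t₁+t₂| + |t₁| - |t₂|`, which is
nonnegative but may vanish. -/
lemma isTameAt_sin_pi_snd (c : ℂ) {θ₁ θ₂ : ℝ} (h1 : |θ₁| ≤ Real.pi / 2) (h2 : |θ₂| ≤ Real.pi / 2) :
    IsTameAt true (fun _ s₂ => Complex.sin (Real.pi * (s₂ + c))) θ₁ θ₂ := by
  refine isTameAt_of_norm_le (Real.exp_pos (Real.pi * ‖c‖)).le (e := fun t₁ t₂ => Real.pi * |t₂|)
    (fun s₁ s₂ => norm_sin_pi_add_le s₂ c) fun t₁ t₂ => ?_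
  have := two_mul_abs_mul_le h1 t₁
  have := two_mul_abs_mul_le h2 t₂
  have h3 : |t₂| ≤ |t₁ + t₂| + |t₁| := by simpa using abs_sub (t₁ + t₂) t₁
  simp only [decayRate, cond_true]
  nlinarith [Real.pi_pos]

lemma isTameAt_sin_pi_fst (c : ℂ) :
    IsTameAt true (fun s₁ _ => Complex.sin (Real.pi * (s₁ - c))) 0 0 := by
  refine isTameAt_of_norm_le (Real.exp_pos (Real.pi * ‖c‖)).le (e := fun t₁ t₂ => Real.pi * |t₁|)
    (fun s₁ s₂ => norm_sin_pi_sub_le s₁ c) fun t₁ t₂ => ?_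
  simp only [decayRate, cond_true, abs_zero]
  nlinarith [Real.pi_pos, mul_nonneg Real.pi_pos.le (abs_nonneg t₁),
    mul_nonneg Real.pi_pos.le (abs_nonneg t₂), mul_nonneg Real.pi_pos.le (abs_nonneg (t₁ + t₂))]

/-! ### Mellin-Barnes transforms -/

/-- The Mellin-Barnes integral with the weight `W` on the standard contour. -/
noncomputable def barnesTransform (opp : Bool) (μ : Fin 3 → ℂ) (W : ℂ → ℂ → ℂ) : ℂ :=
  (∫ t, contourIntegrand (fun s₁ s₂ => gammaKernel opp μ s₁ s₂ * W s₁ s₂) (standardContour μ)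
    (standardContour μ) t) / (2 * Real.pi * I) ^ 2

/-- Weights for which the Mellin-Barnes integral converges absolutely. -/
structure IsAdmissible (opp : Bool) (W : ℂ → ℂ → ℂ) : Prop where
  continuous : Continuous fun s : ℂ × ℂ => W s.1 s.2
  tame : IsTame opp W

lemma IsAdmissible.add {opp : Bool} {V W : ℂ → ℂ → ℂ} (hV : IsAdmissible opp V)
    (hW : IsAdmissible opp W) : IsAdmissible opp fun s₁ s₂ => V s₁ s₂ + W s₁ s₂ where
  continuous := hV.continuous.add hW.continuous
  tame := fun M => by
    obtain ⟨C, hC, h1⟩ := hV.tame M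
    obtain ⟨D, hD, h2⟩ := hW.tame M
    refine ⟨C + D, add_nonneg hC hD, fun s₁ s₂ e1 e2 => (norm_add_le _ _).trans ?_⟩
    rw [add_mul]
    exact add_le_add (h1 s₁ s₂ e1 e2) (h2 s₁ s₂ e1 e2)

lemma IsAdmissible.const_mul {opp : Bool} {W : ℂ → ℂ → ℂ} (hW : IsAdmissible opp W) (c : ℂ) :
    IsAdmissible opp fun s₁ s₂ => c * W s₁ s₂ where
  continuous := hW.continuous.const_mul c
  tame := fun M => by
    obtain ⟨D, hD, h2⟩ := hW.tame M
    refine ⟨‖c‖ * D, by positivity, fun s₁ s₂ e1 e2 => ?_⟩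
    rw [norm_mul, mul_assoc]
    exact mul_le_mul_of_nonneg_left (h2 s₁ s₂ e1 e2) (norm_nonneg c)

lemma IsTameAt.isAdmissible {opp : Bool} {T : ℂ → ℂ → ℂ} {θ₁ θ₂ : ℝ} (h : IsTameAt opp T θ₁ θ₂)
    (hT : IsWeight T) (a b : ℝ) {m : ℂ} (hm : m.re = 0) {φ₁ φ₂ : ℝ} (h1 : |φ₁| ≤ |θ₁|)
    (h2 : |φ₂| ≤ |θ₂|) : IsAdmissible opp fun s₁ s₂ => T s₁ s₂ * phaseWeight a b m φ₁ φ₂ s₁ s₂ where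
  continuous := (hT.mul (isWeight_phaseWeight _ _ _ _ _)).continuous
  tame := fun M => by
    obtain ⟨C, hC, hC'⟩ := h.exists_norm_le a b hm M
    exact ⟨C, hC, hC' φ₁ φ₂ h1 h2⟩

lemma isBarnesPair_standardContour (opp : Bool) {μ : Fin 3 → ℂ} (hμ : μ ∈ Lambda 0) :
    IsBarnesPair opp μ (standardContour μ) (standardContour μ) :=
  (isBarnesContour_standard .pos .neg hμ).isBarnesPair (fun j => abs_nonpos_iff.1 (hμ.2 j))
    fun _ h => by cases h

lemma IsAdmissible.integrable {opp : Bool} {W : ℂ → ℂ → ℂ} (hW : IsAdmissible opp W)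
    {μ : Fin 3 → ℂ} (hμ : μ ∈ Lambda 0) :
    Integrable (contourIntegrand (fun s₁ s₂ => gammaKernel opp μ s₁ s₂ * W s₁ s₂)
      (standardContour μ) (standardContour μ)) :=
  (isBarnesPair_standardContour opp hμ).integrable (fun j => abs_nonpos_iff.1 (hμ.2 j))
    hW.continuous hW.tame

lemma barnesTransform_add {opp : Bool} {μ : Fin 3 → ℂ} (hμ : μ ∈ Lambda 0) {V W : ℂ → ℂ → ℂ}
    (hV : IsAdmissible opp V) (hW : IsAdmissible opp W) :
    barnesTransform opp μ (fun s₁ s₂ => V s₁ s₂ + W s₁ s₂) =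
      barnesTransform opp μ V + barnesTransform opp μ W := by
  unfold barnesTransform
  rw [← add_div, ← integral_add (hV.integrable hμ) (hW.integrable hμ)]
  congr 1
  refine integral_congr_ae (ae_of_all _ fun t => ?_)
  simp only [contourIntegrand]
  ring

lemma barnesTransform_const_mul (opp : Bool) (μ : Fin 3 → ℂ) (c : ℂ) (W : ℂ → ℂ → ℂ) :
    barnesTransform opp μ (fun s₁ s₂ => c * W s₁ s₂) = c * barnesTransform opp μ W := by
  unfold barnesTransform
  rw [← mul_div_assoc, ← integral_const_mul]
  congr 1
  refine integral_congr_ae (ae_of_all _ fun t => ?_)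
  simp only [contourIntegrand]
  ring

/-! ### The kernels as Mellin-Barnes transforms -/

/-- Whether two signs are different. -/
def oppSigns : Sgn → Sgn → Bool
  | .pos, .neg => true
  | .neg, .pos => true
  | _, _ => false

/-- The trigonometric weights, without the factor `sin (π (s₁ + s₂))`. -/
noncomputable def trigWeight : Sgn → Sgn → (Fin 3 → ℂ) → ℂ → ℂ → ℂ
  | .pos, .pos, μ, _, _ => 1 / (24 * (Real.pi : ℂ) ^ 2) * ∏ j, cosThree (nu μ j)
  | .pos, .neg, μ, s₁, s₂ =>
      -(1 / (32 * (Real.pi : ℂ) ^ 2)) * (cosThree (nu μ 1) / (sinThree (nu μ 0) * sinThree (nu μ 2))) *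
        (Complex.sin (Real.pi * (s₁ - μ 0)) * Complex.sin (Real.pi * (s₂ + μ 1)) *
          Complex.sin (Real.pi * (s₂ + μ 2)))
  | .neg, .pos, μ, s₁, s₂ =>
      -(1 / (32 * (Real.pi : ℂ) ^ 2)) * (cosThree (nu μ 0) / (sinThree (nu μ 1) * sinThree (nu μ 2))) *
        (Complex.sin (Real.pi * (s₁ - μ 0)) * Complex.sin (Real.pi * (s₁ - μ 1)) *
          Complex.sin (Real.pi * (s₂ + μ 2)))
  | .neg, .neg, μ, s₁, s₂ =>
      1 / (32 * (Real.pi : ℂ) ^ 2) * (cosThree (nu μ 2) / (sinThree (nu μ 1) * sinThree (nu μ 0))) *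
        (Complex.sin (Real.pi * (s₁ - μ 1)) * Complex.sin (Real.pi * (s₂ + μ 1)))

lemma isWeight_trigWeight (ε₁ ε₂ : Sgn) (μ : Fin 3 → ℂ) : IsWeight (trigWeight ε₁ ε₂ μ) := by
  match ε₁, ε₂ with
  | .pos, .pos => exact isWeight_const _
  | .pos, .neg => exact (isWeight_const _).mul (((isWeight_sin_pi_fst_sub _).mul
      (isWeight_sin_pi_snd_add _)).mul (isWeight_sin_pi_snd_add _))
  | .neg, .pos => exact (isWeight_const _).mul (((isWeight_sin_pi_fst_sub _).mul
      (isWeight_sin_pi_fst_sub _)).mul (isWeight_sin_pi_snd_add _))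
  | .neg, .neg => exact (isWeight_const _).mul ((isWeight_sin_pi_fst_sub _).mul
      (isWeight_sin_pi_snd_add _))

/-- Each sine grows like `exp(π|t|)`. When a sine occurs, the growth equals the decay of the Gamma
functions in some directions, so the kernels rely on the polynomial decay too. -/
lemma isTameAt_trigWeight (ε₁ ε₂ : Sgn) (μ : Fin 3 → ℂ) :
    IsTameAt (oppSigns ε₁ ε₂) (trigWeight ε₁ ε₂ μ) 0 0 := by
  have hpi := Real.pi_pos
  match ε₁, ε₂ with
  | .pos, .pos => exact isTameAt_false_const _ (by simp; positivity) (by simp; positivity)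
  | .pos, .neg =>
    refine isTameAt_of_norm_le (C := ‖-(1 / (32 * (Real.pi : ℂ) ^ 2)) *
      (cosThree (nu μ 1) / (sinThree (nu μ 0) * sinThree (nu μ 2)))‖ *
      (Real.exp (Real.pi * ‖μ 0‖) * Real.exp (Real.pi * ‖μ 1‖) * Real.exp (Real.pi * ‖μ 2‖)))
      (by positivity) (e := fun t₁ t₂ => Real.pi * |t₁| + Real.pi * |t₂| + Real.pi * |t₂|)
      (fun s₁ s₂ => ?_) fun t₁ t₂ => ?_
    · simp only [trigWeight]
      rw [norm_mul, mul_assoc (norm _), Real.exp_add, Real.exp_add,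
        norm_mul (Complex.sin _ * Complex.sin _), norm_mul (Complex.sin _)]
      refine mul_le_mul_of_nonneg_left ?_ (norm_nonneg _)
      calc _ ≤ (Real.exp (Real.pi * ‖μ 0‖) * Real.exp (Real.pi * |s₁.im|)) *
            (Real.exp (Real.pi * ‖μ 1‖) * Real.exp (Real.pi * |s₂.im|)) *
            (Real.exp (Real.pi * ‖μ 2‖) * Real.exp (Real.pi * |s₂.im|)) := by
            gcongr
            · exact norm_sin_pi_sub_le _ _
            · exact norm_sin_pi_add_le _ _
            · exact norm_sin_pi_add_le _ _
        _ = _ := by ring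
    · have h3 : |t₂| ≤ |t₁ + t₂| + |t₁| := by simpa using abs_sub (t₁ + t₂) t₁
      simp only [decayRate, oppSigns, cond_true, abs_zero]
      nlinarith
  | .neg, .pos =>
    refine isTameAt_of_norm_le (C := ‖-(1 / (32 * (Real.pi : ℂ) ^ 2)) *
      (cosThree (nu μ 0) / (sinThree (nu μ 1) * sinThree (nu μ 2)))‖ *
      (Real.exp (Real.pi * ‖μ 0‖) * Real.exp (Real.pi * ‖μ 1‖) * Real.exp (Real.pi * ‖μ 2‖)))
      (by positivity) (e := fun t₁ t₂ => Real.pi * |t₁| + Real.pi * |t₁| + Real.pi * |t₂|)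
      (fun s₁ s₂ => ?_) fun t₁ t₂ => ?_
    · simp only [trigWeight]
      rw [norm_mul, mul_assoc (norm _), Real.exp_add, Real.exp_add,
        norm_mul (Complex.sin _ * Complex.sin _), norm_mul (Complex.sin _)]
      refine mul_le_mul_of_nonneg_left ?_ (norm_nonneg _)
      calc _ ≤ (Real.exp (Real.pi * ‖μ 0‖) * Real.exp (Real.pi * |s₁.im|)) *
            (Real.exp (Real.pi * ‖μ 1‖) * Real.exp (Real.pi * |s₁.im|)) *
            (Real.exp (Real.pi * ‖μ 2‖) * Real.exp (Real.pi * |s₂.im|)) := by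
            gcongr
            · exact norm_sin_pi_sub_le _ _
            · exact norm_sin_pi_sub_le _ _
            · exact norm_sin_pi_add_le _ _
        _ = _ := by ring
    · have h3 : |t₁| ≤ |t₁ + t₂| + |t₂| := by simpa using abs_sub (t₁ + t₂) t₂
      simp only [decayRate, oppSigns, cond_true, abs_zero]
      nlinarith
  | .neg, .neg =>
    refine isTameAt_of_norm_le (C := ‖1 / (32 * (Real.pi : ℂ) ^ 2) *
      (cosThree (nu μ 2) / (sinThree (nu μ 1) * sinThree (nu μ 0)))‖ *
      (Real.exp (Real.pi * ‖μ 1‖) * Real.exp (Real.pi * ‖μ 1‖)))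
      (by positivity) (e := fun t₁ t₂ => Real.pi * |t₁| + Real.pi * |t₂|)
      (fun s₁ s₂ => ?_) fun t₁ t₂ => ?_
    · simp only [trigWeight]
      rw [norm_mul, mul_assoc (norm _), Real.exp_add, norm_mul (Complex.sin _)]
      refine mul_le_mul_of_nonneg_left ?_ (norm_nonneg _)
      calc _ ≤ (Real.exp (Real.pi * ‖μ 1‖) * Real.exp (Real.pi * |s₁.im|)) *
            (Real.exp (Real.pi * ‖μ 1‖) * Real.exp (Real.pi * |s₂.im|)) := by
            gcongr
            · exact norm_sin_pi_sub_le _ _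
            · exact norm_sin_pi_add_le _ _
        _ = _ := by ring
    · simp only [decayRate, oppSigns, cond_false, abs_zero]
      nlinarith [abs_add_le t₁ t₂]

/-- The argument `2π √|y|` of the Bessel functions. -/
noncomputable def besselScale (y : ℝ) : ℝ := 2 * Real.pi * Real.sqrt |y|

lemma besselScale_pos {y : ℝ} (hy : y ≠ 0) : 0 < besselScale y := by
  have := Real.sqrt_pos.2 (abs_pos.2 hy)
  have := Real.pi_pos
  unfold besselScale
  positivity

lemma besselScale_sq (y : ℝ) : besselScale y ^ 2 = |4 * Real.pi ^ 2 * y| := by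
  rw [besselScale, mul_pow, Real.sq_sqrt (abs_nonneg y), abs_mul,
    abs_of_nonneg (by positivity : 0 ≤ 4 * Real.pi ^ 2)]
  ring

/-- The weight of the kernels. -/
noncomputable def kernelWeight (ε₁ ε₂ : Sgn) (y : ℝ × ℝ) (μ : Fin 3 → ℂ) (s₁ s₂ : ℂ) : ℂ :=
  trigWeight ε₁ ε₂ μ s₁ s₂ * phaseWeight (besselScale y.1) (besselScale y.2) 0 0 0 s₁ s₂

lemma isAdmissible_kernelWeight (ε₁ ε₂ : Sgn) (y : ℝ × ℝ) (μ : Fin 3 → ℂ) :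
    IsAdmissible (oppSigns ε₁ ε₂) (kernelWeight ε₁ ε₂ y μ) :=
  (isTameAt_trigWeight ε₁ ε₂ μ).isAdmissible (isWeight_trigWeight ε₁ ε₂ μ) _ _ zero_re le_rfl le_rfl

lemma cpow_eq_besselScale {y : ℝ} (hy : y ≠ 0) (s : ℂ) :
    ((|4 * Real.pi ^ 2 * y| : ℝ) : ℂ) ^ (-s) = cexp (Real.log (besselScale y) * (-2 * s)) := by
  have h := besselScale_pos hy
  rw [← besselScale_sq, cpow_def_of_ne_zero (ofReal_ne_zero.2 (by positivity)),
    ← ofReal_log (by positivity), Real.log_pow]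
  congr 1
  push_cast
  ring

lemma phaseWeight_zero {y : ℝ × ℝ} (h1 : y.1 ≠ 0) (h2 : y.2 ≠ 0) (s₁ s₂ : ℂ) :
    phaseWeight (besselScale y.1) (besselScale y.2) 0 0 0 s₁ s₂ =
      ((|4 * Real.pi ^ 2 * y.1| : ℝ) : ℂ) ^ (-s₁) * ((|4 * Real.pi ^ 2 * y.2| : ℝ) : ℂ) ^ (-s₂) := by
  rw [cpow_eq_besselScale h1, cpow_eq_besselScale h2, ← Complex.exp_add, phaseWeight]
  congr 1
  push_cast
  ring

/-- Where `sin π(s₁+s₂)` vanishes, the quotient for opposite signs has the default value `0`, while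
the Gamma kernel is the analytic continuation; such points are excluded. -/
lemma mellinBarnes_eq {ε₁ ε₂ : Sgn} {y : ℝ × ℝ} (h1 : y.1 ≠ 0) (h2 : y.2 ≠ 0) (μ : Fin 3 → ℂ)
    {s₁ s₂ : ℂ} (hs : Complex.sin (Real.pi * (s₁ + s₂)) ≠ 0) :
    mellinBarnes ε₁ ε₂ y μ s₁ s₂ =
      gammaKernel (oppSigns ε₁ ε₂) μ s₁ s₂ * kernelWeight ε₁ ε₂ y μ s₁ s₂ := by
  have hg : gammaFactor s₁ s₂ μ = gammaKernel false μ s₁ s₂ := by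
    simp only [gammaFactor, gammaKernel, cond_false]
    ring
  have ht := gammaKernel_true_mul_sin μ hs
  have key : ∀ P g k S : ℂ, k * S = g → S ≠ 0 → ∀ A B D, P * g * (A * (B / (D * S))) =
      k * (A * (B / D) * P) := by
    intro P g k S hk hS A B D
    rw [← hk]
    field_simp
  unfold mellinBarnes kernelWeight
  rw [← phaseWeight_zero h1 h2, hg]
  match ε₁, ε₂ with
  | .pos, .pos => simp only [oppSigns, trigWeight, trigFactor]; ring
  | .pos, .neg =>
    simp only [oppSigns, trigWeight, trigFactor, sinPi]
    rw [key _ _ _ _ ht hs]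
    ring
  | .neg, .pos =>
    simp only [oppSigns, trigWeight, trigFactor, sinPi]
    rw [key _ _ _ _ ht hs]
    ring
  | .neg, .neg => simp only [oppSigns, trigWeight, trigFactor, sinPi]; ring

/-- The sine vanishes only at integers, which forces `t₁ + t₂ = 0`; this is a null set by slices. -/
lemma ae_sin_pi_ne_zero (σ₁ σ₂ : ℝ → ℝ) : ∀ᵐ t : ℝ × ℝ,
    Complex.sin (Real.pi * (contourPoint σ₁ t.1 + contourPoint σ₂ t.2)) ≠ 0 := by
  have h : ∀ᵐ t : ℝ × ℝ, t.1 + t.2 ≠ 0 := by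
    have hm : MeasurableSet {t : ℝ × ℝ | t.1 + t.2 = 0} :=
      (isClosed_eq (continuous_fst.add continuous_snd) continuous_const).measurableSet
    have h0 : volume {t : ℝ × ℝ | t.1 + t.2 = 0} = 0 := by
      rw [Measure.volume_eq_prod, Measure.measure_prod_null hm]
      refine ae_of_all _ fun x => ?_
      have : Prod.mk x ⁻¹' {t : ℝ × ℝ | t.1 + t.2 = 0} = {-x} := by
        ext y
        simp only [mem_preimage, mem_ofPred_eq, mem_singleton_iff]
        constructor <;> intro h <;> linarith
      simp only
      rw [this]
      simp
    exact measure_eq_zero_iff_ae_notMem.1 h0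
  filter_upwards [h] with t ht hs
  obtain ⟨k, hk⟩ := Complex.sin_eq_zero_iff.1 hs
  have h1 : contourPoint σ₁ t.1 + contourPoint σ₂ t.2 = k :=
    mul_left_cancel₀ (ofReal_ne_zero.2 Real.pi_ne_zero) (by rw [hk]; ring)
  have h2 := congrArg Complex.im h1
  rw [add_im, contourPoint_im, contourPoint_im, intCast_im] at h2
  exact ht h2

lemma kernelIntegrand_ae_eq (ε₁ ε₂ : Sgn) (σ₁ σ₂ : ℝ → ℝ) {y : ℝ × ℝ} (h1 : y.1 ≠ 0)
    (h2 : y.2 ≠ 0) (μ : Fin 3 → ℂ) : kernelIntegrand ε₁ ε₂ σ₁ σ₂ y μ =ᵐ[volume]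
      contourIntegrand (fun s₁ s₂ => gammaKernel (oppSigns ε₁ ε₂) μ s₁ s₂ *
        kernelWeight ε₁ ε₂ y μ s₁ s₂) σ₁ σ₂ := by
  filter_upwards [ae_sin_pi_ne_zero σ₁ σ₂] with t ht
  rw [kernelIntegrand, contourIntegrand, mellinBarnes_eq h1 h2 μ ht]

lemma kernelW6_eq_barnesTransform (ε₁ ε₂ : Sgn) {y : ℝ × ℝ} (h1 : y.1 ≠ 0) (h2 : y.2 ≠ 0)
    (μ : Fin 3 → ℂ) : kernelW6 ε₁ ε₂ y μ =
      barnesTransform (oppSigns ε₁ ε₂) μ (kernelWeight ε₁ ε₂ y μ) := by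
  rw [kernelW6, barnesIntegral, barnesTransform,
    integral_congr_ae (kernelIntegrand_ae_eq ε₁ ε₂ _ _ h1 h2 μ)]

/-- The kernels converge absolutely and do not depend on the choice of the contours. -/
theorem kernelWellDefined (ε₁ ε₂ : Sgn) {y : ℝ × ℝ} (h1 : y.1 ≠ 0) (h2 : y.2 ≠ 0) {μ : Fin 3 → ℂ}
    (hμ : μ ∈ Lambda 0) : KernelWellDefined ε₁ ε₂ y μ := by
  intro σ₁ σ₂ hσ
  have hre : ∀ j, (μ j).re = 0 := fun j => abs_nonpos_iff.1 (hμ.2 j)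
  have hp : IsBarnesPair (oppSigns ε₁ ε₂) μ σ₁ σ₂ := hσ.isBarnesPair hre fun h he => by
    subst he
    cases ε₁ <;> simp [oppSigns] at h
  have hs := isBarnesPair_standardContour (oppSigns ε₁ ε₂) hμ
  have ha := isAdmissible_kernelWeight ε₁ ε₂ y μ
  have hi := hp.integrable hre ha.continuous ha.tame
  have hw : IsWeight (kernelWeight ε₁ ε₂ y μ) :=
    (isWeight_trigWeight ε₁ ε₂ μ).mul (isWeight_phaseWeight _ _ _ _ _)
  refine ⟨hi.congr (kernelIntegrand_ae_eq ε₁ ε₂ σ₁ σ₂ h1 h2 μ).symm, ?_⟩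
  rw [kernelW6_eq_barnesTransform ε₁ ε₂ h1 h2, barnesIntegral, barnesTransform,
    integral_congr_ae (kernelIntegrand_ae_eq ε₁ ε₂ σ₁ σ₂ h1 h2 μ),
    integral_contourIntegrand_eq hre hs.toIsContourPair hp.toIsContourPair hw (ha.integrable hμ) hi]


/-! ### The Bessel integrals as Mellin-Barnes transforms -/

lemma prefactor_eq {y : ℝ × ℝ} (h1 : y.1 ≠ 0) (h2 : y.2 ≠ 0) (μ : Fin 3 → ℂ) : prefactor y μ =
    cexp ((Real.log (besselScale y.1) - Real.log (besselScale y.2)) * μ 1) := by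
  have ha := besselScale_pos h1
  have hb := besselScale_pos h2
  have hy : |y.1 / y.2| = (besselScale y.1 / besselScale y.2) ^ 2 := by
    rw [div_pow, besselScale_sq, besselScale_sq, abs_div, abs_mul _ y.1, abs_mul _ y.2,
      mul_div_mul_left]
    have := Real.pi_pos
    positivity
  rw [prefactor, hy, cpow_def_of_ne_zero (ofReal_ne_zero.2 (by positivity)),
    ← ofReal_log (by positivity), Real.log_pow, Real.log_div ha.ne' hb.ne']
  congr 1
  push_cast
  ring

/-- With `a = 2π√|y₁|`, `b = 2π√|y₂|` the prefactor is `(a/b)^{μ₂}`, which cancels `a^{-μ₂} b^{μ₂}`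
and leaves the powers of the kernel and a phase in each variable. -/
lemma prefactor_mul_phaseWeight {y : ℝ × ℝ} (h1 : y.1 ≠ 0) (h2 : y.2 ≠ 0) (μ : Fin 3 → ℂ)
    (θ₁ θ₂ : ℝ) (s₁ s₂ : ℂ) :
    prefactor y μ * phaseWeight (besselScale y.1) (besselScale y.2) (μ 1) θ₁ θ₂ s₁ s₂ =
      phaseWeight (besselScale y.1) (besselScale y.2) 0 0 0 s₁ s₂ *
        (cexp (-θ₁ * I * (2 * s₁ + μ 1)) * cexp (-θ₂ * I * (2 * s₂ - μ 1))) := by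
  rw [prefactor_eq h1 h2, phaseWeight, phaseWeight, ← Complex.exp_add, ← Complex.exp_add,
    ← Complex.exp_add]
  congr 1
  push_cast
  ring

/-- A linear combination of the values of `K_α` at `2x exp(iθ)` and `2x exp(-iθ)`. -/
noncomputable def besselSum (α c c' : ℂ) (θ x : ℝ) : ℂ :=
  c * besselKExt α (2 * cexp (θ * I) * x) + c' * besselKExt α (2 * cexp ((-θ : ℝ) * I) * x)

/-- The weight that corresponds to `besselSum`. -/
noncomputable def phaseSum (c c' : ℂ) (θ : ℝ) (w : ℂ) : ℂ :=
  c * cexp (-θ * I * w) + c' * cexp (θ * I * w)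

/-- The weight of an integral of a product of two Bessel functions. -/
noncomputable def besselWeight (T : ℂ → ℂ → ℂ) (y : ℝ × ℝ) (m c₁ c₁' c₂ c₂' : ℂ) (θ₁ θ₂ : ℝ)
    (s₁ s₂ : ℂ) : ℂ :=
  1 / 8 * (T s₁ s₂ * (phaseSum c₁ c₁' θ₁ (2 * s₁ + m) * phaseSum c₂ c₂' θ₂ (2 * s₂ - m))) *
    phaseWeight (besselScale y.1) (besselScale y.2) 0 0 0 s₁ s₂

/-- The product of two sums is expanded into four products of Bessel functions with angles `±θ₁`,
`±θ₂`; all growth conditions depend only on the absolute values of the angles. -/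
lemma IsBetaRegion.prefactor_mul_integral {opp : Bool} {μ : Fin 3 → ℂ} {S : Set ℝ}
    {p q : ℝ → ℝ} {T : ℂ → ℂ → ℂ} (h : IsBetaRegion opp μ S p q T) (hμ : μ ∈ Lambda 0)
    (hT : IsWeight T) {y : ℝ × ℝ} (hy1 : y.1 ≠ 0) (hy2 : y.2 ≠ 0) {θ₁ θ₂ : ℝ}
    (hθ₁ : |θ₁| ≤ Real.pi / 2) (hθ₂ : |θ₂| ≤ Real.pi / 2)
    (h1 : μ 2 - μ 0 ≠ 0 ∨ |θ₁| < Real.pi / 2) (h2 : μ 2 - μ 0 ≠ 0 ∨ |θ₂| < Real.pi / 2)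
    (ht : IsTameAt opp T θ₁ θ₂) (c₁ c₁' c₂ c₂' : ℂ) :
    IntegrableOn (fun u => besselSum (μ 2 - μ 0) c₁ c₁' θ₁ (besselScale y.1 * p u) *
      besselSum (μ 2 - μ 0) c₂ c₂' θ₂ (besselScale y.2 * q u) * (u : ℂ) ^ (3 * μ 1) / u) S ∧
    IsAdmissible opp (besselWeight T y (μ 1) c₁ c₁' c₂ c₂' θ₁ θ₂) ∧
    prefactor y μ * ∫ u in S, besselSum (μ 2 - μ 0) c₁ c₁' θ₁ (besselScale y.1 * p u) *
      besselSum (μ 2 - μ 0) c₂ c₂' θ₂ (besselScale y.2 * q u) * (u : ℂ) ^ (3 * μ 1) / u =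
      barnesTransform opp μ (besselWeight T y (μ 1) c₁ c₁' c₂ c₂' θ₁ θ₂) := by
  have hre : ∀ j, (μ j).re = 0 := fun j => abs_nonpos_iff.1 (hμ.2 j)
  have ha := besselScale_pos hy1
  have hb := besselScale_pos hy2
  set a := besselScale y.1
  set b := besselScale y.2
  have hbase : ∀ φ₁ φ₂ : ℝ, |φ₁| = |θ₁| → |φ₂| = |θ₂| →
      IntegrableOn (besselProduct μ p q a b φ₁ φ₂) S ∧
      IsAdmissible opp (fun s₁ s₂ => T s₁ s₂ * phaseWeight a b (μ 1) φ₁ φ₂ s₁ s₂) ∧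
      ∫ u in S, besselProduct μ p q a b φ₁ φ₂ u = 1 / 8 * barnesTransform opp μ
        (fun s₁ s₂ => T s₁ s₂ * phaseWeight a b (μ 1) φ₁ φ₂ s₁ s₂) := by
    intro φ₁ φ₂ e1 e2
    have ht' : IsTameAt opp T φ₁ φ₂ := by
      unfold IsTameAt
      rw [e1, e2]
      exact ht
    rw [← e1] at hθ₁ h1
    rw [← e2] at hθ₂ h2
    exact ⟨h.integrableOn_besselProduct hre ha hb hθ₁ hθ₂ h1 h2,
      ht'.isAdmissible hT a b (hre 1) le_rfl le_rfl,
      h.integral_besselProduct hre hμ.1 hT ha hb hθ₁ hθ₂ h1 h2 ht'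
        (isBarnesPair_standardContour opp hμ)⟩
  obtain ⟨i1, d1, v1⟩ := hbase θ₁ θ₂ rfl rfl
  obtain ⟨i2, d2, v2⟩ := hbase θ₁ (-θ₂) rfl (abs_neg _)
  obtain ⟨i3, d3, v3⟩ := hbase (-θ₁) θ₂ (abs_neg _) rfl
  obtain ⟨i4, d4, v4⟩ := hbase (-θ₁) (-θ₂) (abs_neg _) (abs_neg _)
  have hf : (fun u => besselSum (μ 2 - μ 0) c₁ c₁' θ₁ (a * p u) *
      besselSum (μ 2 - μ 0) c₂ c₂' θ₂ (b * q u) * (u : ℂ) ^ (3 * μ 1) / u) = fun u =>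
      (c₁ * c₂ * besselProduct μ p q a b θ₁ θ₂ u + c₁ * c₂' * besselProduct μ p q a b θ₁ (-θ₂) u) +
      (c₁' * c₂ * besselProduct μ p q a b (-θ₁) θ₂ u +
        c₁' * c₂' * besselProduct μ p q a b (-θ₁) (-θ₂) u) := by
    funext u
    simp only [besselSum, besselProduct]
    ring
  have hw : besselWeight T y (μ 1) c₁ c₁' c₂ c₂' θ₁ θ₂ = fun s₁ s₂ =>
      (prefactor y μ / 8 * (c₁ * c₂) * (T s₁ s₂ * phaseWeight a b (μ 1) θ₁ θ₂ s₁ s₂) +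
        prefactor y μ / 8 * (c₁ * c₂') * (T s₁ s₂ * phaseWeight a b (μ 1) θ₁ (-θ₂) s₁ s₂)) +
      (prefactor y μ / 8 * (c₁' * c₂) * (T s₁ s₂ * phaseWeight a b (μ 1) (-θ₁) θ₂ s₁ s₂) +
        prefactor y μ / 8 * (c₁' * c₂') * (T s₁ s₂ * phaseWeight a b (μ 1) (-θ₁) (-θ₂) s₁ s₂)) := by
    funext s₁ s₂
    have e : ∀ (c : ℂ) (φ₁ φ₂ : ℝ), prefactor y μ / 8 * c *
        (T s₁ s₂ * phaseWeight a b (μ 1) φ₁ φ₂ s₁ s₂) = c / 8 * T s₁ s₂ *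
        (phaseWeight a b 0 0 0 s₁ s₂ *
          (cexp (-φ₁ * I * (2 * s₁ + μ 1)) * cexp (-φ₂ * I * (2 * s₂ - μ 1)))) := by
      intro c φ₁ φ₂
      rw [← prefactor_mul_phaseWeight hy1 hy2]
      ring
    rw [e, e, e, e]
    simp only [besselWeight, phaseSum, ofReal_neg, neg_neg]
    ring
  rw [hf, hw]
  have i12 : IntegrableOn (fun u => c₁ * c₂ * besselProduct μ p q a b θ₁ θ₂ u +
      c₁ * c₂' * besselProduct μ p q a b θ₁ (-θ₂) u) S := (i1.const_mul _).add (i2.const_mul _)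
  have i34 : IntegrableOn (fun u => c₁' * c₂ * besselProduct μ p q a b (-θ₁) θ₂ u +
      c₁' * c₂' * besselProduct μ p q a b (-θ₁) (-θ₂) u) S := (i3.const_mul _).add (i4.const_mul _)
  refine ⟨i12.add i34, ((d1.const_mul _).add (d2.const_mul _)).add
    ((d3.const_mul _).add (d4.const_mul _)), ?_⟩
  rw [integral_add i12 i34, integral_add (i1.const_mul _) (i2.const_mul _),
    integral_add (i3.const_mul _) (i4.const_mul _), integral_const_mul, integral_const_mul,
    integral_const_mul, integral_const_mul, v1, v2, v3, v4,
    barnesTransform_add hμ ((d1.const_mul _).add (d2.const_mul _))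
      ((d3.const_mul _).add (d4.const_mul _)),
    barnesTransform_add hμ (d1.const_mul _) (d2.const_mul _),
    barnesTransform_add hμ (d3.const_mul _) (d4.const_mul _), barnesTransform_const_mul,
    barnesTransform_const_mul, barnesTransform_const_mul, barnesTransform_const_mul]
  ring

lemma cexp_pi_div_two_mul_I : cexp ((Real.pi / 2 : ℝ) * I) = I := by
  push_cast
  exact Complex.exp_pi_div_two_mul_I

lemma cexp_neg_pi_div_two_mul_I : cexp ((-(Real.pi / 2) : ℝ) * I) = -I := by
  push_cast
  rw [neg_mul, Complex.exp_neg, Complex.exp_pi_div_two_mul_I, inv_I]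

lemma besselJSgn_neg_eq_besselSum {α : ℂ} (hα : α.re = 0) (h0 : α ≠ 0) {x : ℝ} (hx : 0 < x) :
    besselJSgn .neg α x = besselSum α 1 1 (Real.pi / 2) x := by
  rw [besselJSgn_neg_eq hα h0 hx, besselSum, cexp_pi_div_two_mul_I, cexp_neg_pi_div_two_mul_I,
    one_mul, one_mul]

lemma besselJSgn_pos_eq_besselSum {α : ℂ} (hα : α.re = 0) (h0 : α ≠ 0) {x : ℝ} (hx : 0 < x) :
    besselJSgn .pos α x = besselSum α I (-I) (Real.pi / 2) x := by
  rw [besselJSgn_pos_eq hα h0 hx, besselSum, cexp_pi_div_two_mul_I, cexp_neg_pi_div_two_mul_I]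
  ring

lemma besselKTilde_eq_besselSum (α : ℂ) {x : ℝ} (hx : 0 < x) : besselKTilde α x =
    besselSum α (Complex.cos (Real.pi / 2 * α)) (Complex.cos (Real.pi / 2 * α)) 0 x := by
  rw [besselKTilde_eq α hx, besselSum, neg_zero, ofReal_zero, zero_mul, Complex.exp_zero]
  ring

lemma phaseSum_one_one (w : ℂ) : phaseSum 1 1 (Real.pi / 2) w = 2 * Complex.cos (Real.pi / 2 * w) := by
  rw [phaseSum, Complex.two_cos, add_comm]
  push_cast
  ring_nf

lemma phaseSum_I_neg_I (w : ℂ) :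
    phaseSum I (-I) (Real.pi / 2) w = 2 * Complex.sin (Real.pi / 2 * w) := by
  rw [phaseSum, Complex.two_sin]
  push_cast
  ring_nf

lemma phaseSum_zero (c c' w : ℂ) : phaseSum c c' 0 w = c + c' := by
  simp [phaseSum]

lemma three_mul_nu_two (μ : Fin 3 → ℂ) : 3 * nu μ 2 = μ 2 - μ 0 := by
  simp [nu]
  ring

/-- `𝒥₁⁻` as a Mellin-Barnes transform. -/
lemma calJ1_neg_eq {μ : Fin 3 → ℂ} (hμ : μ ∈ Lambda 0) (h0 : μ 2 - μ 0 ≠ 0) {y : ℝ × ℝ}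
    (h1 : y.1 ≠ 0) (h2 : y.2 ≠ 0) : IntegrableOn (integrand1 .neg y μ) (Ioi 0) ∧
    IsAdmissible false (besselWeight (fun _ _ => 1) y (μ 1) 1 1 1 1 (Real.pi / 2) (Real.pi / 2)) ∧
    calJ1 .neg y μ = barnesTransform false μ
      (besselWeight (fun _ _ => 1) y (μ 1) 1 1 1 1 (Real.pi / 2) (Real.pi / 2)) := by
  have hre : ∀ j, (μ j).re = 0 := fun j => abs_nonpos_iff.1 (hμ.2 j)
  have hα : (μ 2 - μ 0).re = 0 := by simp [hre]
  have hR := isBetaRegion_half_line_false hre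
  have hθ : |Real.pi / 2| ≤ Real.pi / 2 := (abs_of_pos (half_pos Real.pi_pos)).le
  obtain ⟨r1, r2, r3⟩ := hR.prefactor_mul_integral hμ (isWeight_const 1) h1 h2 hθ hθ (Or.inl h0)
    (Or.inl h0) (isTameAt_false_const 1 hθ hθ) 1 1 1 1
  have e : EqOn (fun u => besselSum (μ 2 - μ 0) 1 1 (Real.pi / 2)
      (besselScale y.1 * Real.sqrt (1 + u ^ 2)) * besselSum (μ 2 - μ 0) 1 1 (Real.pi / 2)
      (besselScale y.2 * Real.sqrt (1 + (u ^ 2)⁻¹)) * (u : ℂ) ^ (3 * μ 1) / u)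
      (integrand1 .neg y μ) (Ioi 0) := by
    intro u hu
    obtain ⟨-, hp, hq⟩ := hR.pos u hu
    simp only [integrand1, three_mul_nu_two]
    rw [← besselJSgn_neg_eq_besselSum hα h0 (mul_pos (besselScale_pos h1) hp),
      ← besselJSgn_neg_eq_besselSum hα h0 (mul_pos (besselScale_pos h2) hq)]
    rfl
  refine ⟨r1.congr_fun e measurableSet_Ioi, r2, ?_⟩
  rw [← r3, calJ1, setIntegral_congr_fun measurableSet_Ioi e]

/-- `𝒥₁⁺` as a Mellin-Barnes transform. -/
lemma calJ1_pos_eq {μ : Fin 3 → ℂ} (hμ : μ ∈ Lambda 0) (h0 : μ 2 - μ 0 ≠ 0) {y : ℝ × ℝ}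
    (h1 : y.1 ≠ 0) (h2 : y.2 ≠ 0) : IntegrableOn (integrand1 .pos y μ) (Ioi 0) ∧
    IsAdmissible false (besselWeight (fun _ _ => 1) y (μ 1) I (-I) I (-I) (Real.pi / 2)
      (Real.pi / 2)) ∧
    calJ1 .pos y μ = barnesTransform false μ
      (besselWeight (fun _ _ => 1) y (μ 1) I (-I) I (-I) (Real.pi / 2) (Real.pi / 2)) := by
  have hre : ∀ j, (μ j).re = 0 := fun j => abs_nonpos_iff.1 (hμ.2 j)
  have hα : (μ 2 - μ 0).re = 0 := by simp [hre]
  have hR := isBetaRegion_half_line_false hre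
  have hθ : |Real.pi / 2| ≤ Real.pi / 2 := (abs_of_pos (half_pos Real.pi_pos)).le
  obtain ⟨r1, r2, r3⟩ := hR.prefactor_mul_integral hμ (isWeight_const 1) h1 h2 hθ hθ (Or.inl h0)
    (Or.inl h0) (isTameAt_false_const 1 hθ hθ) I (-I) I (-I)
  have e : EqOn (fun u => besselSum (μ 2 - μ 0) I (-I) (Real.pi / 2)
      (besselScale y.1 * Real.sqrt (1 + u ^ 2)) * besselSum (μ 2 - μ 0) I (-I) (Real.pi / 2)
      (besselScale y.2 * Real.sqrt (1 + (u ^ 2)⁻¹)) * (u : ℂ) ^ (3 * μ 1) / u)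
      (integrand1 .pos y μ) (Ioi 0) := by
    intro u hu
    obtain ⟨-, hp, hq⟩ := hR.pos u hu
    simp only [integrand1, three_mul_nu_two]
    rw [← besselJSgn_pos_eq_besselSum hα h0 (mul_pos (besselScale_pos h1) hp),
      ← besselJSgn_pos_eq_besselSum hα h0 (mul_pos (besselScale_pos h2) hq)]
    rfl
  refine ⟨r1.congr_fun e measurableSet_Ioi, r2, ?_⟩
  rw [← r3, calJ1, setIntegral_congr_fun measurableSet_Ioi e]

/-- `𝒥₂` as a Mellin-Barnes transform. -/
lemma calJ2_eq {μ : Fin 3 → ℂ} (hμ : μ ∈ Lambda 0) (h0 : μ 2 - μ 0 ≠ 0) {y : ℝ × ℝ}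
    (h1 : y.1 ≠ 0) (h2 : y.2 ≠ 0) : IntegrableOn (integrand2 y μ) (Ioi 1) ∧
    IsAdmissible true (besselWeight (fun _ s₂ => Complex.sin (Real.pi * (s₂ + μ 1))) y (μ 1) 1 1 1 1
      (Real.pi / 2) (Real.pi / 2)) ∧
    calJ2 y μ = barnesTransform true μ (besselWeight
      (fun _ s₂ => Complex.sin (Real.pi * (s₂ + μ 1))) y (μ 1) 1 1 1 1 (Real.pi / 2)
      (Real.pi / 2)) := by
  have hre : ∀ j, (μ j).re = 0 := fun j => abs_nonpos_iff.1 (hμ.2 j)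
  have hα : (μ 2 - μ 0).re = 0 := by simp [hre]
  have hR := isBetaRegion_Ioi_one hre
  have hθ : |Real.pi / 2| ≤ Real.pi / 2 := (abs_of_pos (half_pos Real.pi_pos)).le
  obtain ⟨r1, r2, r3⟩ := hR.prefactor_mul_integral hμ (isWeight_sin_pi_snd_add _) h1 h2 hθ hθ
    (Or.inl h0) (Or.inl h0) (isTameAt_sin_pi_snd _ hθ hθ) 1 1 1 1
  have e : EqOn (fun u => besselSum (μ 2 - μ 0) 1 1 (Real.pi / 2)
      (besselScale y.1 * Real.sqrt (u ^ 2 - 1)) * besselSum (μ 2 - μ 0) 1 1 (Real.pi / 2)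
      (besselScale y.2 * Real.sqrt (1 - (u ^ 2)⁻¹)) * (u : ℂ) ^ (3 * μ 1) / u)
      (integrand2 y μ) (Ioi 1) := by
    intro u hu
    obtain ⟨-, hp, hq⟩ := hR.pos u hu
    simp only [integrand2, three_mul_nu_two]
    rw [← besselJSgn_neg_eq_besselSum hα h0 (mul_pos (besselScale_pos h1) hp),
      ← besselJSgn_neg_eq_besselSum hα h0 (mul_pos (besselScale_pos h2) hq)]
    rfl
  refine ⟨r1.congr_fun e measurableSet_Ioi, r2, ?_⟩
  rw [← r3, calJ2, setIntegral_congr_fun measurableSet_Ioi e]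

/-- `𝒥₃` as a Mellin-Barnes transform. -/
lemma calJ3_eq {μ : Fin 3 → ℂ} (hμ : μ ∈ Lambda 0) (h0 : μ 2 - μ 0 ≠ 0) {y : ℝ × ℝ}
    (h1 : y.1 ≠ 0) (h2 : y.2 ≠ 0) : IntegrableOn (integrand3 y μ) (Ioi 0) ∧
    IsAdmissible true (besselWeight (fun s₁ s₂ => Complex.sin (Real.pi * (s₁ + s₂))) y (μ 1)
      (Complex.cos (Real.pi / 2 * (μ 2 - μ 0))) (Complex.cos (Real.pi / 2 * (μ 2 - μ 0))) 1 1
      0 (Real.pi / 2)) ∧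
    calJ3 y μ = barnesTransform true μ (besselWeight
      (fun s₁ s₂ => Complex.sin (Real.pi * (s₁ + s₂))) y (μ 1)
      (Complex.cos (Real.pi / 2 * (μ 2 - μ 0))) (Complex.cos (Real.pi / 2 * (μ 2 - μ 0))) 1 1
      0 (Real.pi / 2)) := by
  have hre : ∀ j, (μ j).re = 0 := fun j => abs_nonpos_iff.1 (hμ.2 j)
  have hα : (μ 2 - μ 0).re = 0 := by simp [hre]
  have hR := isBetaRegion_half_line_true hre
  have hθ : |Real.pi / 2| ≤ Real.pi / 2 := (abs_of_pos (half_pos Real.pi_pos)).le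
  obtain ⟨r1, r2, r3⟩ := hR.prefactor_mul_integral hμ isWeight_sin_pi_add h1 h2
    (abs_zero.trans_le (half_pos Real.pi_pos).le) hθ
    (Or.inl h0) (Or.inl h0) (isTameAt_sin_pi_add hθ) (Complex.cos (Real.pi / 2 * (μ 2 - μ 0)))
    (Complex.cos (Real.pi / 2 * (μ 2 - μ 0))) 1 1
  have e : EqOn (fun u => besselSum (μ 2 - μ 0) (Complex.cos (Real.pi / 2 * (μ 2 - μ 0)))
      (Complex.cos (Real.pi / 2 * (μ 2 - μ 0))) 0
      (besselScale y.1 * Real.sqrt (1 + u ^ 2)) * besselSum (μ 2 - μ 0) 1 1 (Real.pi / 2)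
      (besselScale y.2 * Real.sqrt (1 + (u ^ 2)⁻¹)) * (u : ℂ) ^ (3 * μ 1) / u)
      (integrand3 y μ) (Ioi 0) := by
    intro u hu
    obtain ⟨-, hp, hq⟩ := hR.pos u hu
    simp only [integrand3, three_mul_nu_two]
    rw [← besselKTilde_eq_besselSum _ (mul_pos (besselScale_pos h1) hp),
      ← besselJSgn_neg_eq_besselSum hα h0 (mul_pos (besselScale_pos h2) hq)]
    rfl
  refine ⟨r1.congr_fun e measurableSet_Ioi, r2, ?_⟩
  rw [← r3, calJ3, setIntegral_congr_fun measurableSet_Ioi e]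

/-- `𝒥₄` as a Mellin-Barnes transform. -/
lemma calJ4_eq {μ : Fin 3 → ℂ} (hμ : μ ∈ Lambda 0) {y : ℝ × ℝ}
    (h1 : y.1 ≠ 0) (h2 : y.2 ≠ 0) : IntegrableOn (integrand4 y μ) (Ioo 0 1) ∧
    IsAdmissible true (besselWeight (fun s₁ _ => Complex.sin (Real.pi * (s₁ - μ 1))) y (μ 1)
      (Complex.cos (Real.pi / 2 * (μ 2 - μ 0))) (Complex.cos (Real.pi / 2 * (μ 2 - μ 0)))
      (Complex.cos (Real.pi / 2 * (μ 2 - μ 0))) (Complex.cos (Real.pi / 2 * (μ 2 - μ 0))) 0 0) ∧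
    calJ4 y μ = barnesTransform true μ (besselWeight
      (fun s₁ _ => Complex.sin (Real.pi * (s₁ - μ 1))) y (μ 1)
      (Complex.cos (Real.pi / 2 * (μ 2 - μ 0))) (Complex.cos (Real.pi / 2 * (μ 2 - μ 0)))
      (Complex.cos (Real.pi / 2 * (μ 2 - μ 0))) (Complex.cos (Real.pi / 2 * (μ 2 - μ 0))) 0 0) := by
  have hre : ∀ j, (μ j).re = 0 := fun j => abs_nonpos_iff.1 (hμ.2 j)
  have hR := isBetaRegion_Ioo hre
  have hθ : |(0 : ℝ)| < Real.pi / 2 := by rw [abs_zero]; exact half_pos Real.pi_pos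
  obtain ⟨r1, r2, r3⟩ := hR.prefactor_mul_integral hμ (isWeight_sin_pi_fst_sub _) h1 h2
    hθ.le hθ.le (Or.inr hθ) (Or.inr hθ) (isTameAt_sin_pi_fst _)
    (Complex.cos (Real.pi / 2 * (μ 2 - μ 0))) (Complex.cos (Real.pi / 2 * (μ 2 - μ 0)))
    (Complex.cos (Real.pi / 2 * (μ 2 - μ 0))) (Complex.cos (Real.pi / 2 * (μ 2 - μ 0)))
  have e : EqOn (fun u => besselSum (μ 2 - μ 0) (Complex.cos (Real.pi / 2 * (μ 2 - μ 0)))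
      (Complex.cos (Real.pi / 2 * (μ 2 - μ 0))) 0
      (besselScale y.1 * Real.sqrt (1 - u ^ 2)) * besselSum (μ 2 - μ 0)
      (Complex.cos (Real.pi / 2 * (μ 2 - μ 0))) (Complex.cos (Real.pi / 2 * (μ 2 - μ 0))) 0
      (besselScale y.2 * Real.sqrt ((u ^ 2)⁻¹ - 1)) * (u : ℂ) ^ (3 * μ 1) / u)
      (integrand4 y μ) (Ioo 0 1) := by
    intro u hu
    obtain ⟨-, hp, hq⟩ := hR.pos u hu
    simp only [integrand4, three_mul_nu_two]
    rw [← besselKTilde_eq_besselSum _ (mul_pos (besselScale_pos h1) hp),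
      ← besselKTilde_eq_besselSum _ (mul_pos (besselScale_pos h2) hq)]
    rfl
  refine ⟨r1.congr_fun e measurableSet_Ioo, r2, ?_⟩
  rw [← r3, calJ4, setIntegral_congr_fun measurableSet_Ioo e]

/-- `𝒥₅` as a Mellin-Barnes transform. -/
lemma calJ5_eq {μ : Fin 3 → ℂ} (hμ : μ ∈ Lambda 0) {y : ℝ × ℝ}
    (h1 : y.1 ≠ 0) (h2 : y.2 ≠ 0) : IntegrableOn (integrand5 y μ) (Ioi 0) ∧
    IsAdmissible false (besselWeight (fun _ _ => 1) y (μ 1)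
      (Complex.cos (Real.pi / 2 * (μ 2 - μ 0))) (Complex.cos (Real.pi / 2 * (μ 2 - μ 0)))
      (Complex.cos (Real.pi / 2 * (μ 2 - μ 0))) (Complex.cos (Real.pi / 2 * (μ 2 - μ 0))) 0 0) ∧
    calJ5 y μ = barnesTransform false μ (besselWeight (fun _ _ => 1) y (μ 1)
      (Complex.cos (Real.pi / 2 * (μ 2 - μ 0))) (Complex.cos (Real.pi / 2 * (μ 2 - μ 0)))
      (Complex.cos (Real.pi / 2 * (μ 2 - μ 0))) (Complex.cos (Real.pi / 2 * (μ 2 - μ 0))) 0 0) := by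
  have hre : ∀ j, (μ j).re = 0 := fun j => abs_nonpos_iff.1 (hμ.2 j)
  have hR := isBetaRegion_half_line_false hre
  have hθ : |(0 : ℝ)| < Real.pi / 2 := by rw [abs_zero]; exact half_pos Real.pi_pos
  obtain ⟨r1, r2, r3⟩ := hR.prefactor_mul_integral hμ (isWeight_const 1) h1 h2
    hθ.le hθ.le (Or.inr hθ) (Or.inr hθ) (isTameAt_false_const 1 hθ.le hθ.le)
    (Complex.cos (Real.pi / 2 * (μ 2 - μ 0))) (Complex.cos (Real.pi / 2 * (μ 2 - μ 0)))
    (Complex.cos (Real.pi / 2 * (μ 2 - μ 0))) (Complex.cos (Real.pi / 2 * (μ 2 - μ 0)))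
  have e : EqOn (fun u => besselSum (μ 2 - μ 0) (Complex.cos (Real.pi / 2 * (μ 2 - μ 0)))
      (Complex.cos (Real.pi / 2 * (μ 2 - μ 0))) 0
      (besselScale y.1 * Real.sqrt (1 + u ^ 2)) * besselSum (μ 2 - μ 0)
      (Complex.cos (Real.pi / 2 * (μ 2 - μ 0))) (Complex.cos (Real.pi / 2 * (μ 2 - μ 0))) 0
      (besselScale y.2 * Real.sqrt (1 + (u ^ 2)⁻¹)) * (u : ℂ) ^ (3 * μ 1) / u)
      (integrand5 y μ) (Ioi 0) := by
    intro u hu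
    obtain ⟨-, hp, hq⟩ := hR.pos u hu
    simp only [integrand5, three_mul_nu_two]
    rw [← besselKTilde_eq_besselSum _ (mul_pos (besselScale_pos h1) hp),
      ← besselKTilde_eq_besselSum _ (mul_pos (besselScale_pos h2) hq)]
    rfl
  refine ⟨r1.congr_fun e measurableSet_Ioi, r2, ?_⟩
  rw [← r3, calJ5, setIntegral_congr_fun measurableSet_Ioi e]


/-! ### Trigonometric identities -/

/-- Pairing the sines removes the factors `i`, so that rational Laurent coefficients remain. -/
lemma sin_mul_sin_eq (u v : ℂ) : Complex.sin u * Complex.sin v =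
    -((cexp (u * I) - (cexp (u * I))⁻¹) * (cexp (v * I) - (cexp (v * I))⁻¹)) / 4 := by
  simp only [Complex.sin, neg_mul, Complex.exp_neg]
  linear_combination ((cexp (u * I) - (cexp (u * I))⁻¹) *
    (cexp (v * I) - (cexp (v * I))⁻¹)) / 4 * I_sq

lemma sin_eq_exp_sub (u : ℂ) :
    Complex.sin u = -(I / 2) * (cexp (u * I) - (cexp (u * I))⁻¹) := by
  simp only [Complex.sin, neg_mul, Complex.exp_neg]
  ring

lemma cos_eq_exp_add (u : ℂ) :
    Complex.cos u = (cexp (u * I) + (cexp (u * I))⁻¹) / 2 := by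
  simp only [Complex.cos, neg_mul, Complex.exp_neg]

/-- The variables stand for `e^{iA}`, `e^{iB}`, `e^{iC}`, `e^{ix}`, `e^{iy}`, and `pqr = 1`
expresses `A + B + C = 0`. After clearing denominators it is a polynomial identity. -/
lemma laurent_neg_neg {p q r X Y : ℂ} (hp : p ≠ 0) (hq : q ≠ 0) (hr : r = p⁻¹ * q⁻¹) (hX : X ≠ 0)
    (hY : Y ≠ 0) :
    3 * ((r / p + p / r) * ((X / q ^ 2 - q ^ 2 / X) * (Y * q ^ 2 - (Y * q ^ 2)⁻¹)) *
        (r / p - p / r) +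
      (q / r + r / q) * ((X / p ^ 2 - p ^ 2 / X) * (Y * p ^ 2 - (Y * p ^ 2)⁻¹)) *
        (q / r - r / q) +
      (p / q + q / p) * ((X / r ^ 2 - r ^ 2 / X) * (Y * r ^ 2 - (Y * r ^ 2)⁻¹)) *
        (p / q - q / p)) =
    ((2 * ((X * q + (X * q)⁻¹) * (Y / q + q / Y)) - (X * q - (X * q)⁻¹) * (Y / q - q / Y)) +
      (2 * ((X * p + (X * p)⁻¹) * (Y / p + p / Y)) - (X * p - (X * p)⁻¹) * (Y / p - p / Y)) +
      (2 * ((X * r + (X * r)⁻¹) * (Y / r + r / Y)) - (X * r - (X * r)⁻¹) * (Y / r - r / Y))) *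
      ((p / q - q / p) * (q / r - r / q)) * (r / p - p / r) := by
  subst hr
  field_simp
  ring

lemma laurent_pos_neg {p q r X Y : ℂ} (hp : p ≠ 0) (hq : q ≠ 0) (hr : r = p⁻¹ * q⁻¹) (hX : X ≠ 0)
    (hY : Y ≠ 0) :
    -3 * ((q / r + r / q) * (X / p ^ 2 - p ^ 2 / X) * (Y * q ^ 2 - (Y * q ^ 2)⁻¹) *
        (Y * r ^ 2 - (Y * r ^ 2)⁻¹) * (q / r - r / q) +
      (p / q + q / p) * (X / r ^ 2 - r ^ 2 / X) * (Y * p ^ 2 - (Y * p ^ 2)⁻¹) *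
        (Y * q ^ 2 - (Y * q ^ 2)⁻¹) * (p / q - q / p) +
      (r / p + p / r) * (X / q ^ 2 - q ^ 2 / X) * (Y * r ^ 2 - (Y * r ^ 2)⁻¹) *
        (Y * p ^ 2 - (Y * p ^ 2)⁻¹) * (r / p - p / r)) =
    (((X * q + (X * q)⁻¹) * (Y / q + q / Y) * (Y * q ^ 2 - (Y * q ^ 2)⁻¹) +
      (r / p + p / r) * (Y / q + q / Y) * (X * Y - (X * Y)⁻¹) +
      (r / p + p / r) ^ 2 * (X / q ^ 2 - q ^ 2 / X)) +
     ((X * p + (X * p)⁻¹) * (Y / p + p / Y) * (Y * p ^ 2 - (Y * p ^ 2)⁻¹) +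
      (q / r + r / q) * (Y / p + p / Y) * (X * Y - (X * Y)⁻¹) +
      (q / r + r / q) ^ 2 * (X / p ^ 2 - p ^ 2 / X)) +
     ((X * r + (X * r)⁻¹) * (Y / r + r / Y) * (Y * r ^ 2 - (Y * r ^ 2)⁻¹) +
      (p / q + q / p) * (Y / r + r / Y) * (X * Y - (X * Y)⁻¹) +
      (p / q + q / p) ^ 2 * (X / r ^ 2 - r ^ 2 / X))) *
      ((p / q - q / p) * (q / r - r / q) * (r / p - p / r)) := by
  subst hr
  field_simp
  ring

lemma cexp_values {A B C : ℂ} (h : A + B + C = 0) :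
    cexp (C * I) = (cexp (A * I))⁻¹ * (cexp (B * I))⁻¹ ∧
    (∀ u v, cexp ((u - v) * I) = cexp (u * I) / cexp (v * I)) ∧
    (∀ u v, cexp ((u + v) * I) = cexp (u * I) * cexp (v * I)) ∧
    (∀ u, cexp (2 * u * I) = cexp (u * I) ^ 2) := by
  refine ⟨?_, fun u v => ?_, fun u v => ?_, fun u => ?_⟩
  · rw [← Complex.exp_neg, ← Complex.exp_neg, ← Complex.exp_add]
    congr 1
    linear_combination h * I
  · rw [sub_mul, Complex.exp_sub]
  · rw [add_mul, Complex.exp_add]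
  · rw [← Complex.exp_nat_mul]
    push_cast
    ring_nf

/-- For `A, B, C = πμ_j/2`, `x = πs₁`, `y = πs₂` this is the equality of the summed weights after
multiplication by the common denominator `∏ sin(3πν_j/2)`. -/
lemma trig_neg_neg {A B C : ℂ} (x y : ℂ) (h : A + B + C = 0) :
    3 * (Complex.cos (C - A) * (Complex.sin (x - 2 * B) * Complex.sin (y + 2 * B)) *
        Complex.sin (C - A) +
      Complex.cos (B - C) * (Complex.sin (x - 2 * A) * Complex.sin (y + 2 * A)) *
        Complex.sin (B - C) +
      Complex.cos (A - B) * (Complex.sin (x - 2 * C) * Complex.sin (y + 2 * C)) *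
        Complex.sin (A - B)) =
    2 * ((2 * (Complex.cos (x + B) * Complex.cos (y - B)) +
        Complex.sin (x + B) * Complex.sin (y - B)) +
      (2 * (Complex.cos (x + A) * Complex.cos (y - A)) +
        Complex.sin (x + A) * Complex.sin (y - A)) +
      (2 * (Complex.cos (x + C) * Complex.cos (y - C)) +
        Complex.sin (x + C) * Complex.sin (y - C))) *
      (Complex.sin (A - B) * Complex.sin (B - C)) * Complex.sin (C - A) := by
  obtain ⟨hr, hsub, hadd, htwo⟩ := cexp_values h
  have key := laurent_neg_neg (Complex.exp_ne_zero (A * I)) (Complex.exp_ne_zero (B * I)) hr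
    (Complex.exp_ne_zero (x * I)) (Complex.exp_ne_zero (y * I))
  simp only [sin_mul_sin_eq]
  simp only [sin_eq_exp_sub, cos_eq_exp_add, hsub, hadd, htwo, inv_div]
  linear_combination I / 16 * key

lemma trig_pos_neg {A B C : ℂ} (x y : ℂ) (h : A + B + C = 0) :
    -3 * (Complex.cos (B - C) * (Complex.sin (x - 2 * A) * Complex.sin (y + 2 * B)) *
        (Complex.sin (y + 2 * C) * Complex.sin (B - C)) +
      Complex.cos (A - B) * (Complex.sin (x - 2 * C) * Complex.sin (y + 2 * A)) *
        (Complex.sin (y + 2 * B) * Complex.sin (A - B)) +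
      Complex.cos (C - A) * (Complex.sin (x - 2 * B) * Complex.sin (y + 2 * C)) *
        (Complex.sin (y + 2 * A) * Complex.sin (C - A))) =
    2 * ((Complex.cos (x + B) * Complex.cos (y - B) * (Complex.sin (y + 2 * B) * Complex.sin (A - B)) +
        Complex.cos (C - A) * Complex.cos (y - B) * (Complex.sin (x + y) * Complex.sin (A - B)) +
        Complex.cos (C - A) ^ 2 * (Complex.sin (x - 2 * B) * Complex.sin (A - B))) +
      (Complex.cos (x + A) * Complex.cos (y - A) * (Complex.sin (y + 2 * A) * Complex.sin (A - B)) +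
        Complex.cos (B - C) * Complex.cos (y - A) * (Complex.sin (x + y) * Complex.sin (A - B)) +
        Complex.cos (B - C) ^ 2 * (Complex.sin (x - 2 * A) * Complex.sin (A - B))) +
      (Complex.cos (x + C) * Complex.cos (y - C) * (Complex.sin (y + 2 * C) * Complex.sin (A - B)) +
        Complex.cos (A - B) * Complex.cos (y - C) * (Complex.sin (x + y) * Complex.sin (A - B)) +
        Complex.cos (A - B) ^ 2 * (Complex.sin (x - 2 * C) * Complex.sin (A - B)))) *
      (Complex.sin (B - C) * Complex.sin (C - A)) := by
  obtain ⟨hr, hsub, hadd, htwo⟩ := cexp_values h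
  have key := laurent_pos_neg (Complex.exp_ne_zero (A * I)) (Complex.exp_ne_zero (B * I)) hr
    (Complex.exp_ne_zero (x * I)) (Complex.exp_ne_zero (y * I))
  simp only [sin_mul_sin_eq, cos_eq_exp_add, hsub, hadd, htwo, inv_div]
  linear_combination 1 / 32 * key

/-! ### Symmetries -/

lemma w4_mem_Lambda {μ : Fin 3 → ℂ} {c : ℝ} (hμ : μ ∈ Lambda c) : w4 μ ∈ Lambda c := by
  refine ⟨?_, fun j => ?_⟩
  · have := hμ.1
    simp only [w4, Matrix.cons_val_zero, Matrix.cons_val_one, Matrix.cons_val]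
    linear_combination this
  · fin_cases j
    exacts [hμ.2 2, hμ.2 0, hμ.2 1]

lemma w5_mem_Lambda {μ : Fin 3 → ℂ} {c : ℝ} (hμ : μ ∈ Lambda c) : w5 μ ∈ Lambda c := by
  refine ⟨?_, fun j => ?_⟩
  · have := hμ.1
    simp only [w5, Matrix.cons_val_zero, Matrix.cons_val_one, Matrix.cons_val]
    linear_combination this
  · fin_cases j
    exacts [hμ.2 1, hμ.2 2, hμ.2 0]

lemma neg_mem_Lambda {μ : Fin 3 → ℂ} {c : ℝ} (hμ : μ ∈ Lambda c) : -μ ∈ Lambda c := by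
  refine ⟨?_, fun j => ?_⟩
  · have := hμ.1
    simp only [Pi.neg_apply]
    linear_combination -this
  · simpa using hμ.2 j

lemma standardContour_w4 (μ : Fin 3 → ℂ) : standardContour (w4 μ) = standardContour μ := by
  have : ∑ j, ‖w4 μ j‖ ^ 2 = ∑ j, ‖μ j‖ ^ 2 := by
    simp only [Fin.sum_univ_three, w4, Matrix.cons_val_zero, Matrix.cons_val_one, Matrix.cons_val]
    ring
  funext t
  rw [standardContour, standardContour, this]

lemma standardContour_w5 (μ : Fin 3 → ℂ) : standardContour (w5 μ) = standardContour μ := by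
  have : ∑ j, ‖w5 μ j‖ ^ 2 = ∑ j, ‖μ j‖ ^ 2 := by
    simp only [Fin.sum_univ_three, w5, Matrix.cons_val_zero, Matrix.cons_val_one, Matrix.cons_val]
    ring
  funext t
  rw [standardContour, standardContour, this]

lemma standardContour_neg (μ : Fin 3 → ℂ) : standardContour (-μ) = standardContour μ := by
  funext t
  simp [standardContour]

lemma gammaKernel_w4 (opp : Bool) (μ : Fin 3 → ℂ) : gammaKernel opp (w4 μ) = gammaKernel opp μ := by
  funext s₁ s₂
  simp only [gammaKernel, Fin.prod_univ_three, w4, Matrix.cons_val_zero, Matrix.cons_val_one,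
    Matrix.cons_val]
  ring

lemma gammaKernel_w5 (opp : Bool) (μ : Fin 3 → ℂ) : gammaKernel opp (w5 μ) = gammaKernel opp μ := by
  funext s₁ s₂
  simp only [gammaKernel, Fin.prod_univ_three, w5, Matrix.cons_val_zero, Matrix.cons_val_one,
    Matrix.cons_val]
  ring

/-- The Gamma product and the standard contour are symmetric in the `μ_j`; hence all terms of a
cyclic sum are transforms against the same kernel on the same contour. -/
lemma barnesTransform_w4 (opp : Bool) (μ : Fin 3 → ℂ) (W : ℂ → ℂ → ℂ) :
    barnesTransform opp (w4 μ) W = barnesTransform opp μ W := by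
  rw [barnesTransform, barnesTransform, gammaKernel_w4, standardContour_w4]

lemma barnesTransform_w5 (opp : Bool) (μ : Fin 3 → ℂ) (W : ℂ → ℂ → ℂ) :
    barnesTransform opp (w5 μ) W = barnesTransform opp μ W := by
  rw [barnesTransform, barnesTransform, gammaKernel_w5, standardContour_w5]

/-- For `w₄(-μ)` the triple `(ν₁, ν₂, ν₃)` becomes `(-ν₃, -ν₁, -ν₂)`; the cosine is even and the
signs of the two sines in the denominator cancel. -/
lemma mellinBarnes_swap (y₁ y₂ : ℝ) (μ : Fin 3 → ℂ) (s₁ s₂ : ℂ) :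
    mellinBarnes .pos .neg (y₂, y₁) (w4 (-μ)) s₂ s₁ = mellinBarnes .neg .pos (y₁, y₂) μ s₁ s₂ := by
  have hs : ∀ j : Fin 3, sinThree (-nu μ j) = -sinThree (nu μ j) := fun j => by
    simp [sinThree]
  have hc : ∀ j : Fin 3, cosThree (-nu μ j) = cosThree (nu μ j) := fun j => by
    simp [cosThree]
  have n0 : nu (w4 (-μ)) 0 = -nu μ 2 := by simp [nu, w4]; ring
  have n1 : nu (w4 (-μ)) 1 = -nu μ 0 := by simp [nu, w4]; ring
  have n2 : nu (w4 (-μ)) 2 = -nu μ 1 := by simp [nu, w4]; ring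
  simp only [mellinBarnes, trigFactor, n0, n1, n2, hs, hc]
  simp only [gammaFactor, Fin.prod_univ_three, w4, Matrix.cons_val_zero, Matrix.cons_val_one,
    Matrix.cons_val, Pi.neg_apply, sub_neg_eq_add, ← sub_eq_add_neg, add_comm s₂ s₁]
  ring

theorem kernelW6_swap (y₁ y₂ : ℝ) (μ : Fin 3 → ℂ) :
    kernelW6 .neg .pos (y₁, y₂) μ = kernelW6 .pos .neg (y₂, y₁) (w4 (-μ)) := by
  unfold kernelW6 barnesIntegral
  rw [standardContour_w4, standardContour_neg]
  congr 1
  rw [Measure.volume_eq_prod, ← integral_prod_swap]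
  refine integral_congr_ae (ae_of_all _ fun t => ?_)
  simp only [kernelIntegrand, Prod.fst_swap, Prod.snd_swap]
  rw [← mellinBarnes_swap]
  ring


/-! ### Sums over cyclic permutations -/

lemma sinThree_ne_zero {z : ℂ} (hz : z.re = 0) (h0 : z ≠ 0) : sinThree z ≠ 0 := by
  have h := sin_pi_mul_ne_zero (α := 3 / 2 * z) (by
    rw [mul_re, hz, mul_zero, zero_sub, neg_eq_zero]
    norm_num) (mul_ne_zero (by norm_num) h0)
  rw [sinThree]
  convert h using 2
  ring

/-- The zeros of the cosine are real and nonzero, whereas the argument is imaginary. -/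
lemma cosThree_ne_zero {z : ℂ} (hz : z.re = 0) : cosThree z ≠ 0 := by
  rw [cosThree, Complex.cos_ne_zero_iff]
  intro k hk
  have h2 := congrArg Complex.re hk
  have e1 : (3 / 2 * (Real.pi : ℂ) * z).re = 0 := by
    rw [show (3 / 2 * (Real.pi : ℂ)) = ((3 / 2 * Real.pi : ℝ) : ℂ) by push_cast; ring,
      re_ofReal_mul, hz, mul_zero]
  have e2 : ((2 * (k : ℂ) + 1) * Real.pi / 2).re = (2 * (k : ℝ) + 1) * Real.pi / 2 := by
    rw [show (2 * (k : ℂ) + 1) * Real.pi / 2 = (((2 * (k : ℝ) + 1) * Real.pi / 2 : ℝ) : ℂ) by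
      push_cast; ring, ofReal_re]
  rw [e1, e2] at h2
  have h3 : (2 * (k : ℝ) + 1) = 0 := by
    have := Real.pi_pos
    by_contra h
    have : (2 * (k : ℝ) + 1) * Real.pi / 2 ≠ 0 := by positivity
    exact this h2.symm
  have h4 : 2 * k + 1 = 0 := by exact_mod_cast h3
  omega

lemma nu_re {μ : Fin 3 → ℂ} (hμ : ∀ j, (μ j).re = 0) (j : Fin 3) : (nu μ j).re = 0 := by
  fin_cases j <;> simp [nu, hμ]

lemma trigWeight_neg_neg (μ : Fin 3 → ℂ) (s₁ s₂ : ℂ) : trigWeight .neg .neg μ s₁ s₂ =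
    1 / (32 * (Real.pi : ℂ) ^ 2) * (cosThree (nu μ 2) / (sinThree (nu μ 1) * sinThree (nu μ 0)) *
      (Complex.sin (Real.pi * s₁ - 2 * (Real.pi / 2 * μ 1)) *
        Complex.sin (Real.pi * s₂ + 2 * (Real.pi / 2 * μ 1)))) := by
  rw [trigWeight, mul_assoc]
  congr 4 <;> ring_nf

lemma trigWeight_pos_neg (μ : Fin 3 → ℂ) (s₁ s₂ : ℂ) : trigWeight .pos .neg μ s₁ s₂ =
    -(1 / (32 * (Real.pi : ℂ) ^ 2)) * (cosThree (nu μ 1) / (sinThree (nu μ 0) * sinThree (nu μ 2)) *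
      (Complex.sin (Real.pi * s₁ - 2 * (Real.pi / 2 * μ 0)) *
        Complex.sin (Real.pi * s₂ + 2 * (Real.pi / 2 * μ 1)) *
        Complex.sin (Real.pi * s₂ + 2 * (Real.pi / 2 * μ 2)))) := by
  rw [trigWeight, mul_assoc]
  congr 5 <;> ring_nf

lemma w4_nu (μ : Fin 3 → ℂ) : nu (w4 μ) = w4 (nu μ) := by
  funext j
  fin_cases j <;> simp [nu, w4]

lemma w5_nu (μ : Fin 3 → ℂ) : nu (w5 μ) = w5 (nu μ) := by
  funext j
  fin_cases j <;> simp [nu, w5]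

lemma trig_nu (μ : Fin 3 → ℂ) :
    sinThree (nu μ 0) = Complex.sin (Real.pi / 2 * μ 0 - Real.pi / 2 * μ 1) ∧
    sinThree (nu μ 1) = Complex.sin (Real.pi / 2 * μ 1 - Real.pi / 2 * μ 2) ∧
    sinThree (nu μ 2) = Complex.sin (Real.pi / 2 * μ 2 - Real.pi / 2 * μ 0) ∧
    cosThree (nu μ 0) = Complex.cos (Real.pi / 2 * μ 0 - Real.pi / 2 * μ 1) ∧
    cosThree (nu μ 1) = Complex.cos (Real.pi / 2 * μ 1 - Real.pi / 2 * μ 2) ∧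
    cosThree (nu μ 2) = Complex.cos (Real.pi / 2 * μ 2 - Real.pi / 2 * μ 0) := by
  simp only [sinThree, cosThree, nu, Matrix.cons_val_zero, Matrix.cons_val_one, Matrix.cons_val]
  refine ⟨?_, ?_, ?_, ?_, ?_, ?_⟩ <;> congr 1 <;> ring

lemma half_pi_mul_two_mul_add (s m : ℂ) :
    (Real.pi : ℂ) / 2 * (2 * s + m) = Real.pi * s + Real.pi / 2 * m := by
  ring

lemma half_pi_mul_two_mul_sub (s m : ℂ) :
    (Real.pi : ℂ) / 2 * (2 * s - m) = Real.pi * s - Real.pi / 2 * m := by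
  ring

lemma pi_mul_add_eq (s m : ℂ) :
    (Real.pi : ℂ) * (s + m) = Real.pi * s + 2 * (Real.pi / 2 * m) := by
  ring

lemma pi_mul_sub_eq (s m : ℂ) :
    (Real.pi : ℂ) * (s - m) = Real.pi * s - 2 * (Real.pi / 2 * m) := by
  ring

lemma cyclic_weight_neg_neg {μ : Fin 3 → ℂ} (hsum : μ 0 + μ 1 + μ 2 = 0)
    (hs : ∀ j, sinThree (nu μ j) ≠ 0) (y : ℝ × ℝ) (s₁ s₂ : ℂ) :
    kernelWeight .neg .neg y μ s₁ s₂ + kernelWeight .neg .neg y (w4 μ) s₁ s₂ +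
      kernelWeight .neg .neg y (w5 μ) s₁ s₂ =
    cyclicSum (fun μ' => 4 / (48 * (Real.pi : ℂ) ^ 2) *
      besselWeight (fun _ _ => 1) y (μ' 1) 1 1 1 1 (Real.pi / 2) (Real.pi / 2) s₁ s₂ +
      2 / (48 * (Real.pi : ℂ) ^ 2) *
      besselWeight (fun _ _ => 1) y (μ' 1) I (-I) I (-I) (Real.pi / 2) (Real.pi / 2) s₁ s₂) μ := by
  have hpi : (Real.pi : ℂ) ≠ 0 := ofReal_ne_zero.2 Real.pi_ne_zero
  -- Each of the three weights lacks one of the sines `S0`, `S1`, `S2` in its denominator;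
  -- multiplying by all three gives the hypothesis.
  have halg : ∀ {S0 S1 S2 c0 c1 c2 t0 t1 t2 R : ℂ}, S0 ≠ 0 → S1 ≠ 0 → S2 ≠ 0 →
      3 * (c2 * t2 * S2 + c1 * t1 * S1 + c0 * t0 * S0) = 2 * R * (S0 * S1) * S2 →
      1 / (32 * (Real.pi : ℂ) ^ 2) * (c2 / (S1 * S0) * t2) +
      1 / (32 * (Real.pi : ℂ) ^ 2) * (c1 / (S0 * S2) * t1) +
      1 / (32 * (Real.pi : ℂ) ^ 2) * (c0 / (S2 * S1) * t0) = 1 / (48 * (Real.pi : ℂ) ^ 2) * R := by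
    intro S0 S1 S2 c0 c1 c2 t0 t1 t2 R h0 h1 h2 h
    field_simp
    linear_combination 16 * h
  obtain ⟨s0, s1, s2, c0, c1, c2⟩ := trig_nu μ
  have key := trig_neg_neg (Real.pi * s₁) (Real.pi * s₂)
    (show (Real.pi : ℂ) / 2 * μ 0 + Real.pi / 2 * μ 1 + Real.pi / 2 * μ 2 = 0 by
      linear_combination (Real.pi : ℂ) / 2 * hsum)
  rw [← s0, ← s1, ← s2, ← c0, ← c1, ← c2] at key
  have key2 := halg (hs 0) (hs 1) (hs 2) key
  unfold kernelWeight cyclicSum besselWeight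
  rw [trigWeight_neg_neg, trigWeight_neg_neg, trigWeight_neg_neg, w4_nu, w5_nu]
  simp only [show ∀ f : Fin 3 → ℂ, w4 f 0 = f 2 from fun _ => rfl,
    show ∀ f : Fin 3 → ℂ, w4 f 1 = f 0 from fun _ => rfl,
    show ∀ f : Fin 3 → ℂ, w4 f 2 = f 1 from fun _ => rfl,
    show ∀ f : Fin 3 → ℂ, w5 f 0 = f 1 from fun _ => rfl,
    show ∀ f : Fin 3 → ℂ, w5 f 1 = f 2 from fun _ => rfl,
    show ∀ f : Fin 3 → ℂ, w5 f 2 = f 0 from fun _ => rfl,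
    phaseSum_one_one, phaseSum_I_neg_I, half_pi_mul_two_mul_add, half_pi_mul_two_mul_sub]
  rw [← add_mul, ← add_mul, key2]
  ring

lemma cyclic_weight_pos_neg {μ : Fin 3 → ℂ} (hsum : μ 0 + μ 1 + μ 2 = 0)
    (hs : ∀ j, sinThree (nu μ j) ≠ 0) (y : ℝ × ℝ) (s₁ s₂ : ℂ) :
    kernelWeight .pos .neg y μ s₁ s₂ + kernelWeight .pos .neg y (w4 μ) s₁ s₂ +
      kernelWeight .pos .neg y (w5 μ) s₁ s₂ =
    cyclicSum (fun μ' => 1 / (24 * (Real.pi : ℂ) ^ 2) *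
      (besselWeight (fun _ s₂ => Complex.sin (Real.pi * (s₂ + μ' 1))) y (μ' 1) 1 1 1 1
        (Real.pi / 2) (Real.pi / 2) s₁ s₂ +
      besselWeight (fun s₁ s₂ => Complex.sin (Real.pi * (s₁ + s₂))) y (μ' 1)
        (Complex.cos (Real.pi / 2 * (μ' 2 - μ' 0))) (Complex.cos (Real.pi / 2 * (μ' 2 - μ' 0))) 1 1
        0 (Real.pi / 2) s₁ s₂ +
      besselWeight (fun s₁ _ => Complex.sin (Real.pi * (s₁ - μ' 1))) y (μ' 1)
        (Complex.cos (Real.pi / 2 * (μ' 2 - μ' 0))) (Complex.cos (Real.pi / 2 * (μ' 2 - μ' 0)))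
        (Complex.cos (Real.pi / 2 * (μ' 2 - μ' 0))) (Complex.cos (Real.pi / 2 * (μ' 2 - μ' 0)))
        0 0 s₁ s₂)) μ := by
  have hpi : (Real.pi : ℂ) ≠ 0 := ofReal_ne_zero.2 Real.pi_ne_zero
  have halg : ∀ {S0 S1 S2 c0 c1 c2 t0 t1 t2 R : ℂ}, S0 ≠ 0 → S1 ≠ 0 → S2 ≠ 0 →
      -3 * (c1 * t1 * S1 + c0 * t0 * S0 + c2 * t2 * S2) = 2 * R * (S0 * S1 * S2) →
      -(1 / (32 * (Real.pi : ℂ) ^ 2)) * (c1 / (S0 * S2) * t1) +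
      -(1 / (32 * (Real.pi : ℂ) ^ 2)) * (c0 / (S2 * S1) * t0) +
      -(1 / (32 * (Real.pi : ℂ) ^ 2)) * (c2 / (S1 * S0) * t2) =
        1 / (24 * (Real.pi : ℂ) ^ 2) * (R / 2) := by
    intro S0 S1 S2 c0 c1 c2 t0 t1 t2 R h0 h1 h2 h
    field_simp
    linear_combination 16 * h
  obtain ⟨s0, s1, s2, c0, c1, c2⟩ := trig_nu μ
  have key := trig_pos_neg (Real.pi * s₁) (Real.pi * s₂)
    (show (Real.pi : ℂ) / 2 * μ 0 + Real.pi / 2 * μ 1 + Real.pi / 2 * μ 2 = 0 by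
      linear_combination (Real.pi : ℂ) / 2 * hsum)
  rw [← s0, ← s1, ← s2, ← c0, ← c1, ← c2] at key
  have key2 := halg (hs 0) (hs 1) (hs 2)
    (t0 := Complex.sin (Real.pi * s₁ - 2 * (Real.pi / 2 * μ 2)) *
      Complex.sin (Real.pi * s₂ + 2 * (Real.pi / 2 * μ 0)) *
      Complex.sin (Real.pi * s₂ + 2 * (Real.pi / 2 * μ 1)))
    (t1 := Complex.sin (Real.pi * s₁ - 2 * (Real.pi / 2 * μ 0)) *
      Complex.sin (Real.pi * s₂ + 2 * (Real.pi / 2 * μ 1)) *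
      Complex.sin (Real.pi * s₂ + 2 * (Real.pi / 2 * μ 2)))
    (t2 := Complex.sin (Real.pi * s₁ - 2 * (Real.pi / 2 * μ 1)) *
      Complex.sin (Real.pi * s₂ + 2 * (Real.pi / 2 * μ 2)) *
      Complex.sin (Real.pi * s₂ + 2 * (Real.pi / 2 * μ 0)))
    (c0 := cosThree (nu μ 0)) (c1 := cosThree (nu μ 1)) (c2 := cosThree (nu μ 2))
    (R := (Complex.cos (Real.pi * s₁ + (Real.pi / 2 * μ 1)) * Complex.cos (Real.pi * s₂ - (Real.pi / 2 * μ 1)) *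
          Complex.sin (Real.pi * s₂ + 2 * (Real.pi / 2 * μ 1)) +
        cosThree (nu μ 2) * Complex.cos (Real.pi * s₂ - (Real.pi / 2 * μ 1)) *
          Complex.sin (Real.pi * s₁ + Real.pi * s₂) +
        cosThree (nu μ 2) ^ 2 * Complex.sin (Real.pi * s₁ - 2 * (Real.pi / 2 * μ 1))) +
      (Complex.cos (Real.pi * s₁ + (Real.pi / 2 * μ 0)) * Complex.cos (Real.pi * s₂ - (Real.pi / 2 * μ 0)) *
          Complex.sin (Real.pi * s₂ + 2 * (Real.pi / 2 * μ 0)) +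
        cosThree (nu μ 1) * Complex.cos (Real.pi * s₂ - (Real.pi / 2 * μ 0)) *
          Complex.sin (Real.pi * s₁ + Real.pi * s₂) +
        cosThree (nu μ 1) ^ 2 * Complex.sin (Real.pi * s₁ - 2 * (Real.pi / 2 * μ 0))) +
      (Complex.cos (Real.pi * s₁ + (Real.pi / 2 * μ 2)) * Complex.cos (Real.pi * s₂ - (Real.pi / 2 * μ 2)) *
          Complex.sin (Real.pi * s₂ + 2 * (Real.pi / 2 * μ 2)) +
        cosThree (nu μ 0) * Complex.cos (Real.pi * s₂ - (Real.pi / 2 * μ 2)) *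
          Complex.sin (Real.pi * s₁ + Real.pi * s₂) +
        cosThree (nu μ 0) ^ 2 * Complex.sin (Real.pi * s₁ - 2 * (Real.pi / 2 * μ 2))))
    (by linear_combination key)
  unfold kernelWeight cyclicSum besselWeight
  rw [trigWeight_pos_neg, trigWeight_pos_neg, trigWeight_pos_neg, w4_nu, w5_nu]
  simp only [show ∀ f : Fin 3 → ℂ, w4 f 0 = f 2 from fun _ => rfl,
    show ∀ f : Fin 3 → ℂ, w4 f 1 = f 0 from fun _ => rfl,
    show ∀ f : Fin 3 → ℂ, w4 f 2 = f 1 from fun _ => rfl,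
    show ∀ f : Fin 3 → ℂ, w5 f 0 = f 1 from fun _ => rfl,
    show ∀ f : Fin 3 → ℂ, w5 f 1 = f 2 from fun _ => rfl,
    show ∀ f : Fin 3 → ℂ, w5 f 2 = f 0 from fun _ => rfl,
    phaseSum_one_one, phaseSum_zero, half_pi_mul_two_mul_add, half_pi_mul_two_mul_sub,
    fun i => pi_mul_add_eq s₂ (μ i), pi_mul_sub_eq,
    fun i j => mul_sub ((Real.pi : ℂ) / 2) (μ i) (μ j), ← c0, ← c1, ← c2,
    mul_add (Real.pi : ℂ) s₁ s₂]
  rw [← add_mul, ← add_mul, key2]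
  ring


/-! ### The four kernels -/

lemma cyclicSum_eq_barnesTransform {opp : Bool} {μ : Fin 3 → ℂ} (hμ : μ ∈ Lambda 0)
    {F : (Fin 3 → ℂ) → ℂ} {W : (Fin 3 → ℂ) → ℂ → ℂ → ℂ}
    (h : ∀ μ' ∈ ({μ, w4 μ, w5 μ} : Set (Fin 3 → ℂ)),
      IsAdmissible opp (W μ') ∧ F μ' = barnesTransform opp μ' (W μ')) :
    cyclicSum F μ =
      barnesTransform opp μ fun s₁ s₂ => cyclicSum (fun μ' => W μ' s₁ s₂) μ := by
  obtain ⟨a0, e0⟩ := h μ (by simp)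
  obtain ⟨a1, e1⟩ := h (w4 μ) (by simp)
  obtain ⟨a2, e2⟩ := h (w5 μ) (by simp)
  rw [barnesTransform_w4] at e1
  rw [barnesTransform_w5] at e2
  unfold cyclicSum
  rw [e0, e1, e2, barnesTransform_add hμ (a0.add a1) a2, barnesTransform_add hμ a0 a1]

lemma mem_Lambda_of_mem_orbit {μ μ' : Fin 3 → ℂ} (hμ : μ ∈ Lambda 0)
    (h : μ' ∈ ({μ, w4 μ, w5 μ} : Set (Fin 3 → ℂ))) : μ' ∈ Lambda 0 := by
  rcases h with rfl | rfl | rfl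
  exacts [hμ, w4_mem_Lambda hμ, w5_mem_Lambda hμ]

/-- Over the orbit the Bessel index `α` runs through `3ν₃`, `3ν₂`, `3ν₁`, and the representation of
`J^±_α` by `K_α` divides by `sin(πα)`. -/
lemma sub_ne_zero_of_mem_orbit {μ μ' : Fin 3 → ℂ} (hν : ∀ j, nu μ j ≠ 0)
    (h : μ' ∈ ({μ, w4 μ, w5 μ} : Set (Fin 3 → ℂ))) : μ' 2 - μ' 0 ≠ 0 := by
  have h0 := hν 0
  have h1 := hν 1
  have h2 := hν 2
  simp only [nu, Matrix.cons_val_zero, Matrix.cons_val_one, Matrix.cons_val, ne_eq,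
    div_eq_zero_iff, OfNat.ofNat_ne_zero, or_false] at h0 h1 h2
  rcases h with rfl | rfl | rfl
  exacts [h2, h1, h0]

/-- No cyclic sum is needed: the two factors `2 cos(πα/2)` and the constant `1/8` give `𝒥₅` the
weight `cos²(3πν₃/2)/2` times the powers of `y`, which matches the weight of the kernel directly. -/
lemma kernelW6_pos_pos {μ : Fin 3 → ℂ} (hμ : μ ∈ Lambda 0) {y : ℝ × ℝ} (h1 : y.1 ≠ 0)
    (h2 : y.2 ≠ 0) : kernelW6 .pos .pos y μ =
      1 / (12 * (Real.pi : ℂ) ^ 2) * (cosThree (nu μ 0) * cosThree (nu μ 1) / cosThree (nu μ 2)) *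
        calJ5 y μ := by
  have hre : ∀ j, (μ j).re = 0 := fun j => abs_nonpos_iff.1 (hμ.2 j)
  have hc := cosThree_ne_zero (nu_re hre 2)
  have e : Complex.cos (Real.pi / 2 * (μ 2 - μ 0)) = cosThree (nu μ 2) := by
    rw [(trig_nu μ).2.2.2.2.2, mul_sub]
  have hpi : (Real.pi : ℂ) ≠ 0 := ofReal_ne_zero.2 Real.pi_ne_zero
  rw [kernelW6_eq_barnesTransform _ _ h1 h2, (calJ5_eq hμ h1 h2).2.2, ← barnesTransform_const_mul]
  congr 1
  funext s₁ s₂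
  simp only [kernelWeight, trigWeight, besselWeight, phaseSum_zero, e, Fin.prod_univ_three]
  field_simp
  ring

lemma cyclicSum_kernelW6_pos_neg {μ : Fin 3 → ℂ} (hμ : μ ∈ Lambda 0) (hν : ∀ j, nu μ j ≠ 0)
    {y : ℝ × ℝ} (h1 : y.1 ≠ 0) (h2 : y.2 ≠ 0) :
    cyclicSum (fun μ' => kernelW6 .pos .neg y μ') μ = 1 / (24 * (Real.pi : ℂ) ^ 2) *
      cyclicSum (fun μ' => calJ2 y μ' + calJ3 y μ' + calJ4 y μ') μ := by
  have hre : ∀ j, (μ j).re = 0 := fun j => abs_nonpos_iff.1 (hμ.2 j)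
  have hR : 1 / (24 * (Real.pi : ℂ) ^ 2) *
      cyclicSum (fun μ' => calJ2 y μ' + calJ3 y μ' + calJ4 y μ') μ =
      cyclicSum (fun μ' => 1 / (24 * (Real.pi : ℂ) ^ 2) *
        (calJ2 y μ' + calJ3 y μ' + calJ4 y μ')) μ := by
    simp only [cyclicSum, mul_add]
  rw [hR, cyclicSum_eq_barnesTransform (W := kernelWeight .pos .neg y) hμ fun μ' _ =>
    ⟨isAdmissible_kernelWeight .pos .neg y μ', kernelW6_eq_barnesTransform .pos .neg h1 h2 μ'⟩]
  refine (Eq.trans (cyclicSum_eq_barnesTransform (opp := true) hμ (W := ?_) fun μ' h => ?_) ?_).symm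
  · exact fun μ' s₁ s₂ => 1 / (24 * (Real.pi : ℂ) ^ 2) *
      (besselWeight (fun _ s₂ => Complex.sin (Real.pi * (s₂ + μ' 1))) y (μ' 1) 1 1 1 1
        (Real.pi / 2) (Real.pi / 2) s₁ s₂ +
      besselWeight (fun s₁ s₂ => Complex.sin (Real.pi * (s₁ + s₂))) y (μ' 1)
        (Complex.cos (Real.pi / 2 * (μ' 2 - μ' 0))) (Complex.cos (Real.pi / 2 * (μ' 2 - μ' 0))) 1 1
        0 (Real.pi / 2) s₁ s₂ +
      besselWeight (fun s₁ _ => Complex.sin (Real.pi * (s₁ - μ' 1))) y (μ' 1)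
        (Complex.cos (Real.pi / 2 * (μ' 2 - μ' 0))) (Complex.cos (Real.pi / 2 * (μ' 2 - μ' 0)))
        (Complex.cos (Real.pi / 2 * (μ' 2 - μ' 0))) (Complex.cos (Real.pi / 2 * (μ' 2 - μ' 0)))
        0 0 s₁ s₂)
  · have hμ' := mem_Lambda_of_mem_orbit hμ h
    have h0 := sub_ne_zero_of_mem_orbit hν h
    obtain ⟨-, a2, e2⟩ := calJ2_eq hμ' h0 h1 h2
    obtain ⟨-, a3, e3⟩ := calJ3_eq hμ' h0 h1 h2
    obtain ⟨-, a4, e4⟩ := calJ4_eq hμ' h1 h2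
    refine ⟨((a2.add a3).add a4).const_mul _, ?_⟩
    rw [e2, e3, e4, ← barnesTransform_add hμ' a2 a3, ← barnesTransform_add hμ' (a2.add a3) a4,
      ← barnesTransform_const_mul]
  · congr 1
    funext s₁ s₂
    exact (cyclic_weight_pos_neg hμ.1 (fun j => sinThree_ne_zero (nu_re hre j) (hν j)) y s₁ s₂).symm

lemma cyclicSum_kernelW6_neg_neg {μ : Fin 3 → ℂ} (hμ : μ ∈ Lambda 0) (hν : ∀ j, nu μ j ≠ 0)
    {y : ℝ × ℝ} (h1 : y.1 ≠ 0) (h2 : y.2 ≠ 0) :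
    cyclicSum (fun μ' => kernelW6 .neg .neg y μ') μ = 1 / (48 * (Real.pi : ℂ) ^ 2) *
      cyclicSum (fun μ' => 4 * calJ1 .neg y μ' + 2 * calJ1 .pos y μ') μ := by
  have hre : ∀ j, (μ j).re = 0 := fun j => abs_nonpos_iff.1 (hμ.2 j)
  have hR : 1 / (48 * (Real.pi : ℂ) ^ 2) *
      cyclicSum (fun μ' => 4 * calJ1 .neg y μ' + 2 * calJ1 .pos y μ') μ =
      cyclicSum (fun μ' => 4 / (48 * (Real.pi : ℂ) ^ 2) * calJ1 .neg y μ' +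
        2 / (48 * (Real.pi : ℂ) ^ 2) * calJ1 .pos y μ') μ := by
    simp only [cyclicSum]
    ring
  rw [hR, cyclicSum_eq_barnesTransform (W := kernelWeight .neg .neg y) hμ fun μ' _ =>
    ⟨isAdmissible_kernelWeight .neg .neg y μ', kernelW6_eq_barnesTransform .neg .neg h1 h2 μ'⟩]
  refine (Eq.trans (cyclicSum_eq_barnesTransform (opp := false) hμ (W := ?_) fun μ' h => ?_) ?_).symm
  · exact fun μ' s₁ s₂ => 4 / (48 * (Real.pi : ℂ) ^ 2) *
      besselWeight (fun _ _ => 1) y (μ' 1) 1 1 1 1 (Real.pi / 2) (Real.pi / 2) s₁ s₂ +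
      2 / (48 * (Real.pi : ℂ) ^ 2) *
      besselWeight (fun _ _ => 1) y (μ' 1) I (-I) I (-I) (Real.pi / 2) (Real.pi / 2) s₁ s₂
  · have hμ' := mem_Lambda_of_mem_orbit hμ h
    have h0 := sub_ne_zero_of_mem_orbit hν h
    obtain ⟨-, a1, e1⟩ := calJ1_neg_eq hμ' h0 h1 h2
    obtain ⟨-, a2, e2⟩ := calJ1_pos_eq hμ' h0 h1 h2
    refine ⟨(a1.const_mul _).add (a2.const_mul _), ?_⟩
    rw [e1, e2, barnesTransform_add hμ' (a1.const_mul _) (a2.const_mul _),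
      barnesTransform_const_mul, barnesTransform_const_mul]
  · congr 1
    funext s₁ s₂
    exact (cyclic_weight_neg_neg hμ.1 (fun j => sinThree_ne_zero (nu_re hre j) (hν j)) y s₁ s₂).symm

end GL3Kernel

end

/-! ### The four sign cases -/

theorem lemma5p2 (μ : Fin 3 → ℂ) (hμ : μ ∈ GL3Kernel.Lambda 0) (y₁ y₂ : ℝ) :
    -- the case (+, +)
    (0 < y₁ → 0 < y₂ →
      GL3Kernel.KernelWellDefined .pos .pos (y₁, y₂) μ ∧
      MeasureTheory.IntegrableOn (GL3Kernel.integrand5 (y₁, y₂) μ) (Set.Ioi 0) ∧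
      GL3Kernel.kernelW6 .pos .pos (y₁, y₂) μ =
        1 / (12 * (Real.pi : ℂ) ^ 2) *
          (Complex.cos (3 / 2 * (Real.pi : ℂ) * GL3Kernel.nu μ 0) *
              Complex.cos (3 / 2 * (Real.pi : ℂ) * GL3Kernel.nu μ 1) /
            Complex.cos (3 / 2 * (Real.pi : ℂ) * GL3Kernel.nu μ 2)) *
          GL3Kernel.calJ5 (y₁, y₂) μ) ∧
    -- the case (+, -)
    (0 < y₁ → y₂ < 0 → (∀ j, GL3Kernel.nu μ j ≠ 0) →
      (∀ μ' ∈ ({μ, GL3Kernel.w4 μ, GL3Kernel.w5 μ} : Set (Fin 3 → ℂ)),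
        GL3Kernel.KernelWellDefined .pos .neg (y₁, y₂) μ' ∧
        MeasureTheory.IntegrableOn (GL3Kernel.integrand2 (y₁, y₂) μ') (Set.Ioi 1) ∧
        MeasureTheory.IntegrableOn (GL3Kernel.integrand3 (y₁, y₂) μ') (Set.Ioi 0) ∧
        MeasureTheory.IntegrableOn (GL3Kernel.integrand4 (y₁, y₂) μ') (Set.Ioo 0 1)) ∧
      GL3Kernel.cyclicSum (fun μ' => GL3Kernel.kernelW6 .pos .neg (y₁, y₂) μ') μ =
        1 / (24 * (Real.pi : ℂ) ^ 2) *
          GL3Kernel.cyclicSum (fun μ' => GL3Kernel.calJ2 (y₁, y₂) μ' +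
            GL3Kernel.calJ3 (y₁, y₂) μ' + GL3Kernel.calJ4 (y₁, y₂) μ') μ) ∧
    -- the case (-, +)
    (y₁ < 0 → 0 < y₂ → GL3Kernel.nu μ 1 ≠ 0 → GL3Kernel.nu μ 2 ≠ 0 →
      GL3Kernel.KernelWellDefined .neg .pos (y₁, y₂) μ ∧
      GL3Kernel.KernelWellDefined .pos .neg (y₂, y₁) (GL3Kernel.w4 (-μ)) ∧
      GL3Kernel.kernelW6 .neg .pos (y₁, y₂) μ =
        GL3Kernel.kernelW6 .pos .neg (y₂, y₁) (GL3Kernel.w4 (-μ))) ∧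
    -- the case (-, -)
    (y₁ < 0 → y₂ < 0 → (∀ j, GL3Kernel.nu μ j ≠ 0) →
      (∀ μ' ∈ ({μ, GL3Kernel.w4 μ, GL3Kernel.w5 μ} : Set (Fin 3 → ℂ)),
        GL3Kernel.KernelWellDefined .neg .neg (y₁, y₂) μ' ∧
        MeasureTheory.IntegrableOn (GL3Kernel.integrand1 .neg (y₁, y₂) μ') (Set.Ioi 0) ∧
        MeasureTheory.IntegrableOn (GL3Kernel.integrand1 .pos (y₁, y₂) μ') (Set.Ioi 0)) ∧
      GL3Kernel.cyclicSum (fun μ' => GL3Kernel.kernelW6 .neg .neg (y₁, y₂) μ') μ =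
        1 / (48 * (Real.pi : ℂ) ^ 2) *
          GL3Kernel.cyclicSum (fun μ' => 4 * GL3Kernel.calJ1 .neg (y₁, y₂) μ' +
            2 * GL3Kernel.calJ1 .pos (y₁, y₂) μ') μ) := by
  refine ⟨fun h1 h2 => ⟨GL3Kernel.kernelWellDefined _ _ h1.ne' h2.ne' hμ,
      (GL3Kernel.calJ5_eq hμ h1.ne' h2.ne').1, GL3Kernel.kernelW6_pos_pos hμ h1.ne' h2.ne'⟩,
    fun h1 h2 hν => ⟨fun μ' h => ?_, GL3Kernel.cyclicSum_kernelW6_pos_neg hμ hν h1.ne' h2.ne⟩,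
    fun h1 h2 _ _ => ⟨GL3Kernel.kernelWellDefined _ _ h1.ne h2.ne' hμ,
      GL3Kernel.kernelWellDefined _ _ h2.ne' h1.ne
        (GL3Kernel.w4_mem_Lambda (GL3Kernel.neg_mem_Lambda hμ)),
      GL3Kernel.kernelW6_swap y₁ y₂ μ⟩,
    fun h1 h2 hν => ⟨fun μ' h => ?_, GL3Kernel.cyclicSum_kernelW6_neg_neg hμ hν h1.ne h2.ne⟩⟩
  · have hμ' := GL3Kernel.mem_Lambda_of_mem_orbit hμ h
    have h0 := GL3Kernel.sub_ne_zero_of_mem_orbit hν h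
    exact ⟨GL3Kernel.kernelWellDefined _ _ h1.ne' h2.ne hμ',
      (GL3Kernel.calJ2_eq hμ' h0 h1.ne' h2.ne).1, (GL3Kernel.calJ3_eq hμ' h0 h1.ne' h2.ne).1,
      (GL3Kernel.calJ4_eq hμ' h1.ne' h2.ne).1⟩
  · have hμ' := GL3Kernel.mem_Lambda_of_mem_orbit hμ h
    have h0 := GL3Kernel.sub_ne_zero_of_mem_orbit hν h
    exact ⟨GL3Kernel.kernelWellDefined _ _ h1.ne h2.ne hμ',
      (GL3Kernel.calJ1_neg_eq hμ' h0 h1.ne h2.ne).1, (GL3Kernel.calJ1_pos_eq hμ' h0 h1.ne h2.ne).1⟩
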